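/- **Setting.** Let $P\ge 4$ be even, $\beta,\gamma>0$, $\beta'=2\beta/P!$. For $a\in\mathbb N$ and $N\in\mathbb N$ let $K=\lfloor\gamma N^a\rfloor$. Let $\xi^1$ be uniform on $\{\pm1\}^N$ and, independently, let $\xi^\mu_{i_1\cdots i_{P/2}}$ ($2\le\mu\le K$, $1\le i_1,\dots,i_{P/2}\le N$) be i.i.d. standard Gaussians; put $\xi^1_{i_1\cdots i_{P/2}}=\xi^1_{i_1}\cdots\xi^1_{i_{P/2}}$ and $$S_\mu(\sigma)=\sum_{i_1,\dots,i_{P/2}=1}^N\xi^\mu_{i_1\cdots i_{P/2}}\sigma_{i_1}\cdots\sigma_{i_{P/2}},\qquad \sigma\in\{\pm1\}^N .$$ The dense Hebbian network has the Hamiltonian, partition function and quenched pressure $$H_N(\sigma)=-\frac{1}{P!\,N^{P-1}}\Big(S_1(\sigma)^2+\sum_{\mu=2}^{K}S_\mu(\sigma)^2\Big)+\frac{\gamma}{P!}N^{a+1-P/2},\qquad Z_N=\sum_\sigma e^{-\beta H_N(\sigma)},\qquad \mathcal A_N^{(a)}=\frac1N\,\mathbb E\ln Z_N .$$ Let $m=\frac1N\sum_i\xi^1_i\sigma_i$.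 **1-RSB (two-delta, "ziqqurat") ansatz at $a=P-1$.** Let $\theta\in(0,1]$ and $\bar m,\bar q_1,\bar q_2,\bar p_1,\bar p_2\in\mathbb R$. For $t\in[0,1]$ and independent standard Gaussian families $J^{(b)}_i$ ($1\le i\le N$), $\tilde J^{(b)}_\mu$ ($2\le \mu\le K$), $b=1,2$, let $$\mathcal B_t(\sigma,\tau)=\exp\Big[t\tfrac{\beta'N}{2}m^P+(1-t)N\psi m+\sqrt{t\tfrac{\beta'}{N^{P-1}}}\sum_{\mu>1}S_\mu(\sigma)\tau_\mu+\sqrt{1-t}\sum_{b=1}^2\Big(A_b\sum_{\mu>1}\tilde J^{(b)}_\mu\tau_\mu+B_b\sum_iJ^{(b)}_i\sigma_i\Big)+\tfrac{1-t}{2}C\sum_{\mu>1}\tau_\mu^2-\tfrac{\beta'\gamma}{2}N^{P/2}\Big],$$ with $\psi=\frac{\beta'P}{2}\bar m^{P-1}$, $A_1^2=\beta'N^{1-P/2}\bar q_1^{P/2}$, $A_2^2=\beta'N^{1-P/2}(\bar q_2^{P/2}-\bar q_1^{P/2})$, $B_1^2=\frac{\beta'\gamma P}{2}\bar p_1\bar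 q_1^{P/2-1}$, $B_2^2=\frac{\beta'\gamma P}{2}(\bar p_2\bar q_2^{P/2-1}-\bar p_1\bar q_1^{P/2-1})$, $C=\beta'N^{1-P/2}(1-\bar q_2^{P/2})$ and $A_b,B_b\ge0$. Let $\omega$ be the Gibbs average with density proportional to $\mathcal B_t$ with respect to counting measure in $\sigma$ times the standard Gaussian law in $\tau$, with partition function $Z_2$. Let $\mathbb E_0$ be the average over all $\xi$, $\mathbb E_b$ the average over $J^{(b)},\tilde J^{(b)}$, and $\mathcal W_2=Z_2^\theta/\mathbb E_2[Z_2^\theta]$. Put $\langle f\rangle=\mathbb E_0\mathbb E_1\mathbb E_2[\mathcal W_2\,\omega(f)]$ and, for functions of two replicas, $\langle f\rangle_1=\mathbb E_0\mathbb E_1\big[(\mathbb E_2[\mathcal W_2\,\omega])^{\otimes2}(f)\big]$ and $\langle f\rangle_2=\mathbb E_0\mathbb E_1\mathbb E_2\big[\mathcal W_2\,\omega^{\otimes2}(f)\big]$; in the overlap distribution these components carry the weights $\theta$ and $1-\theta$. With $q_{12}=\frac1N\sum_i\sigma_i\sigma_i'$ and the rescaled overlap $p_{12}=N^{P/2-1}\frac1K\sum_{\mu>1}\tau_\mu\tau_\mu'$,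 the ansatz says that, for every $t\in[0,1)$ and $b=1,2$, as $N\to\infty$, $$\langle(m-\bar m)^2\rangle\to0,\qquad\langle(q_{12}-\bar q_b)^2\rangle_b\to0,\qquad\langle(p_{12}-\bar p_b)^2\rangle_b\to0 .$$ **Theorem.** (i) The maximal storage scales as $K\propto N^{P-1}$: $a=P-1$ is the largest $a\in\mathbb N$ for which the pressure is intensive, i.e. for which $(\mathcal A^{(a)}_N)_N$ is bounded. (ii) Let $a=P-1$. If the 1-RSB ansatz holds with $\theta\in(0,1]$ and $\bar m,\bar q_1,\bar q_2,\bar p_1,\bar p_2$, then $\mathcal A^{(P)}=\lim_{N\to\infty}\mathcal A_N^{(P-1)}$ exists and $$\mathcal A^{(P)}=\ln2+\frac1\theta\,\mathbb E_1\ln\mathbb E_2\cosh^\theta g(J,\bar m)-\frac{\gamma\beta'}{4}\bar q_2^{P/2-1}\bar p_2\big(P-(P-1)\bar q_2\big)+\frac{\beta'}{2}\bar m^P(1-P)-\theta(P-1)\frac{\beta'\gamma}{4}\big(\bar q_2^{P/2}\bar p_2-\bar q_1^{P/2}\bar p_1\big)+\frac14\beta'^2\gamma,$$ where $$g(J,\bar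 m)=\frac{\beta'P}{2}\bar m^{P-1}+J^{(1)}\sqrt{\frac{\beta'}{2}\gamma\bar p_1P\bar q_1^{P/2-1}}+J^{(2)}\sqrt{\frac{\beta'}{2}P\gamma\big[\bar p_2\bar q_2^{P/2-1}-\bar p_1\bar q_1^{P/2-1}\big]}$$ and $\mathbb E_1,\mathbb E_2$ are here the averages over the independent standard Gaussians $J^{(1)},J^{(2)}$. -/

import Mathlib

open MeasureTheory ProbabilityTheory Filter Topology
open scoped Nat

noncomputable section

namespace DenseHebbian

/-! ### The dense Hebbian network -/

/-- Configurations of `N` Ising spins (`ℤˣ = {1, -1}`). -/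
abbrev Spins (N : ℕ) := Fin N → ℤˣ

/-- The real value `±1` of a spin. -/
def val (u : ℤˣ) : ℝ := ((u : ℤ) : ℝ)

/-- The effective inverse temperature `β' = 2 β / P!`. -/
def betaEff (P : ℕ) (β : ℝ) : ℝ := 2 * β / (P ! : ℝ)

/-- The number `K = γ N ^ a` of stored patterns (rounded down). -/
def numPatterns (γ : ℝ) (a N : ℕ) : ℕ := ⌊γ * (N : ℝ) ^ a⌋₊

/-- The entries of the `K - 1` noise patterns `ξ²,…,ξᴷ`; each has `N ^ (P/2)` entries
`ξ^μ_{i₁ … i_{P/2}}`. -/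
abbrev Noise (P N K : ℕ) := Fin (K - 1) × (Fin (P / 2) → Fin N) → ℝ

/-- The law of a finite family of i.i.d. standard Gaussian variables. -/
def iidGaussian (ι : Type) [Fintype ι] : Measure (ι → ℝ) :=
  Measure.pi fun _ => gaussianReal 0 1

/-- `∑_{i₁,…,i_{P/2}} ξ^μ_{i₁ … i_{P/2}} σ_{i₁} ⋯ σ_{i_{P/2}}` for a noise pattern `μ > 1`. -/
def noiseField {P N K : ℕ} (ξ : Noise P N K) (σ : Spins N) (μ : Fin (K - 1)) : ℝ :=
  ∑ i : Fin (P / 2) → Fin N, ξ (μ, i) * ∏ k, val (σ (i k))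

/-- The same sum for the retrieved pattern `μ = 1`, whose tensor is
`ξ¹_{i₁} ⋯ ξ¹_{i_{P/2}}` with `ξ¹ = η ∈ {±1}ᴺ`. -/
def signalField (P : ℕ) {N : ℕ} (η σ : Spins N) : ℝ :=
  ∑ i : Fin (P / 2) → Fin N, (∏ k, val (η (i k))) * ∏ k, val (σ (i k))

/-- The Hamiltonian of the dense Hebbian network with `K = γ N ^ a` patterns; the last term removes
the diagonal contribution to the squares and equals `γ N ^ (a + 1 - P/2) / P!`. -/
def hamiltonian (P a : ℕ) (γ : ℝ) {N K : ℕ} (η : Spins N) (ξ : Noise P N K) (σ : Spins N) : ℝ :=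
  -(1 / ((P ! : ℝ) * (N : ℝ) ^ (P - 1))) *
      (signalField P η σ ^ 2 + ∑ μ, noiseField ξ σ μ ^ 2)
    + γ / (P ! : ℝ) * ((N : ℝ) ^ (a + 1) / (N : ℝ) ^ (P / 2))

/-- The partition function. -/
def partitionFunction (P a : ℕ) (β γ : ℝ) {N K : ℕ} (η : Spins N) (ξ : Noise P N K) : ℝ :=
  ∑ σ : Spins N, Real.exp (-β * hamiltonian P a γ η ξ σ)

/-- The average `𝔼₀` over the patterns: `ξ¹` is uniform on `{±1}ᴺ`, the entries of
`ξ²,…,ξᴷ` are i.i.d. standard Gaussians. -/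
def patternAvg {P N K : ℕ} (F : Spins N → Noise P N K → ℝ) : ℝ :=
  (1 / 2 ^ N) * ∑ η : Spins N, ∫ ξ, F η ξ ∂(iidGaussian (Fin (K - 1) × (Fin (P / 2) → Fin N)))

/-- The quenched statistical pressure `A_N = (1/N) 𝔼 ln Z_N` at storage `K = γ N ^ a`. -/
def pressure (P a : ℕ) (β γ : ℝ) (N : ℕ) : ℝ :=
  (1 / (N : ℝ)) * patternAvg (P := P) (N := N) (K := numPatterns γ a N) fun η ξ =>
    Real.log (partitionFunction P a β γ η ξ)

/-- The pressure stays intensive (bounded in the size `N`) at storage `K = γ N ^ a`. -/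
def IsIntensive (P : ℕ) (β γ : ℝ) (a : ℕ) : Prop :=
  ∃ C : ℝ, ∀ N : ℕ, |pressure P a β γ N| ≤ C

/-! ### The broken interpolating system at storage `K = γ N ^ (P - 1)` -/

/-- The parameters of the 1-RSB ansatz. -/
structure OrderParameters where
  /-- the value `m̄` of the Mattis magnetization -/
  m : ℝ
  /-- the lower value `q̄₁` of the spin overlap -/
  q₁ : ℝ
  /-- the upper value `q̄₂` of the spin overlap -/
  q₂ : ℝ
  /-- the lower value `p̄₁` of the (rescaled) overlap of the hidden variables -/
  p₁ : ℝ
  /-- the upper value `p̄₂` of the (rescaled) overlap of the hidden variables -/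
  p₂ : ℝ
  /-- the weight `θ` of the lower values -/
  θ : ℝ

/-- The Mattis magnetization `m`. -/
def magnetization {N : ℕ} (η σ : Spins N) : ℝ :=
  (1 / (N : ℝ)) * ∑ i, val (η i) * val (σ i)

/-- The overlap `q₁₂` of two spin configurations. -/
def overlapQ {N : ℕ} (σ σ' : Spins N) : ℝ :=
  (1 / (N : ℝ)) * ∑ i, val (σ i) * val (σ' i)

/-- The rescaled overlap `N ^ (P/2 - 1) · (1/K) ∑_{μ > 1} τ_μ τ'_μ` of the hidden variables. -/
def overlapP (P N : ℕ) {K : ℕ} (τ τ' : Fin (K - 1) → ℝ) : ℝ :=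
  (N : ℝ) ^ (P / 2 - 1) * ((1 / (K : ℝ)) * ∑ μ, τ μ * τ' μ)

/-- The field `ψ`, coupled to the magnetization. -/
def psi (P : ℕ) (β : ℝ) (o : OrderParameters) : ℝ :=
  betaEff P β / 2 * P * o.m ^ (P - 1)

/-- The strength of the first field acting on the hidden variables. -/
def coefA₁ (P : ℕ) (β : ℝ) (o : OrderParameters) (N : ℕ) : ℝ :=
  √(betaEff P β / (N : ℝ) ^ (P / 2 - 1) * o.q₁ ^ (P / 2))

/-- The strength of the second field acting on the hidden variables. -/
def coefA₂ (P : ℕ) (β : ℝ) (o : OrderParameters) (N : ℕ) : ℝ :=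
  √(betaEff P β / (N : ℝ) ^ (P / 2 - 1) * (o.q₂ ^ (P / 2) - o.q₁ ^ (P / 2)))

/-- The strength of the first field acting on the spins. -/
def coefB₁ (P : ℕ) (β γ : ℝ) (o : OrderParameters) : ℝ :=
  √(betaEff P β / 2 * γ * P * (o.p₁ * o.q₁ ^ (P / 2 - 1)))

/-- The strength of the second field acting on the spins. -/
def coefB₂ (P : ℕ) (β γ : ℝ) (o : OrderParameters) : ℝ :=
  √(betaEff P β / 2 * γ * P * (o.p₂ * o.q₂ ^ (P / 2 - 1) - o.p₁ * o.q₁ ^ (P / 2 - 1)))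

/-- The coefficient of `τ² / 2` in the interpolation. -/
def coefC (P : ℕ) (β : ℝ) (o : OrderParameters) (N : ℕ) : ℝ :=
  betaEff P β / (N : ℝ) ^ (P / 2 - 1) * (1 - o.q₂ ^ (P / 2))

/-- One level of auxiliary Gaussian fields: `J_i = J (inl i)` acts on the spins,
`J̃_μ = J (inr μ)` on the hidden variables. -/
abbrev Aux (N K : ℕ) := Fin N ⊕ Fin (K - 1) → ℝ

/-- The interpolating Boltzmann factor at time `t`. At `t = 1` it is the integral (Gaussian
linearized) representation of the network, at `t = 0` it is a one-body system. -/
def boltzmann (P : ℕ) (β γ : ℝ) (o : OrderParameters) (t : ℝ) {N K : ℕ}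
    (η : Spins N) (ξ : Noise P N K) (J₁ J₂ : Aux N K)
    (σ : Spins N) (τ : Fin (K - 1) → ℝ) : ℝ :=
  Real.exp (t * (betaEff P β * N / 2) * magnetization η σ ^ P
    + (1 - t) * N * psi P β o * magnetization η σ
    + √t * √(betaEff P β / (N : ℝ) ^ (P - 1)) * ∑ μ, noiseField ξ σ μ * τ μ
    + √(1 - t) *
      ((coefA₁ P β o N * ∑ μ, J₁ (Sum.inr μ) * τ μ
          + coefB₁ P β γ o * ∑ i, J₁ (Sum.inl i) * val (σ i))
        + (coefA₂ P β o N * ∑ μ, J₂ (Sum.inr μ) * τ μ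
          + coefB₂ P β γ o * ∑ i, J₂ (Sum.inl i) * val (σ i)))
    + (1 - t) / 2 * coefC P β o N * ∑ μ, τ μ ^ 2
    - betaEff P β * γ / 2 * ((N : ℝ) ^ P / (N : ℝ) ^ (P / 2)))

/-- The interpolating partition function `Z₂`: sum over the spins, standard Gaussian integral over
the hidden variables. -/
def Z₂ (P : ℕ) (β γ : ℝ) (o : OrderParameters) (t : ℝ) {N K : ℕ}
    (η : Spins N) (ξ : Noise P N K) (J₁ J₂ : Aux N K) : ℝ :=
  ∑ σ : Spins N, ∫ τ, boltzmann P β γ o t η ξ J₁ J₂ σ τ ∂(iidGaussian (Fin (K - 1)))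

/-- The average `𝔼₁` or `𝔼₂` over one level of auxiliary fields. -/
def auxAvg {N K : ℕ} (F : Aux N K → ℝ) : ℝ :=
  ∫ J, F J ∂(iidGaussian (Fin N ⊕ Fin (K - 1)))

/-- The weight `W₂ = Z₂^θ / 𝔼₂[Z₂^θ]`. -/
def weight (P : ℕ) (β γ : ℝ) (o : OrderParameters) (t : ℝ) {N K : ℕ}
    (η : Spins N) (ξ : Noise P N K) (J₁ J₂ : Aux N K) : ℝ :=
  Z₂ P β γ o t η ξ J₁ J₂ ^ o.θ / auxAvg fun J => Z₂ P β γ o t η ξ J₁ J ^ o.θ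

/-- The interpolating Gibbs average `ω(f)` of one replica. -/
def gibbs (P : ℕ) (β γ : ℝ) (o : OrderParameters) (t : ℝ) {N K : ℕ}
    (η : Spins N) (ξ : Noise P N K) (J₁ J₂ : Aux N K)
    (f : Spins N → (Fin (K - 1) → ℝ) → ℝ) : ℝ :=
  (∑ σ : Spins N, ∫ τ, f σ τ * boltzmann P β γ o t η ξ J₁ J₂ σ τ
      ∂(iidGaussian (Fin (K - 1)))) / Z₂ P β γ o t η ξ J₁ J₂

/-- The Gibbs average of two independent replicas with the same patterns and first-level fields,
the first replica having second-level fields `J₂`, the second one `J₂'`. -/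
def gibbsPair (P : ℕ) (β γ : ℝ) (o : OrderParameters) (t : ℝ) {N K : ℕ}
    (η : Spins N) (ξ : Noise P N K) (J₁ J₂ J₂' : Aux N K)
    (f : Spins N → (Fin (K - 1) → ℝ) → Spins N → (Fin (K - 1) → ℝ) → ℝ) : ℝ :=
  gibbs P β γ o t η ξ J₁ J₂ fun σ τ => gibbs P β γ o t η ξ J₁ J₂' fun σ' τ' => f σ τ σ' τ'

/-- `⟨f⟩ = 𝔼₀ 𝔼₁ 𝔼₂ [W₂ ω(f)]` for a one-replica observable (which may involve `ξ¹ = η`). -/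
def avg (P : ℕ) (β γ : ℝ) (o : OrderParameters) (t : ℝ) {N K : ℕ}
    (f : Spins N → Spins N → ℝ) : ℝ :=
  patternAvg (P := P) (K := K) fun η ξ => auxAvg fun J₁ => auxAvg fun J₂ =>
    weight P β γ o t η ξ J₁ J₂ * gibbs P β γ o t η ξ J₁ J₂ fun σ _ => f η σ

/-- `⟨f⟩₂ = 𝔼₀ 𝔼₁ 𝔼₂ [W₂ (ω ⊗ ω)(f)]`: the replicas share both levels of auxiliary fields. -/
def avgPair₂ (P : ℕ) (β γ : ℝ) (o : OrderParameters) (t : ℝ) {N K : ℕ}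
    (f : Spins N → (Fin (K - 1) → ℝ) → Spins N → (Fin (K - 1) → ℝ) → ℝ) : ℝ :=
  patternAvg (P := P) (K := K) fun η ξ => auxAvg fun J₁ => auxAvg fun J₂ =>
    weight P β γ o t η ξ J₁ J₂ * gibbsPair P β γ o t η ξ J₁ J₂ J₂ f

/-- `⟨f⟩₁ = 𝔼₀ 𝔼₁ [(𝔼₂[W₂ ω] ⊗ 𝔼₂[W₂ ω])(f)]`: the replicas share only the first level. -/
def avgPair₁ (P : ℕ) (β γ : ℝ) (o : OrderParameters) (t : ℝ) {N K : ℕ}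
    (f : Spins N → (Fin (K - 1) → ℝ) → Spins N → (Fin (K - 1) → ℝ) → ℝ) : ℝ :=
  patternAvg (P := P) (K := K) fun η ξ => auxAvg fun J₁ => auxAvg fun J₂ => auxAvg fun J₂' =>
    weight P β γ o t η ξ J₁ J₂ * weight P β γ o t η ξ J₁ J₂' *
      gibbsPair P β γ o t η ξ J₁ J₂ J₂' f

/-- The 1-RSB ("ziqqurat") ansatz at storage `K = γ N ^ (P - 1)`: along the interpolation, in the
limit `N → ∞`, the magnetization concentrates at `m̄`, and the overlaps `q₁₂`, `p₁₂` concentrate at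
`q̄₁`, `p̄₁` under `⟨·⟩₁` (total weight `θ`) and at `q̄₂`, `p̄₂` under `⟨·⟩₂` (total weight `1 - θ`).
The endpoint `t = 1` is left out: there the spin-flip symmetry is restored and the auxiliary fields
have disappeared, so that `⟨·⟩₁` and `⟨·⟩₂` coincide. -/
structure OneRSBAnsatz (P : ℕ) (β γ : ℝ) (o : OrderParameters) : Prop where
  magnetization_conc : ∀ t ∈ Set.Ico (0 : ℝ) 1, Tendsto
    (fun N : ℕ => avg P β γ o t (K := numPatterns γ (P - 1) N)
      fun η σ : Spins N => (magnetization η σ - o.m) ^ 2) atTop (𝓝 0)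
  overlapQ_conc₁ : ∀ t ∈ Set.Ico (0 : ℝ) 1, Tendsto
    (fun N : ℕ => avgPair₁ P β γ o t (K := numPatterns γ (P - 1) N)
      fun (σ : Spins N) _ σ' _ => (overlapQ σ σ' - o.q₁) ^ 2) atTop (𝓝 0)
  overlapQ_conc₂ : ∀ t ∈ Set.Ico (0 : ℝ) 1, Tendsto
    (fun N : ℕ => avgPair₂ P β γ o t (K := numPatterns γ (P - 1) N)
      fun (σ : Spins N) _ σ' _ => (overlapQ σ σ' - o.q₂) ^ 2) atTop (𝓝 0)
  overlapP_conc₁ : ∀ t ∈ Set.Ico (0 : ℝ) 1, Tendsto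
    (fun N : ℕ => avgPair₁ P β γ o t (K := numPatterns γ (P - 1) N)
      fun (_ : Spins N) τ _ τ' => (overlapP P N τ τ' - o.p₁) ^ 2) atTop (𝓝 0)
  overlapP_conc₂ : ∀ t ∈ Set.Ico (0 : ℝ) 1, Tendsto
    (fun N : ℕ => avgPair₂ P β γ o t (K := numPatterns γ (P - 1) N)
      fun (_ : Spins N) τ _ τ' => (overlapP P N τ τ' - o.p₂) ^ 2) atTop (𝓝 0)

/-! ### The 1-RSB expression of the pressure -/

/-- The effective field `g(J, m̄)`, with `J = (J⁽¹⁾, J⁽²⁾) = (x, y)`. -/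
def effField (P : ℕ) (β γ : ℝ) (o : OrderParameters) (x y : ℝ) : ℝ :=
  betaEff P β * P / 2 * o.m ^ (P - 1)
    + x * √(betaEff P β / 2 * γ * o.p₁ * P * o.q₁ ^ (P / 2 - 1))
    + y * √(betaEff P β / 2 * P * γ *
        (o.p₂ * o.q₂ ^ (P / 2 - 1) - o.p₁ * o.q₁ ^ (P / 2 - 1)))

/-- The 1-RSB pressure. -/
def oneRSBPressure (P : ℕ) (β γ : ℝ) (o : OrderParameters) : ℝ :=
  Real.log 2
    + 1 / o.θ * ∫ x, Real.log (∫ y, Real.cosh (effField P β γ o x y) ^ o.θ ∂(gaussianReal 0 1))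
        ∂(gaussianReal 0 1)
    - γ * betaEff P β / 4 * o.q₂ ^ (P / 2 - 1) * o.p₂ * (P - (P - 1) * o.q₂)
    + betaEff P β / 2 * o.m ^ P * (1 - P)
    - o.θ * (P - 1) * (betaEff P β * γ / 4) *
        (o.q₂ ^ (P / 2) * o.p₂ - o.q₁ ^ (P / 2) * o.p₁)
    + 1 / 4 * betaEff P β ^ 2 * γ

end DenseHebbian

end

/-!
The quenched pressure is the end of an interpolation between a solvable system and the network.
The hidden variables `τ_μ` enter the Boltzmann weight quadratically and can be integrated out
(`integral_mul_boltzmann`): for given spins and environment they are Gaussian with mean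
`X_μ = cmean` and variance `1 / den`, and what is left is a Gibbs measure on the spins with the
effective Hamiltonian `ham`. The free energy at `t`, with two levels of averaging over the
environment, is the quenched pressure at `t = 1` (`freeEnergy_end`) and factorizes over sites and
patterns at `t = 0` (`free_energy_start`, `tendsto_start`).

Along `t = sin² α` every Gaussian coupling has a coefficient `sin α` or `cos α`, so the free energy
is differentiable in `α` up to the endpoints (`hasDerivAt_free_energy`). Gaussian integration by
parts at each of the two levels (`ibp_first_level`, `ibp_second_level`) turns the derivative into
averages of overlaps of two replicas (`Small.avg_hamD`, `avg_hamD_eq_bracket`). The only terms in it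
which are not averages of a single overlap are `⟨(q₁₂ ^ (P/2) - q̄_b ^ (P/2)) p₁₂⟩_b`. As both
overlaps concentrate under the ansatz, these vanish (`abs_crossOv₂_le`, `abs_crossOv₁_le`), and the
derivative converges to `sin α cos α` times a constant (`tendsto_bracket`). It is bounded uniformly
in the size without any ansatz (`eventually_abs_bracket_le`), since integration by parts also gives
`⟨∑ X_μ²⟩ = O(K N ^ (1 - P/2))` (`Small.hidSq_le`). Dominated convergence then yields the limit of
the pressure (`tendsto_of_interpolation`, `tendsto_pressure`). All interchanges of limits and
integrals rest on one growth condition, `GBdd`: at most `exp (δ r)`, where `r` is the squared norm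
of the environment and `δ` is small. The partition function is bounded below because the odd part
of the Hamiltonian cancels between `σ` and `-σ`.

The limit found in this way is the stated expression only if the order parameters satisfy
relations which the ansatz does not list, and which it implies. At `t = 0` the hidden variables are
independent of the spins and their overlaps are explicit, so the concentration of `p₁₂` forces
`p̄_b = β' q̄_b ^ (P/2)` (`OneRSBAnsatz.p_eq`). The overlap `q₁₂` has a nonnegative mean at the first
level, and by Jensen's inequality a larger one at the second, whence `0 ≤ q̄₁ ≤ q̄₂`
(`OneRSBAnsatz.q₁_nonneg`, `OneRSBAnsatz.q₁_le_q₂`). In particular the square roots defining `A_b`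
and `B_b` have nonnegative arguments.

For the maximal storage, boundedness at `a = P - 1` is the same interpolation with all order
parameters zero: the starting free energies converge and the derivative is bounded
(`isIntensive_pred`). For `a ≥ P` the energy fluctuates too much. On `N = 2 ^ R` sites there are `R`
pairwise orthogonal configurations (`exists_orthogonal_spins`), at which the Gaussian fields are
independent (`map_iidGaussian`), so that the sums of their squares are independent chi-square
variables with `K - 1` degrees of freedom. The maximum of `R` such centered variables exceeds any
multiple of `√K` in mean, by the second moment method applied to the sum of their exponentials
(`exists_expected_max`), and `√K` is already of the order of an extensive energy when `a ≥ P`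
(`not_isIntensive`).
-/

set_option linter.unusedSectionVars false

noncomputable section

namespace DenseHebbian

/-! ### Gaussian integrals, tilting and integration by parts -/

/-- The standard Gaussian law on the line. -/
abbrev stdG : Measure ℝ := gaussianReal 0 1

instance {ι : Type} [Fintype ι] : IsProbabilityMeasure (iidGaussian ι) := by
  unfold iidGaussian; infer_instance

lemma gaussianPDFReal_tilt (h c : ℝ) (hc : c < 1) (x : ℝ) :
    gaussianPDFReal 0 1 x * Real.exp (h * x + c / 2 * x ^ 2) =
      ((√(1 - c))⁻¹ * Real.exp (h ^ 2 / (2 * (1 - c)))) *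
        gaussianPDFReal (h / (1 - c)) (Real.toNNReal (1 - c)⁻¹) x := by
  have h1 : 0 < 1 - c := by linarith
  have h2 : (0 : ℝ) ≤ (1 - c)⁻¹ := by positivity
  rw [gaussianPDFReal_def, gaussianPDFReal_def, Real.coe_toNNReal _ h2]
  have h3 : √(2 * Real.pi * (1 - c)⁻¹) = √(2 * Real.pi) * (√(1 - c))⁻¹ := by
    rw [Real.sqrt_mul (by positivity), Real.sqrt_inv]
  simp only [NNReal.coe_one, mul_one, h3, mul_inv, inv_inv]
  have h4 : √(1 - c) ≠ 0 := (Real.sqrt_pos.2 h1).ne'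
  rw [mul_assoc, ← Real.exp_add]
  have h5 : -(x - 0) ^ 2 / 2 + (h * x + c / 2 * x ^ 2) =
      h ^ 2 / (2 * (1 - c)) + -(x - h / (1 - c)) ^ 2 / (2 * (1 - c)⁻¹) := by
    field_simp; ring
  rw [h5, Real.exp_add]
  field_simp

/-- The normalization of the Gaussian law tilted by `exp (h x + c x² / 2)`. -/
def tiltNorm (h c : ℝ) : ℝ := (√(1 - c))⁻¹ * Real.exp (h ^ 2 / (2 * (1 - c)))

lemma tiltNorm_pos {h c : ℝ} (hc : c < 1) : 0 < tiltNorm h c := by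
  have h1 : 0 < 1 - c := by linarith
  unfold tiltNorm; positivity

lemma gaussian_withDensity_tilt (h c : ℝ) (hc : c < 1) :
    stdG.withDensity (fun x => ENNReal.ofReal (Real.exp (h * x + c / 2 * x ^ 2))) =
      ENNReal.ofReal (tiltNorm h c) • gaussianReal (h / (1 - c)) (Real.toNNReal (1 - c)⁻¹) := by
  have h1 : 0 < 1 - c := by linarith
  have hv : Real.toNNReal (1 - c)⁻¹ ≠ 0 := by
    simpa [Real.toNNReal_eq_zero] using h1
  rw [stdG, gaussianReal_of_var_ne_zero _ one_ne_zero, gaussianReal_of_var_ne_zero _ hv,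
    ← withDensity_mul _ (measurable_gaussianPDF _ _) (by fun_prop),
    ← withDensity_smul _ (measurable_gaussianPDF _ _)]
  congr 1
  ext x
  simp only [Pi.mul_apply, Pi.smul_apply, smul_eq_mul, gaussianPDF]
  rw [← ENNReal.ofReal_mul (gaussianPDFReal_nonneg _ _ _),
    ← ENNReal.ofReal_mul (tiltNorm_pos hc).le, gaussianPDFReal_tilt h c hc]
  rfl

lemma pi_withDensity {ι : Type} [Fintype ι] (ν : ι → Measure ℝ) [∀ i, IsProbabilityMeasure (ν i)]
    (f : ι → ℝ → ENNReal) (hf : ∀ i, Measurable (f i))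
    (hfin : ∀ i, SigmaFinite ((ν i).withDensity (f i))) :
    (Measure.pi ν).withDensity (fun x => ∏ i, f i (x i)) =
      Measure.pi fun i => (ν i).withDensity (f i) := by
  symm
  apply Measure.pi_eq
  intro s hs
  have hm : ∀ i, Measurable ((s i).indicator (f i)) := fun i => (hf i).indicator (hs i)
  rw [withDensity_apply _ (MeasurableSet.univ_pi hs), ← lintegral_indicator
    (MeasurableSet.univ_pi hs)]
  have h1 : ∀ x : ι → ℝ, (Set.univ.pi s).indicator (fun x => ∏ i, f i (x i)) x =
      ∏ i, (s i).indicator (f i) (x i) := by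
    intro x
    by_cases hx : x ∈ Set.univ.pi s
    · rw [Set.indicator_of_mem hx]
      refine Finset.prod_congr rfl fun i _ => ?_
      rw [Set.indicator_of_mem (hx i trivial)]
    · rw [Set.indicator_of_notMem hx]
      simp only [Set.mem_pi, Set.mem_univ, true_implies, not_forall] at hx
      obtain ⟨i, hi⟩ := hx
      exact (Finset.prod_eq_zero (Finset.mem_univ i) (Set.indicator_of_notMem hi _)).symm
  simp_rw [h1]
  have hind : iIndepFun (fun i (x : ι → ℝ) => (s i).indicator (f i) (x i)) (Measure.pi ν) :=
    iIndepFun_pi (X := fun i => (s i).indicator (f i)) fun i => (hm i).aemeasurable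
  have h2 := lintegral_prod_eq_prod_lintegral_of_indepFun (μ := Measure.pi ν) Finset.univ
    (fun i (x : ι → ℝ) => (s i).indicator (f i) (x i)) hind
    (fun i => (hm i).comp (measurable_pi_apply i))
  rw [h2]
  refine Finset.prod_congr rfl fun i _ => ?_
  rw [withDensity_apply _ (hs i), ← lintegral_indicator (hs i)]
  exact (measurePreserving_eval ν i).lintegral_comp (hm i)

/-- The product of the tilted Gaussian laws. -/
def tiltedLaw {ι : Type} [Fintype ι] (h : ι → ℝ) (c : ℝ) : Measure (ι → ℝ) :=
  Measure.pi fun i => gaussianReal (h i / (1 - c)) (Real.toNNReal (1 - c)⁻¹)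

instance {ι : Type} [Fintype ι] (h : ι → ℝ) (c : ℝ) : IsProbabilityMeasure (tiltedLaw h c) := by
  unfold tiltedLaw; infer_instance

lemma pi_smul_prob {ι : Type} [Fintype ι] (ν : ι → Measure ℝ) [∀ i, IsProbabilityMeasure (ν i)]
    (a : ι → ℝ) :
    Measure.pi (fun i => ENNReal.ofReal (a i) • ν i) =
      (∏ i, ENNReal.ofReal (a i)) • Measure.pi ν := by
  have : ∀ i, SigmaFinite (ENNReal.ofReal (a i) • ν i) := fun i =>
    have : IsFiniteMeasure (ENNReal.ofReal (a i) • ν i) :=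
      Measure.smul_finite (ν i) ENNReal.ofReal_ne_top
    inferInstance
  apply Measure.pi_eq
  intro s hs
  rw [Measure.smul_apply, Measure.pi_pi, smul_eq_mul, ← Finset.prod_mul_distrib]
  rfl

/-- Completing the square in all coordinates at once. -/
lemma integral_tilt {ι : Type} [Fintype ι] (h : ι → ℝ) (c : ℝ) (hc : c < 1)
    (f : (ι → ℝ) → ℝ) :
    ∫ x, f x * Real.exp (∑ i, h i * x i + c / 2 * ∑ i, x i ^ 2) ∂(iidGaussian ι) =
      (∏ i, tiltNorm (h i) c) * ∫ x, f x ∂(tiltedLaw h c) := by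
  have hs : ∀ i, (stdG.withDensity
      (fun x => ENNReal.ofReal (Real.exp (h i * x + c / 2 * x ^ 2)))) =
      ENNReal.ofReal (tiltNorm (h i) c) • gaussianReal (h i / (1 - c)) (Real.toNNReal (1 - c)⁻¹) :=
    fun i => gaussian_withDensity_tilt (h i) c hc
  have h1 := pi_withDensity (fun _ : ι => stdG)
    (fun i x => ENNReal.ofReal (Real.exp (h i * x + c / 2 * x ^ 2))) (fun i => by fun_prop)
    (fun i => by
      rw [hs i]
      have : IsFiniteMeasure (ENNReal.ofReal (tiltNorm (h i) c) •
        gaussianReal (h i / (1 - c)) (Real.toNNReal (1 - c)⁻¹)) :=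
        Measure.smul_finite _ ENNReal.ofReal_ne_top
      infer_instance)
  simp_rw [hs] at h1
  rw [pi_smul_prob] at h1
  have h2 : ∀ x : ι → ℝ, ∏ i, ENNReal.ofReal (Real.exp (h i * x i + c / 2 * x i ^ 2)) =
      ENNReal.ofReal (Real.exp (∑ i, h i * x i + c / 2 * ∑ i, x i ^ 2)) := by
    intro x
    rw [← ENNReal.ofReal_prod_of_nonneg (fun i _ => (Real.exp_pos _).le), ← Real.exp_sum,
      Finset.sum_add_distrib, Finset.mul_sum]
  simp_rw [h2] at h1
  have h3 : ∫ x, f x ∂((Measure.pi fun _ : ι => stdG).withDensity fun x =>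
      ENNReal.ofReal (Real.exp (∑ i, h i * x i + c / 2 * ∑ i, x i ^ 2))) =
      ∫ x, f x * Real.exp (∑ i, h i * x i + c / 2 * ∑ i, x i ^ 2) ∂(iidGaussian ι) := by
    rw [integral_withDensity_eq_integral_toReal_smul (by fun_prop)
      (Eventually.of_forall fun _ => ENNReal.ofReal_lt_top)]
    refine integral_congr_ae (Eventually.of_forall fun x => ?_)
    simp only [smul_eq_mul]
    rw [ENNReal.toReal_ofReal (Real.exp_pos _).le, mul_comm]
  rw [← h3, h1, integral_smul_measure, smul_eq_mul, ENNReal.toReal_prod]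
  simp_rw [ENNReal.toReal_ofReal (tiltNorm_pos hc).le]
  rfl

lemma integrable_exp_quadratic (h c : ℝ) (hc : c < 1) :
    Integrable (fun x => Real.exp (h * x + c / 2 * x ^ 2)) stdG := by
  have h1 : IsFiniteMeasure (stdG.withDensity
      (fun x => ENNReal.ofReal (Real.exp (h * x + c / 2 * x ^ 2)))) := by
    rw [gaussian_withDensity_tilt h c hc]
    exact Measure.smul_finite _ ENNReal.ofReal_ne_top
  refine ⟨by fun_prop, ?_⟩
  have := h1.measure_univ_lt_top
  rw [withDensity_apply _ MeasurableSet.univ, Measure.restrict_univ] at this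
  rw [hasFiniteIntegral_iff_norm]
  simpa [Real.norm_eq_abs, abs_of_pos (Real.exp_pos _)] using this

lemma integral_exp_quadratic (h c : ℝ) (hc : c < 1) :
    ∫ x, Real.exp (h * x + c / 2 * x ^ 2) ∂stdG = tiltNorm h c := by
  have h1 := integral_tilt (ι := Unit) (fun _ => h) c hc (fun _ => 1)
  simp only [Finset.univ_unique, Finset.sum_singleton, one_mul, Finset.prod_singleton,
    integral_const, probReal_univ, smul_eq_mul, mul_one] at h1
  rw [← h1]
  exact (integral_comp_eval (μ := fun _ : Unit => stdG) (i := ())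
    (f := fun x => Real.exp (h * x + c / 2 * x ^ 2)) (by fun_prop)).symm

lemma integral_tiltedLaw_eval {ι : Type} [Fintype ι] (h : ι → ℝ) (c : ℝ) (i : ι) :
    ∫ x, x i ∂(tiltedLaw h c) = h i / (1 - c) := by
  exact (integral_comp_eval (μ := fun i => gaussianReal (h i / (1 - c)) (Real.toNNReal (1 - c)⁻¹))
    (i := i) (f := fun x : ℝ => x) (by fun_prop)).trans integral_id_gaussianReal

/-- Second moment of an affine function under the tilted law. -/
lemma integral_tiltedLaw_linear_sq {ι : Type} [Fintype ι] (h : ι → ℝ) (c : ℝ) (hc : c < 1)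
    (b : ι → ℝ) (p : ℝ) :
    ∫ x, (∑ i, b i * x i - p) ^ 2 ∂(tiltedLaw h c) =
      (∑ i, b i * (h i / (1 - c)) - p) ^ 2 + (1 - c)⁻¹ * ∑ i, b i ^ 2 := by
  have hv : (0 : ℝ) ≤ (1 - c)⁻¹ := inv_nonneg.2 (by linarith)
  have hL1 : ∀ i, MemLp (fun x : ℝ => b i * x) 2
      (gaussianReal (h i / (1 - c)) (Real.toNNReal (1 - c)⁻¹)) := fun i =>
    (memLp_id_gaussianReal' 2 (by simp)).const_mul _
  have hL : ∀ i, MemLp (fun x : ι → ℝ => b i * x i) 2 (tiltedLaw h c) := fun i =>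
    (hL1 i).comp_measurePreserving (measurePreserving_eval _ i)
  have hS : MemLp (fun x : ι → ℝ => ∑ i, b i * x i) 2 (tiltedLaw h c) :=
    memLp_finsetSum _ fun i _ => hL i
  have hvar := variance_sum_pi (ι := ι)
    (μ := fun i => gaussianReal (h i / (1 - c)) (Real.toNNReal (1 - c)⁻¹))
    (X := fun i x => b i * x) hL1
  have hv1 : ∀ i, Var[fun x : ℝ => b i * x; gaussianReal (h i / (1 - c)) (Real.toNNReal (1 - c)⁻¹)]
      = b i ^ 2 * (1 - c)⁻¹ := fun i => by
    rw [variance_const_mul, variance_fun_id_gaussianReal, Real.coe_toNNReal _ hv]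
  simp_rw [hv1] at hvar
  have hmean : ∫ x, ∑ i, b i * x i ∂(tiltedLaw h c) = ∑ i, b i * (h i / (1 - c)) := by
    rw [integral_finsetSum _ fun i _ => (hL i).integrable (by norm_num)]
    refine Finset.sum_congr rfl fun i _ => ?_
    rw [integral_const_mul, integral_tiltedLaw_eval]
  -- The second moment is the variance, which is additive over the coordinates, plus the
  -- squared mean.
  have h1 := variance_eq_sub hS
  have h2 : Var[fun x : ι → ℝ => ∑ i, b i * x i; tiltedLaw h c] = ∑ i, b i ^ 2 * (1 - c)⁻¹ := by
    rw [← hvar]; unfold tiltedLaw; congr 1; ext x; simp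
  rw [h2, hmean] at h1
  have h3 : ∫ x, (∑ i, b i * x i - p) ^ 2 ∂(tiltedLaw h c) =
      ∫ x, (∑ i, b i * x i) ^ 2 ∂(tiltedLaw h c) -
        2 * p * ∫ x, (∑ i, b i * x i) ∂(tiltedLaw h c) + p ^ 2 := by
    have hS1 : Integrable (fun x : ι → ℝ => ∑ i, b i * x i) (tiltedLaw h c) :=
      hS.integrable (by norm_num)
    have e : ∀ x : ι → ℝ, (∑ i, b i * x i - p) ^ 2 =
        ((∑ i, b i * x i) ^ 2 - 2 * p * ∑ i, b i * x i) + p ^ 2 := fun x => by ring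
    simp_rw [e]
    rw [integral_add (f := fun x : ι → ℝ => (∑ i, b i * x i) ^ 2 - 2 * p * ∑ i, b i * x i)
      (hS.integrable_sq.sub (hS1.const_mul _)) (integrable_const _),
      integral_sub hS.integrable_sq (hS1.const_mul _), integral_const_mul, integral_const]
    simp
  have h4 : ∫ x, (∑ i, b i * x i) ^ 2 ∂(tiltedLaw h c) =
      (tiltedLaw h c)[(fun x : ι → ℝ => ∑ i, b i * x i) ^ 2] := rfl
  rw [h3, h4, hmean]
  rw [← Finset.sum_mul] at h1
  linear_combination -h1

/-- **Gaussian integration by parts** on the line. -/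
lemma gaussian_ibp {G G' : ℝ → ℝ} (hd : ∀ s, HasDerivAt G (G' s) s) (hG : Integrable G stdG)
    (hsG : Integrable (fun s => s * G s) stdG) (hG' : Integrable G' stdG) :
    ∫ s, s * G s ∂stdG = ∫ s, G' s ∂stdG := by
  have key : ∀ f : ℝ → ℝ, Integrable f stdG →
      Integrable (fun x => gaussianPDFReal 0 1 x * f x) := by
    intro f hf
    rw [stdG, gaussianReal_of_var_ne_zero _ one_ne_zero,
      integrable_withDensity_iff_integrable_smul' (measurable_gaussianPDF _ _)
        (Eventually.of_forall fun _ => gaussianPDF_lt_top)] at hf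
    simpa [toReal_gaussianPDF] using hf
  have hp : ∀ x, HasDerivAt (gaussianPDFReal 0 1) (-x * gaussianPDFReal 0 1 x) x := by
    intro x
    rw [gaussianPDFReal_def]
    have h1 : HasDerivAt (fun x : ℝ => -(x - 0) ^ 2 / (2 * ((1 : NNReal) : ℝ))) (-x) x := by
      exact ((((hasDerivAt_id x).sub_const 0).fun_pow 2).fun_neg.div_const
        (2 * ((1 : NNReal) : ℝ))).congr_deriv (by simp; ring)
    exact ((h1.exp).const_mul (√(2 * Real.pi * ((1 : NNReal) : ℝ)))⁻¹).congr_deriv (by ring)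
  -- The derivative of `density * G` integrates to zero.
  have h0 := integral_eq_zero_of_hasDerivAt_of_integrable
    (f := fun x => gaussianPDFReal 0 1 x * G x)
    (f' := fun x => -x * gaussianPDFReal 0 1 x * G x + gaussianPDFReal 0 1 x * G' x)
    (fun x => (hp x).mul (hd x))
    (by
      have := ((key _ hsG).neg).add (key _ hG')
      refine this.congr (Eventually.of_forall fun x => ?_)
      simp; ring)
    (key _ hG)
  rw [stdG, integral_gaussianReal_eq_integral_smul one_ne_zero,
    integral_gaussianReal_eq_integral_smul one_ne_zero]
  simp only [smul_eq_mul]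
  have h1 : ∫ x, (-x * gaussianPDFReal 0 1 x * G x + gaussianPDFReal 0 1 x * G' x) =
      (∫ x, gaussianPDFReal 0 1 x * G' x) - ∫ x, gaussianPDFReal 0 1 x * (x * G x) := by
    rw [← integral_sub (key _ hG') (key _ hsG)]
    refine integral_congr_ae (Eventually.of_forall fun x => ?_)
    ring
  rw [h1] at h0
  linarith

/-! ### Functions of Gaussian growth on a probability space with Gaussian coordinates -/

section Size

variable {Ω Ω' : Type*} [MeasurableSpace Ω] [MeasurableSpace Ω']

/-- `r` behaves like the squared norm under a Gaussian law `ν`: `exp (δ r)` is integrable for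
every `δ < 1/2`. -/
structure IsSize (ν : Measure Ω) (r : Ω → ℝ) : Prop where
  nonneg : ∀ x, 0 ≤ r x
  meas : Measurable r
  integrable_exp : ∀ δ : ℝ, δ < 1 / 2 → Integrable (fun x => Real.exp (δ * r x)) ν

lemma isSize_iidGaussian (ι : Type) [Fintype ι] :
    IsSize (iidGaussian ι) (fun x => ∑ i, x i ^ 2) where
  nonneg x := by positivity
  meas := by fun_prop
  integrable_exp δ hδ := by
    have h1 : ∀ x : ι → ℝ, Real.exp (δ * ∑ i, x i ^ 2) =
        ∏ i, Real.exp (0 * x i + (2 * δ) / 2 * x i ^ 2) := by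
      intro x
      rw [← Real.exp_sum, Finset.mul_sum]
      congr 1
      exact Finset.sum_congr rfl fun i _ => by ring
    simp_rw [h1]
    exact Integrable.fintype_prod (f := fun _ : ι => fun x : ℝ =>
      Real.exp (0 * x + (2 * δ) / 2 * x ^ 2))
      fun _ => integrable_exp_quadratic 0 (2 * δ) (by linarith)

lemma IsSize.prod {ν : Measure Ω} {ν' : Measure Ω'} [SFinite ν] [SFinite ν'] {r : Ω → ℝ}
    {r' : Ω' → ℝ} (h : IsSize ν r) (h' : IsSize ν' r') :
    IsSize (ν.prod ν') (fun p => r p.1 + r' p.2) where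
  nonneg p := add_nonneg (h.nonneg _) (h'.nonneg _)
  meas := (h.meas.comp measurable_fst).add (h'.meas.comp measurable_snd)
  integrable_exp δ hδ := by
    refine ((h.integrable_exp δ hδ).mul_prod (h'.integrable_exp δ hδ)).congr
      (Eventually.of_forall fun p => ?_)
    simp only
    rw [← Real.exp_add]; ring_nf

/-- `c` is a standard Gaussian coordinate of `ν`, independent of the rest: `u x s` is the point `x`
with this coordinate replaced by `s`. -/
structure IsGaussCoord (ν : Measure Ω) (r : Ω → ℝ) (c : Ω → ℝ) (u : Ω → ℝ → Ω) : Prop where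
  meas_u : Measurable fun p : Ω × ℝ => u p.1 p.2
  meas_c : Measurable c
  map_u : (ν.prod stdG).map (fun p : Ω × ℝ => u p.1 p.2) = ν
  coord : ∀ x s, c (u x s) = s
  size_u : ∀ x s, r (u x s) ≤ r x + s ^ 2
  sq_le : ∀ x, c x ^ 2 ≤ r x

/-- Each coordinate of an i.i.d. Gaussian family can be resampled; the size is the sum of the
squares. -/
lemma isGaussCoord_iidGaussian {ι : Type} [Fintype ι] [DecidableEq ι] (i : ι) :
    IsGaussCoord (iidGaussian ι) (fun x => ∑ i, x i ^ 2) (fun x => x i)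
      (fun x s => Function.update x i s) where
  meas_u := by
    rw [measurable_pi_iff]
    intro j
    by_cases hj : j = i
    · subst hj; simpa using measurable_snd
    · simp only [Function.update_of_ne hj]; fun_prop
  meas_c := by fun_prop
  map_u := by
    have hm : Measurable fun p : (ι → ℝ) × ℝ => Function.update p.1 i p.2 := by
      rw [measurable_pi_iff]
      intro j
      by_cases hj : j = i
      · subst hj; simpa using measurable_snd
      · simp only [Function.update_of_ne hj]; fun_prop
    symm
    apply Measure.pi_eq
    intro s hs
    rw [Measure.map_apply hm (MeasurableSet.univ_pi hs)]
    -- Resampling does not see the old value of the coordinate, so the preimage of a box is a box.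
    have h1 : (fun p : (ι → ℝ) × ℝ => Function.update p.1 i p.2) ⁻¹' Set.univ.pi s =
        (Set.univ.pi (Function.update s i Set.univ)) ×ˢ s i := by
      ext p
      simp only [Set.mem_preimage, Set.mem_pi, Set.mem_univ, true_implies, Set.mem_prod]
      constructor
      · intro h
        refine ⟨fun j => ?_, by simpa using h i⟩
        by_cases hj : j = i
        · subst hj; simp
        · simpa [Function.update_of_ne hj] using h j
      · rintro ⟨h, h2⟩ j
        by_cases hj : j = i
        · subst hj; simpa using h2
        · simpa [Function.update_of_ne hj] using h j
    rw [h1, Measure.prod_prod, iidGaussian, Measure.pi_pi,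
      ← Finset.mul_prod_erase _ (fun j => stdG (s j)) (Finset.mem_univ i),
      ← Finset.mul_prod_erase _ (fun j => stdG (Function.update s i Set.univ j))
        (Finset.mem_univ i)]
    rw [Function.update_self, measure_univ, one_mul, mul_comm]
    congr 1
    refine Finset.prod_congr rfl fun j hj => ?_
    rw [Function.update_of_ne (Finset.ne_of_mem_erase hj)]
  coord x s := by simp
  size_u x s := by
    rw [← Finset.add_sum_erase _ _ (Finset.mem_univ i), ← Finset.add_sum_erase _
      (fun j => x j ^ 2) (Finset.mem_univ i), Function.update_self]
    have : ∑ j ∈ Finset.univ.erase i, Function.update x i s j ^ 2 =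
        ∑ j ∈ Finset.univ.erase i, x j ^ 2 :=
      Finset.sum_congr rfl fun j hj => by rw [Function.update_of_ne (Finset.ne_of_mem_erase hj)]
    rw [this]
    nlinarith [sq_nonneg (x i)]
  sq_le x := Finset.single_le_sum (f := fun j => x j ^ 2) (fun j _ => sq_nonneg _)
    (Finset.mem_univ i)

lemma IsGaussCoord.fst {ν : Measure Ω} {ν' : Measure Ω'} [IsProbabilityMeasure ν]
    [IsProbabilityMeasure ν'] {r : Ω → ℝ} {r' : Ω' → ℝ} (hr' : ∀ y, 0 ≤ r' y) {c : Ω → ℝ}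
    {u : Ω → ℝ → Ω} (h : IsGaussCoord ν r c u) :
    IsGaussCoord (ν.prod ν') (fun p => r p.1 + r' p.2) (fun p => c p.1)
      (fun p s => (u p.1 s, p.2)) where
  meas_u := by
    have := h.meas_u.comp (f := fun q : (Ω × Ω') × ℝ => (q.1.1, q.2)) (by fun_prop)
    exact this.prodMk (by fun_prop)
  meas_c := h.meas_c.comp measurable_fst
  map_u := by
    have h0 : Measurable fun q : (Ω × Ω') × ℝ => (u q.1.1 q.2, q.1.2) :=
      (h.meas_u.comp (f := fun q : (Ω × Ω') × ℝ => (q.1.1, q.2)) (by fun_prop)).prodMk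
        (by fun_prop)
    symm
    apply Measure.prod_eq
    intro s t hs ht
    have hb : MeasurableSet ((fun p : Ω × ℝ => u p.1 p.2) ⁻¹' s) := h.meas_u hs
    have e1 := congrArg (fun m => m s) h.map_u
    rw [Measure.map_apply h.meas_u hs] at e1
    rw [← e1, Measure.map_apply h0 (hs.prod ht),
      Measure.prod_apply (h0 (hs.prod ht)), Measure.prod_apply hb,
      lintegral_prod _ (by
        exact (measurable_measure_prodMk_left (h0 (hs.prod ht))).aemeasurable)]
    rw [← lintegral_mul_const _ (measurable_measure_prodMk_left hb)]
    refine lintegral_congr fun x => ?_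
    have : ∀ y, stdG (Prod.mk (x, y) ⁻¹' ((fun q : (Ω × Ω') × ℝ => (u q.1.1 q.2, q.1.2)) ⁻¹'
        s ×ˢ t)) = t.indicator (fun _ => stdG (Prod.mk x ⁻¹' ((fun p : Ω × ℝ => u p.1 p.2) ⁻¹' s)))
          y := by
      intro y
      by_cases hy : y ∈ t
      · rw [Set.indicator_of_mem hy]
        congr 1
        ext z; simp [hy]
      · rw [Set.indicator_of_notMem hy]
        convert measure_empty (μ := stdG)
        ext z; simp [hy]
    simp_rw [this]
    rw [lintegral_indicator ht, setLIntegral_const]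
  coord p s := h.coord _ _
  size_u p s := by have := h.size_u p.1 s; linarith
  sq_le p := by have := h.sq_le p.1; have := hr' p.2; linarith

lemma IsGaussCoord.swap {ν : Measure Ω} {ν' : Measure Ω'} [IsProbabilityMeasure ν]
    [IsProbabilityMeasure ν'] {r : Ω → ℝ} {r' : Ω' → ℝ} {c : Ω × Ω' → ℝ}
    {u : Ω × Ω' → ℝ → Ω × Ω'}
    (h : IsGaussCoord (ν.prod ν') (fun p => r p.1 + r' p.2) c u) :
    IsGaussCoord (ν'.prod ν) (fun p => r' p.1 + r p.2) (fun p => c p.swap)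
      (fun p s => (u p.swap s).swap) where
  meas_u := measurable_swap.comp
    (h.meas_u.comp (f := fun q : (Ω' × Ω) × ℝ => (q.1.swap, q.2)) (by fun_prop))
  meas_c := h.meas_c.comp measurable_swap
  map_u := by
    have h1 : (fun p : (Ω' × Ω) × ℝ => (u p.1.swap p.2).swap) =
        Prod.swap ∘ (fun p : (Ω × Ω') × ℝ => u p.1 p.2) ∘ (Prod.map Prod.swap id) := by
      ext p <;> rfl
    have hsw : Measurable (Prod.map Prod.swap id : (Ω' × Ω) × ℝ → (Ω × Ω') × ℝ) := by fun_prop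
    rw [h1, ← Measure.map_map measurable_swap (h.meas_u.comp hsw), ← Measure.map_map h.meas_u hsw,
      ← Measure.map_prod_map _ _ measurable_swap measurable_id, Measure.prod_swap, Measure.map_id,
      h.map_u, Measure.prod_swap]
  coord p s := by simp [h.coord]
  size_u p s := by have := h.size_u p.swap s; simp at this ⊢; linarith
  sq_le p := by have := h.sq_le p.swap; simp at this ⊢; linarith

lemma IsGaussCoord.snd {ν : Measure Ω} {ν' : Measure Ω'} [IsProbabilityMeasure ν]
    [IsProbabilityMeasure ν'] {r : Ω → ℝ} {r' : Ω' → ℝ} (hr : ∀ y, 0 ≤ r y) {c : Ω' → ℝ}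
    {u : Ω' → ℝ → Ω'} (h : IsGaussCoord ν' r' c u) :
    IsGaussCoord (ν.prod ν') (fun p => r p.1 + r' p.2) (fun p => c p.2)
      (fun p s => (p.1, u p.2 s)) :=
  (h.fst (ν' := ν) hr).swap

/-- Gaussian integration by parts along one coordinate. -/
lemma IsGaussCoord.ibp {ν : Measure Ω} [IsProbabilityMeasure ν] {r c : Ω → ℝ} {u : Ω → ℝ → Ω}
    (h : IsGaussCoord ν r c u) {G G' : Ω → ℝ}
    (hd : ∀ x s, HasDerivAt (fun s => G (u x s)) (G' (u x s)) s) (hG : Integrable G ν)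
    (hcG : Integrable (fun x => c x * G x) ν) (hG' : Integrable G' ν) :
    ∫ x, c x * G x ∂ν = ∫ x, G' x ∂ν := by
  have hmp : MeasurePreserving (fun p : Ω × ℝ => u p.1 p.2) (ν.prod stdG) ν :=
    ⟨h.meas_u, h.map_u⟩
  have key : ∀ f : Ω → ℝ, Integrable f ν →
      Integrable (fun p : Ω × ℝ => f (u p.1 p.2)) (ν.prod stdG) ∧
        ∫ x, f x ∂ν = ∫ x, ∫ s, f (u x s) ∂stdG ∂ν := by
    intro f hf
    have h1 : Integrable (fun p : Ω × ℝ => f (u p.1 p.2)) (ν.prod stdG) :=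
      hmp.integrable_comp_of_integrable hf
    refine ⟨h1, ?_⟩
    rw [← integral_prod _ h1]
    conv_lhs => rw [← h.map_u]
    rw [integral_map h.meas_u.aemeasurable (by rw [h.map_u]; exact hf.aestronglyMeasurable)]
  rw [(key _ hcG).2, (key _ hG').2]
  refine integral_congr_ae ?_
  filter_upwards [(key _ hG).1.prod_right_ae, (key _ hcG).1.prod_right_ae,
    (key _ hG').1.prod_right_ae] with x h1 h2 h3
  simp only [h.coord] at h2 ⊢
  exact gaussian_ibp (hd x) h1 h2 h3

/-- Measurable functions bounded by `C exp (δ r)`. -/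
structure GBdd (r : Ω → ℝ) (δ : ℝ) (f : Ω → ℝ) : Prop where
  meas : Measurable f
  bound : ∃ C, 0 ≤ C ∧ ∀ x, |f x| ≤ C * Real.exp (δ * r x)

variable {ν : Measure Ω} {r : Ω → ℝ} {δ δ' : ℝ} {f g : Ω → ℝ}

lemma GBdd.integrable (hr : IsSize ν r) (hf : GBdd r δ f) (hδ : δ < 1 / 2) : Integrable f ν := by
  obtain ⟨C, -, hC⟩ := hf.bound
  exact ((hr.integrable_exp δ hδ).const_mul C).mono' hf.meas.aestronglyMeasurable
    (Eventually.of_forall hC)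

lemma GBdd.mono (hr : ∀ x, 0 ≤ r x) (hf : GBdd r δ f) (h : δ ≤ δ') : GBdd r δ' f where
  meas := hf.meas
  bound := by
    obtain ⟨C, h0, hC⟩ := hf.bound
    refine ⟨C, h0, fun x => (hC x).trans ?_⟩
    gcongr
    exact hr x

lemma GBdd.of_le (hg : GBdd r δ g) (hf : Measurable f) (h : ∀ x, |f x| ≤ |g x|) : GBdd r δ f where
  meas := hf
  bound := let ⟨C, h0, hC⟩ := hg.bound; ⟨C, h0, fun x => (h x).trans (hC x)⟩

lemma GBdd.const (c : ℝ) : GBdd r 0 (fun _ => c) :=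
  ⟨measurable_const, |c|, abs_nonneg c, fun x => by simp⟩

lemma GBdd.bounded (hf : Measurable f) (C : ℝ) (h : ∀ x, |f x| ≤ C) : GBdd r 0 f :=
  ⟨hf, |C|, abs_nonneg C, fun x => by simpa using (h x).trans (le_abs_self C)⟩

lemma GBdd.mul (hf : GBdd r δ f) (hg : GBdd r δ' g) : GBdd r (δ + δ') (fun x => f x * g x) where
  meas := hf.meas.mul hg.meas
  bound := by
    obtain ⟨C, h0, hC⟩ := hf.bound
    obtain ⟨C', h0', hC'⟩ := hg.bound
    refine ⟨C * C', by positivity, fun x => ?_⟩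
    rw [abs_mul, add_mul, Real.exp_add]
    calc |f x| * |g x| ≤ (C * Real.exp (δ * r x)) * (C' * Real.exp (δ' * r x)) :=
          mul_le_mul (hC x) (hC' x) (abs_nonneg _) (by positivity)
      _ = _ := by ring

lemma GBdd.add (hf : GBdd r δ f) (hg : GBdd r δ g) : GBdd r δ (fun x => f x + g x) where
  meas := hf.meas.add hg.meas
  bound := by
    obtain ⟨C, h0, hC⟩ := hf.bound
    obtain ⟨C', h0', hC'⟩ := hg.bound
    exact ⟨C + C', by positivity, fun x => (abs_add_le _ _).trans
      (by rw [add_mul]; exact add_le_add (hC x) (hC' x))⟩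

lemma GBdd.const_mul (c : ℝ) (hf : GBdd r δ f) : GBdd r δ (fun x => c * f x) := by
  simpa using (GBdd.const (r := r) c).mul hf

lemma GBdd.sub (hf : GBdd r δ f) (hg : GBdd r δ g) : GBdd r δ (fun x => f x - g x) := by
  simpa [sub_eq_add_neg] using hf.add (hg.const_mul (-1))

lemma GBdd.sum {T : Type*} (s : Finset T) {F : T → Ω → ℝ} (hr : ∀ x, 0 ≤ r x) (hδ : 0 ≤ δ)
    (hF : ∀ t, GBdd r δ (F t)) : GBdd r δ (fun x => ∑ t ∈ s, F t x) := by
  classical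
  induction s using Finset.induction_on with
  | empty => simpa using (GBdd.const (r := r) 0).mono hr hδ
  | insert a s ha ih => simp_rw [Finset.sum_insert ha]; exact (hF a).add ih

lemma GBdd.congr (hf : GBdd r δ f) (h : ∀ x, f x = g x) : GBdd r δ g := by
  have : f = g := funext h
  exact this ▸ hf

lemma GBdd.comp {s : Ω' → ℝ} (hf : GBdd r δ f) {e : Ω' → Ω} (he : Measurable e) (hδ : 0 ≤ δ)
    (h : ∀ x, r (e x) ≤ s x) : GBdd s δ (fun x => f (e x)) where
  meas := hf.meas.comp he
  bound := by
    obtain ⟨C, h0, hC⟩ := hf.bound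
    refine ⟨C, h0, fun x => (hC _).trans ?_⟩
    gcongr
    exact h x

/-- Integrating out one factor of a product keeps the growth in the other one. -/
lemma GBdd.integral_right {ν' : Measure Ω'} [SFinite ν'] {r' : Ω' → ℝ} (hr' : IsSize ν' r')
    {F : Ω × Ω' → ℝ} (hF : GBdd (fun p => r p.1 + r' p.2) δ F) (hδ : δ < 1 / 2) :
    GBdd r δ (fun x => ∫ y, F (x, y) ∂ν') where
  meas := hF.meas.stronglyMeasurable.integral_prod_right'.measurable
  bound := by
    obtain ⟨C, h0, hC⟩ := hF.bound
    have hint := hr'.integrable_exp δ hδ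
    refine ⟨C * ∫ y, Real.exp (δ * r' y) ∂ν', mul_nonneg h0 (integral_nonneg fun _ =>
      (Real.exp_pos _).le), fun x => ?_⟩
    have h1 : ‖∫ y, F (x, y) ∂ν'‖ ≤ ∫ y, C * Real.exp (δ * r x) * Real.exp (δ * r' y) ∂ν' := by
      refine norm_integral_le_of_norm_le (hint.const_mul _) (Eventually.of_forall fun y => ?_)
      refine (hC (x, y)).trans (le_of_eq ?_)
      rw [mul_add, Real.exp_add]; ring
    rw [integral_const_mul] at h1
    rw [← Real.norm_eq_abs]
    linarith

lemma GBdd.slice {r' : Ω' → ℝ} {F : Ω × Ω' → ℝ} (hF : GBdd (fun p => r p.1 + r' p.2) δ F) (x : Ω) :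
    GBdd r' δ (fun y => F (x, y)) where
  meas := hF.meas.comp measurable_prodMk_left
  bound := by
    obtain ⟨C, h0, hC⟩ := hF.bound
    refine ⟨C * Real.exp (δ * r x), by positivity, fun y => (hC (x, y)).trans (le_of_eq ?_)⟩
    simp only
    rw [mul_add, Real.exp_add]; ring

lemma IsGaussCoord.gbdd {c : Ω → ℝ} {u : Ω → ℝ → Ω} (h : IsGaussCoord ν r c u) (hδ : 0 < δ) :
    GBdd r δ c where
  meas := h.meas_c
  bound := by
    refine ⟨1 + 1 / δ, by positivity, fun x => ?_⟩
    have h1 : |c x| ≤ 1 + r x := by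
      have := h.sq_le x
      nlinarith [sq_nonneg (|c x| - 1), sq_abs (c x)]
    have h2 : δ * r x + 1 ≤ Real.exp (δ * r x) := Real.add_one_le_exp _
    have h3 : 0 ≤ r x := (sq_nonneg _).trans (h.sq_le x)
    have h4 : 1 ≤ Real.exp (δ * r x) := Real.one_le_exp (by positivity)
    have h5 : r x ≤ 1 / δ * Real.exp (δ * r x) := by
      rw [one_div, inv_mul_eq_div, le_div_iff₀ hδ]; linarith
    linarith

/-- Differentiation under an integral whose integrand has a derivative of Gaussian growth. -/
lemma hasDerivAt_integral_growth [IsProbabilityMeasure ν] (hr : IsSize ν r) {F F' : ℝ → Ω → ℝ}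
    {C a : ℝ} (hδ : δ < 1 / 2) (ha : 0 ≤ a) (hC0 : 0 ≤ C)
    (hF : ∀ s, Measurable (F s)) (hFi : ∀ s, Integrable (F s) ν) (hF' : ∀ s, Measurable (F' s))
    (hd : ∀ s x, HasDerivAt (fun s => F s x) (F' s x) s)
    (hb : ∀ s x, |F' s x| ≤ C * Real.exp (a * s ^ 2) * Real.exp (δ * r x)) (s : ℝ) :
    HasDerivAt (fun s => ∫ x, F s x ∂ν) (∫ x, F' s x ∂ν) s := by
  refine (hasDerivAt_integral_of_dominated_loc_of_deriv_le (s := Metric.ball s 1)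
    (bound := fun x => C * Real.exp (a * (|s| + 1) ^ 2) * Real.exp (δ * r x))
    (Metric.ball_mem_nhds s one_pos) (Eventually.of_forall fun s => (hF s).aestronglyMeasurable)
    (hFi s) (hF' s).aestronglyMeasurable (Eventually.of_forall fun x t ht => ?_)
    ((hr.integrable_exp δ hδ).const_mul _) (Eventually.of_forall fun x t _ => hd t x)).2
  refine (hb t x).trans ?_
  have h1 : t ^ 2 ≤ (|s| + 1) ^ 2 := by
    have h2 : |t - s| < 1 := by simpa [Real.dist_eq] using ht
    have h3 : |t| ≤ |s| + 1 := by
      have := abs_sub_abs_le_abs_sub t s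
      linarith
    rw [← sq_abs t]
    exact pow_le_pow_left₀ (abs_nonneg t) h3 2
  gcongr

end Size

/-! ### Finite Gibbs measures -/

section Gibbs

variable {S : Type*} [Fintype S]

/-- The partition function of the energy function `h` on a finite set. -/
def zsum (h : S → ℝ) : ℝ := ∑ σ, Real.exp (h σ)

/-- The Gibbs weights of `h`. -/
def gw (h : S → ℝ) (σ : S) : ℝ := Real.exp (h σ) / zsum h

/-- The Gibbs average of `g`. -/
def gav (h g : S → ℝ) : ℝ := ∑ σ, gw h σ * g σ

lemma zsum_nonneg (h : S → ℝ) : 0 ≤ zsum h := Finset.sum_nonneg fun _ _ => (Real.exp_pos _).le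

lemma exp_le_zsum (h : S → ℝ) (σ : S) : Real.exp (h σ) ≤ zsum h :=
  Finset.single_le_sum (f := fun σ => Real.exp (h σ)) (fun _ _ => (Real.exp_pos _).le)
    (Finset.mem_univ σ)

lemma zsum_pos [Nonempty S] (h : S → ℝ) : 0 < zsum h :=
  (Real.exp_pos _).trans_le (exp_le_zsum h (Classical.arbitrary S))

lemma gw_nonneg (h : S → ℝ) (σ : S) : 0 ≤ gw h σ := div_nonneg (Real.exp_pos _).le (zsum_nonneg h)

lemma gw_le_one (h : S → ℝ) (σ : S) : gw h σ ≤ 1 :=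
  div_le_one_of_le₀ (exp_le_zsum h σ) (zsum_nonneg h)

lemma sum_gw [Nonempty S] (h : S → ℝ) : ∑ σ, gw h σ = 1 := by
  simp only [gw, ← Finset.sum_div]
  exact div_self (zsum_pos h).ne'

lemma gav_const [Nonempty S] (h : S → ℝ) (c : ℝ) : gav h (fun _ => c) = c := by
  rw [gav, ← Finset.sum_mul, sum_gw, one_mul]

lemma gav_const_mul (h g : S → ℝ) (c : ℝ) : gav h (fun σ => c * g σ) = c * gav h g := by
  simp only [gav, Finset.mul_sum]
  exact Finset.sum_congr rfl fun _ _ => by ring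

lemma hasDerivAt_zsum {h : S → ℝ → ℝ} {h' : S → ℝ} {s : ℝ}
    (hh : ∀ σ, HasDerivAt (h σ) (h' σ) s) [Nonempty S] :
    HasDerivAt (fun s => zsum fun σ => h σ s)
      (zsum (fun σ => h σ s) * gav (fun σ => h σ s) h') s := by
  refine (HasDerivAt.fun_sum fun σ _ => (hh σ).exp).congr_deriv ?_
  simp only [gav, gw, Finset.mul_sum]
  refine Finset.sum_congr rfl fun σ _ => ?_
  have := (zsum_pos fun σ => h σ s).ne'
  field_simp

lemma hasDerivAt_zsum_rpow {h : S → ℝ → ℝ} {h' : S → ℝ} {s : ℝ} (θ : ℝ)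
    (hh : ∀ σ, HasDerivAt (h σ) (h' σ) s) [Nonempty S] :
    HasDerivAt (fun s => (zsum fun σ => h σ s) ^ θ)
      (θ * (zsum (fun σ => h σ s) ^ θ * gav (fun σ => h σ s) h')) s := by
  have h0 := zsum_pos fun σ => h σ s
  refine ((hasDerivAt_zsum hh).rpow_const (p := θ) (Or.inl h0.ne')).congr_deriv ?_
  rw [Real.rpow_sub_one h0.ne']
  field_simp

lemma hasDerivAt_gav {h g : S → ℝ → ℝ} {h' g' : S → ℝ} {s : ℝ}
    (hh : ∀ σ, HasDerivAt (h σ) (h' σ) s) (hg : ∀ σ, HasDerivAt (g σ) (g' σ) s) [Nonempty S] :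
    HasDerivAt (fun s => gav (fun σ => h σ s) (fun σ => g σ s))
      (gav (fun σ => h σ s) (fun σ => g' σ + g σ s * h' σ) -
        gav (fun σ => h σ s) (fun σ => g σ s) * gav (fun σ => h σ s) h') s := by
  have h0 := zsum_pos fun σ => h σ s
  have h1 : ∀ σ, HasDerivAt (fun s => gw (fun σ => h σ s) σ * g σ s)
      (gw (fun σ => h σ s) σ * (g' σ + g σ s * h' σ) -
        gw (fun σ => h σ s) σ * g σ s * gav (fun σ => h σ s) h') s := fun σ => by
    refine (((hh σ).exp.div (hasDerivAt_zsum hh) h0.ne').mul (hg σ)).congr_deriv ?_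
    simp only [gw, Pi.div_apply]
    field_simp
    ring
  refine (HasDerivAt.fun_sum fun σ _ => h1 σ).congr_deriv ?_
  rw [Finset.sum_sub_distrib, ← Finset.sum_mul]
  rfl

end Gibbs

/-! ### The two-level free energy of a finite Gibbs measure in a Gaussian environment -/

section Levels

variable {S X Y : Type*} [Fintype S] [MeasurableSpace X] [MeasurableSpace Y]

/-- The `θ`-th power of the partition function. -/
def zpow (θ : ℝ) (H : S → X × Y → ℝ) (p : X × Y) : ℝ := zsum (fun σ => H σ p) ^ θ

/-- The average of the `θ`-th power of the partition function over the second level. -/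
def lvlU (γ : Measure Y) (θ : ℝ) (H : S → X × Y → ℝ) (x : X) : ℝ := ∫ y, zpow θ H (x, y) ∂γ

/-- The weight of the second level. -/
def lvlW (γ : Measure Y) (θ : ℝ) (H : S → X × Y → ℝ) (p : X × Y) : ℝ :=
  zpow θ H p / lvlU γ θ H p.1

/-- The Gibbs average of an observable as a function of the environment. -/
def gavE (H g : S → X × Y → ℝ) (p : X × Y) : ℝ := gav (fun σ => H σ p) (fun σ => g σ p)

/-- The growth rate allowed for the energy and for the observables. -/
abbrev rate : ℝ := 1 / 20

/-- A Hamiltonian whose partition function is bounded below and has slow Gaussian growth. -/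
structure Tame (r : X × Y → ℝ) (H : S → X × Y → ℝ) : Prop where
  meas : ∀ σ, Measurable (H σ)
  upper : ∃ B, ∀ σ p, H σ p ≤ B + rate * r p
  lower : ∃ b, ∀ p, ∃ σ, b ≤ H σ p

variable {r : X × Y → ℝ} {H : S → X × Y → ℝ} {θ : ℝ}

lemma measurable_zpow (hm : ∀ σ, Measurable (H σ)) : Measurable (zpow θ H) := by
  unfold zpow zsum
  exact (Finset.measurable_fun_sum _ fun σ _ => (hm σ).exp).pow_const θ

lemma measurable_gw (hm : ∀ σ, Measurable (H σ)) (σ : S) :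
    Measurable fun p => gw (fun σ => H σ p) σ := by
  unfold gw zsum
  exact (hm σ).exp.div (Finset.measurable_fun_sum _ fun σ _ => (hm σ).exp)

lemma zpow_le (hθ0 : 0 < θ) (hθ1 : θ ≤ 1) (hr : ∀ p, 0 ≤ r p) {B : ℝ}
    (hB : ∀ σ p, H σ p ≤ B + rate * r p) (p : X × Y) :
    |zpow θ H p| ≤ (1 + Fintype.card S * Real.exp B) * Real.exp (rate * r p) := by
  have h0 := zsum_nonneg fun σ => H σ p
  rw [zpow, abs_of_nonneg (Real.rpow_nonneg h0 _)]
  have h1 : zsum (fun σ => H σ p) ≤ Fintype.card S * Real.exp B * Real.exp (rate * r p) := by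
    calc zsum (fun σ => H σ p) ≤ ∑ _σ : S, Real.exp (B + rate * r p) :=
          Finset.sum_le_sum fun σ _ => Real.exp_le_exp.2 (hB σ p)
      _ = _ := by rw [Finset.sum_const, Finset.card_univ, nsmul_eq_mul, Real.exp_add]; ring
  have h2 : zsum (fun σ => H σ p) ^ θ ≤ 1 + zsum (fun σ => H σ p) := by
    calc zsum (fun σ => H σ p) ^ θ ≤ (1 + zsum (fun σ => H σ p)) ^ θ :=
          Real.rpow_le_rpow h0 (by linarith) hθ0.le
      _ ≤ (1 + zsum (fun σ => H σ p)) ^ (1 : ℝ) :=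
          Real.rpow_le_rpow_of_exponent_le (by linarith) hθ1
      _ = _ := Real.rpow_one _
  have h3 : 1 ≤ Real.exp (rate * r p) := Real.one_le_exp (mul_nonneg (by norm_num) (hr p))
  linarith

lemma le_zpow (hθ0 : 0 < θ) {b : ℝ} (hb : ∀ p, ∃ σ, b ≤ H σ p) (p : X × Y) :
    Real.exp (b * θ) ≤ zpow θ H p := by
  obtain ⟨σ, hσ⟩ := hb p
  rw [Real.exp_mul]
  exact Real.rpow_le_rpow (Real.exp_pos _).le
    ((Real.exp_le_exp.2 hσ).trans (exp_le_zsum (fun σ => H σ p) σ)) hθ0.le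

lemma GBdd.gavE {δ : ℝ} (hm : ∀ σ, Measurable (H σ)) (hr : ∀ p, 0 ≤ r p) (hδ : 0 ≤ δ)
    {g : S → X × Y → ℝ} (hg : ∀ σ, GBdd r δ (g σ)) : GBdd r δ (gavE H g) := by
  refine GBdd.sum _ hr hδ fun σ => ?_
  refine (hg σ).of_le ((measurable_gw hm σ).mul (hg σ).meas) fun p => ?_
  rw [abs_mul, abs_of_nonneg (gw_nonneg _ _)]
  exact mul_le_of_le_one_left (abs_nonneg _) (gw_le_one _ _)

variable {γX : Measure X} {γY : Measure Y} [IsProbabilityMeasure γX] [IsProbabilityMeasure γY]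
  {rX : X → ℝ} {rY : Y → ℝ}

/-- The size function of a product. -/
abbrev prodSize (rX : X → ℝ) (rY : Y → ℝ) (p : X × Y) : ℝ := rX p.1 + rY p.2

lemma GBdd.zpow (hr : ∀ p, 0 ≤ r p) (hH : Tame r H) (hθ0 : 0 < θ) (hθ1 : θ ≤ 1) :
    GBdd r rate (zpow θ H) where
  meas := measurable_zpow hH.meas
  bound := by
    obtain ⟨B, hB⟩ := hH.upper
    exact ⟨_, by positivity, zpow_le hθ0 hθ1 hr hB⟩

lemma IsSize.prod_nonneg (hX : IsSize γX rX) (hY : IsSize γY rY) (p : X × Y) :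
    0 ≤ prodSize rX rY p := add_nonneg (hX.nonneg _) (hY.nonneg _)

lemma GBdd.lvlU (hX : IsSize γX rX) (hY : IsSize γY rY) (hH : Tame (prodSize rX rY) H)
    (hθ0 : 0 < θ) (hθ1 : θ ≤ 1) : GBdd rX rate (lvlU γY θ H) :=
  (GBdd.zpow (hX.prod_nonneg hY) hH hθ0 hθ1).integral_right hY (by norm_num)

lemma integrable_zpow (hX : IsSize γX rX) (hY : IsSize γY rY) (hH : Tame (prodSize rX rY) H)
    (hθ0 : 0 < θ) (hθ1 : θ ≤ 1) (x : X) : Integrable (fun y => zpow θ H (x, y)) γY :=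
  ((GBdd.zpow (hX.prod_nonneg hY) hH hθ0 hθ1).slice x).integrable hY (by norm_num)

lemma le_lvlU (hθ0 : 0 < θ) {b : ℝ} (hb : ∀ p, ∃ σ, b ≤ H σ p) (x : X)
    (hi : Integrable (fun y => zpow θ H (x, y)) γY) :
    Real.exp (b * θ) ≤ lvlU γY θ H x := by
  have h1 : ∫ _y : Y, Real.exp (b * θ) ∂γY ≤ ∫ y, zpow θ H (x, y) ∂γY :=
    integral_mono (integrable_const _) hi fun y => le_zpow hθ0 hb (x, y)
  simpa [lvlU] using h1

lemma lvlU_pos (hX : IsSize γX rX) (hY : IsSize γY rY) (hH : Tame (prodSize rX rY) H)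
    (hθ0 : 0 < θ) (hθ1 : θ ≤ 1) (x : X) : 0 < lvlU γY θ H x :=
  let ⟨_, hb⟩ := hH.lower
  (Real.exp_pos _).trans_le (le_lvlU hθ0 hb x (integrable_zpow hX hY hH hθ0 hθ1 x))

lemma GBdd.lvlW (hX : IsSize γX rX) (hY : IsSize γY rY) (hH : Tame (prodSize rX rY) H)
    (hθ0 : 0 < θ) (hθ1 : θ ≤ 1) : GBdd (prodSize rX rY) rate (lvlW γY θ H) := by
  obtain ⟨b, hb⟩ := hH.lower
  have hU := GBdd.lvlU hX hY hH hθ0 hθ1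
  have h1 : GBdd (prodSize rX rY) 0 (fun p => (DenseHebbian.lvlU γY θ H p.1)⁻¹) :=
    GBdd.bounded (hU.meas.comp measurable_fst).inv (Real.exp (b * θ))⁻¹ fun p => by
      have h2 := le_lvlU hθ0 hb p.1 (integrable_zpow hX hY hH hθ0 hθ1 p.1)
      rw [abs_of_pos (inv_pos.2 ((Real.exp_pos _).trans_le h2))]
      exact inv_anti₀ (Real.exp_pos _) h2
  exact (((GBdd.zpow (hX.prod_nonneg hY) hH hθ0 hθ1).mul h1).mono (hX.prod_nonneg hY)
    (by norm_num)).congr fun p => by rw [DenseHebbian.lvlW, div_eq_mul_inv]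

lemma zpow_nonneg (p : X × Y) : 0 ≤ zpow θ H p := Real.rpow_nonneg (zsum_nonneg _) _

lemma lvlW_nonneg (p : X × Y) : 0 ≤ lvlW γY θ H p :=
  div_nonneg (zpow_nonneg p) (integral_nonneg fun _ => zpow_nonneg _)

lemma integral_lvlW (hX : IsSize γX rX) (hY : IsSize γY rY) (hH : Tame (prodSize rX rY) H)
    (hθ0 : 0 < θ) (hθ1 : θ ≤ 1) (x : X) : ∫ y, lvlW γY θ H (x, y) ∂γY = 1 := by
  simp only [lvlW, integral_div]
  exact div_self (lvlU_pos hX hY hH hθ0 hθ1 x).ne'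

/-- Integration by parts along a coordinate of the second level: the weight `lvlW` contributes the
term with factor `θ`, the normalization of the Gibbs measure the term with factor `-1`. -/
lemma ibp_second_level [Nonempty S] (hX : IsSize γX rX) (hY : IsSize γY rY)
    (hH : Tame (prodSize rX rY) H) (hθ0 : 0 < θ) (hθ1 : θ ≤ 1) {c : Y → ℝ} {u : Y → ℝ → Y}
    (hc : IsGaussCoord γY rY c u) {H' g g' : S → X × Y → ℝ}
    (hH' : ∀ σ, GBdd (prodSize rX rY) rate (H' σ)) (hg : ∀ σ, GBdd (prodSize rX rY) rate (g σ))
    (hg' : ∀ σ, GBdd (prodSize rX rY) rate (g' σ))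
    (dH : ∀ σ x y s, HasDerivAt (fun s => H σ (x, u y s)) (H' σ (x, u y s)) s)
    (dg : ∀ σ x y s, HasDerivAt (fun s => g σ (x, u y s)) (g' σ (x, u y s)) s) (x : X) :
    ∫ y, c y * (lvlW γY θ H (x, y) * gavE H g (x, y)) ∂γY =
      ∫ y, lvlW γY θ H (x, y) * (gavE H (fun σ p => g' σ p + g σ p * H' σ p) (x, y) +
        (θ - 1) * (gavE H g (x, y) * gavE H H' (x, y))) ∂γY := by
  have hr := hX.prod_nonneg hY
  have bW := GBdd.lvlW hX hY hH hθ0 hθ1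
  have bg := GBdd.gavE hH.meas hr (by norm_num) hg
  have bH' := GBdd.gavE hH.meas hr (by norm_num) hH'
  have b1 := GBdd.gavE hH.meas hr (by norm_num) (δ := rate + rate)
    (g := fun σ p => g' σ p + g σ p * H' σ p)
    fun σ => ((hg' σ).mono hr (by norm_num)).add ((hg σ).mul (hH' σ))
  have bG := bW.mul bg
  have bG' := bW.mul (b1.add ((bg.mul bH').const_mul (θ - 1)))
  have bc : GBdd rY rate c := hc.gbdd (by norm_num)
  refine hc.ibp (G := fun y => lvlW γY θ H (x, y) * gavE H g (x, y)) (fun y s => ?_)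
    ((bG.slice x).integrable hY (by norm_num))
    ((bc.mul (bG.slice x)).integrable hY (by norm_num))
    ((bG'.slice x).integrable hY (by norm_num))
  -- The normalization `lvlU` does not depend on the second level.
  have d1 := (hasDerivAt_zsum_rpow θ fun σ => dH σ x y s).div_const (lvlU γY θ H x)
  have d2 := hasDerivAt_gav (fun σ => dH σ x y s) (fun σ => dg σ x y s)
  refine (d1.mul d2).congr_deriv ?_
  simp only [lvlW, zpow, gavE]
  ring

/-- Differentiation of the second-level average along a curve of environments. -/
lemma hasDerivAt_lvlU [Nonempty S] (hY : IsSize γY rY) (hθ0 : 0 < θ) (hθ1 : θ ≤ 1)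
    {h h' : ℝ → S → Y → ℝ} {B C a : ℝ} (ha : 0 ≤ a) (hC : 0 ≤ C)
    (mh : ∀ s σ, Measurable (h s σ)) (mh' : ∀ s σ, Measurable (h' s σ))
    (dh : ∀ s σ y, HasDerivAt (fun s => h s σ y) (h' s σ y) s)
    (hB : ∀ s σ y, h s σ y ≤ B + rate * (a * s ^ 2 + rY y))
    (hC' : ∀ s σ y, |h' s σ y| ≤ C * Real.exp (rate * (a * s ^ 2 + rY y))) (s : ℝ) :
    HasDerivAt (fun s => ∫ y, zsum (fun σ => h s σ y) ^ θ ∂γY)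
      (∫ y, θ * (zsum (fun σ => h s σ y) ^ θ * gav (fun σ => h s σ y) (fun σ => h' s σ y)) ∂γY)
      s := by
  have mz : ∀ s, Measurable fun y => zsum (fun σ => h s σ y) ^ θ := fun s => by
    unfold zsum
    exact (Finset.measurable_fun_sum _ fun σ _ => (mh s σ).exp).pow_const θ
  have mg : ∀ s, Measurable fun y => gav (fun σ => h s σ y) (fun σ => h' s σ y) := fun s => by
    unfold gav gw zsum
    exact Finset.measurable_fun_sum _ fun σ _ => ((mh s σ).exp.div
      (Finset.measurable_fun_sum _ fun σ _ => (mh s σ).exp)).mul (mh' s σ)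
  have bz : ∀ s y, |zsum (fun σ => h s σ y) ^ θ| ≤
      (1 + Fintype.card S * Real.exp B) * Real.exp (rate * (a * s ^ 2 + rY y)) := fun s y =>
    zpow_le (X := ℝ) (Y := Y) (H := fun σ p => h p.1 σ p.2) (r := fun p => a * p.1 ^ 2 + rY p.2)
      hθ0 hθ1 (fun p => add_nonneg (by positivity) (hY.nonneg _)) (fun σ p => hB p.1 σ p.2) (s, y)
  have bg : ∀ s y, |gav (fun σ => h s σ y) (fun σ => h' s σ y)| ≤
      C * Real.exp (rate * (a * s ^ 2 + rY y)) := fun s y => by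
    calc |gav (fun σ => h s σ y) (fun σ => h' s σ y)|
        ≤ ∑ σ, |gw (fun σ => h s σ y) σ * h' s σ y| := Finset.abs_sum_le_sum_abs _ _
      _ ≤ ∑ σ, gw (fun σ => h s σ y) σ * (C * Real.exp (rate * (a * s ^ 2 + rY y))) := by
          refine Finset.sum_le_sum fun σ _ => ?_
          rw [abs_mul, abs_of_nonneg (gw_nonneg _ _)]
          exact mul_le_mul_of_nonneg_left (hC' s σ y) (gw_nonneg _ _)
      _ = _ := by rw [← Finset.sum_mul, sum_gw, one_mul]
  refine hasDerivAt_integral_growth hY (δ := 2 * rate) (a := 2 * rate * a)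
    (F' := fun s y => θ * (zsum (fun σ => h s σ y) ^ θ *
      gav (fun σ => h s σ y) (fun σ => h' s σ y)))
    (C := (1 + Fintype.card S * Real.exp B) * C) (by norm_num) (by positivity) (by positivity)
    mz (fun s => ?_) (fun s => ((mz s).mul (mg s)).const_mul θ)
    (fun s y => hasDerivAt_zsum_rpow θ fun σ => dh s σ y) (fun s y => ?_) s
  · refine GBdd.integrable (r := rY) (δ := rate) hY ⟨mz s, (1 + Fintype.card S * Real.exp B) *
      Real.exp (rate * (a * s ^ 2)), by positivity, fun y => (bz s y).trans (le_of_eq ?_)⟩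
      (by norm_num)
    rw [mul_add, Real.exp_add]; ring
  · rw [abs_mul, abs_mul, abs_of_pos hθ0]
    calc θ * (|zsum (fun σ => h s σ y) ^ θ| * |gav (fun σ => h s σ y) (fun σ => h' s σ y)|)
        ≤ 1 * (((1 + Fintype.card S * Real.exp B) * Real.exp (rate * (a * s ^ 2 + rY y))) *
            (C * Real.exp (rate * (a * s ^ 2 + rY y)))) := by
          gcongr
          · exact bz s y
          · exact bg s y
      _ = (1 + Fintype.card S * Real.exp B) * C *
            (Real.exp (rate * (a * s ^ 2 + rY y)) * Real.exp (rate * (a * s ^ 2 + rY y))) := by ring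
      _ = _ := by
        rw [← Real.exp_add, show rate * (a * s ^ 2 + rY y) + rate * (a * s ^ 2 + rY y) =
          2 * rate * a * s ^ 2 + 2 * rate * rY y by ring, Real.exp_add]
        ring

/-- Integration by parts along a coordinate of the first level: compared with the second level,
the normalization of the weight contributes in addition. -/
lemma ibp_first_level [Nonempty S] (hX : IsSize γX rX) (hY : IsSize γY rY)
    (hH : Tame (prodSize rX rY) H) (hθ0 : 0 < θ) (hθ1 : θ ≤ 1) {c : X → ℝ} {u : X → ℝ → X}
    (hc : IsGaussCoord γX rX c u) {H' g g' : S → X × Y → ℝ}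
    (hH' : ∀ σ, GBdd (prodSize rX rY) rate (H' σ)) (hg : ∀ σ, GBdd (prodSize rX rY) rate (g σ))
    (hg' : ∀ σ, GBdd (prodSize rX rY) rate (g' σ))
    (dH : ∀ σ x y s, HasDerivAt (fun s => H σ (u x s, y)) (H' σ (u x s, y)) s)
    (dg : ∀ σ x y s, HasDerivAt (fun s => g σ (u x s, y)) (g' σ (u x s, y)) s) :
    ∫ x, ∫ y, c x * (lvlW γY θ H (x, y) * gavE H g (x, y)) ∂γY ∂γX =
      ∫ x, ∫ y, lvlW γY θ H (x, y) * (gavE H (fun σ p => g' σ p + g σ p * H' σ p) (x, y) +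
          (θ - 1) * (gavE H g (x, y) * gavE H H' (x, y))) ∂γY ∂γX -
        θ * ∫ x, (∫ y, lvlW γY θ H (x, y) * gavE H g (x, y) ∂γY) *
          (∫ y, lvlW γY θ H (x, y) * gavE H H' (x, y) ∂γY) ∂γX := by
  have hr := hX.prod_nonneg hY
  have hXY : IsSize (γX.prod γY) (prodSize rX rY) := hX.prod hY
  have bW := GBdd.lvlW hX hY hH hθ0 hθ1
  have bg := GBdd.gavE hH.meas hr (by norm_num) hg
  have bH' := GBdd.gavE hH.meas hr (by norm_num) hH'
  have b1 := GBdd.gavE hH.meas hr (by norm_num) (δ := rate + rate)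
    (g := fun σ p => g' σ p + g σ p * H' σ p)
    fun σ => ((hg' σ).mono hr (by norm_num)).add ((hg σ).mul (hH' σ))
  have bG := bW.mul bg
  have bGH' := bW.mul bH'
  have bA := bW.mul (b1.add ((bg.mul bH').const_mul (θ - 1)))
  have bI : GBdd rX (rate + rate) (fun x => ∫ y, lvlW γY θ H (x, y) * gavE H H' (x, y) ∂γY) :=
    bGH'.integral_right hY (by norm_num)
  have bI' : GBdd rX (rate + rate) (fun x => ∫ y, lvlW γY θ H (x, y) * gavE H g (x, y) ∂γY) :=
    bG.integral_right hY (by norm_num)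
  have bI2 : GBdd (prodSize rX rY) (rate + rate)
      (fun p => ∫ y, lvlW γY θ H (p.1, y) * gavE H H' (p.1, y) ∂γY) :=
    bI.comp measurable_fst (by norm_num) fun p => le_add_of_nonneg_right (hY.nonneg _)
  have bB := (bG.mul bI2).const_mul θ
  have bc : GBdd (prodSize rX rY) rate (fun p => c p.1) :=
    (hc.fst (ν' := γY) hY.nonneg).gbdd (by norm_num)
  have iG := bG.integrable hXY (by norm_num)
  have icG := (bc.mul bG).integrable hXY (by norm_num)
  have iA := bA.integrable hXY (by norm_num)
  have iB := bB.integrable hXY (by norm_num)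
  -- The normalization of the weight depends on the first level; its logarithmic derivative is
  -- `θ` times the weighted average of `H'`.
  have dU : ∀ x s, HasDerivAt (fun s => lvlU γY θ H (u x s))
      (θ * (lvlU γY θ H (u x s) * ∫ y, lvlW γY θ H (u x s, y) * gavE H H' (u x s, y) ∂γY)) s := by
    intro x s
    obtain ⟨B, hB⟩ := hH.upper
    have hCσ : ∃ C, 0 ≤ C ∧ ∀ σ p, |H' σ p| ≤ C * Real.exp (rate * prodSize rX rY p) := by
      choose C h0 hC using fun σ => (hH' σ).bound
      refine ⟨∑ σ, C σ, Finset.sum_nonneg fun σ _ => h0 σ, fun σ p => (hC σ p).trans ?_⟩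
      gcongr
      exact Finset.single_le_sum (f := C) (fun σ _ => h0 σ) (Finset.mem_univ σ)
    obtain ⟨C, hC0, hC⟩ := hCσ
    have hsz : ∀ s y, prodSize rX rY (u x s, y) ≤ rX x + (1 * s ^ 2 + rY y) := fun s y => by
      have := hc.size_u x s
      simp only [prodSize]; linarith
    have mu : ∀ s, Measurable fun y : Y => (u x s, y) := fun s => measurable_prodMk_left
    have := hasDerivAt_lvlU (γY := γY) hY hθ0 hθ1 (a := 1) (B := B + rate * rX x)
      (C := C * Real.exp (rate * rX x)) (h := fun s σ y => H σ (u x s, y))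
      (h' := fun s σ y => H' σ (u x s, y)) zero_le_one (by positivity)
      (fun s σ => (hH.meas σ).comp (mu s)) (fun s σ => (hH' σ).meas.comp (mu s))
      (fun s σ y => dH σ x y s)
      (fun s σ y => (hB σ _).trans (by have := hsz s y; simp only [rate]; linarith))
      (fun s σ y => (hC σ _).trans (by
        rw [mul_assoc, ← Real.exp_add, ← mul_add]
        gcongr
        exact hsz s y)) s
    refine this.congr_deriv ?_
    have hU := (lvlU_pos hX hY hH hθ0 hθ1 (u x s)).ne'
    rw [integral_const_mul, ← integral_const_mul (lvlU γY θ H (u x s))]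
    congr 1
    refine integral_congr_ae (Eventually.of_forall fun y => ?_)
    simp only [lvlW, zpow, gavE]
    field_simp
  have key := (hc.fst (ν' := γY) hY.nonneg).ibp
    (G := fun p => lvlW γY θ H p * gavE H g p)
    (G' := fun p => lvlW γY θ H p * (gavE H (fun σ p => g' σ p + g σ p * H' σ p) p +
          (θ - 1) * (gavE H g p * gavE H H' p)) - θ * (lvlW γY θ H p * gavE H g p *
          ∫ y, lvlW γY θ H (p.1, y) * gavE H H' (p.1, y) ∂γY))
    (fun p s => by
      have hU := (lvlU_pos hX hY hH hθ0 hθ1 (u p.1 s)).ne'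
      have d1 := (hasDerivAt_zsum_rpow θ fun σ => dH σ p.1 p.2 s).div (dU p.1 s) hU
      have d2 := hasDerivAt_gav (fun σ => dH σ p.1 p.2 s) (fun σ => dg σ p.1 p.2 s)
      refine (d1.mul d2).congr_deriv ?_
      rw [Pi.div_apply]
      set I := ∫ y, lvlW γY θ H (u p.1 s, y) * gavE H H' (u p.1 s, y) ∂γY
      simp only [lvlW, zpow, gavE]
      field_simp
      ring)
    iG icG (iA.sub iB)
  rw [integral_sub iA iB, integral_const_mul] at key
  rw [← integral_prod _ icG, key, integral_prod _ iA]
  congr 2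
  have iB' := (bG.mul bI2).integrable hXY (by norm_num)
  rw [integral_prod _ iB']
  refine integral_congr_ae (Eventually.of_forall fun x => ?_)
  simp only
  rw [integral_mul_const]

/-- Differentiation of the two-level free energy along a one-parameter family of Hamiltonians. -/
lemma hasDerivAt_free_energy [Nonempty S] (hX : IsSize γX rX) (hY : IsSize γY rY)
    (hθ0 : 0 < θ) (hθ1 : θ ≤ 1) {H H' : ℝ → S → X × Y → ℝ} {B C b : ℝ} (hC : 0 ≤ C)
    (mH : ∀ s σ, Measurable (H s σ)) (mH' : ∀ s σ, Measurable (H' s σ))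
    (dH : ∀ s σ p, HasDerivAt (fun s => H s σ p) (H' s σ p) s)
    (hB : ∀ s σ p, H s σ p ≤ B + rate * prodSize rX rY p)
    (hb : ∀ s p, ∃ σ, b ≤ H s σ p)
    (hC' : ∀ s σ p, |H' s σ p| ≤ C * Real.exp (rate * prodSize rX rY p)) (s : ℝ) :
    HasDerivAt (fun s => ∫ x, Real.log (lvlU γY θ (H s) x) ∂γX)
      (θ * ∫ x, ∫ y, lvlW γY θ (H s) (x, y) * gavE (H s) (H' s) (x, y) ∂γY ∂γX) s := by
  have hr := hX.prod_nonneg hY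
  have hT : ∀ s, Tame (prodSize rX rY) (H s) := fun s => ⟨mH s, ⟨B, hB s⟩, ⟨b, hb s⟩⟩
  have bH' : ∀ s σ, GBdd (prodSize rX rY) rate (H' s σ) := fun s σ => ⟨mH' s σ, C, hC, hC' s σ⟩
  have bU := fun s => GBdd.lvlU hX hY (hT s) hθ0 hθ1
  have bZ := fun s => GBdd.zpow hr (hT s) hθ0 hθ1
  have bg := fun s => GBdd.gavE (mH s) hr (by norm_num) (bH' s)
  have bV := fun s => ((bZ s).mul (bg s)).const_mul θ
  -- A uniform lower bound of the normalization keeps the logarithm and its derivative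
  -- under control.
  have lU : ∀ s x, Real.exp (b * θ) ≤ lvlU γY θ (H s) x := fun s x =>
    le_lvlU hθ0 (hb s) x (integrable_zpow hX hY (hT s) hθ0 hθ1 x)
  have dU : ∀ s x, HasDerivAt (fun s => lvlU γY θ (H s) x)
      (∫ y, θ * (zpow θ (H s) (x, y) * gavE (H s) (H' s) (x, y)) ∂γY) s := by
    intro s x
    refine hasDerivAt_lvlU (γY := γY) hY hθ0 hθ1 (a := 0) (B := B + rate * rX x)
      (C := C * Real.exp (rate * rX x)) (h := fun s σ y => H s σ (x, y))
      (h' := fun s σ y => H' s σ (x, y)) le_rfl (by positivity)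
      (fun s σ => (mH s σ).comp measurable_prodMk_left)
      (fun s σ => (mH' s σ).comp measurable_prodMk_left)
      (fun s σ y => dH s σ (x, y))
      (fun s σ y => (hB s σ _).trans (le_of_eq ?_))
      (fun s σ y => (hC' s σ _).trans (le_of_eq ?_)) s
    · simp only [prodSize]; ring
    · rw [mul_assoc, ← Real.exp_add]; simp only [prodSize]; ring_nf
  have bdU : ∀ s, Measurable fun x =>
      ∫ y, θ * (zpow θ (H s) (x, y) * gavE (H s) (H' s) (x, y)) ∂γY :=
    fun s => ((bV s).integral_right hY (by norm_num)).meas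
  have hcard : (0 : ℝ) ≤ 1 + Fintype.card S * Real.exp B := by positivity
  set K : ℝ := (1 + Fintype.card S * Real.exp B) * C with hK
  have hbound : ∀ s x, |∫ y, θ * (zpow θ (H s) (x, y) * gavE (H s) (H' s) (x, y)) ∂γY| ≤
      K * Real.exp (2 * rate * rX x) * ∫ y, Real.exp (2 * rate * rY y) ∂γY := by
    intro s x
    rw [← integral_const_mul, ← Real.norm_eq_abs]
    refine norm_integral_le_of_norm_le ((hY.integrable_exp _ (by norm_num)).const_mul _)
      (Eventually.of_forall fun y => ?_)
    have b1 := zpow_le hθ0 hθ1 hr (hB s) (x, y)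
    have b2 : |gavE (H s) (H' s) (x, y)| ≤ C * Real.exp (rate * prodSize rX rY (x, y)) := by
      calc |gavE (H s) (H' s) (x, y)|
          ≤ ∑ σ, |gw (fun σ => H s σ (x, y)) σ * H' s σ (x, y)| := Finset.abs_sum_le_sum_abs _ _
        _ ≤ ∑ σ, gw (fun σ => H s σ (x, y)) σ * (C * Real.exp (rate * prodSize rX rY (x, y))) := by
            refine Finset.sum_le_sum fun σ _ => ?_
            rw [abs_mul, abs_of_nonneg (gw_nonneg _ _)]
            exact mul_le_mul_of_nonneg_left (hC' s σ _) (gw_nonneg _ _)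
        _ = _ := by rw [← Finset.sum_mul, sum_gw, one_mul]
    rw [Real.norm_eq_abs, abs_mul, abs_mul, abs_of_pos hθ0]
    calc θ * (|zpow θ (H s) (x, y)| * |gavE (H s) (H' s) (x, y)|)
        ≤ 1 * (((1 + Fintype.card S * Real.exp B) * Real.exp (rate * prodSize rX rY (x, y))) *
            (C * Real.exp (rate * prodSize rX rY (x, y)))) := by gcongr
      _ = K * (Real.exp (rate * prodSize rX rY (x, y)) *
            Real.exp (rate * prodSize rX rY (x, y))) := by rw [hK]; ring
      _ = _ := by
        rw [← Real.exp_add, show rate * prodSize rX rY (x, y) + rate * prodSize rX rY (x, y) =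
          2 * rate * rX x + 2 * rate * rY y by simp only [prodSize]; ring, Real.exp_add]
        ring
  have key := hasDerivAt_integral_growth (ν := γX) (r := rX) hX (δ := 2 * rate) (a := 0)
    (C := K * (∫ y, Real.exp (2 * rate * rY y) ∂γY) * (Real.exp (b * θ))⁻¹)
    (F := fun s x => Real.log (lvlU γY θ (H s) x))
    (F' := fun s x => (∫ y, θ * (zpow θ (H s) (x, y) * gavE (H s) (H' s) (x, y)) ∂γY) /
      lvlU γY θ (H s) x) (by norm_num) le_rfl
    (mul_nonneg (mul_nonneg (by positivity) (integral_nonneg fun _ => (Real.exp_pos _).le))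
      (by positivity))
    (fun s => (bU s).meas.log)
    (fun s => by
      refine (((bU s).add ((GBdd.const |b * θ|).mono hX.nonneg (by norm_num))).of_le
        (bU s).meas.log fun x => ?_).integrable hX (by norm_num)
      have h1 := lU s x
      have h0 := (Real.exp_pos _).trans_le h1
      have h2 := Real.log_le_sub_one_of_pos h0
      have h3 : b * θ ≤ Real.log (lvlU γY θ (H s) x) := by
        rw [Real.le_log_iff_exp_le h0]; exact h1
      rw [abs_of_nonneg (a := lvlU γY θ (H s) x + |b * θ|) (by positivity), abs_le]
      constructor
      · have := neg_abs_le (b * θ); linarith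
      · have := abs_nonneg (b * θ); linarith)
    (fun s => (bdU s).div (bU s).meas)
    (fun s x => (dU s x).log ((Real.exp_pos _).trans_le (lU s x)).ne')
    (fun s x => by
      have h1 := lU s x
      have h0 := (Real.exp_pos _).trans_le h1
      rw [abs_div, abs_of_pos h0, zero_mul, Real.exp_zero, mul_one, div_eq_mul_inv]
      calc |∫ y, θ * (zpow θ (H s) (x, y) * gavE (H s) (H' s) (x, y)) ∂γY| *
            (lvlU γY θ (H s) x)⁻¹
          ≤ (K * Real.exp (2 * rate * rX x) * ∫ y, Real.exp (2 * rate * rY y) ∂γY) *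
            (Real.exp (b * θ))⁻¹ :=
            mul_le_mul (hbound s x) (inv_anti₀ (Real.exp_pos _) h1) (inv_pos.2 h0).le
              (mul_nonneg (by positivity) (integral_nonneg fun _ => (Real.exp_pos _).le))
        _ = _ := by ring) s
  refine key.congr_deriv ?_
  rw [← integral_const_mul]
  refine integral_congr_ae (Eventually.of_forall fun x => ?_)
  simp only
  rw [← integral_div, ← integral_const_mul]
  refine integral_congr_ae (Eventually.of_forall fun y => ?_)
  simp only [lvlW]
  ring

end Levels

/-! ### Averages of one and of two replicas -/

section KernelAverage

variable {T Ω : Type*} [Fintype T] [MeasurableSpace Ω] {ν : Measure Ω} {k f g : T → Ω → ℝ}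

/-- The average of `f` with the density `k` with respect to counting measure times `ν`. -/
def kavg (ν : Measure Ω) (k f : T → Ω → ℝ) : ℝ := ∫ ω, ∑ t, k t ω * f t ω ∂ν

/-- Integrability with respect to the density `k`. -/
def KInt (ν : Measure Ω) (k f : T → Ω → ℝ) : Prop := ∀ t, Integrable (fun ω => k t ω * f t ω) ν

lemma KInt.sum_integrable (hf : KInt ν k f) : Integrable (fun ω => ∑ t, k t ω * f t ω) ν :=
  integrable_finsetSum _ fun t _ => hf t

lemma kavg_add (hf : KInt ν k f) (hg : KInt ν k g) :
    kavg ν k (fun t ω => f t ω + g t ω) = kavg ν k f + kavg ν k g := by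
  simp only [kavg, mul_add, Finset.sum_add_distrib]
  exact integral_add hf.sum_integrable hg.sum_integrable

lemma kavg_const_mul (a : ℝ) : kavg ν k (fun t ω => a * f t ω) = a * kavg ν k f := by
  simp only [kavg]
  rw [← integral_const_mul]
  congr 1; ext ω
  rw [Finset.mul_sum]
  exact Finset.sum_congr rfl fun _ _ => by ring

lemma KInt.const_mul (hf : KInt ν k f) (a : ℝ) : KInt ν k (fun t ω => a * f t ω) := fun t =>
  ((hf t).const_mul a).congr (Eventually.of_forall fun ω => by ring)

lemma KInt.add (hf : KInt ν k f) (hg : KInt ν k g) : KInt ν k (fun t ω => f t ω + g t ω) := fun t =>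
  ((hf t).add (hg t)).congr (Eventually.of_forall fun ω => by simp [mul_add])

lemma kavg_sub (hf : KInt ν k f) (hg : KInt ν k g) :
    kavg ν k (fun t ω => f t ω - g t ω) = kavg ν k f - kavg ν k g := by
  have := kavg_add hf (hg.const_mul (-1))
  rw [kavg_const_mul] at this
  simpa [sub_eq_add_neg] using this

lemma KInt.sub (hf : KInt ν k f) (hg : KInt ν k g) : KInt ν k (fun t ω => f t ω - g t ω) := by
  simpa [sub_eq_add_neg] using hf.add (hg.const_mul (-1))

lemma kavg_sum {ι : Type*} (s : Finset ι) {F : ι → T → Ω → ℝ} (hF : ∀ i, KInt ν k (F i)) :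
    kavg ν k (fun t ω => ∑ i ∈ s, F i t ω) = ∑ i ∈ s, kavg ν k (F i) := by
  simp only [kavg]
  rw [← integral_finsetSum _ fun i _ => (hF i).sum_integrable]
  congr 1; ext ω
  rw [Finset.sum_comm]
  exact Finset.sum_congr rfl fun _ _ => Finset.mul_sum _ _ _

lemma kavg_mono (hk : ∀ t ω, 0 ≤ k t ω) (hf : KInt ν k f) (hg : KInt ν k g)
    (h : ∀ t ω, f t ω ≤ g t ω) : kavg ν k f ≤ kavg ν k g :=
  integral_mono hf.sum_integrable hg.sum_integrable fun ω =>
    Finset.sum_le_sum fun t _ => mul_le_mul_of_nonneg_left (h t ω) (hk t ω)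

lemma kavg_nonneg (hk : ∀ t ω, 0 ≤ k t ω) (h : ∀ t ω, 0 ≤ f t ω) : 0 ≤ kavg ν k f :=
  integral_nonneg fun ω => Finset.sum_nonneg fun t _ => mul_nonneg (hk t ω) (h t ω)

lemma abs_kavg_le (hk : ∀ t ω, 0 ≤ k t ω) (hf : KInt ν k f) (hg : KInt ν k g)
    (h : ∀ t ω, |f t ω| ≤ g t ω) : |kavg ν k f| ≤ kavg ν k g := by
  rw [abs_le]
  refine ⟨?_, kavg_mono hk hf hg fun t ω => (le_abs_self _).trans (h t ω)⟩
  have := kavg_mono hk (hg.const_mul (-1)) hf fun t ω => by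
    have := neg_abs_le (f t ω); have := h t ω; linarith
  rw [kavg_const_mul] at this
  linarith

lemma kavg_const (hk : kavg ν k (fun _ _ => 1) = 1) (a : ℝ) : kavg ν k (fun _ _ => a) = a := by
  have := kavg_const_mul (ν := ν) (k := k) (f := fun _ _ => 1) a
  simpa [hk] using this

lemma kavg_congr (h : ∀ t ω, f t ω = g t ω) : kavg ν k f = kavg ν k g := by
  simp only [kavg, h]

end KernelAverage

section Replicas

variable {S X Y : Type*} [Fintype S] [MeasurableSpace X] [MeasurableSpace Y]

/-- The density of one replica. -/
def ker₀ (γ : Measure Y) (θ : ℝ) (H : S → X × Y → ℝ) (σ : S) (p : X × Y) : ℝ :=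
  lvlW γ θ H p * gw (fun σ => H σ p) σ

/-- The density of two replicas sharing both levels of the environment. -/
def ker₂ (γ : Measure Y) (θ : ℝ) (H : S → X × Y → ℝ) (t : S × S) (p : X × Y) : ℝ :=
  lvlW γ θ H p * (gw (fun σ => H σ p) t.1 * gw (fun σ => H σ p) t.2)

/-- The environment seen by the first of two replicas which share the first level only. -/
abbrev rep₁ (q : X × Y × Y) : X × Y := (q.1, q.2.1)

/-- The environment seen by the second of two replicas which share the first level only. -/
abbrev rep₂ (q : X × Y × Y) : X × Y := (q.1, q.2.2)

/-- The density of two replicas which share the first level of the environment only. -/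
def ker₁ (γ : Measure Y) (θ : ℝ) (H : S → X × Y → ℝ) (t : S × S) (q : X × Y × Y) : ℝ :=
  ker₀ γ θ H t.1 (rep₁ q) * ker₀ γ θ H t.2 (rep₂ q)

variable {H : S → X × Y → ℝ} {θ : ℝ}
  {γX : Measure X} {γY : Measure Y} [IsProbabilityMeasure γX] [IsProbabilityMeasure γY]
  {rX : X → ℝ} {rY : Y → ℝ}

lemma ker₀_nonneg (σ : S) (p : X × Y) : 0 ≤ ker₀ γY θ H σ p :=
  mul_nonneg (lvlW_nonneg p) (gw_nonneg _ _)

lemma ker₂_nonneg (t : S × S) (p : X × Y) : 0 ≤ ker₂ γY θ H t p :=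
  mul_nonneg (lvlW_nonneg p) (mul_nonneg (gw_nonneg _ _) (gw_nonneg _ _))

lemma ker₁_nonneg (t : S × S) (q : X × Y × Y) : 0 ≤ ker₁ γY θ H t q :=
  mul_nonneg (ker₀_nonneg _ _) (ker₀_nonneg _ _)

lemma sum_ker₀_mul (g : S → X × Y → ℝ) (p : X × Y) :
    ∑ σ, ker₀ γY θ H σ p * g σ p = lvlW γY θ H p * gavE H g p := by
  simp only [ker₀, gavE, gav, Finset.mul_sum]
  exact Finset.sum_congr rfl fun _ _ => by ring

lemma sum_ker₂_mul (f g : S → X × Y → ℝ) (p : X × Y) :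
    ∑ t, ker₂ γY θ H t p * (f t.1 p * g t.2 p) =
      lvlW γY θ H p * (gavE H f p * gavE H g p) := by
  simp only [ker₂, gavE, gav, Fintype.sum_prod_type]
  rw [Finset.sum_mul_sum, Finset.mul_sum]
  refine Finset.sum_congr rfl fun _ _ => ?_
  rw [Finset.mul_sum]
  exact Finset.sum_congr rfl fun _ _ => by ring

lemma sum_ker₂_fst [Nonempty S] (f : S → X × Y → ℝ) (p : X × Y) :
    ∑ t, ker₂ γY θ H t p * f t.1 p = lvlW γY θ H p * gavE H f p := by
  have := sum_ker₂_mul (γY := γY) (θ := θ) (H := H) f (fun _ _ => 1) p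
  simpa [gavE, gav_const] using this

lemma sum_ker₂_snd [Nonempty S] (f : S → X × Y → ℝ) (p : X × Y) :
    ∑ t, ker₂ γY θ H t p * f t.2 p = lvlW γY θ H p * gavE H f p := by
  have := sum_ker₂_mul (γY := γY) (θ := θ) (H := H) (fun _ _ => 1) f p
  simpa [gavE, gav_const] using this

lemma sum_ker₁_mul (f g : S → X × Y → ℝ) (q : X × Y × Y) :
    ∑ t, ker₁ γY θ H t q * (f t.1 (rep₁ q) * g t.2 (rep₂ q)) =
      (lvlW γY θ H (rep₁ q) * gavE H f (rep₁ q)) * (lvlW γY θ H (rep₂ q) * gavE H g (rep₂ q)) := by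
  rw [← sum_ker₀_mul, ← sum_ker₀_mul, Finset.sum_mul_sum, Fintype.sum_prod_type]
  exact Finset.sum_congr rfl fun _ _ => Finset.sum_congr rfl fun _ _ => by
    simp only [ker₁]; ring

/-- The size of an environment with two copies of the second level. -/
abbrev tripleSize (rX : X → ℝ) (rY : Y → ℝ) : X × Y × Y → ℝ := prodSize rX (prodSize rY rY)

/-- A Hamiltonian of tame growth in a two-level Gaussian environment, and an admissible weight. -/
structure Env (γX : Measure X) (γY : Measure Y) (rX : X → ℝ) (rY : Y → ℝ) (θ : ℝ)
    (H : S → X × Y → ℝ) : Prop where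
  sizeX : IsSize γX rX
  sizeY : IsSize γY rY
  tame : Tame (prodSize rX rY) H
  θ_pos : 0 < θ
  θ_le : θ ≤ 1

lemma Env.size_pair (hE : Env γX γY rX rY θ H) : IsSize (γX.prod γY) (prodSize rX rY) :=
  hE.sizeX.prod hE.sizeY

lemma Env.size_triple (hE : Env γX γY rX rY θ H) :
    IsSize (γX.prod (γY.prod γY)) (tripleSize rX rY) :=
  hE.sizeX.prod (hE.sizeY.prod hE.sizeY)

lemma Env.ker₀ (hE : Env γX γY rX rY θ H) (σ : S) :
    GBdd (prodSize rX rY) rate (ker₀ γY θ H σ) := by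
  have hW := GBdd.lvlW hE.sizeX hE.sizeY hE.tame hE.θ_pos hE.θ_le
  refine hW.of_le (hW.meas.mul (measurable_gw hE.tame.meas σ)) fun p => ?_
  rw [DenseHebbian.ker₀, abs_mul, abs_of_nonneg (gw_nonneg _ _)]
  exact mul_le_of_le_one_right (abs_nonneg _) (gw_le_one _ _)

lemma Env.ker₂ (hE : Env γX γY rX rY θ H) (t : S × S) :
    GBdd (prodSize rX rY) rate (ker₂ γY θ H t) := by
  have hW := GBdd.lvlW hE.sizeX hE.sizeY hE.tame hE.θ_pos hE.θ_le
  refine hW.of_le (hW.meas.mul ((measurable_gw hE.tame.meas _).mul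
    (measurable_gw hE.tame.meas _))) fun p => ?_
  rw [DenseHebbian.ker₂, abs_mul, abs_of_nonneg (mul_nonneg (gw_nonneg _ _) (gw_nonneg _ _))]
  exact mul_le_of_le_one_right (abs_nonneg _)
    (mul_le_one₀ (gw_le_one _ _) (gw_nonneg _ _) (gw_le_one _ _))

lemma GBdd.rep₁ {δ : ℝ} {f : X × Y → ℝ} (hf : GBdd (prodSize rX rY) δ f) (hY : ∀ y, 0 ≤ rY y)
    (hδ : 0 ≤ δ) : GBdd (tripleSize rX rY) δ (fun q => f (rep₁ q)) :=
  hf.comp (by fun_prop) hδ fun q => by simp only [prodSize]; linarith [hY q.2.2]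

lemma GBdd.rep₂ {δ : ℝ} {f : X × Y → ℝ} (hf : GBdd (prodSize rX rY) δ f) (hY : ∀ y, 0 ≤ rY y)
    (hδ : 0 ≤ δ) : GBdd (tripleSize rX rY) δ (fun q => f (rep₂ q)) :=
  hf.comp (by fun_prop) hδ fun q => by simp only [prodSize]; linarith [hY q.2.1]

lemma Env.ker₁ (hE : Env γX γY rX rY θ H) (t : S × S) :
    GBdd (tripleSize rX rY) (2 * rate) (ker₁ γY θ H t) := by
  rw [two_mul]
  exact ((hE.ker₀ t.1).rep₁ hE.sizeY.nonneg (by norm_num)).mul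
    ((hE.ker₀ t.2).rep₂ hE.sizeY.nonneg (by norm_num))

/-- The average `⟨g⟩` of a one-replica observable. -/
def avg₀ (γX : Measure X) (γY : Measure Y) (θ : ℝ) (H g : S → X × Y → ℝ) : ℝ :=
  kavg (γX.prod γY) (DenseHebbian.ker₀ γY θ H) g

/-- The average `⟨f⟩₂` of a two-replica observable. -/
def avg₂ (γX : Measure X) (γY : Measure Y) (θ : ℝ) (H : S → X × Y → ℝ)
    (f : S × S → X × Y → ℝ) : ℝ :=
  kavg (γX.prod γY) (DenseHebbian.ker₂ γY θ H) f

/-- The average `⟨f⟩₁` of a two-replica observable. -/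
def avg₁ (γX : Measure X) (γY : Measure Y) (θ : ℝ) (H : S → X × Y → ℝ)
    (f : S × S → X × Y × Y → ℝ) : ℝ :=
  kavg (γX.prod (γY.prod γY)) (DenseHebbian.ker₁ γY θ H) f

lemma Env.int₀ (hE : Env γX γY rX rY θ H) {δ : ℝ} (hδ : δ ≤ 8 * rate) {f : S → X × Y → ℝ}
    (hf : ∀ t, GBdd (prodSize rX rY) δ (f t)) : KInt (γX.prod γY) (DenseHebbian.ker₀ γY θ H) f :=
  fun t => ((hE.ker₀ t).mul (hf t)).integrable hE.size_pair (by norm_num at hδ ⊢; linarith)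

lemma Env.int₂ (hE : Env γX γY rX rY θ H) {δ : ℝ} (hδ : δ ≤ 7 * rate) {f : S × S → X × Y → ℝ}
    (hf : ∀ t, GBdd (prodSize rX rY) δ (f t)) : KInt (γX.prod γY) (DenseHebbian.ker₂ γY θ H) f :=
  fun t => ((hE.ker₂ t).mul (hf t)).integrable hE.size_pair (by norm_num at hδ ⊢; linarith)

lemma Env.int₁ (hE : Env γX γY rX rY θ H) {δ : ℝ} (hδ : δ ≤ 7 * rate)
    {f : S × S → X × Y × Y → ℝ} (hf : ∀ t, GBdd (tripleSize rX rY) δ (f t)) :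
    KInt (γX.prod (γY.prod γY)) (DenseHebbian.ker₁ γY θ H) f :=
  fun t => ((hE.ker₁ t).mul (hf t)).integrable hE.size_triple (by norm_num at hδ ⊢; linarith)

/-- `⟨g⟩` as an iterated integral. -/
lemma Env.avg₀_eq (hE : Env γX γY rX rY θ H) {δ : ℝ} (hδ : δ ≤ 8 * rate) {g : S → X × Y → ℝ}
    (hg : ∀ t, GBdd (prodSize rX rY) δ (g t)) :
    avg₀ γX γY θ H g = ∫ x, ∫ y, lvlW γY θ H (x, y) * gavE H g (x, y) ∂γY ∂γX := by
  rw [avg₀, kavg, integral_prod _ (hE.int₀ hδ hg).sum_integrable]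
  simp_rw [sum_ker₀_mul]

/-- `⟨f⟩₂` as an iterated integral. -/
lemma Env.avg₂_eq (hE : Env γX γY rX rY θ H) {δ : ℝ} (hδ : δ ≤ 7 * rate)
    {f : S × S → X × Y → ℝ} (hf : ∀ t, GBdd (prodSize rX rY) δ (f t)) :
    avg₂ γX γY θ H f =
      ∫ x, ∫ y, ∑ t, DenseHebbian.ker₂ γY θ H t (x, y) * f t (x, y) ∂γY ∂γX := by
  rw [avg₂, kavg, integral_prod _ (hE.int₂ hδ hf).sum_integrable]

/-- `⟨f⟩₁` as an iterated integral. -/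
lemma Env.avg₁_eq (hE : Env γX γY rX rY θ H) {δ : ℝ} (hδ : δ ≤ 7 * rate)
    {f : S × S → X × Y × Y → ℝ} (hf : ∀ t, GBdd (tripleSize rX rY) δ (f t)) :
    avg₁ γX γY θ H f =
      ∫ x, ∫ y, ∫ y', ∑ t, DenseHebbian.ker₁ γY θ H t (x, y, y') * f t (x, y, y') ∂γY ∂γY ∂γX := by
  have h1 := (hE.int₁ hδ hf).sum_integrable
  rw [avg₁, kavg, integral_prod _ h1]
  refine integral_congr_ae ?_
  filter_upwards [h1.prod_right_ae] with x hx
  rw [integral_prod _ hx]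

/-- `⟨f⟩₂` of a product observable. -/
lemma Env.avg₂_mul (hE : Env γX γY rX rY θ H) {δ δ' : ℝ} (hδ : δ + δ' ≤ 7 * rate)
    {f g : S → X × Y → ℝ} (hf : ∀ t, GBdd (prodSize rX rY) δ (f t))
    (hg : ∀ t, GBdd (prodSize rX rY) δ' (g t)) :
    avg₂ γX γY θ H (fun t p => f t.1 p * g t.2 p) =
      ∫ x, ∫ y, lvlW γY θ H (x, y) * (gavE H f (x, y) * gavE H g (x, y)) ∂γY ∂γX := by
  rw [hE.avg₂_eq hδ fun t => (hf t.1).mul (hg t.2)]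
  simp_rw [sum_ker₂_mul]

/-- `⟨f⟩₁` of a product observable. -/
lemma Env.avg₁_mul (hE : Env γX γY rX rY θ H) {δ δ' : ℝ} (h0 : 0 ≤ δ) (h0' : 0 ≤ δ')
    (hδ : δ + δ' ≤ 7 * rate)
    {f g : S → X × Y → ℝ} (hf : ∀ t, GBdd (prodSize rX rY) δ (f t))
    (hg : ∀ t, GBdd (prodSize rX rY) δ' (g t)) :
    avg₁ γX γY θ H (fun t q => f t.1 (rep₁ q) * g t.2 (rep₂ q)) =
      ∫ x, (∫ y, lvlW γY θ H (x, y) * gavE H f (x, y) ∂γY) *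
        (∫ y, lvlW γY θ H (x, y) * gavE H g (x, y) ∂γY) ∂γX := by
  have h1 := (hE.int₁ hδ (f := fun t q => f t.1 (rep₁ q) * g t.2 (rep₂ q)) fun t =>
    ((hf t.1).rep₁ hE.sizeY.nonneg h0).mul ((hg t.2).rep₂ hE.sizeY.nonneg h0')).sum_integrable
  rw [avg₁, kavg, integral_prod _ h1]
  simp_rw [sum_ker₁_mul]
  refine integral_congr_ae (Eventually.of_forall fun x => ?_)
  exact integral_prod_mul (fun y => lvlW γY θ H (x, y) * gavE H f (x, y))
    (fun y => lvlW γY θ H (x, y) * gavE H g (x, y))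

lemma Env.avg₀_one [Nonempty S] (hE : Env γX γY rX rY θ H) :
    avg₀ γX γY θ H (fun _ _ => 1) = 1 := by
  rw [hE.avg₀_eq (by norm_num) fun _ => GBdd.const 1]
  simp only [gavE, gav_const, mul_one]
  simp_rw [integral_lvlW hE.sizeX hE.sizeY hE.tame hE.θ_pos hE.θ_le]
  simp

lemma Env.avg₂_one [Nonempty S] (hE : Env γX γY rX rY θ H) :
    avg₂ γX γY θ H (fun _ _ => 1) = 1 := by
  have := hE.avg₂_mul (f := fun _ _ => 1) (g := fun _ _ => 1) (δ := 0) (δ' := 0) (by norm_num)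
    (fun _ => GBdd.const 1) fun _ => GBdd.const 1
  simp only [gavE, gav_const, mul_one] at this
  rw [this]
  simp_rw [integral_lvlW hE.sizeX hE.sizeY hE.tame hE.θ_pos hE.θ_le]
  simp

lemma Env.avg₁_one [Nonempty S] (hE : Env γX γY rX rY θ H) :
    avg₁ γX γY θ H (fun _ _ => 1) = 1 := by
  have := hE.avg₁_mul (f := fun _ _ => 1) (g := fun _ _ => 1) (δ := 0) (δ' := 0) le_rfl le_rfl
    (by norm_num) (fun _ => GBdd.const 1) fun _ => GBdd.const 1
  simp only [gavE, gav_const, mul_one] at this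
  rw [this]
  simp_rw [integral_lvlW hE.sizeX hE.sizeY hE.tame hE.θ_pos hE.θ_le]
  simp

/-- Both marginals of `⟨·⟩₂` are `⟨·⟩`. -/
lemma Env.avg₂_fst [Nonempty S] (hE : Env γX γY rX rY θ H) {δ : ℝ} (hδ : δ ≤ 7 * rate)
    {f : S → X × Y → ℝ} (hf : ∀ t, GBdd (prodSize rX rY) δ (f t)) :
    avg₂ γX γY θ H (fun t p => f t.1 p) = avg₀ γX γY θ H f := by
  rw [hE.avg₂_eq hδ fun t => hf t.1, hE.avg₀_eq (by norm_num at hδ ⊢; linarith) hf]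
  simp_rw [sum_ker₂_fst]

lemma Env.avg₂_snd [Nonempty S] (hE : Env γX γY rX rY θ H) {δ : ℝ} (hδ : δ ≤ 7 * rate)
    {f : S → X × Y → ℝ} (hf : ∀ t, GBdd (prodSize rX rY) δ (f t)) :
    avg₂ γX γY θ H (fun t p => f t.2 p) = avg₀ γX γY θ H f := by
  rw [hE.avg₂_eq hδ fun t => hf t.2, hE.avg₀_eq (by norm_num at hδ ⊢; linarith) hf]
  simp_rw [sum_ker₂_snd]

/-- Both marginals of `⟨·⟩₁` are `⟨·⟩`. -/
lemma Env.avg₁_fst [Nonempty S] (hE : Env γX γY rX rY θ H) {δ : ℝ} (h0 : 0 ≤ δ)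
    (hδ : δ ≤ 7 * rate) {f : S → X × Y → ℝ} (hf : ∀ t, GBdd (prodSize rX rY) δ (f t)) :
    avg₁ γX γY θ H (fun t q => f t.1 (rep₁ q)) = avg₀ γX γY θ H f := by
  have h1 := hE.avg₁_mul (f := f) (g := fun _ _ => 1) h0 le_rfl (by simpa using hδ) hf
    fun _ => GBdd.const 1
  simp only [mul_one, gavE, gav_const] at h1
  rw [h1, hE.avg₀_eq (by norm_num at hδ ⊢; linarith) hf]
  simp_rw [integral_lvlW hE.sizeX hE.sizeY hE.tame hE.θ_pos hE.θ_le, mul_one]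
  rfl

lemma Env.avg₁_snd [Nonempty S] (hE : Env γX γY rX rY θ H) {δ : ℝ} (h0 : 0 ≤ δ)
    (hδ : δ ≤ 7 * rate) {f : S → X × Y → ℝ} (hf : ∀ t, GBdd (prodSize rX rY) δ (f t)) :
    avg₁ γX γY θ H (fun t q => f t.2 (rep₂ q)) = avg₀ γX γY θ H f := by
  have h1 := hE.avg₁_mul (f := fun _ _ => 1) (g := f) le_rfl h0 (by simpa using hδ)
    (fun _ => GBdd.const 1) hf
  simp only [one_mul, mul_one, gavE, gav_const] at h1
  rw [h1, hE.avg₀_eq (by norm_num at hδ ⊢; linarith) hf]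
  simp_rw [integral_lvlW hE.sizeX hE.sizeY hE.tame hE.θ_pos hE.θ_le, one_mul]
  rfl

/-- A square observable has a nonnegative average `⟨·⟩₁`. -/
lemma Env.avg₁_sq_nonneg (hE : Env γX γY rX rY θ H) {δ : ℝ} (h0 : 0 ≤ δ) (hδ : δ + δ ≤ 7 * rate)
    {f : S → X × Y → ℝ} (hf : ∀ t, GBdd (prodSize rX rY) δ (f t)) :
    0 ≤ avg₁ γX γY θ H (fun t q => f t.1 (rep₁ q) * f t.2 (rep₂ q)) := by
  rw [hE.avg₁_mul h0 h0 hδ hf hf]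
  exact integral_nonneg fun x => mul_self_nonneg _

/-- Jensen's inequality: sharing the second level increases the overlaps. -/
lemma Env.avg₁_le_avg₂ (hE : Env γX γY rX rY θ H) {δ : ℝ} (h0 : 0 ≤ δ) (hδ : δ ≤ 2 * rate)
    {f : S → X × Y → ℝ} (hf : ∀ t, GBdd (prodSize rX rY) δ (f t)) :
    avg₁ γX γY θ H (fun t q => f t.1 (rep₁ q) * f t.2 (rep₂ q)) ≤
      avg₂ γX γY θ H (fun t p => f t.1 p * f t.2 p) := by
  have hr := hE.size_pair.nonneg
  have bW := GBdd.lvlW hE.sizeX hE.sizeY hE.tame hE.θ_pos hE.θ_le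
  have bf := GBdd.gavE hE.tame.meas hr h0 hf
  have hδ' : δ ≤ 1 / 10 := by norm_num at hδ ⊢; linarith
  have b1 : GBdd rX (rate + δ) fun x => ∫ y, lvlW γY θ H (x, y) * gavE H f (x, y) ∂γY :=
    (bW.mul bf).integral_right hE.sizeY (by norm_num; linarith)
  have b2 : GBdd rX (rate + (δ + δ))
      fun x => ∫ y, lvlW γY θ H (x, y) * (gavE H f (x, y) * gavE H f (x, y)) ∂γY :=
    (bW.mul (bf.mul bf)).integral_right hE.sizeY (by norm_num; linarith)
  have hδ2 : δ + δ ≤ 7 * rate := by norm_num; linarith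
  rw [hE.avg₁_mul h0 h0 hδ2 hf hf, hE.avg₂_mul hδ2 hf hf]
  refine integral_mono ((b1.mul b1).integrable hE.sizeX (by norm_num; linarith))
    (b2.integrable hE.sizeX (by norm_num; linarith)) fun x => ?_
  -- the variance of `gavE H f` under the weight is nonnegative
  set a := ∫ y, lvlW γY θ H (x, y) * gavE H f (x, y) ∂γY with ha
  have i1 := (((bW.mul bf).slice x).integrable hE.sizeY (by norm_num; linarith)).const_mul (2 * a)
  have i2 := ((bW.mul (bf.mul bf)).slice x).integrable hE.sizeY (by norm_num; linarith)
  have i3 := ((bW.slice x).integrable hE.sizeY (by norm_num)).const_mul (a ^ 2)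
  have h1 : 0 ≤ ∫ y, lvlW γY θ H (x, y) * (gavE H f (x, y) - a) ^ 2 ∂γY :=
    integral_nonneg fun y => mul_nonneg (lvlW_nonneg _) (sq_nonneg _)
  have h2 : ∫ y, lvlW γY θ H (x, y) * (gavE H f (x, y) - a) ^ 2 ∂γY =
      (∫ y, lvlW γY θ H (x, y) * (gavE H f (x, y) * gavE H f (x, y)) ∂γY) - 2 * a * a +
        a ^ 2 * 1 := by
    have e1 : 2 * a * a = ∫ y, 2 * a * (lvlW γY θ H (x, y) * gavE H f (x, y)) ∂γY := by
      rw [integral_const_mul]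
    have e2 : a ^ 2 * 1 = ∫ y, a ^ 2 * lvlW γY θ H (x, y) ∂γY := by
      rw [integral_const_mul, integral_lvlW hE.sizeX hE.sizeY hE.tame hE.θ_pos hE.θ_le]
    rw [e1, e2, ← integral_sub i2 i1]
    refine Eq.trans ?_ (integral_add (i2.sub i1) i3)
    refine integral_congr_ae (Eventually.of_forall fun y => ?_)
    simp only
    ring
  show a * a ≤ _
  linarith

/-- Integration by parts along a coordinate of the first level. -/
lemma Env.ibp₁ [Nonempty S] (hE : Env γX γY rX rY θ H) {c : X → ℝ} {u : X → ℝ → X}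
    (hc : IsGaussCoord γX rX c u) {H' g g' : S → X × Y → ℝ}
    (hH' : ∀ σ, GBdd (prodSize rX rY) rate (H' σ)) (hg : ∀ σ, GBdd (prodSize rX rY) rate (g σ))
    (hg' : ∀ σ, GBdd (prodSize rX rY) rate (g' σ))
    (dH : ∀ σ x y s, HasDerivAt (fun s => H σ (u x s, y)) (H' σ (u x s, y)) s)
    (dg : ∀ σ x y s, HasDerivAt (fun s => g σ (u x s, y)) (g' σ (u x s, y)) s) :
    avg₀ γX γY θ H (fun σ p => c p.1 * g σ p) =
      avg₀ γX γY θ H (fun σ p => g' σ p + g σ p * H' σ p) +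
        (θ - 1) * avg₂ γX γY θ H (fun t p => g t.1 p * H' t.2 p) -
        θ * avg₁ γX γY θ H (fun t q => g t.1 (rep₁ q) * H' t.2 (rep₂ q)) := by
  have hr := hE.size_pair.nonneg
  have bc : GBdd (prodSize rX rY) rate (fun p => c p.1) :=
    (hc.fst (ν' := γY) hE.sizeY.nonneg).gbdd (by norm_num)
  have b1 : ∀ σ, GBdd (prodSize rX rY) (rate + rate) (fun p => g' σ p + g σ p * H' σ p) :=
    fun σ => ((hg' σ).mono hr (by norm_num)).add ((hg σ).mul (hH' σ))
  have bW := GBdd.lvlW hE.sizeX hE.sizeY hE.tame hE.θ_pos hE.θ_le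
  have iA := (bW.mul (GBdd.gavE hE.tame.meas hr (by norm_num) b1)).integrable
    hE.size_pair (by norm_num)
  have iB := ((bW.mul ((GBdd.gavE hE.tame.meas hr (by norm_num) hg).mul
    (GBdd.gavE hE.tame.meas hr (by norm_num) hH'))).const_mul (θ - 1)).integrable
    hE.size_pair (by norm_num)
  have key := ibp_first_level hE.sizeX hE.sizeY hE.tame hE.θ_pos hE.θ_le hc hH' hg hg' dH dg
  rw [hE.avg₁_mul (by norm_num) (by norm_num) (by norm_num) hg hH',
    hE.avg₂_mul (by norm_num) hg hH', hE.avg₀_eq (by norm_num) b1,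
    hE.avg₀_eq (by norm_num) fun σ => bc.mul (hg σ), ← integral_prod _ iA]
  simp_rw [← integral_const_mul (θ - 1)]
  rw [← integral_prod _ iB, ← integral_add iA iB]
  have e1 : ∀ x y, lvlW γY θ H (x, y) * gavE H (fun σ p => c p.1 * g σ p) (x, y) =
      c x * (lvlW γY θ H (x, y) * gavE H g (x, y)) := fun x y => by
    simp only [gavE]; rw [gav_const_mul]; ring
  simp_rw [e1]
  rw [key]
  congr 1
  refine Eq.trans ?_ (integral_prod _ (iA.add iB)).symm
  refine integral_congr_ae (Eventually.of_forall fun x => integral_congr_ae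
    (Eventually.of_forall fun y => ?_))
  simp only [Pi.add_apply]
  ring

/-- Integration by parts along a coordinate of the second level. -/
lemma Env.ibp₂ [Nonempty S] (hE : Env γX γY rX rY θ H) {c : Y → ℝ} {u : Y → ℝ → Y}
    (hc : IsGaussCoord γY rY c u) {H' g g' : S → X × Y → ℝ}
    (hH' : ∀ σ, GBdd (prodSize rX rY) rate (H' σ)) (hg : ∀ σ, GBdd (prodSize rX rY) rate (g σ))
    (hg' : ∀ σ, GBdd (prodSize rX rY) rate (g' σ))
    (dH : ∀ σ x y s, HasDerivAt (fun s => H σ (x, u y s)) (H' σ (x, u y s)) s)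
    (dg : ∀ σ x y s, HasDerivAt (fun s => g σ (x, u y s)) (g' σ (x, u y s)) s) :
    avg₀ γX γY θ H (fun σ p => c p.2 * g σ p) =
      avg₀ γX γY θ H (fun σ p => g' σ p + g σ p * H' σ p) +
        (θ - 1) * avg₂ γX γY θ H (fun t p => g t.1 p * H' t.2 p) := by
  have hr := hE.size_pair.nonneg
  have bc : GBdd (prodSize rX rY) rate (fun p => c p.2) :=
    (hc.snd (ν := γX) hE.sizeX.nonneg).gbdd (by norm_num)
  have b1 : ∀ σ, GBdd (prodSize rX rY) (rate + rate) (fun p => g' σ p + g σ p * H' σ p) :=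
    fun σ => ((hg' σ).mono hr (by norm_num)).add ((hg σ).mul (hH' σ))
  have bW := GBdd.lvlW hE.sizeX hE.sizeY hE.tame hE.θ_pos hE.θ_le
  have iA := (bW.mul (GBdd.gavE hE.tame.meas hr (by norm_num) b1)).integrable
    hE.size_pair (by norm_num)
  have iB := ((bW.mul ((GBdd.gavE hE.tame.meas hr (by norm_num) hg).mul
    (GBdd.gavE hE.tame.meas hr (by norm_num) hH'))).const_mul (θ - 1)).integrable
    hE.size_pair (by norm_num)
  have key := ibp_second_level hE.sizeX hE.sizeY hE.tame hE.θ_pos hE.θ_le hc hH' hg hg' dH dg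
  rw [hE.avg₂_mul (by norm_num) hg hH', hE.avg₀_eq (by norm_num) b1,
    hE.avg₀_eq (by norm_num) fun σ => bc.mul (hg σ), ← integral_prod _ iA]
  simp_rw [← integral_const_mul (θ - 1)]
  rw [← integral_prod _ iB, ← integral_add iA iB]
  have e1 : ∀ x y, lvlW γY θ H (x, y) * gavE H (fun σ p => c p.2 * g σ p) (x, y) =
      c y * (lvlW γY θ H (x, y) * gavE H g (x, y)) := fun x y => by
    simp only [gavE]; rw [gav_const_mul]; ring
  simp_rw [e1, key]
  refine Eq.trans ?_ (integral_prod _ (iA.add iB)).symm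
  refine integral_congr_ae (Eventually.of_forall fun x => integral_congr_ae
    (Eventually.of_forall fun y => ?_))
  simp only [Pi.add_apply]
  ring

end Replicas

/-! ### The interpolating Hamiltonian after integration of the hidden variables -/

lemma val_sq (u : ℤˣ) : val u ^ 2 = 1 := by
  rcases Int.units_eq_one_or u with h | h <;> simp [h, val]

lemma abs_val (u : ℤˣ) : |val u| = 1 := by
  rcases Int.units_eq_one_or u with h | h <;> simp [h, val]

lemma val_neg (u : ℤˣ) : val (-u) = -val u := by simp [val]

/-- The monomial `σ_{i₁} ⋯ σ_{i_k}`. -/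
def mon {N k : ℕ} (σ : Spins N) (i : Fin k → Fin N) : ℝ := ∏ j, val (σ (i j))

lemma mon_sq {N k : ℕ} (σ : Spins N) (i : Fin k → Fin N) : mon σ i ^ 2 = 1 := by
  simp [mon, ← Finset.prod_pow, val_sq]

lemma sum_mon_mul_mon {N k : ℕ} (σ σ' : Spins N) :
    ∑ i : Fin k → Fin N, mon σ i * mon σ' i = (∑ i, val (σ i) * val (σ' i)) ^ k := by
  simp only [mon, ← Finset.prod_mul_distrib]
  rw [← Fintype.piFinset_univ, Finset.sum_prod_piFinset Finset.univ
    (fun _ i => val (σ i) * val (σ' i))]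
  simp

lemma abs_sum_val_le {N : ℕ} (σ σ' : Spins N) : |∑ i, val (σ i) * val (σ' i)| ≤ N := by
  calc |∑ i, val (σ i) * val (σ' i)| ≤ ∑ i, |val (σ i) * val (σ' i)| :=
        Finset.abs_sum_le_sum_abs _ _
    _ = N := by simp [abs_mul, abs_val]

lemma abs_overlapQ_le {N : ℕ} (σ σ' : Spins N) : |overlapQ σ σ'| ≤ 1 := by
  rw [overlapQ, abs_mul, abs_of_nonneg (by positivity : (0 : ℝ) ≤ 1 / N)]
  rcases Nat.eq_zero_or_pos N with h | h
  · subst h; simp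
  · rw [one_div, inv_mul_le_iff₀ (by exact_mod_cast h), mul_one]
    exact abs_sum_val_le σ σ'

lemma magnetization_neg {N : ℕ} (η σ : Spins N) :
    magnetization η (-σ) = -magnetization η σ := by
  simp [magnetization, val_neg]

/-- The couplings of the interpolating Hamiltonian. -/
structure Couplings where
  /-- coupling of the noise patterns -/
  κ : ℝ
  /-- first field on the hidden variables -/
  A₁ : ℝ
  /-- second field on the hidden variables -/
  A₂ : ℝ
  /-- first field on the spins -/
  B₁ : ℝ
  /-- second field on the spins -/
  B₂ : ℝ
  /-- coefficient of `τ² / 2` -/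
  C : ℝ
  /-- coefficient of `m ^ P` -/
  b₁ : ℝ
  /-- coefficient of `m` -/
  b₂ : ℝ
  /-- the constant term -/
  b₃ : ℝ

variable {P N K : ℕ}

/-- The patterns and the auxiliary fields of the first level. -/
abbrev Lvl₁ (P N K : ℕ) := Noise P N K × Aux N K

/-- The whole environment: patterns and both levels of auxiliary fields. -/
abbrev EnvPt (P N K : ℕ) := Lvl₁ P N K × Aux N K

/-- The field acting on the hidden variable `τ_μ`. -/
def fld (a : Couplings) (s c : ℝ) (σ : Spins N) (p : EnvPt P N K) (μ : Fin (K - 1)) : ℝ :=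
  s * a.κ * noiseField p.1.1 σ μ + c * (a.A₁ * p.1.2 (Sum.inr μ) + a.A₂ * p.2 (Sum.inr μ))

/-- The inverse variance of a hidden variable given the spins. -/
def den (a : Couplings) (c : ℝ) : ℝ := 1 - c ^ 2 * a.C

/-- The field acting on the spins. -/
def spinFld (a : Couplings) (σ : Spins N) (p : EnvPt P N K) : ℝ :=
  a.B₁ * ∑ i, p.1.2 (Sum.inl i) * val (σ i) + a.B₂ * ∑ i, p.2 (Sum.inl i) * val (σ i)

/-- The logarithm of the interpolating Boltzmann factor after integration over the hidden
variables; `s = √t` and `c = √(1 - t)`. -/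
def ham (a : Couplings) (η : Spins N) (s c : ℝ) (σ : Spins N) (p : EnvPt P N K) : ℝ :=
  s ^ 2 * (a.b₁ * magnetization η σ ^ P) + c ^ 2 * (a.b₂ * magnetization η σ) + c * spinFld a σ p
    - a.b₃ + (∑ μ, fld a s c σ p μ ^ 2) / (2 * den a c) - (K - 1 : ℕ) / 2 * Real.log (den a c)

/-- The derivative of `fld` along a curve with velocities `s'`, `c'`, `v`. -/
def fldD (a : Couplings) (s c s' c' : ℝ) (σ : Spins N) (p v : EnvPt P N K) (μ : Fin (K - 1)) : ℝ :=
  fld a s' c' σ p μ + fld a s c σ v μ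

/-- The derivative of `ham` along a curve with velocities `s'`, `c'`, `v`. -/
def hamD (a : Couplings) (η : Spins N) (s c s' c' : ℝ) (σ : Spins N) (p v : EnvPt P N K) : ℝ :=
  2 * s * s' * (a.b₁ * magnetization η σ ^ P) + 2 * c * c' * (a.b₂ * magnetization η σ)
    + (c' * spinFld a σ p + c * spinFld a σ v)
    + (∑ μ, fld a s c σ p μ * fldD a s c s' c' σ p v μ) / den a c
    + c * c' * a.C * ((∑ μ, fld a s c σ p μ ^ 2) / den a c ^ 2 + (K - 1 : ℕ) / den a c)

/-- `v` is the velocity at `t` of the curve `p` of environments. -/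
def HasVel (p : ℝ → EnvPt P N K) (v : EnvPt P N K) (t : ℝ) : Prop :=
  (∀ j, HasDerivAt (fun t => (p t).1.1 j) (v.1.1 j) t) ∧
    (∀ j, HasDerivAt (fun t => (p t).1.2 j) (v.1.2 j) t) ∧
      ∀ j, HasDerivAt (fun t => (p t).2 j) (v.2 j) t

lemma hasVel_const (p : EnvPt P N K) (t : ℝ) : HasVel (fun _ => p) 0 t :=
  ⟨fun _ => hasDerivAt_const _ _, fun _ => hasDerivAt_const _ _, fun _ => hasDerivAt_const _ _⟩

lemma hasDerivAt_fld (a : Couplings) (σ : Spins N) {s c : ℝ → ℝ} {s' c' : ℝ}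
    {p : ℝ → EnvPt P N K} {v : EnvPt P N K} {t : ℝ} (hs : HasDerivAt s s' t)
    (hc : HasDerivAt c c' t) (hp : HasVel p v t) (μ : Fin (K - 1)) :
    HasDerivAt (fun t => fld a (s t) (c t) σ (p t) μ)
      (fldD a (s t) (c t) s' c' σ (p t) v μ) t := by
  have h1 : HasDerivAt (fun t => noiseField (p t).1.1 σ μ) (noiseField v.1.1 σ μ) t :=
    HasDerivAt.fun_sum fun i _ => (hp.1 (μ, i)).mul_const _
  have h2 := ((hs.mul_const a.κ).mul h1).add
    (hc.mul (((hp.2.1 (Sum.inr μ)).const_mul a.A₁).add ((hp.2.2 (Sum.inr μ)).const_mul a.A₂)))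
  refine h2.congr_deriv ?_
  simp only [fldD, fld, Pi.add_apply]
  ring

lemma hasDerivAt_spinFld (a : Couplings) (σ : Spins N)
    {p : ℝ → EnvPt P N K} {v : EnvPt P N K} {t : ℝ} (hp : HasVel p v t) :
    HasDerivAt (fun t => spinFld a σ (p t)) (spinFld a σ v) t :=
  ((HasDerivAt.fun_sum fun i _ => (hp.2.1 (Sum.inl i)).mul_const _).const_mul _).add
    ((HasDerivAt.fun_sum fun i _ => (hp.2.2 (Sum.inl i)).mul_const _).const_mul _)

lemma hasDerivAt_ham (a : Couplings) (η σ : Spins N) {s c : ℝ → ℝ} {s' c' : ℝ}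
    {p : ℝ → EnvPt P N K} {v : EnvPt P N K} {t : ℝ} (hs : HasDerivAt s s' t)
    (hc : HasDerivAt c c' t) (hp : HasVel p v t) (hd : den a (c t) ≠ 0) :
    HasDerivAt (fun t => ham a η (s t) (c t) σ (p t))
      (hamD a η (s t) (c t) s' c' σ (p t) v) t := by
  have hden : HasDerivAt (fun t => den a (c t)) (-(2 * c t * c' * a.C)) t := by
    refine (((hc.fun_pow 2).mul_const a.C).const_sub 1).congr_deriv ?_
    ring
  have h1 : HasDerivAt (fun t => ∑ μ, fld a (s t) (c t) σ (p t) μ ^ 2)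
      (2 * ∑ μ, fld a (s t) (c t) σ (p t) μ * fldD a (s t) (c t) s' c' σ (p t) v μ) t := by
    rw [Finset.mul_sum]
    refine HasDerivAt.fun_sum fun μ _ => ?_
    refine ((hasDerivAt_fld a σ hs hc hp μ).fun_pow 2).congr_deriv ?_
    ring
  have h2 := (((((hs.fun_pow 2).mul_const (a.b₁ * magnetization η σ ^ P)).fun_add
    ((hc.fun_pow 2).mul_const (a.b₂ * magnetization η σ))).fun_add
    (hc.fun_mul (hasDerivAt_spinFld a σ hp))).sub_const a.b₃).fun_add
    (h1.fun_div (hden.const_mul 2) (by simpa using hd)) |>.fun_sub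
    ((hden.log hd).const_mul ((K - 1 : ℕ) / 2 : ℝ))
  refine h2.congr_deriv ?_
  simp only [hamD]
  field_simp
  ring

/-- The squared norm of a finite family of reals. -/
abbrev sqSize {ι : Type} [Fintype ι] (x : ι → ℝ) : ℝ := ∑ i, x i ^ 2

/-- The squared norm of the first-level environment. -/
abbrev size₁ (P N K : ℕ) : Lvl₁ P N K → ℝ := prodSize sqSize sqSize

/-- The law of the patterns and of the first level of auxiliary fields. -/
abbrev law₁ (P N K : ℕ) : Measure (Lvl₁ P N K) := (iidGaussian _).prod (iidGaussian _)

/-- The law of one level of auxiliary fields. -/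
abbrev lawAux (N K : ℕ) : Measure (Aux N K) := iidGaussian _

/-- The squared norm of the whole environment. -/
abbrev envSize (P N K : ℕ) : EnvPt P N K → ℝ := prodSize (size₁ P N K) sqSize

lemma envSize_eq (p : EnvPt P N K) : envSize P N K p =
    (∑ j, p.1.1 j ^ 2 + ∑ j, p.1.2 j ^ 2) + ∑ j, p.2 j ^ 2 := rfl

lemma envSize_nonneg (p : EnvPt P N K) : 0 ≤ envSize P N K p := by
  rw [envSize_eq]; positivity

/-- Couplings which are small enough for all the Gaussian integrals to converge. -/
structure Small (a : Couplings) (P N : ℕ) : Prop where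
  C_le : |a.C| ≤ 1 / 2
  κ_le : a.κ ^ 2 * N ^ (P / 2) ≤ 1 / 200
  A₁_le : a.A₁ ^ 2 ≤ 1 / 200
  A₂_le : a.A₂ ^ 2 ≤ 1 / 200
  b₁_nonneg : 0 ≤ a.b₁
  even : Even P

lemma Small.den_bounds {a : Couplings} (ha : Small a P N) {c : ℝ} (hc : |c| ≤ 1) :
    1 / 2 ≤ den a c ∧ den a c ≤ 3 / 2 := by
  have h1 := abs_le.1 ha.C_le
  have h2 : c ^ 2 ≤ 1 := by rw [← sq_abs]; exact pow_le_one₀ (abs_nonneg c) hc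
  have h3 := sq_nonneg c
  unfold den
  constructor <;> nlinarith

lemma Small.den_pos {a : Couplings} (ha : Small a P N) {c : ℝ} (hc : |c| ≤ 1) : 0 < den a c := by
  linarith [(ha.den_bounds hc).1]

lemma Small.abs_log_den {a : Couplings} (ha : Small a P N) {c : ℝ} (hc : |c| ≤ 1) :
    |Real.log (den a c)| ≤ 1 := by
  have h := ha.den_bounds hc
  have h0 := ha.den_pos hc
  have h1 := Real.log_le_sub_one_of_pos h0
  have h2 := Real.one_sub_inv_le_log_of_pos h0
  have h3 : (den a c)⁻¹ ≤ 2 := by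
    have := inv_anti₀ (by norm_num) h.1
    simpa using this
  rw [abs_le]
  constructor <;> linarith

lemma noiseField_sq_le (ξ : Noise P N K) (σ : Spins N) (μ : Fin (K - 1)) :
    noiseField ξ σ μ ^ 2 ≤ N ^ (P / 2) * ∑ i, ξ (μ, i) ^ 2 := by
  have h1 := Finset.sum_mul_sq_le_sq_mul_sq Finset.univ
    (fun i : Fin (P / 2) → Fin N => ξ (μ, i)) (fun i => mon σ i)
  have h2 : ∑ i : Fin (P / 2) → Fin N, mon σ i ^ 2 = (N : ℝ) ^ (P / 2) := by
    simp [mon_sq]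
  rw [h2] at h1
  calc noiseField ξ σ μ ^ 2 = (∑ i : Fin (P / 2) → Fin N, ξ (μ, i) * mon σ i) ^ 2 := rfl
    _ ≤ _ := h1
    _ = _ := mul_comm _ _

/-- The fields acting on the hidden variables are small compared with the environment. -/
lemma Small.sum_fld_sq_le {a : Couplings} (ha : Small a P N) {s c : ℝ} (hs : |s| ≤ 1)
    (hc : |c| ≤ 1) (σ : Spins N) (p : EnvPt P N K) :
    ∑ μ, fld a s c σ p μ ^ 2 ≤ 3 / 200 * envSize P N K p := by
  have hs2 : s ^ 2 ≤ 1 := by rw [← sq_abs]; exact pow_le_one₀ (abs_nonneg s) hs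
  have hc2 : c ^ 2 ≤ 1 := by rw [← sq_abs]; exact pow_le_one₀ (abs_nonneg c) hc
  have h1 : ∀ μ, fld a s c σ p μ ^ 2 ≤ 3 / 200 * ((∑ i, p.1.1 (μ, i) ^ 2) +
      p.1.2 (Sum.inr μ) ^ 2 + p.2 (Sum.inr μ) ^ 2) := by
    intro μ
    have e1 : (s * a.κ * noiseField p.1.1 σ μ) ^ 2 ≤ 1 / 200 * ∑ i, p.1.1 (μ, i) ^ 2 := by
      have h := noiseField_sq_le p.1.1 σ μ
      have h0 : (0 : ℝ) ≤ ∑ i, p.1.1 (μ, i) ^ 2 := Finset.sum_nonneg fun _ _ => sq_nonneg _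
      calc (s * a.κ * noiseField p.1.1 σ μ) ^ 2
          = s ^ 2 * (a.κ ^ 2 * noiseField p.1.1 σ μ ^ 2) := by ring
        _ ≤ 1 * (a.κ ^ 2 * (N ^ (P / 2) * ∑ i, p.1.1 (μ, i) ^ 2)) := by gcongr
        _ = (a.κ ^ 2 * N ^ (P / 2)) * ∑ i, p.1.1 (μ, i) ^ 2 := by ring
        _ ≤ _ := mul_le_mul_of_nonneg_right ha.κ_le h0
    have e2 : ∀ A x : ℝ, A ^ 2 ≤ 1 / 200 → (c * (A * x)) ^ 2 ≤ 1 / 200 * x ^ 2 := by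
      intro A x hA
      calc (c * (A * x)) ^ 2 = c ^ 2 * (A ^ 2 * x ^ 2) := by ring
        _ ≤ 1 * (1 / 200 * x ^ 2) := by gcongr
        _ = _ := by ring
    have e3 := e2 _ (p.1.2 (Sum.inr μ)) ha.A₁_le
    have e4 := e2 _ (p.2 (Sum.inr μ)) ha.A₂_le
    have e5 : ∀ x y z : ℝ, (x + (y + z)) ^ 2 ≤ 3 * (x ^ 2 + y ^ 2 + z ^ 2) := fun x y z => by
      nlinarith [sq_nonneg (x - y), sq_nonneg (x - z), sq_nonneg (y - z)]
    have e6 := e5 (s * a.κ * noiseField p.1.1 σ μ) (c * (a.A₁ * p.1.2 (Sum.inr μ)))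
      (c * (a.A₂ * p.2 (Sum.inr μ)))
    rw [fld, mul_add]
    linarith
  refine (Finset.sum_le_sum fun μ _ => h1 μ).trans ?_
  rw [← Finset.mul_sum, Finset.sum_add_distrib, Finset.sum_add_distrib]
  rw [envSize_eq]
  simp only [Fintype.sum_prod_type, Fintype.sum_sum_type]
  have h2 : (0 : ℝ) ≤ ∑ i, p.1.2 (Sum.inl i) ^ 2 := Finset.sum_nonneg fun _ _ => sq_nonneg _
  have h3 : (0 : ℝ) ≤ ∑ i, p.2 (Sum.inl i) ^ 2 := Finset.sum_nonneg fun _ _ => sq_nonneg _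
  linarith

/-- The constant in the bound of the spin fields. -/
def spinConst (a : Couplings) (N : ℕ) : ℝ := 25 * N * (a.B₁ ^ 2 + a.B₂ ^ 2)

lemma abs_spinFld_le (a : Couplings) (σ : Spins N) (p : EnvPt P N K) :
    |spinFld a σ p| ≤ spinConst a N + 1 / 100 * envSize P N K p := by
  have h1 : ∀ (B : ℝ) (J : Aux N K), |B * ∑ i, J (Sum.inl i) * val (σ i)| ≤
      25 * N * B ^ 2 + 1 / 100 * ∑ i, J (Sum.inl i) ^ 2 := by
    intro B J
    rw [Finset.mul_sum]
    calc |∑ i, B * (J (Sum.inl i) * val (σ i))| ≤ ∑ i, |B * (J (Sum.inl i) * val (σ i))| :=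
          Finset.abs_sum_le_sum_abs _ _
      _ ≤ ∑ i : Fin N, (25 * B ^ 2 + 1 / 100 * J (Sum.inl i) ^ 2) := by
          refine Finset.sum_le_sum fun i _ => ?_
          rw [abs_mul, abs_mul, abs_val, mul_one, ← sq_abs B, ← sq_abs (J (Sum.inl i))]
          nlinarith [sq_nonneg (5 * |B| - 1 / 10 * |J (Sum.inl i)|)]
      _ = _ := by
          rw [Finset.sum_add_distrib, Finset.sum_const, Finset.card_univ,
            Fintype.card_fin, nsmul_eq_mul, ← Finset.mul_sum]
          ring
  have h2 := h1 a.B₁ p.1.2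
  have h3 := h1 a.B₂ p.2
  have h4 : (0 : ℝ) ≤ ∑ i, p.1.2 (Sum.inr i) ^ 2 := Finset.sum_nonneg fun _ _ => sq_nonneg _
  have h5 : (0 : ℝ) ≤ ∑ i, p.2 (Sum.inr i) ^ 2 := Finset.sum_nonneg fun _ _ => sq_nonneg _
  have h6 : (0 : ℝ) ≤ ∑ i, p.1.1 i ^ 2 := Finset.sum_nonneg fun _ _ => sq_nonneg _
  rw [spinFld, spinConst]
  refine (abs_add_le _ _).trans ?_
  rw [envSize_eq]
  simp only [Fintype.sum_sum_type]
  linarith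

lemma abs_magnetization_le (η σ : Spins N) : |magnetization η σ| ≤ 1 := abs_overlapQ_le η σ

lemma abs_magnetization_pow_le (η σ : Spins N) (k : ℕ) : |magnetization η σ ^ k| ≤ 1 := by
  rw [abs_pow]; exact pow_le_one₀ (abs_nonneg _) (abs_magnetization_le η σ)

/-- The constant in the upper bound of the Hamiltonian. -/
def hamConst (a : Couplings) (N K : ℕ) : ℝ :=
  |a.b₁| + |a.b₂| + |a.b₃| + spinConst a N + (K - 1 : ℕ)

lemma abs_mul_le_of_le_one {x y : ℝ} (hx : |x| ≤ 1) : |x * y| ≤ |y| := by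
  rw [abs_mul]; exact mul_le_of_le_one_left (abs_nonneg _) hx

/-- The Hamiltonian grows at most like `rate` times the squared norm of the environment, so that all
powers of the partition function which occur are integrable. -/
lemma Small.ham_le {a : Couplings} (ha : Small a P N) (η : Spins N) {s c : ℝ} (hs : |s| ≤ 1)
    (hc : |c| ≤ 1) (σ : Spins N) (p : EnvPt P N K) :
    ham a η s c σ p ≤ hamConst a N K + rate * envSize P N K p := by
  have hs2 : |s ^ 2| ≤ 1 := by rw [abs_pow]; exact pow_le_one₀ (abs_nonneg s) hs
  have hc2 : |c ^ 2| ≤ 1 := by rw [abs_pow]; exact pow_le_one₀ (abs_nonneg c) hc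
  have h0 := envSize_nonneg p
  have h1 : s ^ 2 * (a.b₁ * magnetization η σ ^ P) ≤ |a.b₁| := (le_abs_self _).trans
    ((abs_mul_le_of_le_one hs2).trans (by
      rw [mul_comm]; exact abs_mul_le_of_le_one (abs_magnetization_pow_le η σ P)))
  have h2 : c ^ 2 * (a.b₂ * magnetization η σ) ≤ |a.b₂| := (le_abs_self _).trans
    ((abs_mul_le_of_le_one hc2).trans (by
      rw [mul_comm]; exact abs_mul_le_of_le_one (abs_magnetization_le η σ)))
  have h3 : c * spinFld a σ p ≤ spinConst a N + 1 / 100 * envSize P N K p :=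
    (le_abs_self _).trans ((abs_mul_le_of_le_one hc).trans (abs_spinFld_le a σ p))
  have h4 : (∑ μ, fld a s c σ p μ ^ 2) / (2 * den a c) ≤ 3 / 200 * envSize P N K p := by
    have := ha.sum_fld_sq_le hs hc σ p
    refine (div_le_self (Finset.sum_nonneg fun _ _ => sq_nonneg _) ?_).trans this
    linarith [(ha.den_bounds hc).1]
  have h5 : -((K - 1 : ℕ) / 2 * Real.log (den a c)) ≤ (K - 1 : ℕ) := by
    have h6 := (abs_le.1 (ha.abs_log_den hc)).1
    have h7 : (0 : ℝ) ≤ (K - 1 : ℕ) := Nat.cast_nonneg _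
    nlinarith
  have h8 := neg_abs_le a.b₃
  have h9 : rate = (1 : ℝ) / 20 := rfl
  rw [ham, hamConst, h9]
  linarith

/-- The partition function is bounded below: the odd part of the Hamiltonian cancels between a
configuration and its opposite. -/
lemma Small.exists_le_ham {a : Couplings} (ha : Small a P N) (η : Spins N) {s c : ℝ}
    (hc : |c| ≤ 1) (p : EnvPt P N K) :
    ∃ σ, -|a.b₃| - (K - 1 : ℕ) ≤ ham a η s c σ p := by
  have key : ∀ σ, -|a.b₃| - (K - 1 : ℕ) + (c ^ 2 * (a.b₂ * magnetization η σ) + c * spinFld a σ p) ≤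
      ham a η s c σ p := by
    intro σ
    have h1 : 0 ≤ s ^ 2 * (a.b₁ * magnetization η σ ^ P) :=
      mul_nonneg (sq_nonneg _) (mul_nonneg ha.b₁_nonneg (ha.even.pow_nonneg _))
    have h2 : 0 ≤ (∑ μ, fld a s c σ p μ ^ 2) / (2 * den a c) :=
      div_nonneg (Finset.sum_nonneg fun _ _ => sq_nonneg _) (by linarith [ha.den_pos hc])
    have h3 : (K - 1 : ℕ) / 2 * Real.log (den a c) ≤ (K - 1 : ℕ) := by
      have h6 := (abs_le.1 (ha.abs_log_den hc)).2
      have h7 : (0 : ℝ) ≤ (K - 1 : ℕ) := Nat.cast_nonneg _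
      nlinarith
    have h4 := le_abs_self a.b₃
    rw [ham]
    linarith
  have hs : ∀ σ : Spins N, spinFld a (-σ) p = -spinFld a σ p := fun σ => by
    simp only [spinFld, Pi.neg_apply, val_neg, mul_neg, Finset.sum_neg_distrib]; ring
  -- The odd part is nonnegative at one of the configurations `1` and `-1`.
  by_cases h : 0 ≤ c ^ 2 * (a.b₂ * magnetization η 1) + c * spinFld a 1 p
  · exact ⟨1, by linarith [key 1]⟩
  · refine ⟨-1, ?_⟩
    have h1 := key (-1)
    rw [magnetization_neg, hs] at h1
    linarith

lemma measurable_noiseField (σ : Spins N) (μ : Fin (K - 1)) :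
    Measurable fun ξ : Noise P N K => noiseField ξ σ μ := by
  unfold noiseField; fun_prop

lemma measurable_fld (a : Couplings) (s c : ℝ) (σ : Spins N) (μ : Fin (K - 1)) :
    Measurable fun p : EnvPt P N K => fld a s c σ p μ := by
  have := (measurable_noiseField (P := P) σ μ).comp (f := fun p : EnvPt P N K => p.1.1)
    (by fun_prop)
  unfold fld
  exact (this.const_mul _).add (by fun_prop)

lemma measurable_spinFld (a : Couplings) (σ : Spins N) :
    Measurable fun p : EnvPt P N K => spinFld a σ p := by
  unfold spinFld; fun_prop

lemma measurable_ham (a : Couplings) (η : Spins N) (s c : ℝ) (σ : Spins N) :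
    Measurable fun p : EnvPt P N K => ham a η s c σ p := by
  unfold ham
  have h1 := measurable_spinFld (P := P) (K := K) a σ
  have h2 : Measurable fun p : EnvPt P N K => ∑ μ, fld a s c σ p μ ^ 2 :=
    Finset.measurable_fun_sum _ fun μ _ => (measurable_fld a s c σ μ).pow_const 2
  fun_prop

lemma Small.tame {a : Couplings} (ha : Small a P N) (η : Spins N) {s c : ℝ} (hs : |s| ≤ 1)
    (hc : |c| ≤ 1) : Tame (envSize P N K) (ham a η s c) where
  meas := measurable_ham a η s c
  upper := ⟨_, ha.ham_le η hs hc⟩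
  lower := ⟨_, ha.exists_le_ham η hc⟩

lemma isSize_size₁ : IsSize (law₁ P N K) (size₁ P N K) :=
  (isSize_iidGaussian _).prod (isSize_iidGaussian _)

lemma isSize_sqSize : IsSize (lawAux N K) sqSize := isSize_iidGaussian _

lemma Small.env {a : Couplings} (ha : Small a P N) (η : Spins N) {s c θ : ℝ} (hs : |s| ≤ 1)
    (hc : |c| ≤ 1) (hθ0 : 0 < θ) (hθ1 : θ ≤ 1) :
    Env (law₁ P N K) (lawAux N K) (size₁ P N K) sqSize θ (ham a η s c) :=
  ⟨isSize_size₁, isSize_sqSize, ha.tame η hs hc, hθ0, hθ1⟩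

lemma affine_le_exp {x y r : ℝ} (hx : 0 ≤ x) (hy : 0 ≤ y) (hr : 0 ≤ r) :
    x + y * r ≤ (x + 20 * y) * Real.exp (rate * r) := by
  have h1 : rate * r + 1 ≤ Real.exp (rate * r) := Real.add_one_le_exp _
  have h2 : rate = (1 : ℝ) / 20 := rfl
  rw [h2] at h1 ⊢
  nlinarith

lemma GBdd.of_affine {Ω : Type*} [MeasurableSpace Ω] {r f : Ω → ℝ} (hr : ∀ x, 0 ≤ r x)
    (hf : Measurable f) {x y : ℝ} (hx : 0 ≤ x) (hy : 0 ≤ y) (h : ∀ p, |f p| ≤ x + y * r p) :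
    GBdd r rate f :=
  ⟨hf, x + 20 * y, by positivity, fun p => (h p).trans (affine_le_exp hx hy (hr p))⟩

lemma Small.abs_fld_le {a : Couplings} (ha : Small a P N) {s c : ℝ} (hs : |s| ≤ 1)
    (hc : |c| ≤ 1) (σ : Spins N) (p : EnvPt P N K) (μ : Fin (K - 1)) :
    |fld a s c σ p μ| ≤ 1 + 1 * envSize P N K p := by
  have h1 := ha.sum_fld_sq_le hs hc σ p
  have h2 := Finset.single_le_sum (f := fun μ => fld a s c σ p μ ^ 2) (fun _ _ => sq_nonneg _)
    (Finset.mem_univ μ)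
  have h0 := envSize_nonneg p
  nlinarith [sq_abs (fld a s c σ p μ), sq_nonneg (|fld a s c σ p μ| - 1)]

lemma Small.gbdd_fld {a : Couplings} (ha : Small a P N) {s c : ℝ} (hs : |s| ≤ 1)
    (hc : |c| ≤ 1) (σ : Spins N) (μ : Fin (K - 1)) :
    GBdd (envSize P N K) rate (fun p => fld a s c σ p μ) :=
  GBdd.of_affine envSize_nonneg (measurable_fld a s c σ μ) zero_le_one zero_le_one
    fun p => ha.abs_fld_le hs hc σ p μ

/-- The derivative of the Hamiltonian in the interpolation parameter has affine growth. -/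
lemma Small.abs_hamD_le {a : Couplings} (ha : Small a P N) (η : Spins N) {s c s' c' : ℝ}
    (hs : |s| ≤ 1) (hc : |c| ≤ 1) (hs' : |s'| ≤ 1) (hc' : |c'| ≤ 1) (σ : Spins N)
    (p : EnvPt P N K) :
    |hamD a η s c s' c' σ p 0| ≤
      (2 * |a.b₁| + 2 * |a.b₂| + spinConst a N + 2 * (K - 1 : ℕ)) + 1 * envSize P N K p := by
  have h0 := envSize_nonneg p
  have hd := ha.den_bounds hc
  have hd0 := ha.den_pos hc
  have hk : (0 : ℝ) ≤ (K - 1 : ℕ) := Nat.cast_nonneg _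
  have hss : |s * s'| ≤ 1 := by rw [abs_mul]; exact mul_le_one₀ hs (abs_nonneg _) hs'
  have hcc : |c * c'| ≤ 1 := by rw [abs_mul]; exact mul_le_one₀ hc (abs_nonneg _) hc'
  have h1 : |2 * s * s' * (a.b₁ * magnetization η σ ^ P)| ≤ 2 * |a.b₁| := by
    rw [show 2 * s * s' * (a.b₁ * magnetization η σ ^ P) =
      2 * (s * s' * (magnetization η σ ^ P * a.b₁)) by ring, abs_mul, abs_two]
    refine mul_le_mul_of_nonneg_left ?_ zero_le_two
    exact (abs_mul_le_of_le_one hss).trans (abs_mul_le_of_le_one (abs_magnetization_pow_le η σ P))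
  have h2 : |2 * c * c' * (a.b₂ * magnetization η σ)| ≤ 2 * |a.b₂| := by
    rw [show 2 * c * c' * (a.b₂ * magnetization η σ) =
      2 * (c * c' * (magnetization η σ * a.b₂)) by ring, abs_mul, abs_two]
    refine mul_le_mul_of_nonneg_left ?_ zero_le_two
    exact (abs_mul_le_of_le_one hcc).trans (abs_mul_le_of_le_one (abs_magnetization_le η σ))
  have z1 : spinFld a σ (0 : EnvPt P N K) = 0 := by simp [spinFld]
  have z2 : ∀ μ, fld a s c σ (0 : EnvPt P N K) μ = 0 := fun μ => by simp [fld, noiseField]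
  have h3 : |c' * spinFld a σ p + c * spinFld a σ (0 : EnvPt P N K)| ≤
      spinConst a N + 1 / 100 * envSize P N K p := by
    rw [z1, mul_zero, add_zero]
    exact (abs_mul_le_of_le_one hc').trans (abs_spinFld_le a σ p)
  have s1 := ha.sum_fld_sq_le hs hc σ p
  have s2 := ha.sum_fld_sq_le hs' hc' σ p
  have hdi : (den a c)⁻¹ ≤ 2 := by
    have := inv_anti₀ (by norm_num) hd.1
    simpa using this
  have hdi0 : 0 < (den a c)⁻¹ := inv_pos.2 hd0
  have h4 : |(∑ μ, fld a s c σ p μ * fldD a s c s' c' σ p 0 μ) / den a c| ≤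
      6 / 200 * envSize P N K p := by
    have e1 : |∑ μ, fld a s c σ p μ * fldD a s c s' c' σ p 0 μ| ≤ 3 / 200 * envSize P N K p := by
      calc |∑ μ, fld a s c σ p μ * fldD a s c s' c' σ p 0 μ|
          ≤ ∑ μ, |fld a s c σ p μ * fldD a s c s' c' σ p 0 μ| := Finset.abs_sum_le_sum_abs _ _
        _ ≤ ∑ μ, (1 / 2 * fld a s c σ p μ ^ 2 + 1 / 2 * fld a s' c' σ p μ ^ 2) := by
            refine Finset.sum_le_sum fun μ _ => ?_
            rw [fldD, z2, add_zero, abs_mul, ← sq_abs (fld a s c σ p μ),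
              ← sq_abs (fld a s' c' σ p μ)]
            nlinarith [sq_nonneg (|fld a s c σ p μ| - |fld a s' c' σ p μ|)]
        _ ≤ _ := by
            rw [Finset.sum_add_distrib, ← Finset.mul_sum, ← Finset.mul_sum]
            linarith
    rw [abs_div, abs_of_pos hd0, div_eq_mul_inv]
    calc _ ≤ (3 / 200 * envSize P N K p) * 2 :=
          mul_le_mul e1 hdi hdi0.le (by positivity)
      _ = _ := by ring
  have h5 : |c * c' * a.C * ((∑ μ, fld a s c σ p μ ^ 2) / den a c ^ 2 + (K - 1 : ℕ) / den a c)| ≤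
      12 / 200 * envSize P N K p + 2 * (K - 1 : ℕ) := by
    have e0 : (0 : ℝ) ≤ ∑ μ, fld a s c σ p μ ^ 2 := Finset.sum_nonneg fun _ _ => sq_nonneg _
    have e1 : (∑ μ, fld a s c σ p μ ^ 2) / den a c ^ 2 ≤ 12 / 200 * envSize P N K p := by
      rw [div_eq_mul_inv, ← inv_pow]
      calc _ ≤ (3 / 200 * envSize P N K p) * 2 ^ 2 := by gcongr
        _ = _ := by ring
    have e2 : ((K - 1 : ℕ) : ℝ) / den a c ≤ 2 * (K - 1 : ℕ) := by
      rw [div_eq_mul_inv, mul_comm]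
      gcongr
    have e3 : |c * c' * a.C| ≤ 1 := by
      refine (abs_mul_le_of_le_one hcc).trans (ha.C_le.trans (by norm_num))
    refine (abs_mul_le_of_le_one e3).trans ?_
    rw [abs_of_nonneg (by positivity)]
    linarith
  rw [hamD]
  refine (abs_add_le _ _).trans ?_
  refine (add_le_add_left (abs_add_le _ _) _).trans ?_
  refine (add_le_add_left (add_le_add_left (abs_add_le _ _) _) _).trans ?_
  refine (add_le_add_left (add_le_add_left (add_le_add_left (abs_add_le _ _) _) _) _).trans ?_
  linarith

/-! ### Integration by parts in the interpolating system -/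

section Families

variable {S X Y ι : Type*} [Fintype S] [Fintype ι] [MeasurableSpace X] [MeasurableSpace Y]
  {H : S → X × Y → ℝ} {θ : ℝ} {γX : Measure X} {γY : Measure Y} [IsProbabilityMeasure γX]
  [IsProbabilityMeasure γY] {rX : X → ℝ} {rY : Y → ℝ}

/-- Integration by parts for a family of first-level coordinates along which the derivatives of the
Hamiltonian are the observables `r₀ D i`. -/
lemma Env.sum_ibp₁ [Nonempty S] (hE : Env γX γY rX rY θ H) {c : ι → X → ℝ} {u : ι → X → ℝ → X}
    (hc : ∀ i, IsGaussCoord γX rX (c i) (u i)) {D : ι → S → X × Y → ℝ} {r₀ DD : ℝ}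
    (hD : ∀ i σ, GBdd (prodSize rX rY) rate (D i σ))
    (dH : ∀ i σ x y s, HasDerivAt (fun s => H σ (u i x s, y)) (r₀ * D i σ (u i x s, y)) s)
    (dD : ∀ i σ x y s, HasDerivAt (fun s => D i σ (u i x s, y)) (r₀ * DD) s) :
    avg₀ γX γY θ H (fun σ p => ∑ i, c i p.1 * D i σ p) =
      r₀ * (Fintype.card ι * DD + avg₀ γX γY θ H (fun σ p => ∑ i, D i σ p ^ 2) +
        (θ - 1) * avg₂ γX γY θ H (fun t p => ∑ i, D i t.1 p * D i t.2 p) -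
        θ * avg₁ γX γY θ H (fun t q => ∑ i, D i t.1 (rep₁ q) * D i t.2 (rep₂ q))) := by
  have hr := hE.size_pair.nonneg
  have hrY := hE.sizeY.nonneg
  have bc : ∀ i, GBdd (prodSize rX rY) rate (fun p => c i p.1) := fun i =>
    ((hc i).fst (ν' := γY) hE.sizeY.nonneg).gbdd (by norm_num)
  have bsq : ∀ i σ, GBdd (prodSize rX rY) (rate + rate) (fun p => D i σ p ^ 2) := fun i σ =>
    ((hD i σ).mul (hD i σ)).congr fun p => (sq _).symm
  have bc0 : ∀ a : ℝ, GBdd (prodSize rX rY) (rate + rate) (fun _ => a) := fun a =>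
    (GBdd.const a).mono hr (by norm_num)
  have h1 : ∀ i, avg₀ γX γY θ H (fun σ p => c i p.1 * D i σ p) =
      r₀ * (DD + avg₀ γX γY θ H (fun σ p => D i σ p ^ 2) +
        (θ - 1) * avg₂ γX γY θ H (fun t p => D i t.1 p * D i t.2 p) -
        θ * avg₁ γX γY θ H (fun t q => D i t.1 (rep₁ q) * D i t.2 (rep₂ q))) := by
    intro i
    rw [hE.ibp₁ (hc i) (H' := fun σ p => r₀ * D i σ p) (g := D i) (g' := fun _ _ => r₀ * DD)
      (fun σ => (hD i σ).const_mul r₀) (hD i) (fun σ => (GBdd.const _).mono hr (by norm_num))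
      (dH i) (dD i)]
    have e1 : avg₀ γX γY θ H (fun σ p => r₀ * DD + D i σ p * (r₀ * D i σ p)) =
        r₀ * DD + r₀ * avg₀ γX γY θ H (fun σ p => D i σ p ^ 2) := by
      have i1 := hE.int₀ (by norm_num) (f := fun _ _ => r₀ * DD) fun σ => bc0 _
      have i2 := hE.int₀ (by norm_num) (f := fun σ p => r₀ * D i σ p ^ 2)
        fun σ => (bsq i σ).const_mul _
      rw [avg₀, ← kavg_const hE.avg₀_one (r₀ * DD), avg₀, ← kavg_const_mul, ← kavg_add i1 i2]
      exact kavg_congr fun σ p => by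
        rw [kavg_const hE.avg₀_one]; ring
    have e2 : avg₂ γX γY θ H (fun t p => D i t.1 p * (r₀ * D i t.2 p)) =
        r₀ * avg₂ γX γY θ H (fun t p => D i t.1 p * D i t.2 p) := by
      rw [avg₂, avg₂, ← kavg_const_mul]
      exact kavg_congr fun σ p => by ring
    have e3 : avg₁ γX γY θ H (fun t q => D i t.1 (rep₁ q) * (r₀ * D i t.2 (rep₂ q))) =
        r₀ * avg₁ γX γY θ H (fun t q => D i t.1 (rep₁ q) * D i t.2 (rep₂ q)) := by
      rw [avg₁, avg₁, ← kavg_const_mul]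
      exact kavg_congr fun σ p => by ring
    rw [e1, e2, e3]; ring
  have s0 : avg₀ γX γY θ H (fun σ p => ∑ i, c i p.1 * D i σ p) =
      ∑ i, avg₀ γX γY θ H (fun σ p => c i p.1 * D i σ p) :=
    kavg_sum _ fun i => hE.int₀ (by norm_num) fun σ => (bc i).mul (hD i σ)
  have s1 : avg₀ γX γY θ H (fun σ p => ∑ i, D i σ p ^ 2) =
      ∑ i, avg₀ γX γY θ H (fun σ p => D i σ p ^ 2) :=
    kavg_sum _ fun i => hE.int₀ (by norm_num) fun σ => bsq i σ
  have s2 : avg₂ γX γY θ H (fun t p => ∑ i, D i t.1 p * D i t.2 p) =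
      ∑ i, avg₂ γX γY θ H (fun t p => D i t.1 p * D i t.2 p) :=
    kavg_sum _ fun i => hE.int₂ (by norm_num) fun t => (hD i t.1).mul (hD i t.2)
  have s3 : avg₁ γX γY θ H (fun t q => ∑ i, D i t.1 (rep₁ q) * D i t.2 (rep₂ q)) =
      ∑ i, avg₁ γX γY θ H (fun t q => D i t.1 (rep₁ q) * D i t.2 (rep₂ q)) :=
    kavg_sum _ fun i => hE.int₁ (by norm_num) fun t =>
      ((hD i t.1).rep₁ hrY (by norm_num)).mul ((hD i t.2).rep₂ hrY (by norm_num))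
  rw [s0, s1, s2, s3, Finset.sum_congr rfl fun i _ => h1 i, ← Finset.mul_sum,
    Finset.sum_sub_distrib, Finset.sum_add_distrib, Finset.sum_add_distrib, Finset.mul_sum,
    Finset.mul_sum]
  simp

/-- Integration by parts for a family of second-level coordinates. -/
lemma Env.sum_ibp₂ [Nonempty S] (hE : Env γX γY rX rY θ H) {c : ι → Y → ℝ} {u : ι → Y → ℝ → Y}
    (hc : ∀ i, IsGaussCoord γY rY (c i) (u i)) {D : ι → S → X × Y → ℝ} {r₀ DD : ℝ}
    (hD : ∀ i σ, GBdd (prodSize rX rY) rate (D i σ))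
    (dH : ∀ i σ x y s, HasDerivAt (fun s => H σ (x, u i y s)) (r₀ * D i σ (x, u i y s)) s)
    (dD : ∀ i σ x y s, HasDerivAt (fun s => D i σ (x, u i y s)) (r₀ * DD) s) :
    avg₀ γX γY θ H (fun σ p => ∑ i, c i p.2 * D i σ p) =
      r₀ * (Fintype.card ι * DD + avg₀ γX γY θ H (fun σ p => ∑ i, D i σ p ^ 2) +
        (θ - 1) * avg₂ γX γY θ H (fun t p => ∑ i, D i t.1 p * D i t.2 p)) := by
  have hr := hE.size_pair.nonneg
  have bc : ∀ i, GBdd (prodSize rX rY) rate (fun p => c i p.2) := fun i =>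
    ((hc i).snd (ν := γX) hE.sizeX.nonneg).gbdd (by norm_num)
  have bsq : ∀ i σ, GBdd (prodSize rX rY) (rate + rate) (fun p => D i σ p ^ 2) := fun i σ =>
    ((hD i σ).mul (hD i σ)).congr fun p => (sq _).symm
  have bc0 : ∀ a : ℝ, GBdd (prodSize rX rY) (rate + rate) (fun _ => a) := fun a =>
    (GBdd.const a).mono hr (by norm_num)
  have h1 : ∀ i, avg₀ γX γY θ H (fun σ p => c i p.2 * D i σ p) =
      r₀ * (DD + avg₀ γX γY θ H (fun σ p => D i σ p ^ 2) +
        (θ - 1) * avg₂ γX γY θ H (fun t p => D i t.1 p * D i t.2 p)) := by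
    intro i
    rw [hE.ibp₂ (hc i) (H' := fun σ p => r₀ * D i σ p) (g := D i) (g' := fun _ _ => r₀ * DD)
      (fun σ => (hD i σ).const_mul r₀) (hD i) (fun σ => (GBdd.const _).mono hr (by norm_num))
      (dH i) (dD i)]
    have e1 : avg₀ γX γY θ H (fun σ p => r₀ * DD + D i σ p * (r₀ * D i σ p)) =
        r₀ * DD + r₀ * avg₀ γX γY θ H (fun σ p => D i σ p ^ 2) := by
      have i1 := hE.int₀ (by norm_num) (f := fun _ _ => r₀ * DD) fun σ => bc0 _
      have i2 := hE.int₀ (by norm_num) (f := fun σ p => r₀ * D i σ p ^ 2)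
        fun σ => (bsq i σ).const_mul _
      rw [avg₀, ← kavg_const hE.avg₀_one (r₀ * DD), avg₀, ← kavg_const_mul, ← kavg_add i1 i2]
      exact kavg_congr fun σ p => by
        rw [kavg_const hE.avg₀_one]; ring
    have e2 : avg₂ γX γY θ H (fun t p => D i t.1 p * (r₀ * D i t.2 p)) =
        r₀ * avg₂ γX γY θ H (fun t p => D i t.1 p * D i t.2 p) := by
      rw [avg₂, avg₂, ← kavg_const_mul]
      exact kavg_congr fun σ p => by ring
    rw [e1, e2]; ring
  have s0 : avg₀ γX γY θ H (fun σ p => ∑ i, c i p.2 * D i σ p) =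
      ∑ i, avg₀ γX γY θ H (fun σ p => c i p.2 * D i σ p) :=
    kavg_sum _ fun i => hE.int₀ (by norm_num) fun σ => (bc i).mul (hD i σ)
  have s1 : avg₀ γX γY θ H (fun σ p => ∑ i, D i σ p ^ 2) =
      ∑ i, avg₀ γX γY θ H (fun σ p => D i σ p ^ 2) :=
    kavg_sum _ fun i => hE.int₀ (by norm_num) fun σ => bsq i σ
  have s2 : avg₂ γX γY θ H (fun t p => ∑ i, D i t.1 p * D i t.2 p) =
      ∑ i, avg₂ γX γY θ H (fun t p => D i t.1 p * D i t.2 p) :=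
    kavg_sum _ fun i => hE.int₂ (by norm_num) fun t => (hD i t.1).mul (hD i t.2)
  rw [s0, s1, s2, Finset.sum_congr rfl fun i _ => h1 i, ← Finset.mul_sum,
    Finset.sum_add_distrib, Finset.sum_add_distrib, Finset.mul_sum]
  simp

end Families

variable {P N K : ℕ}

lemma hasDerivAt_update {ι : Type} [DecidableEq ι] (x : ι → ℝ) (j k : ι) (t : ℝ) :
    HasDerivAt (fun t => Function.update x j t k) ((Pi.single j (1 : ℝ) : ι → ℝ) k) t := by
  by_cases h : k = j
  · subst h
    simp only [Function.update_self, Pi.single_eq_same]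
    exact hasDerivAt_id' t
  · simpa [Function.update_of_ne h, Pi.single_eq_of_ne h] using hasDerivAt_const t (x k)

/-- The conditional mean of the hidden variable `τ_μ` given the spins. -/
def cmean (a : Couplings) (s c : ℝ) (σ : Spins N) (p : EnvPt P N K) (μ : Fin (K - 1)) : ℝ :=
  fld a s c σ p μ / den a c

/-- The (unnormalized) overlap of the conditional means of the hidden variables. -/
def hidOv (a : Couplings) (s c : ℝ) (σ σ' : Spins N) (p p' : EnvPt P N K) : ℝ :=
  ∑ μ, cmean a s c σ p μ * cmean a s c σ' p' μ

/-- The (unnormalized) spin overlap. -/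
def spinOv (σ σ' : Spins N) : ℝ := ∑ i, val (σ i) * val (σ' i)

lemma hamD_of_vel (a : Couplings) (η : Spins N) (s c : ℝ) (σ : Spins N) (p v : EnvPt P N K) :
    hamD a η s c 0 0 σ p v =
      c * spinFld a σ v + ∑ μ, cmean a s c σ p μ * fld a s c σ v μ := by
  have : ∀ μ, fld a 0 0 σ p μ = 0 := fun μ => by simp [fld]
  simp only [hamD, fldD, this, cmean, zero_add, mul_zero, zero_mul, add_zero, Finset.sum_div]
  congr 1
  exact Finset.sum_congr rfl fun μ _ => by ring

lemma hasDerivAt_ham_of_vel {a : Couplings} (η σ : Spins N) {s c : ℝ}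
    {p : ℝ → EnvPt P N K} {v : EnvPt P N K} {t : ℝ} (hp : HasVel p v t) (hd : den a c ≠ 0) :
    HasDerivAt (fun t => ham a η s c σ (p t))
      (c * spinFld a σ v + ∑ μ, cmean a s c σ (p t) μ * fld a s c σ v μ) t := by
  rw [← hamD_of_vel a η]
  exact hasDerivAt_ham (s := fun _ => s) (c := fun _ => c) a η σ (hasDerivAt_const _ _)
    (hasDerivAt_const _ _) hp hd

lemma hasDerivAt_cmean_of_vel {a : Couplings} (σ : Spins N) {s c : ℝ}
    {p : ℝ → EnvPt P N K} {v : EnvPt P N K} {t : ℝ} (hp : HasVel p v t) (μ : Fin (K - 1)) :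
    HasDerivAt (fun t => cmean a s c σ (p t) μ) (fld a s c σ v μ / den a c) t := by
  have h := (hasDerivAt_fld (s := fun _ => s) (c := fun _ => c) a σ (hasDerivAt_const t s)
    (hasDerivAt_const t c) hp μ).div_const (den a c)
  refine h.congr_deriv ?_
  simp [fldD, fld]

lemma Small.gbdd_cmean {a : Couplings} (ha : Small a P N) {s c : ℝ} (hs : |s| ≤ 1)
    (hc : |c| ≤ 1) (σ : Spins N) (μ : Fin (K - 1)) :
    GBdd (envSize P N K) rate (fun p => cmean a s c σ p μ) :=
  ((ha.gbdd_fld hs hc σ μ).const_mul (den a c)⁻¹).congr fun p => by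
    rw [cmean]; ring

section Sums

variable {a : Couplings} {s c θ : ℝ}

/-- `⟨·⟩` in the interpolating system. -/
abbrev iAvg₀ (a : Couplings) (η : Spins N) (s c θ : ℝ) (g : Spins N → EnvPt P N K → ℝ) : ℝ :=
  avg₀ (law₁ P N K) (lawAux N K) θ (ham a η s c) g

/-- `⟨·⟩₂` in the interpolating system. -/
abbrev iAvg₂ (a : Couplings) (η : Spins N) (s c θ : ℝ)
    (f : Spins N × Spins N → EnvPt P N K → ℝ) : ℝ :=
  avg₂ (law₁ P N K) (lawAux N K) θ (ham a η s c) f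

/-- `⟨·⟩₁` in the interpolating system. -/
abbrev iAvg₁ (a : Couplings) (η : Spins N) (s c θ : ℝ)
    (f : Spins N × Spins N → Lvl₁ P N K × Aux N K × Aux N K → ℝ) : ℝ :=
  avg₁ (law₁ P N K) (lawAux N K) θ (ham a η s c) f

variable (K) in
/-- `⟨∑ X_μ²⟩` for the conditional means `X_μ` of the hidden variables. -/
def hidSq (P : ℕ) (a : Couplings) (η : Spins N) (s c θ : ℝ) : ℝ :=
  iAvg₀ (P := P) (K := K) a η s c θ fun σ p => ∑ μ, cmean a s c σ p μ ^ 2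

/-- The contribution of the noise patterns. -/
lemma Small.sum_noise (ha : Small a P N) (η : Spins N) (hs : |s| ≤ 1) (hc : |c| ≤ 1)
    (hθ0 : 0 < θ) (hθ1 : θ ≤ 1) :
    iAvg₀ (P := P) (K := K) a η s c θ
        (fun σ p => ∑ μ, a.κ * noiseField p.1.1 σ μ * cmean a s c σ p μ) =
      s * a.κ ^ 2 * (N ^ (P / 2) * ((K - 1 : ℕ) / den a c + hidSq K P a η s c θ) +
        (θ - 1) * iAvg₂ (P := P) (K := K) a η s c θ
          (fun t p => spinOv t.1 t.2 ^ (P / 2) * hidOv a s c t.1 t.2 p p) -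
        θ * iAvg₁ (P := P) (K := K) a η s c θ
          (fun t q => spinOv t.1 t.2 ^ (P / 2) * hidOv a s c t.1 t.2 (rep₁ q) (rep₂ q))) := by
  classical
  have hE := ha.env (K := K) η hs hc hθ0 hθ1
  have hd := (ha.den_pos hc).ne'
  set D : Fin (K - 1) × (Fin (P / 2) → Fin N) → Spins N → EnvPt P N K → ℝ :=
    fun j σ p => a.κ * mon σ j.2 * cmean a s c σ p j.1 with hDdef
  have hvel : ∀ (j : Fin (K - 1) × (Fin (P / 2) → Fin N)) (x : Lvl₁ P N K) (y : Aux N K) (t : ℝ),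
      HasVel (fun t => ((Function.update x.1 j t, x.2), y)) ((Pi.single j 1, 0), 0) t :=
    fun j x y t => ⟨fun k => hasDerivAt_update _ _ _ _, fun k => hasDerivAt_const _ _,
      fun k => hasDerivAt_const _ _⟩
  have hfld : ∀ (j : Fin (K - 1) × (Fin (P / 2) → Fin N)) (σ : Spins N) (μ : Fin (K - 1)),
      fld a s c σ ((Pi.single j 1, 0), 0) μ = if μ = j.1 then s * (a.κ * mon σ j.2) else 0 := by
    intro j σ μ
    have : noiseField (Pi.single j 1 : Noise P N K) σ μ = if μ = j.1 then mon σ j.2 else 0 := by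
      unfold noiseField
      split_ifs with h
      · subst h
        rw [Finset.sum_eq_single j.2]
        · simp [mon]
        · intro i _ hi
          rw [Pi.single_eq_of_ne (by intro h; exact hi (congrArg Prod.snd h)), zero_mul]
        · simp
      · refine Finset.sum_eq_zero fun i _ => ?_
        rw [Pi.single_eq_of_ne (by intro h'; exact h (congrArg Prod.fst h')), zero_mul]
    rw [fld, this]
    split_ifs <;> simp [mul_assoc]
  have key := hE.sum_ibp₁ (ι := Fin (K - 1) × (Fin (P / 2) → Fin N))
    (c := fun j x => x.1 j) (u := fun j x t => (Function.update x.1 j t, x.2)) (D := D)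
    (r₀ := s) (DD := a.κ ^ 2 / den a c)
    (fun j => (isGaussCoord_iidGaussian j).fst (fun y => by positivity))
    (fun j σ => (ha.gbdd_cmean hs hc σ j.1).const_mul _)
    (fun j σ x y t => by
      refine (hasDerivAt_ham_of_vel η σ (hvel j x y t) hd).congr_deriv ?_
      simp only [hfld, mul_ite, mul_zero, Finset.sum_ite_eq', Finset.mem_univ, if_true, hDdef]
      simp [spinFld]; ring)
    (fun j σ x y t => by
      refine ((hasDerivAt_cmean_of_vel σ (hvel j x y t) j.1).const_mul (a.κ * mon σ j.2)
        ).congr_deriv ?_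
      rw [hfld, if_pos rfl]
      have := mon_sq σ j.2
      field_simp
      linear_combination s * a.κ ^ 2 * this)
  have hsum : ∀ (σ σ' : Spins N) (p p' : EnvPt P N K), ∑ j, D j σ p * D j σ' p' =
      a.κ ^ 2 * (spinOv σ σ' ^ (P / 2) * hidOv a s c σ σ' p p') := by
    intro σ σ' p p'
    rw [spinOv, ← sum_mon_mul_mon, hidOv, Fintype.sum_prod_type, Finset.sum_comm,
      Finset.sum_mul_sum, Finset.mul_sum]
    refine Finset.sum_congr rfl fun i _ => ?_
    rw [Finset.mul_sum]
    refine Finset.sum_congr rfl fun μ _ => ?_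
    simp only [hDdef]; ring
  have e0 : iAvg₀ (P := P) (K := K) a η s c θ
        (fun σ p => ∑ μ, a.κ * noiseField p.1.1 σ μ * cmean a s c σ p μ) =
      avg₀ (law₁ P N K) (lawAux N K) θ (ham a η s c) (fun σ p => ∑ j, p.1.1 j * D j σ p) := by
    refine kavg_congr fun σ p => ?_
    rw [Fintype.sum_prod_type]
    refine Finset.sum_congr rfl fun μ _ => ?_
    rw [noiseField, Finset.mul_sum, Finset.sum_mul]
    refine Finset.sum_congr rfl fun i _ => ?_
    simp only [hDdef, mon]; ring
  have e1 : avg₀ (law₁ P N K) (lawAux N K) θ (ham a η s c) (fun σ p => ∑ j, D j σ p ^ 2) =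
      a.κ ^ 2 * N ^ (P / 2) * hidSq K P a η s c θ := by
    rw [hidSq, iAvg₀, avg₀, avg₀, ← kavg_const_mul]
    refine kavg_congr fun σ p => ?_
    rw [Fintype.sum_prod_type, Finset.mul_sum]
    refine Finset.sum_congr rfl fun μ _ => ?_
    have : ∀ i : Fin (P / 2) → Fin N, D (μ, i) σ p ^ 2 = a.κ ^ 2 * cmean a s c σ p μ ^ 2 := by
      intro i
      simp only [hDdef]
      rw [mul_pow, mul_pow, mon_sq, mul_one]
    simp only [this, Finset.sum_const, Finset.card_univ, Fintype.card_fun, Fintype.card_fin,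
      nsmul_eq_mul]
    push_cast; ring
  have e2 : avg₂ (law₁ P N K) (lawAux N K) θ (ham a η s c)
      (fun t p => ∑ j, D j t.1 p * D j t.2 p) = a.κ ^ 2 * iAvg₂ (P := P) (K := K) a η s c θ
          (fun t p => spinOv t.1 t.2 ^ (P / 2) * hidOv a s c t.1 t.2 p p) := by
    rw [iAvg₂, avg₂, avg₂, ← kavg_const_mul]
    exact kavg_congr fun t p => hsum _ _ _ _
  have e3 : avg₁ (law₁ P N K) (lawAux N K) θ (ham a η s c)
      (fun t q => ∑ j, D j t.1 (rep₁ q) * D j t.2 (rep₂ q)) =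
        a.κ ^ 2 * iAvg₁ (P := P) (K := K) a η s c θ
          (fun t q => spinOv t.1 t.2 ^ (P / 2) * hidOv a s c t.1 t.2 (rep₁ q) (rep₂ q)) := by
    rw [iAvg₁, avg₁, avg₁, ← kavg_const_mul]
    exact kavg_congr fun t p => hsum _ _ _ _
  rw [e0, key, e1, e2, e3]
  simp only [Fintype.card_prod, Fintype.card_fun, Fintype.card_fin]
  push_cast; ring

/-- The contribution of the first-level fields on the hidden variables. -/
lemma Small.sum_hid₁ (ha : Small a P N) (η : Spins N) (hs : |s| ≤ 1) (hc : |c| ≤ 1)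
    (hθ0 : 0 < θ) (hθ1 : θ ≤ 1) :
    iAvg₀ (P := P) (K := K) a η s c θ
        (fun σ p => ∑ μ, a.A₁ * p.1.2 (Sum.inr μ) * cmean a s c σ p μ) =
      c * a.A₁ ^ 2 * ((K - 1 : ℕ) / den a c + hidSq K P a η s c θ +
        (θ - 1) * iAvg₂ (P := P) (K := K) a η s c θ
          (fun t p => hidOv a s c t.1 t.2 p p) -
        θ * iAvg₁ (P := P) (K := K) a η s c θ
          (fun t q => hidOv a s c t.1 t.2 (rep₁ q) (rep₂ q))) := by
  classical
  have hE := ha.env (K := K) η hs hc hθ0 hθ1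
  have hd := (ha.den_pos hc).ne'
  set D : Fin (K - 1) → Spins N → EnvPt P N K → ℝ :=
    fun μ σ p => a.A₁ * cmean a s c σ p μ with hDdef
  have hvel : ∀ (μ : Fin (K - 1)) (x : Lvl₁ P N K) (y : Aux N K) (t : ℝ),
      HasVel (fun t => ((x.1, Function.update x.2 (Sum.inr μ) t), y))
        ((0, Pi.single (Sum.inr μ) 1), 0) t :=
    fun j x y t => ⟨fun k => hasDerivAt_const _ _, fun k => hasDerivAt_update _ _ _ _,
      fun k => hasDerivAt_const _ _⟩
  have hfld : ∀ (ν : Fin (K - 1)) (σ : Spins N) (μ : Fin (K - 1)),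
      fld (P := P) a s c σ ((0, Pi.single (Sum.inr ν) 1), 0) μ = if μ = ν then c * a.A₁ else 0 := by
    intro ν σ μ
    simp only [fld, noiseField, Pi.zero_apply, zero_mul, Finset.sum_const_zero, mul_zero, zero_add,
      add_zero, Pi.single_apply, Sum.inr.injEq]
    split_ifs <;> simp
  have key := hE.sum_ibp₁ (ι := Fin (K - 1))
    (c := fun μ x => x.2 (Sum.inr μ))
    (u := fun μ x t => (x.1, Function.update x.2 (Sum.inr μ) t)) (D := D)
    (r₀ := c) (DD := a.A₁ ^ 2 / den a c)
    (fun μ => (isGaussCoord_iidGaussian (Sum.inr μ)).snd (fun y => by positivity))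
    (fun μ σ => (ha.gbdd_cmean hs hc σ μ).const_mul _)
    (fun μ σ x y t => by
      refine (hasDerivAt_ham_of_vel η σ (hvel μ x y t) hd).congr_deriv ?_
      simp only [hfld, mul_ite, mul_zero, Finset.sum_ite_eq', Finset.mem_univ, if_true, hDdef]
      simp [spinFld]; ring)
    (fun μ σ x y t => by
      refine ((hasDerivAt_cmean_of_vel σ (hvel μ x y t) μ).const_mul a.A₁).congr_deriv ?_
      rw [hfld, if_pos rfl]
      ring)
  have hsum : ∀ (σ σ' : Spins N) (p p' : EnvPt P N K), ∑ j, D j σ p * D j σ' p' =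
      a.A₁ ^ 2 * hidOv a s c σ σ' p p' := by
    intro σ σ' p p'
    rw [hidOv, Finset.mul_sum]
    refine Finset.sum_congr rfl fun i _ => ?_
    simp only [hDdef]; ring
  have e0 : iAvg₀ (P := P) (K := K) a η s c θ
        (fun σ p => ∑ μ, a.A₁ * p.1.2 (Sum.inr μ) * cmean a s c σ p μ) =
      avg₀ (law₁ P N K) (lawAux N K) θ (ham a η s c)
        (fun σ p => ∑ μ, p.1.2 (Sum.inr μ) * D μ σ p) :=
    kavg_congr fun σ p => Finset.sum_congr rfl fun μ _ => by simp only [hDdef]; ring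
  have e1 : avg₀ (law₁ P N K) (lawAux N K) θ (ham a η s c) (fun σ p => ∑ j, D j σ p ^ 2) =
      a.A₁ ^ 2 * hidSq K P a η s c θ := by
    rw [hidSq, iAvg₀, avg₀, avg₀, ← kavg_const_mul]
    refine kavg_congr fun σ p => ?_
    rw [Finset.mul_sum]
    exact Finset.sum_congr rfl fun μ _ => by simp only [hDdef]; ring
  have e2 : avg₂ (law₁ P N K) (lawAux N K) θ (ham a η s c)
      (fun t p => ∑ j, D j t.1 p * D j t.2 p) = a.A₁ ^ 2 * iAvg₂ (P := P) (K := K) a η s c θ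
          (fun t p => hidOv a s c t.1 t.2 p p) := by
    rw [iAvg₂, avg₂, avg₂, ← kavg_const_mul]
    exact kavg_congr fun t p => hsum _ _ _ _
  have e3 : avg₁ (law₁ P N K) (lawAux N K) θ (ham a η s c)
      (fun t q => ∑ j, D j t.1 (rep₁ q) * D j t.2 (rep₂ q)) =
        a.A₁ ^ 2 * iAvg₁ (P := P) (K := K) a η s c θ
          (fun t q => hidOv a s c t.1 t.2 (rep₁ q) (rep₂ q)) := by
    rw [iAvg₁, avg₁, avg₁, ← kavg_const_mul]
    exact kavg_congr fun t p => hsum _ _ _ _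
  rw [e0, key, e1, e2, e3]
  simp only [Fintype.card_fin]
  ring

/-- The contribution of the second-level fields on the hidden variables. -/
lemma Small.sum_hid₂ (ha : Small a P N) (η : Spins N) (hs : |s| ≤ 1) (hc : |c| ≤ 1)
    (hθ0 : 0 < θ) (hθ1 : θ ≤ 1) :
    iAvg₀ (P := P) (K := K) a η s c θ
        (fun σ p => ∑ μ, a.A₂ * p.2 (Sum.inr μ) * cmean a s c σ p μ) =
      c * a.A₂ ^ 2 * ((K - 1 : ℕ) / den a c + hidSq K P a η s c θ +
        (θ - 1) * iAvg₂ (P := P) (K := K) a η s c θ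
          (fun t p => hidOv a s c t.1 t.2 p p)) := by
  classical
  have hE := ha.env (K := K) η hs hc hθ0 hθ1
  have hd := (ha.den_pos hc).ne'
  set D : Fin (K - 1) → Spins N → EnvPt P N K → ℝ :=
    fun μ σ p => a.A₂ * cmean a s c σ p μ with hDdef
  have hvel : ∀ (μ : Fin (K - 1)) (x : Lvl₁ P N K) (y : Aux N K) (t : ℝ),
      HasVel (fun t => (x, Function.update y (Sum.inr μ) t)) ((0, 0), Pi.single (Sum.inr μ) 1) t :=
    fun j x y t => ⟨fun k => hasDerivAt_const t (x.1 k), fun k => hasDerivAt_const t (x.2 k),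
      fun k => hasDerivAt_update _ _ _ _⟩
  have hfld : ∀ (ν : Fin (K - 1)) (σ : Spins N) (μ : Fin (K - 1)),
      fld (P := P) a s c σ ((0, 0), Pi.single (Sum.inr ν) 1) μ = if μ = ν then c * a.A₂ else 0 := by
    intro ν σ μ
    simp only [fld, noiseField, Pi.zero_apply, zero_mul,
      Finset.sum_const_zero, mul_zero, zero_add, Pi.single_apply, Sum.inr.injEq]
    split_ifs <;> simp
  have key := hE.sum_ibp₂ (ι := Fin (K - 1))
    (c := fun μ y => y (Sum.inr μ))
    (u := fun μ y t => Function.update y (Sum.inr μ) t) (D := D)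
    (r₀ := c) (DD := a.A₂ ^ 2 / den a c)
    (fun μ => isGaussCoord_iidGaussian (Sum.inr μ))
    (fun μ σ => (ha.gbdd_cmean hs hc σ μ).const_mul _)
    (fun μ σ x y t => by
      refine (hasDerivAt_ham_of_vel η σ (hvel μ x y t) hd).congr_deriv ?_
      simp only [hfld, mul_ite, mul_zero, Finset.sum_ite_eq', Finset.mem_univ, if_true, hDdef]
      simp [spinFld]; ring)
    (fun μ σ x y t => by
      refine ((hasDerivAt_cmean_of_vel σ (hvel μ x y t) μ).const_mul a.A₂).congr_deriv ?_
      rw [hfld, if_pos rfl]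
      ring)
  have e0 : iAvg₀ (P := P) (K := K) a η s c θ
        (fun σ p => ∑ μ, a.A₂ * p.2 (Sum.inr μ) * cmean a s c σ p μ) =
      avg₀ (law₁ P N K) (lawAux N K) θ (ham a η s c)
        (fun σ p => ∑ μ, p.2 (Sum.inr μ) * D μ σ p) :=
    kavg_congr fun σ p => Finset.sum_congr rfl fun μ _ => by simp only [hDdef]; ring
  have e1 : avg₀ (law₁ P N K) (lawAux N K) θ (ham a η s c) (fun σ p => ∑ j, D j σ p ^ 2) =
      a.A₂ ^ 2 * hidSq K P a η s c θ := by
    rw [hidSq, iAvg₀, avg₀, avg₀, ← kavg_const_mul]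
    refine kavg_congr fun σ p => ?_
    rw [Finset.mul_sum]
    exact Finset.sum_congr rfl fun μ _ => by simp only [hDdef]; ring
  have e2 : avg₂ (law₁ P N K) (lawAux N K) θ (ham a η s c)
      (fun t p => ∑ j, D j t.1 p * D j t.2 p) = a.A₂ ^ 2 * iAvg₂ (P := P) (K := K) a η s c θ
          (fun t p => hidOv a s c t.1 t.2 p p) := by
    rw [iAvg₂, avg₂, avg₂, ← kavg_const_mul]
    refine kavg_congr fun t p => ?_
    rw [hidOv, Finset.mul_sum]
    exact Finset.sum_congr rfl fun i _ => by simp only [hDdef]; ring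
  rw [e0, key, e1, e2]
  simp only [Fintype.card_fin]
  ring

/-- The contribution of the first-level fields on the spins. -/
lemma Small.sum_spin₁ (ha : Small a P N) (η : Spins N) (hs : |s| ≤ 1) (hc : |c| ≤ 1)
    (hθ0 : 0 < θ) (hθ1 : θ ≤ 1) :
    iAvg₀ (P := P) (K := K) a η s c θ
        (fun σ p => a.B₁ * ∑ i, p.1.2 (Sum.inl i) * val (σ i)) =
      c * a.B₁ ^ 2 * (N + (θ - 1) * iAvg₂ (P := P) (K := K) a η s c θ
          (fun t _ => spinOv t.1 t.2) -
        θ * iAvg₁ (P := P) (K := K) a η s c θ (fun t _ => spinOv t.1 t.2)) := by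
  classical
  have hE := ha.env (K := K) η hs hc hθ0 hθ1
  have hd := (ha.den_pos hc).ne'
  set D : Fin N → Spins N → EnvPt P N K → ℝ := fun i σ p => a.B₁ * val (σ i) with hDdef
  have hvel : ∀ (i : Fin N) (x : Lvl₁ P N K) (y : Aux N K) (t : ℝ),
      HasVel (fun t => ((x.1, Function.update x.2 (Sum.inl i) t), y))
        ((0, Pi.single (Sum.inl i) 1), 0) t :=
    fun j x y t => ⟨fun k => hasDerivAt_const _ _, fun k => hasDerivAt_update _ _ _ _,
      fun k => hasDerivAt_const _ _⟩
  have hfld : ∀ (i : Fin N) (σ : Spins N) (μ : Fin (K - 1)),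
      fld (P := P) a s c σ ((0, Pi.single (Sum.inl i) 1), 0) μ = 0 := by
    intro i σ μ
    simp [fld, noiseField]
  have key := hE.sum_ibp₁ (ι := Fin N)
    (c := fun i x => x.2 (Sum.inl i))
    (u := fun i x t => (x.1, Function.update x.2 (Sum.inl i) t)) (D := D)
    (r₀ := c) (DD := 0)
    (fun μ => (isGaussCoord_iidGaussian (Sum.inl μ)).snd (fun y => by positivity))
    (fun μ σ => (GBdd.const _).mono envSize_nonneg (by norm_num))
    (fun i σ x y t => by
      refine (hasDerivAt_ham_of_vel η σ (hvel i x y t) hd).congr_deriv ?_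
      simp [hfld, hDdef, spinFld, Pi.single_apply])
    (fun μ σ x y t => (hasDerivAt_const _ _).congr_deriv (by ring))
  have hsum : ∀ (σ σ' : Spins N) (p p' : EnvPt P N K), ∑ j, D j σ p * D j σ' p' =
      a.B₁ ^ 2 * spinOv σ σ' := by
    intro σ σ' p p'
    rw [spinOv, Finset.mul_sum]
    refine Finset.sum_congr rfl fun i _ => ?_
    simp only [hDdef]; ring
  have e0 : iAvg₀ (P := P) (K := K) a η s c θ
        (fun σ p => a.B₁ * ∑ i, p.1.2 (Sum.inl i) * val (σ i)) =
      avg₀ (law₁ P N K) (lawAux N K) θ (ham a η s c)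
        (fun σ p => ∑ i, p.1.2 (Sum.inl i) * D i σ p) :=
    kavg_congr fun σ p => by
      rw [Finset.mul_sum]
      exact Finset.sum_congr rfl fun μ _ => by simp only [hDdef]; ring
  have e1 : avg₀ (law₁ P N K) (lawAux N K) θ (ham a η s c) (fun σ p => ∑ j, D j σ p ^ 2) =
      a.B₁ ^ 2 * N := by
    rw [avg₀, ← kavg_const hE.avg₀_one (a.B₁ ^ 2 * N)]
    refine kavg_congr fun σ p => ?_
    simp only [hDdef, mul_pow, val_sq]
    simp [mul_comm]
  have e2 : avg₂ (law₁ P N K) (lawAux N K) θ (ham a η s c)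
      (fun t p => ∑ j, D j t.1 p * D j t.2 p) = a.B₁ ^ 2 * iAvg₂ (P := P) (K := K) a η s c θ
          (fun t p => spinOv t.1 t.2) := by
    rw [iAvg₂, avg₂, avg₂, ← kavg_const_mul]
    exact kavg_congr fun t p => hsum _ _ p p
  have e3 : avg₁ (law₁ P N K) (lawAux N K) θ (ham a η s c)
      (fun t q => ∑ j, D j t.1 (rep₁ q) * D j t.2 (rep₂ q)) =
        a.B₁ ^ 2 * iAvg₁ (P := P) (K := K) a η s c θ (fun t q => spinOv t.1 t.2) := by
    rw [iAvg₁, avg₁, avg₁, ← kavg_const_mul]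
    exact kavg_congr fun t q => hsum _ _ (rep₁ q) (rep₂ q)
  rw [e0, key, e1, e2, e3]
  ring

/-- The contribution of the second-level fields on the spins. -/
lemma Small.sum_spin₂ (ha : Small a P N) (η : Spins N) (hs : |s| ≤ 1) (hc : |c| ≤ 1)
    (hθ0 : 0 < θ) (hθ1 : θ ≤ 1) :
    iAvg₀ (P := P) (K := K) a η s c θ
        (fun σ p => a.B₂ * ∑ i, p.2 (Sum.inl i) * val (σ i)) =
      c * a.B₂ ^ 2 * (N + (θ - 1) * iAvg₂ (P := P) (K := K) a η s c θ
          (fun t _ => spinOv t.1 t.2)) := by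
  classical
  have hE := ha.env (K := K) η hs hc hθ0 hθ1
  have hd := (ha.den_pos hc).ne'
  set D : Fin N → Spins N → EnvPt P N K → ℝ := fun i σ p => a.B₂ * val (σ i) with hDdef
  have hvel : ∀ (i : Fin N) (x : Lvl₁ P N K) (y : Aux N K) (t : ℝ),
      HasVel (fun t => (x, Function.update y (Sum.inl i) t)) ((0, 0), Pi.single (Sum.inl i) 1) t :=
    fun j x y t => ⟨fun k => hasDerivAt_const t (x.1 k), fun k => hasDerivAt_const t (x.2 k),
      fun k => hasDerivAt_update _ _ _ _⟩
  have hfld : ∀ (i : Fin N) (σ : Spins N) (μ : Fin (K - 1)),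
      fld (P := P) a s c σ ((0, 0), Pi.single (Sum.inl i) 1) μ = 0 := by
    intro i σ μ
    simp [fld, noiseField]
  have key := hE.sum_ibp₂ (ι := Fin N)
    (c := fun i y => y (Sum.inl i))
    (u := fun i y t => Function.update y (Sum.inl i) t) (D := D)
    (r₀ := c) (DD := 0)
    (fun μ => isGaussCoord_iidGaussian (Sum.inl μ))
    (fun μ σ => (GBdd.const _).mono envSize_nonneg (by norm_num))
    (fun i σ x y t => by
      refine (hasDerivAt_ham_of_vel η σ (hvel i x y t) hd).congr_deriv ?_
      simp [hfld, hDdef, spinFld, Pi.single_apply])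
    (fun μ σ x y t => (hasDerivAt_const _ _).congr_deriv (by ring))
  have e0 : iAvg₀ (P := P) (K := K) a η s c θ
        (fun σ p => a.B₂ * ∑ i, p.2 (Sum.inl i) * val (σ i)) =
      avg₀ (law₁ P N K) (lawAux N K) θ (ham a η s c)
        (fun σ p => ∑ i, p.2 (Sum.inl i) * D i σ p) :=
    kavg_congr fun σ p => by
      rw [Finset.mul_sum]
      exact Finset.sum_congr rfl fun μ _ => by simp only [hDdef]; ring
  have e1 : avg₀ (law₁ P N K) (lawAux N K) θ (ham a η s c) (fun σ p => ∑ j, D j σ p ^ 2) =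
      a.B₂ ^ 2 * N := by
    rw [avg₀, ← kavg_const hE.avg₀_one (a.B₂ ^ 2 * N)]
    refine kavg_congr fun σ p => ?_
    simp only [hDdef, mul_pow, val_sq]
    simp [mul_comm]
  have e2 : avg₂ (law₁ P N K) (lawAux N K) θ (ham a η s c)
      (fun t p => ∑ j, D j t.1 p * D j t.2 p) = a.B₂ ^ 2 * iAvg₂ (P := P) (K := K) a η s c θ
          (fun t p => spinOv t.1 t.2) := by
    rw [iAvg₂, avg₂, avg₂, ← kavg_const_mul]
    refine kavg_congr fun t p => ?_
    rw [spinOv, Finset.mul_sum]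
    exact Finset.sum_congr rfl fun i _ => by simp only [hDdef]; ring
  rw [e0, key, e1, e2]
  ring

end Sums

/-! ### The derivative along the interpolation -/

section Derivative

variable {P N K : ℕ} {a : Couplings} {s c θ : ℝ}

variable (K) in
/-- `⟨q₁₂^(P/2) ∑ X_μ X'_μ⟩₂` for the unnormalized spin overlap. -/
def ovR₂ (P : ℕ) (a : Couplings) (η : Spins N) (s c θ : ℝ) : ℝ :=
  iAvg₂ (P := P) (K := K) a η s c θ
    fun t p => spinOv t.1 t.2 ^ (P / 2) * hidOv a s c t.1 t.2 p p

variable (K) in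
/-- `⟨q₁₂^(P/2) ∑ X_μ X'_μ⟩₁` for the unnormalized spin overlap. -/
def ovR₁ (P : ℕ) (a : Couplings) (η : Spins N) (s c θ : ℝ) : ℝ :=
  iAvg₁ (P := P) (K := K) a η s c θ
    fun t q => spinOv t.1 t.2 ^ (P / 2) * hidOv a s c t.1 t.2 (rep₁ q) (rep₂ q)

variable (K) in
/-- `⟨∑ X_μ X'_μ⟩₂`. -/
def ovY₂ (P : ℕ) (a : Couplings) (η : Spins N) (s c θ : ℝ) : ℝ :=
  iAvg₂ (P := P) (K := K) a η s c θ fun t p => hidOv a s c t.1 t.2 p p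

variable (K) in
/-- `⟨∑ X_μ X'_μ⟩₁`. -/
def ovY₁ (P : ℕ) (a : Couplings) (η : Spins N) (s c θ : ℝ) : ℝ :=
  iAvg₁ (P := P) (K := K) a η s c θ fun t q => hidOv a s c t.1 t.2 (rep₁ q) (rep₂ q)

variable (K) in
/-- `⟨∑ σ_i σ'_i⟩₂`. -/
def ovS₂ (P : ℕ) (a : Couplings) (η : Spins N) (s c θ : ℝ) : ℝ :=
  iAvg₂ (P := P) (K := K) a η s c θ fun t _ => spinOv t.1 t.2

variable (K) in
/-- `⟨∑ σ_i σ'_i⟩₁`. -/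
def ovS₁ (P : ℕ) (a : Couplings) (η : Spins N) (s c θ : ℝ) : ℝ :=
  iAvg₁ (P := P) (K := K) a η s c θ fun t _ => spinOv t.1 t.2

lemma Small.gbdd_sum_cmean_sq (ha : Small a P N) (hs : |s| ≤ 1) (hc : |c| ≤ 1) (σ : Spins N) :
    GBdd (envSize P N K) (rate + rate) (fun p => ∑ μ, cmean a s c σ p μ ^ 2) :=
  GBdd.sum _ envSize_nonneg (by norm_num) fun μ =>
    ((ha.gbdd_cmean hs hc σ μ).mul (ha.gbdd_cmean hs hc σ μ)).congr fun _ => (sq _).symm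

lemma gbdd_coord (j : Fin (K - 1) × (Fin (P / 2) → Fin N)) :
    GBdd (envSize P N K) rate (fun p => p.1.1 j) :=
  GBdd.of_affine envSize_nonneg (by fun_prop) zero_le_one zero_le_one fun p => by
    have h2 := Finset.single_le_sum (f := fun j => p.1.1 j ^ 2) (fun _ _ => sq_nonneg _)
      (Finset.mem_univ j)
    have h3 : (0 : ℝ) ≤ ∑ i, p.1.2 i ^ 2 := Finset.sum_nonneg fun _ _ => sq_nonneg _
    have h4 : (0 : ℝ) ≤ ∑ i, p.2 i ^ 2 := Finset.sum_nonneg fun _ _ => sq_nonneg _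
    rw [envSize_eq]
    nlinarith [sq_abs (p.1.1 j), sq_nonneg (|p.1.1 j| - 1)]

lemma gbdd_aux₁ (j : Fin N ⊕ Fin (K - 1)) :
    GBdd (envSize P N K) rate (fun p => p.1.2 j) :=
  GBdd.of_affine envSize_nonneg (by fun_prop) zero_le_one zero_le_one fun p => by
    have h2 := Finset.single_le_sum (f := fun j => p.1.2 j ^ 2) (fun _ _ => sq_nonneg _)
      (Finset.mem_univ j)
    have h3 : (0 : ℝ) ≤ ∑ i, p.1.1 i ^ 2 := Finset.sum_nonneg fun _ _ => sq_nonneg _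
    have h4 : (0 : ℝ) ≤ ∑ i, p.2 i ^ 2 := Finset.sum_nonneg fun _ _ => sq_nonneg _
    rw [envSize_eq]
    nlinarith [sq_abs (p.1.2 j), sq_nonneg (|p.1.2 j| - 1)]

lemma gbdd_aux₂ (j : Fin N ⊕ Fin (K - 1)) :
    GBdd (envSize P N K) rate (fun p => p.2 j) :=
  GBdd.of_affine envSize_nonneg (by fun_prop) zero_le_one zero_le_one fun p => by
    have h2 := Finset.single_le_sum (f := fun j => p.2 j ^ 2) (fun _ _ => sq_nonneg _)
      (Finset.mem_univ j)
    have h3 : (0 : ℝ) ≤ ∑ i, p.1.1 i ^ 2 := Finset.sum_nonneg fun _ _ => sq_nonneg _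
    have h4 : (0 : ℝ) ≤ ∑ i, p.1.2 i ^ 2 := Finset.sum_nonneg fun _ _ => sq_nonneg _
    rw [envSize_eq]
    nlinarith [sq_abs (p.2 j), sq_nonneg (|p.2 j| - 1)]

lemma gbdd_noiseField (σ : Spins N) (μ : Fin (K - 1)) :
    GBdd (envSize P N K) rate (fun p => noiseField p.1.1 σ μ) :=
  GBdd.sum _ envSize_nonneg (by norm_num) fun i =>
    ((gbdd_coord (μ, i)).const_mul (∏ k, val (σ (i k)))).congr fun _ => mul_comm _ _

/-- The three observables coupling the fields to the conditional means of the hidden variables. -/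
lemma Small.int_noise (ha : Small a P N) (η : Spins N) (hs : |s| ≤ 1) (hc : |c| ≤ 1)
    (hθ0 : 0 < θ) (hθ1 : θ ≤ 1) :
    KInt ((law₁ P N K).prod (lawAux N K)) (ker₀ (lawAux N K) θ (ham a η s c))
        (fun σ p => ∑ μ, a.κ * noiseField p.1.1 σ μ * cmean a s c σ p μ) ∧
      KInt ((law₁ P N K).prod (lawAux N K)) (ker₀ (lawAux N K) θ (ham a η s c))
        (fun σ p => ∑ μ, a.A₁ * p.1.2 (Sum.inr μ) * cmean a s c σ p μ) ∧
      KInt ((law₁ P N K).prod (lawAux N K)) (ker₀ (lawAux N K) θ (ham a η s c))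
        (fun σ p => ∑ μ, a.A₂ * p.2 (Sum.inr μ) * cmean a s c σ p μ) := by
  have hE := ha.env (K := K) η hs hc hθ0 hθ1
  refine ⟨hE.int₀ (δ := rate + rate) (by norm_num) fun σ => ?_,
    hE.int₀ (δ := rate + rate) (by norm_num) fun σ => ?_,
    hE.int₀ (δ := rate + rate) (by norm_num) fun σ => ?_⟩ <;>
  refine GBdd.sum _ envSize_nonneg (by norm_num) fun μ => ?_
  · exact ((gbdd_noiseField σ μ).const_mul a.κ).mul (ha.gbdd_cmean hs hc σ μ)
  · exact ((gbdd_aux₁ (Sum.inr μ)).const_mul a.A₁).mul (ha.gbdd_cmean hs hc σ μ)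
  · exact ((gbdd_aux₂ (Sum.inr μ)).const_mul a.A₂).mul (ha.gbdd_cmean hs hc σ μ)

/-- The fields are `den` times the conditional means; hence `⟨∑ X_μ²⟩` is expressed by the sums
which are computed by integration by parts. -/
lemma Small.den_mul_hidSq (ha : Small a P N) (η : Spins N) (hs : |s| ≤ 1) (hc : |c| ≤ 1)
    (hθ0 : 0 < θ) (hθ1 : θ ≤ 1) :
    den a c * hidSq K P a η s c θ =
      s ^ 2 * a.κ ^ 2 * (N ^ (P / 2) * ((K - 1 : ℕ) / den a c + hidSq K P a η s c θ) +
        (θ - 1) * ovR₂ K P a η s c θ - θ * ovR₁ K P a η s c θ) +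
      c ^ 2 * (a.A₁ ^ 2 * ((K - 1 : ℕ) / den a c + hidSq K P a η s c θ +
        (θ - 1) * ovY₂ K P a η s c θ - θ * ovY₁ K P a η s c θ) +
        a.A₂ ^ 2 * ((K - 1 : ℕ) / den a c + hidSq K P a η s c θ +
        (θ - 1) * ovY₂ K P a η s c θ)) := by
  have hd := (ha.den_pos hc).ne'
  obtain ⟨i1, i2, i3⟩ := ha.int_noise (K := K) η hs hc hθ0 hθ1
  have n1 := ha.sum_noise (K := K) η hs hc hθ0 hθ1
  have n2 := ha.sum_hid₁ (K := K) η hs hc hθ0 hθ1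
  have n3 := ha.sum_hid₂ (K := K) η hs hc hθ0 hθ1
  have key : den a c * hidSq K P a η s c θ = s * iAvg₀ (P := P) (K := K) a η s c θ
        (fun σ p => ∑ μ, a.κ * noiseField p.1.1 σ μ * cmean a s c σ p μ) +
      (c * iAvg₀ (P := P) (K := K) a η s c θ
        (fun σ p => ∑ μ, a.A₁ * p.1.2 (Sum.inr μ) * cmean a s c σ p μ) +
      c * iAvg₀ (P := P) (K := K) a η s c θ
        (fun σ p => ∑ μ, a.A₂ * p.2 (Sum.inr μ) * cmean a s c σ p μ)) := by
    rw [hidSq, iAvg₀, iAvg₀, iAvg₀, iAvg₀, avg₀, avg₀, avg₀, avg₀, ← kavg_const_mul,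
      ← kavg_const_mul, ← kavg_const_mul, ← kavg_const_mul,
      ← kavg_add (i2.const_mul c) (i3.const_mul c),
      ← kavg_add (i1.const_mul s) ((i2.const_mul c).add (i3.const_mul c))]
    refine kavg_congr fun σ p => ?_
    simp only [Finset.mul_sum]
    rw [← Finset.sum_add_distrib, ← Finset.sum_add_distrib]
    refine Finset.sum_congr rfl fun μ _ => ?_
    have : den a c * cmean a s c σ p μ ^ 2 = fld a s c σ p μ * cmean a s c σ p μ := by
      rw [cmean]; field_simp
    rw [this, fld]
    ring
  rw [key, n1, n2, n3, ovR₂, ovR₁, ovY₂, ovY₁]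
  ring

lemma abs_spinOv_le (σ σ' : Spins N) : |spinOv σ σ'| ≤ N := abs_sum_val_le σ σ'

lemma abs_hidOv_le (σ σ' : Spins N) (p p' : EnvPt P N K) :
    |hidOv a s c σ σ' p p'| ≤ 1 / 2 * ∑ μ, cmean a s c σ p μ ^ 2 +
      1 / 2 * ∑ μ, cmean a s c σ' p' μ ^ 2 := by
  rw [hidOv, Finset.mul_sum, Finset.mul_sum, ← Finset.sum_add_distrib]
  refine (Finset.abs_sum_le_sum_abs _ _).trans (Finset.sum_le_sum fun μ _ => ?_)
  rw [abs_mul, ← sq_abs (cmean a s c σ p μ), ← sq_abs (cmean a s c σ' p' μ)]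
  nlinarith [sq_nonneg (|cmean a s c σ p μ| - |cmean a s c σ' p' μ|)]

lemma Small.gbdd_hidOv (ha : Small a P N) (hs : |s| ≤ 1) (hc : |c| ≤ 1) (t : Spins N × Spins N) :
    GBdd (envSize P N K) (rate + rate) (fun p => hidOv a s c t.1 t.2 p p) :=
  GBdd.sum _ envSize_nonneg (by norm_num) fun μ =>
    (ha.gbdd_cmean hs hc t.1 μ).mul (ha.gbdd_cmean hs hc t.2 μ)

lemma Small.gbdd_hidOv' (ha : Small a P N) (hs : |s| ≤ 1) (hc : |c| ≤ 1) (t : Spins N × Spins N) :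
    GBdd (tripleSize (size₁ P N K) (sqSize (ι := Fin N ⊕ Fin (K - 1)))) (rate + rate)
      (fun q => hidOv a s c t.1 t.2 (rep₁ q) (rep₂ q)) :=
  GBdd.sum _ (isSize_size₁.prod (isSize_sqSize.prod isSize_sqSize)).nonneg (by norm_num) fun μ =>
    ((ha.gbdd_cmean hs hc t.1 μ).rep₁ isSize_sqSize.nonneg (by norm_num)).mul
      ((ha.gbdd_cmean hs hc t.2 μ).rep₂ isSize_sqSize.nonneg (by norm_num))

/-- A two-replica observable `w · ∑ X_μ X'_μ` with `|w| ≤ B` has `⟨·⟩₂` at most `B ⟨∑ X_μ²⟩`. -/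
lemma Small.abs_avg₂_hidOv_le (ha : Small a P N) (η : Spins N) (hs : |s| ≤ 1) (hc : |c| ≤ 1)
    (hθ0 : 0 < θ) (hθ1 : θ ≤ 1) {w : Spins N × Spins N → ℝ} {B : ℝ} (hw : ∀ t, |w t| ≤ B) :
    |iAvg₂ (P := P) (K := K) a η s c θ (fun t p => w t * hidOv a s c t.1 t.2 p p)| ≤
      B * hidSq K P a η s c θ := by
  have hE := ha.env (K := K) η hs hc hθ0 hθ1
  have g1 := fun σ => ha.gbdd_sum_cmean_sq (K := K) hs hc σ
  have i1 := hE.int₂ (by norm_num) (f := fun t p => 1 / 2 * ∑ μ, cmean a s c t.1 p μ ^ 2)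
    fun t => (g1 t.1).const_mul _
  have i2 := hE.int₂ (by norm_num) (f := fun t p => 1 / 2 * ∑ μ, cmean a s c t.2 p μ ^ 2)
    fun t => (g1 t.2).const_mul _
  have m1 := hE.avg₂_fst (by norm_num) (f := fun σ p => 1 / 2 * ∑ μ, cmean a s c σ p μ ^ 2)
    fun σ => (g1 σ).const_mul _
  have m2 := hE.avg₂_snd (by norm_num) (f := fun σ p => 1 / 2 * ∑ μ, cmean a s c σ p μ ^ 2)
    fun σ => (g1 σ).const_mul _
  have h0 : avg₀ (law₁ P N K) (lawAux N K) θ (ham a η s c)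
      (fun σ p => 1 / 2 * ∑ μ, cmean a s c σ p μ ^ 2) = 1 / 2 * hidSq K P a η s c θ := by
    rw [hidSq, iAvg₀, avg₀, avg₀, kavg_const_mul]
  have h1 := abs_kavg_le ker₂_nonneg
    (hE.int₂ (by norm_num) (f := fun t p => w t * hidOv a s c t.1 t.2 p p)
      fun t => (ha.gbdd_hidOv hs hc t).const_mul _) ((i1.add i2).const_mul B) fun t p => by
        rw [abs_mul]
        exact mul_le_mul (hw t) (abs_hidOv_le t.1 t.2 p p) (abs_nonneg _)
          ((abs_nonneg _).trans (hw t))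
  rw [kavg_const_mul, kavg_add i1 i2] at h1
  refine h1.trans (le_of_eq ?_)
  rw [avg₂] at m1 m2
  rw [m1, m2, h0]
  ring

/-- A two-replica observable `w · ∑ X_μ X'_μ` with `|w| ≤ B` has `⟨·⟩₁` at most `B ⟨∑ X_μ²⟩`. -/
lemma Small.abs_avg₁_hidOv_le (ha : Small a P N) (η : Spins N) (hs : |s| ≤ 1) (hc : |c| ≤ 1)
    (hθ0 : 0 < θ) (hθ1 : θ ≤ 1) {w : Spins N × Spins N → ℝ} {B : ℝ} (hw : ∀ t, |w t| ≤ B) :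
    |iAvg₁ (P := P) (K := K) a η s c θ
        (fun t q => w t * hidOv a s c t.1 t.2 (rep₁ q) (rep₂ q))| ≤
      B * hidSq K P a η s c θ := by
  have hE := ha.env (K := K) η hs hc hθ0 hθ1
  have g1 := fun σ => ha.gbdd_sum_cmean_sq (K := K) hs hc σ
  have i1 := hE.int₁ (by norm_num) (f := fun t q => 1 / 2 * ∑ μ, cmean a s c t.1 (rep₁ q) μ ^ 2)
    fun t => ((g1 t.1).const_mul _).rep₁ isSize_sqSize.nonneg (by norm_num)
  have i2 := hE.int₁ (by norm_num) (f := fun t q => 1 / 2 * ∑ μ, cmean a s c t.2 (rep₂ q) μ ^ 2)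
    fun t => ((g1 t.2).const_mul _).rep₂ isSize_sqSize.nonneg (by norm_num)
  have m1 := hE.avg₁_fst (by norm_num) (by norm_num)
    (f := fun σ p => 1 / 2 * ∑ μ, cmean a s c σ p μ ^ 2) fun σ => (g1 σ).const_mul _
  have m2 := hE.avg₁_snd (by norm_num) (by norm_num)
    (f := fun σ p => 1 / 2 * ∑ μ, cmean a s c σ p μ ^ 2) fun σ => (g1 σ).const_mul _
  have h0 : avg₀ (law₁ P N K) (lawAux N K) θ (ham a η s c)
      (fun σ p => 1 / 2 * ∑ μ, cmean a s c σ p μ ^ 2) = 1 / 2 * hidSq K P a η s c θ := by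
    rw [hidSq, iAvg₀, avg₀, avg₀, kavg_const_mul]
  have h1 := abs_kavg_le ker₁_nonneg
    (hE.int₁ (by norm_num) (f := fun t q => w t * hidOv a s c t.1 t.2 (rep₁ q) (rep₂ q))
      fun t => (ha.gbdd_hidOv' hs hc t).const_mul _) ((i1.add i2).const_mul B) fun t q => by
        rw [abs_mul]
        exact mul_le_mul (hw t) (abs_hidOv_le t.1 t.2 (rep₁ q) (rep₂ q)) (abs_nonneg _)
          ((abs_nonneg _).trans (hw t))
  rw [kavg_const_mul, kavg_add i1 i2] at h1
  refine h1.trans (le_of_eq ?_)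
  rw [avg₁] at m1 m2
  rw [m1, m2, h0]
  ring

lemma hidSq_nonneg (η : Spins N) : 0 ≤ hidSq K P a η s c θ :=
  kavg_nonneg ker₀_nonneg fun _ _ => Finset.sum_nonneg fun _ _ => sq_nonneg _

lemma Small.abs_ovY₂_le (ha : Small a P N) (η : Spins N) (hs : |s| ≤ 1) (hc : |c| ≤ 1)
    (hθ0 : 0 < θ) (hθ1 : θ ≤ 1) : |ovY₂ K P a η s c θ| ≤ hidSq K P a η s c θ := by
  have := ha.abs_avg₂_hidOv_le (K := K) η hs hc hθ0 hθ1 (w := fun _ => 1) (B := 1) (by simp)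
  simpa [ovY₂] using this

lemma Small.abs_ovY₁_le (ha : Small a P N) (η : Spins N) (hs : |s| ≤ 1) (hc : |c| ≤ 1)
    (hθ0 : 0 < θ) (hθ1 : θ ≤ 1) : |ovY₁ K P a η s c θ| ≤ hidSq K P a η s c θ := by
  have := ha.abs_avg₁_hidOv_le (K := K) η hs hc hθ0 hθ1 (w := fun _ => 1) (B := 1) (by simp)
  simpa [ovY₁] using this

lemma abs_spinOv_pow_le (t : Spins N × Spins N) (k : ℕ) : |spinOv t.1 t.2 ^ k| ≤ (N : ℝ) ^ k := by
  rw [abs_pow]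
  exact pow_le_pow_left₀ (abs_nonneg _) (abs_spinOv_le _ _) _

/-- Smallness of the squared conditional means of the hidden variables. -/
lemma Small.hidSq_le (ha : Small a P N) (η : Spins N) (hs : |s| ≤ 1) (hc : |c| ≤ 1)
    (hθ0 : 0 < θ) (hθ1 : θ ≤ 1) {e : ℝ}
    (he : s ^ 2 * (a.κ ^ 2 * N ^ (P / 2)) + c ^ 2 * (a.A₁ ^ 2 + a.A₂ ^ 2) ≤ e) (he' : e ≤ 1 / 50) :
    hidSq K P a η s c θ ≤ 5 * e * (K - 1 : ℕ) := by
  have key := ha.den_mul_hidSq (K := K) η hs hc hθ0 hθ1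
  have hS := hidSq_nonneg (K := K) (P := P) (a := a) (s := s) (c := c) (θ := θ) η
  have y2 := abs_le.1 (ha.abs_ovY₂_le (K := K) η hs hc hθ0 hθ1)
  have y1 := abs_le.1 (ha.abs_ovY₁_le (K := K) η hs hc hθ0 hθ1)
  have r2 : |ovR₂ K P a η s c θ| ≤ N ^ (P / 2) * hidSq K P a η s c θ :=
    (ha.abs_avg₂_hidOv_le (K := K) η hs hc hθ0 hθ1 (w := fun t => spinOv t.1 t.2 ^ (P / 2)) fun t => abs_spinOv_pow_le t _)
  have r1 : |ovR₁ K P a η s c θ| ≤ N ^ (P / 2) * hidSq K P a η s c θ :=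
    (ha.abs_avg₁_hidOv_le (K := K) η hs hc hθ0 hθ1 (w := fun t => spinOv t.1 t.2 ^ (P / 2)) fun t => abs_spinOv_pow_le t _)
  replace r2 := abs_le.1 r2
  replace r1 := abs_le.1 r1
  have hd := ha.den_bounds hc
  have hn0 : (0 : ℝ) ≤ (K - 1 : ℕ) := Nat.cast_nonneg _
  have hM0 : (0 : ℝ) ≤ (N : ℝ) ^ (P / 2) := by positivity
  generalize hidSq K P a η s c θ = S at *
  generalize ovR₂ K P a η s c θ = R₂ at *
  generalize ovR₁ K P a η s c θ = R₁ at *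
  generalize ovY₂ K P a η s c θ = Y₂ at *
  generalize ovY₁ K P a η s c θ = Y₁ at *
  generalize den a c = d at *
  generalize ((K - 1 : ℕ) : ℝ) = n at *
  generalize (N : ℝ) ^ (P / 2) = M at *
  have hnd : n / d ≤ 2 * n := by
    rw [div_le_iff₀ (by linarith)]
    nlinarith
  -- Since `|R_b| ≤ M S`, `|Y_b| ≤ S` and the weights `1 - θ`, `θ` sum to one, each bracket costs at
  -- most one further `S`.
  have u1 : M * (n / d + S) + (θ - 1) * R₂ - θ * R₁ ≤ M * (n / d + 2 * S) := by
    linarith [mul_nonneg (sub_nonneg.2 hθ1) (by linarith [r2.1] : 0 ≤ R₂ + M * S),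
      mul_nonneg hθ0.le (by linarith [r1.1] : 0 ≤ R₁ + M * S)]
  have u2 : n / d + S + (θ - 1) * Y₂ - θ * Y₁ ≤ n / d + 2 * S := by
    linarith [mul_nonneg (sub_nonneg.2 hθ1) (by linarith [y2.1] : 0 ≤ Y₂ + S),
      mul_nonneg hθ0.le (by linarith [y1.1] : 0 ≤ Y₁ + S)]
  have u3 : n / d + S + (θ - 1) * Y₂ ≤ n / d + 2 * S := by
    linarith [mul_nonneg (sub_nonneg.2 hθ1) (by linarith [y2.1] : 0 ≤ Y₂ + S),
      mul_nonneg hθ0.le hS]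
  have v : d * S ≤ e * (2 * n + 2 * S) := by
    have hx : 0 ≤ n / d + 2 * S := by
      have : 0 ≤ n / d := div_nonneg hn0 (by linarith)
      linarith
    calc d * S ≤ s ^ 2 * a.κ ^ 2 * (M * (n / d + 2 * S)) +
          c ^ 2 * (a.A₁ ^ 2 * (n / d + 2 * S) + a.A₂ ^ 2 * (n / d + 2 * S)) := by
          rw [key]; gcongr
      _ = (s ^ 2 * (a.κ ^ 2 * M) + c ^ 2 * (a.A₁ ^ 2 + a.A₂ ^ 2)) * (n / d + 2 * S) := by ring
      _ ≤ e * (n / d + 2 * S) := mul_le_mul_of_nonneg_right he hx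
      _ ≤ e * (2 * n + 2 * S) := by
          refine mul_le_mul_of_nonneg_left (by linarith) (le_trans ?_ he)
          positivity
  have he0 : 0 ≤ e := le_trans (by positivity) he
  -- As `d ≥ 1 / 2` and `e ≤ 1 / 50`, the term `2 e S` on the right is absorbed into `d S`.
  linarith [mul_nonneg (by linarith : (0 : ℝ) ≤ d - 1 / 2) hS,
    mul_nonneg (by linarith : (0 : ℝ) ≤ 1 / 50 - e) hS, mul_nonneg he0 hn0]

lemma gbdd_spinSum₁ (a : Couplings) (σ : Spins N) :
    GBdd (envSize P N K) rate (fun p => a.B₁ * ∑ i, p.1.2 (Sum.inl i) * val (σ i)) :=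
  (GBdd.sum _ envSize_nonneg (by norm_num) fun i =>
    ((gbdd_aux₁ (Sum.inl i)).const_mul (val (σ i))).congr fun _ => mul_comm _ _).const_mul _

lemma gbdd_spinSum₂ (a : Couplings) (σ : Spins N) :
    GBdd (envSize P N K) rate (fun p => a.B₂ * ∑ i, p.2 (Sum.inl i) * val (σ i)) :=
  (GBdd.sum _ envSize_nonneg (by norm_num) fun i =>
    ((gbdd_aux₂ (Sum.inl i)).const_mul (val (σ i))).congr fun _ => mul_comm _ _).const_mul _

/-- The average of the derivative of the Hamiltonian along `s = sin φ`, `c = cos φ`, after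
integration by parts. -/
lemma Small.avg_hamD (ha : Small a P N) (η : Spins N) (hs : |s| ≤ 1) (hc : |c| ≤ 1)
    (hθ0 : 0 < θ) (hθ1 : θ ≤ 1) :
    iAvg₀ (P := P) (K := K) a η s c θ (fun σ p => hamD a η s c c (-s) σ p 0) =
      s * c * (2 * a.b₁ * iAvg₀ (P := P) (K := K) a η s c θ (fun σ _ => magnetization η σ ^ P)
        - 2 * a.b₂ * iAvg₀ (P := P) (K := K) a η s c θ (fun σ _ => magnetization η σ)
        + a.κ ^ 2 * ((θ - 1) * ovR₂ K P a η s c θ - θ * ovR₁ K P a η s c θ)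
        - a.A₁ ^ 2 * ((θ - 1) * ovY₂ K P a η s c θ - θ * ovY₁ K P a η s c θ)
        - a.A₂ ^ 2 * ((θ - 1) * ovY₂ K P a η s c θ)
        - a.B₁ ^ 2 * (N + (θ - 1) * ovS₂ K P a η s c θ - θ * ovS₁ K P a η s c θ)
        - a.B₂ ^ 2 * (N + (θ - 1) * ovS₂ K P a η s c θ)
        + (a.κ ^ 2 * N ^ (P / 2) - a.A₁ ^ 2 - a.A₂ ^ 2 - a.C) *
          ((K - 1 : ℕ) / den a c + hidSq K P a η s c θ)) := by
  have hE := ha.env (K := K) η hs hc hθ0 hθ1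
  have hd := (ha.den_pos hc).ne'
  obtain ⟨i1, i2, i3⟩ := ha.int_noise (K := K) η hs hc hθ0 hθ1
  have n1 := ha.sum_noise (K := K) η hs hc hθ0 hθ1
  have n2 := ha.sum_hid₁ (K := K) η hs hc hθ0 hθ1
  have n3 := ha.sum_hid₂ (K := K) η hs hc hθ0 hθ1
  have n4 := ha.sum_spin₁ (K := K) η hs hc hθ0 hθ1
  have n5 := ha.sum_spin₂ (K := K) η hs hc hθ0 hθ1
  have i4 := hE.int₀ (by norm_num) (fun σ => gbdd_spinSum₁ (P := P) (K := K) a σ)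
  have i5 := hE.int₀ (by norm_num) (fun σ => gbdd_spinSum₂ (P := P) (K := K) a σ)
  have i6 := hE.int₀ (δ := 0) (by norm_num) (f := fun σ _ => magnetization η σ ^ P)
    fun σ => GBdd.const _
  have i7 := hE.int₀ (δ := 0) (by norm_num) (f := fun σ _ => magnetization η σ)
    fun σ => GBdd.const _
  have i8 := hE.int₀ (by norm_num) fun σ => ha.gbdd_sum_cmean_sq (K := K) hs hc σ
  have i9 := hE.int₀ (δ := 0) (by norm_num)
    (f := fun _ _ => s * c * (-a.C) * ((K - 1 : ℕ) / den a c))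
    fun σ => GBdd.const _
  have c9 := kavg_const hE.avg₀_one (s * c * (-a.C) * ((K - 1 : ℕ) / den a c))
  have e1 : ∀ σ (p : EnvPt P N K), hamD a η s c c (-s) σ p 0 =
      (2 * s * c * a.b₁) * magnetization η σ ^ P + (-(2 * s * c * a.b₂)) * magnetization η σ +
      (-s) * (a.B₁ * ∑ i, p.1.2 (Sum.inl i) * val (σ i)) +
      (-s) * (a.B₂ * ∑ i, p.2 (Sum.inl i) * val (σ i)) +
      c * (∑ μ, a.κ * noiseField p.1.1 σ μ * cmean a s c σ p μ) +
      (-s) * (∑ μ, a.A₁ * p.1.2 (Sum.inr μ) * cmean a s c σ p μ) +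
      (-s) * (∑ μ, a.A₂ * p.2 (Sum.inr μ) * cmean a s c σ p μ) +
      (s * c * (-a.C)) * (∑ μ, cmean a s c σ p μ ^ 2) +
      s * c * (-a.C) * ((K - 1 : ℕ) / den a c) := by
    intro σ p
    have z1 : spinFld a σ (0 : EnvPt P N K) = 0 := by simp [spinFld]
    have z2 : ∀ μ, fld a s c σ (0 : EnvPt P N K) μ = 0 := fun μ => by simp [fld, noiseField]
    -- The fields enter through `X_μ = fld / den`, linearly in each Gaussian coordinate.
    have z3 : (∑ μ, fld a s c σ p μ * fldD a s c c (-s) σ p 0 μ) / den a c =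
        c * (∑ μ, a.κ * noiseField p.1.1 σ μ * cmean a s c σ p μ) +
      (-s) * (∑ μ, a.A₁ * p.1.2 (Sum.inr μ) * cmean a s c σ p μ) +
      (-s) * (∑ μ, a.A₂ * p.2 (Sum.inr μ) * cmean a s c σ p μ) := by
      simp only [Finset.mul_sum]
      rw [← Finset.sum_add_distrib, ← Finset.sum_add_distrib, Finset.sum_div]
      refine Finset.sum_congr rfl fun μ _ => ?_
      rw [fldD, z2, add_zero, mul_div_right_comm, ← cmean, fld]
      ring
    have z4 : (∑ μ, fld a s c σ p μ ^ 2) / den a c ^ 2 = ∑ μ, cmean a s c σ p μ ^ 2 := by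
      rw [Finset.sum_div]
      exact Finset.sum_congr rfl fun μ _ => by rw [cmean, div_pow]
    rw [hamD, z1, z3, z4, spinFld]
    ring
  rw [iAvg₀, avg₀, kavg_congr e1]
  have j1 := (i6.const_mul (2 * s * c * a.b₁)).add (i7.const_mul (-(2 * s * c * a.b₂)))
  have j2 := j1.add (i4.const_mul (-s))
  have j3 := j2.add (i5.const_mul (-s))
  have j4 := j3.add (i1.const_mul c)
  have j5 := j4.add (i2.const_mul (-s))
  have j6 := j5.add (i3.const_mul (-s))
  have j7 := j6.add (i8.const_mul (s * c * (-a.C)))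
  rw [kavg_add j7 i9, kavg_add j6 (i8.const_mul _), kavg_add j5 (i3.const_mul _),
    kavg_add j4 (i2.const_mul _), kavg_add j3 (i1.const_mul _), kavg_add j2 (i5.const_mul _),
    kavg_add j1 (i4.const_mul _), kavg_add (i6.const_mul _) (i7.const_mul _), c9]
  rw [kavg_const_mul (2 * s * c * a.b₁), kavg_const_mul (-(2 * s * c * a.b₂)), kavg_const_mul (-s),
    kavg_const_mul (-s), kavg_const_mul c, kavg_const_mul (-s), kavg_const_mul (-s),
    kavg_const_mul (s * c * (-a.C))]
  rw [iAvg₀, avg₀] at n1 n2 n3 n4 n5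
  rw [n1, n2, n3, n4, n5, hidSq, ovR₁, ovR₂, ovY₁, ovY₂, ovS₁, ovS₂, iAvg₀, iAvg₀, iAvg₀, avg₀,
    avg₀, avg₀]
  ring

end Derivative

/-! ### The overlaps of the hidden variables at the beginning of the interpolation -/

section Start

variable {P N K : ℕ} {a : Couplings} {θ : ℝ}

lemma cmean_start (σ σ' : Spins N) (p : EnvPt P N K) (μ : Fin (K - 1)) :
    cmean a 0 1 σ p μ = cmean a 0 1 σ' p μ := by
  simp [cmean, fld]

lemma hidSq_start (ha : Small a P N) (η : Spins N) (hθ0 : 0 < θ) (hθ1 : θ ≤ 1) :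
    hidSq K P a η 0 1 θ = ovY₂ K P a η 0 1 θ := by
  have hE := ha.env (K := K) (s := 0) (c := 1) η (by simp) (by simp) hθ0 hθ1
  have h1 := hE.avg₂_fst (by norm_num)
    (fun σ => ha.gbdd_sum_cmean_sq (K := K) (s := 0) (c := 1) (by simp) (by simp) σ)
  rw [hidSq, iAvg₀, ← h1, ovY₂, iAvg₂, avg₂, avg₂]
  refine kavg_congr fun t p => Finset.sum_congr rfl fun μ _ => ?_
  rw [cmean_start t.2 t.1, sq]

/-- At the beginning the hidden variables decouple from the spins: `⟨X_μ⟩` given the first level is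
`A₁ J_μ / (den - θ A₂²)`. -/
lemma Small.ovY₁_start (ha : Small a P N) (η : Spins N) (hθ0 : 0 < θ) (hθ1 : θ ≤ 1) :
    ovY₁ K P a η 0 1 θ = (K - 1 : ℕ) * a.A₁ ^ 2 / (1 - a.C - θ * a.A₂ ^ 2) ^ 2 := by
  classical
  have hs : |(0 : ℝ)| ≤ 1 := by simp
  have hc : |(1 : ℝ)| ≤ 1 := by simp
  have hE := ha.env (K := K) (s := 0) (c := 1) η hs hc hθ0 hθ1
  have hd : den a 1 = 1 - a.C := by simp [den]
  have hd0 := ha.den_bounds hc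
  have hD : 0 < 1 - a.C - θ * a.A₂ ^ 2 := by
    have := ha.A₂_le
    nlinarith [sq_nonneg a.A₂]
  have hg : ∀ (μ : Fin (K - 1)) (σ : Spins N), GBdd (prodSize (size₁ P N K) sqSize) rate
      (fun p : EnvPt P N K => cmean a 0 1 σ p μ) := fun μ σ => ha.gbdd_cmean hs hc σ μ
  have hgav : ∀ (μ : Fin (K - 1)) (p : EnvPt P N K),
      gavE (ham a η 0 1) (fun σ p => cmean a 0 1 σ p μ) p = cmean a 0 1 1 p μ := by
    intro μ p
    rw [gavE, show (fun σ : Spins N => cmean a 0 1 σ p μ) = fun _ => cmean a 0 1 1 p μ from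
      funext fun σ => cmean_start σ 1 p μ, gav_const]
  have inner : ∀ (μ : Fin (K - 1)) (x : Lvl₁ P N K),
      ∫ y, lvlW (lawAux N K) θ (ham a η 0 1) (x, y) * cmean a 0 1 1 (x, y) μ ∂(lawAux N K) =
        a.A₁ * x.2 (Sum.inr μ) / (1 - a.C - θ * a.A₂ ^ 2) := by
    intro μ x
    have hW := GBdd.lvlW hE.sizeX hE.sizeY hE.tame hθ0 hθ1
    have hI1 : Integrable (fun y => lvlW (lawAux N K) θ (ham a η 0 1) (x, y)) (lawAux N K) :=
      (hW.slice x).integrable isSize_sqSize (by norm_num)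
    have hI2 : Integrable (fun y => y (Sum.inr μ) * lvlW (lawAux N K) θ (ham a η 0 1) (x, y))
        (lawAux N K) := by
      have := (gbdd_aux₂ (P := P) (N := N) (K := K) (Sum.inr μ)).mul hW
      exact (this.slice x).integrable isSize_sqSize (by norm_num)
    have hone := integral_lvlW hE.sizeX hE.sizeY hE.tame hθ0 hθ1 x
    have hvel : ∀ (x : Lvl₁ P N K) (y : Aux N K) (t : ℝ),
        HasVel (fun t => (x, Function.update y (Sum.inr μ) t))
          ((0, 0), Pi.single (Sum.inr μ) 1) t :=
      fun x y t => ⟨fun k => hasDerivAt_const t (x.1 k), fun k => hasDerivAt_const t (x.2 k),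
        fun k => hasDerivAt_update _ _ _ _⟩
    have hfld : ∀ (σ : Spins N) (ν : Fin (K - 1)),
        fld (P := P) a 0 1 σ ((0, 0), Pi.single (Sum.inr μ) 1) ν = if ν = μ then a.A₂ else 0 := by
      intro σ ν
      simp only [fld, Pi.zero_apply, zero_mul, mul_zero, zero_add, Pi.single_apply, Sum.inr.injEq,
        one_mul]
      split_ifs <;> simp
    have key := ibp_second_level hE.sizeX hE.sizeY hE.tame hθ0 hθ1
      (isGaussCoord_iidGaussian (ι := Fin N ⊕ Fin (K - 1)) (Sum.inr μ))
      (H' := fun σ p => a.A₂ * cmean a 0 1 σ p μ) (g := fun _ _ => 1) (g' := fun _ _ => 0)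
      (fun σ => (hg μ σ).const_mul _)
      (fun σ => (GBdd.const _).mono envSize_nonneg (by norm_num))
      (fun σ => (GBdd.const _).mono envSize_nonneg (by norm_num))
      (fun σ x y t => by
        refine (hasDerivAt_ham_of_vel η σ (hvel x y t) (ha.den_pos hc).ne').congr_deriv ?_
        simp only [hfld, mul_ite, mul_zero, Finset.sum_ite_eq', Finset.mem_univ, if_true]
        simp [spinFld, mul_comm])
      (fun σ x y t => hasDerivAt_const _ _) x
    have hgav' : ∀ p : EnvPt P N K,
        gavE (ham a η 0 1) (fun σ p => 0 + 1 * (a.A₂ * cmean a 0 1 σ p μ)) p =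
          a.A₂ * cmean a 0 1 1 p μ := by
      intro p
      have := gav_const_mul (fun σ => ham a η 0 1 σ p) (fun σ => cmean a 0 1 σ p μ) a.A₂
      have h2 := hgav μ p
      simp only [gavE, zero_add, one_mul] at h2 ⊢
      rw [this, h2]
    have hgav'' : ∀ p : EnvPt P N K,
        gavE (ham a η 0 1) (fun σ p => a.A₂ * cmean a 0 1 σ p μ) p =
          a.A₂ * cmean a 0 1 1 p μ := by
      intro p
      simpa using hgav' p
    have hgav3 : ∀ p : EnvPt P N K, gavE (ham a η 0 1) (fun _ _ => 1) p = 1 := fun p =>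
      gav_const _ _
    simp only [zero_add, mul_one, one_mul, hgav'', hgav3] at key
    set W := fun y => lvlW (lawAux N K) θ (ham a η 0 1) (x, y)
    set M := ∫ y, W y * cmean a 0 1 1 (x, y) μ ∂(lawAux N K) with hM
    -- Integration by parts over `J²_μ` gives a linear equation for the mean `M` of `X_μ`.
    have k2 : ∫ y, y (Sum.inr μ) * W y ∂(lawAux N K) = θ * a.A₂ * M := by
      refine key.trans ?_
      rw [hM, ← integral_const_mul]
      congr 1; ext y
      simp only [W]; ring
    have k3 : den a 1 * M = a.A₁ * x.2 (Sum.inr μ) + a.A₂ * (θ * a.A₂ * M) := by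
      rw [← k2, hM, ← integral_const_mul, ← integral_const_mul]
      have : a.A₁ * x.2 (Sum.inr μ) = ∫ y, a.A₁ * x.2 (Sum.inr μ) * W y ∂(lawAux N K) := by
        rw [integral_const_mul, hone, mul_one]
      rw [this, ← integral_add (hI1.const_mul _) (hI2.const_mul _)]
      congr 1; ext y
      have hd1 : den a 1 ≠ 0 := (ha.den_pos hc).ne'
      have : den a 1 * cmean a 0 1 1 (x, y) μ = fld a 0 1 1 (x, y) μ := by
        rw [cmean]; field_simp
      rw [mul_left_comm, this, fld]
      ring
    rw [eq_div_iff hD.ne']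
    rw [hd] at k3
    linarith
  have hsq : ∀ μ : Fin (K - 1), iAvg₁ (P := P) (K := K) a η 0 1 θ
      (fun t q => cmean a 0 1 t.1 (rep₁ q) μ * cmean a 0 1 t.2 (rep₂ q) μ) =
        a.A₁ ^ 2 / (1 - a.C - θ * a.A₂ ^ 2) ^ 2 := by
    intro μ
    rw [iAvg₁, hE.avg₁_mul (by norm_num) (by norm_num) (by norm_num) (hg μ) (hg μ)]
    simp only [hgav, inner]
    have h1 : ∀ x : Lvl₁ P N K, a.A₁ * x.2 (Sum.inr μ) / (1 - a.C - θ * a.A₂ ^ 2) *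
        (a.A₁ * x.2 (Sum.inr μ) / (1 - a.C - θ * a.A₂ ^ 2)) =
          a.A₁ ^ 2 / (1 - a.C - θ * a.A₂ ^ 2) ^ 2 * (x.2 (Sum.inr μ) * x.2 (Sum.inr μ)) := by
      intro x
      field_simp
    simp only [h1]
    rw [integral_const_mul]
    have h2 := ((isGaussCoord_iidGaussian (ι := Fin N ⊕ Fin (K - 1)) (Sum.inr μ)).snd
      (ν := iidGaussian (Fin (K - 1) × (Fin (P / 2) → Fin N)))
      (isSize_iidGaussian _).nonneg).ibp (G := fun x => x.2 (Sum.inr μ)) (G' := fun _ => 1)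
      (fun x t => by
        simp only [Function.update_self]
        exact hasDerivAt_id' t)
      ?_ ?_ (integrable_const _)
    · rw [h2]; simp
    · have := ((isGaussCoord_iidGaussian (ι := Fin N ⊕ Fin (K - 1)) (Sum.inr μ)).snd
        (ν := iidGaussian (Fin (K - 1) × (Fin (P / 2) → Fin N)))
        (isSize_iidGaussian _).nonneg).gbdd (δ := rate) (by norm_num)
      exact this.integrable isSize_size₁ (by norm_num)
    · have := ((isGaussCoord_iidGaussian (ι := Fin N ⊕ Fin (K - 1)) (Sum.inr μ)).snd
        (ν := iidGaussian (Fin (K - 1) × (Fin (P / 2) → Fin N)))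
        (isSize_iidGaussian _).nonneg).gbdd (δ := rate) (by norm_num)
      exact (this.mul this).integrable isSize_size₁ (by norm_num)
  rw [ovY₁]
  unfold hidOv
  change kavg _ _ _ = _
  rw [kavg_sum _ fun μ => hE.int₁ (by norm_num) fun t =>
    ((hg μ t.1).rep₁ isSize_sqSize.nonneg (by norm_num)).mul
      ((hg μ t.2).rep₂ isSize_sqSize.nonneg (by norm_num))]
  have := Finset.sum_congr (rfl : (Finset.univ : Finset (Fin (K - 1))) = _) fun μ _ => hsq μ
  refine this.trans ?_
  simp
  ring

end Start

/-! ### Integration over the hidden variables -/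

section Link

variable {P N K : ℕ} {β γ t : ℝ} {o : OrderParameters}

/-- The couplings of the broken interpolating system of size `N`. -/
def netCouplings (P : ℕ) (β γ : ℝ) (o : OrderParameters) (N : ℕ) : Couplings where
  κ := √(betaEff P β / (N : ℝ) ^ (P - 1))
  A₁ := coefA₁ P β o N
  A₂ := coefA₂ P β o N
  B₁ := coefB₁ P β γ o
  B₂ := coefB₂ P β γ o
  C := coefC P β o N
  b₁ := betaEff P β * N / 2
  b₂ := N * psi P β o
  b₃ := betaEff P β * γ / 2 * ((N : ℝ) ^ P / (N : ℝ) ^ (P / 2))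

lemma inv_sqrt_eq_exp {d : ℝ} (hd : 0 < d) : (√d)⁻¹ = Real.exp (-(Real.log d / 2)) := by
  rw [Real.exp_neg, ← Real.log_sqrt hd.le, Real.exp_log (Real.sqrt_pos.2 hd)]

lemma prod_tiltNorm {n : ℕ} (h : Fin n → ℝ) {c : ℝ} (hc : c < 1) :
    ∏ i, tiltNorm (h i) c =
      Real.exp ((∑ i, h i ^ 2) / (2 * (1 - c)) - n / 2 * Real.log (1 - c)) := by
  have hd : 0 < 1 - c := by linarith
  simp only [tiltNorm, inv_sqrt_eq_exp hd, ← Real.exp_add, ← Real.exp_sum]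
  rw [Finset.sum_add_distrib, Finset.sum_const, Finset.card_univ, Fintype.card_fin, nsmul_eq_mul,
    Finset.sum_div]
  congr 1
  ring

/-- The law of the hidden variables given the spins and the environment. -/
abbrev hidLaw (a : Couplings) (s c : ℝ) (σ : Spins N) (p : EnvPt P N K) :
    Measure (Fin (K - 1) → ℝ) :=
  tiltedLaw (fld a s c σ p) (c ^ 2 * a.C)

/-- Integrating a Boltzmann weight over the hidden variables completes the square in each of them:
it leaves the effective Hamiltonian `ham` and replaces the hidden variables by their conditional
law. -/
lemma integral_mul_boltzmann (ha : Small (netCouplings P β γ o N) P N) (ht0 : 0 ≤ t) (ht1 : t ≤ 1)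
    (η : Spins N) (ξ : Noise P N K) (J₁ J₂ : Aux N K) (σ : Spins N)
    (f : (Fin (K - 1) → ℝ) → ℝ) :
    ∫ τ, f τ * boltzmann P β γ o t η ξ J₁ J₂ σ τ ∂(iidGaussian (Fin (K - 1))) =
      Real.exp (ham (netCouplings P β γ o N) η √t √(1 - t) σ ((ξ, J₁), J₂)) *
        ∫ τ, f τ ∂(hidLaw (netCouplings P β γ o N) √t √(1 - t) σ ((ξ, J₁), J₂)) := by
  set a := netCouplings P β γ o N with hadef
  have hs2 : √t ^ 2 = t := Real.sq_sqrt ht0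
  have hc2 : √(1 - t) ^ 2 = 1 - t := Real.sq_sqrt (by linarith)
  have hc : |√(1 - t)| ≤ 1 := by
    rw [abs_of_nonneg (Real.sqrt_nonneg _)]
    exact Real.sqrt_le_one.2 (by linarith)
  have hd := ha.den_pos hc
  have hlt : √(1 - t) ^ 2 * a.C < 1 := by unfold den at hd; linarith
  set p : EnvPt P N K := ((ξ, J₁), J₂)
  have hB : ∀ τ, boltzmann P β γ o t η ξ J₁ J₂ σ τ =
      Real.exp (√t ^ 2 * (a.b₁ * magnetization η σ ^ P) +
        √(1 - t) ^ 2 * (a.b₂ * magnetization η σ) + √(1 - t) * spinFld a σ p - a.b₃) *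
      Real.exp (∑ μ, fld a √t √(1 - t) σ p μ * τ μ + √(1 - t) ^ 2 * a.C / 2 * ∑ μ, τ μ ^ 2) := by
    intro τ
    rw [boltzmann, ← Real.exp_add, hs2, hc2]
    congr 1
    have e1 : ∑ μ, fld a √t √(1 - t) σ p μ * τ μ = √t * a.κ * ∑ μ, noiseField ξ σ μ * τ μ +
        √(1 - t) * (a.A₁ * ∑ μ, J₁ (Sum.inr μ) * τ μ + a.A₂ * ∑ μ, J₂ (Sum.inr μ) * τ μ) := by
      simp only [Finset.mul_sum, ← Finset.sum_add_distrib]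
      refine Finset.sum_congr rfl fun μ _ => ?_
      simp only [fld, p]; ring
    rw [e1, spinFld]
    simp only [hadef, netCouplings, p]
    ring
  simp only [hB]
  have e2 : ∀ τ : Fin (K - 1) → ℝ, f τ *
      (Real.exp (√t ^ 2 * (a.b₁ * magnetization η σ ^ P) +
        √(1 - t) ^ 2 * (a.b₂ * magnetization η σ) + √(1 - t) * spinFld a σ p - a.b₃) *
      Real.exp (∑ μ, fld a √t √(1 - t) σ p μ * τ μ + √(1 - t) ^ 2 * a.C / 2 * ∑ μ, τ μ ^ 2)) =
      Real.exp (√t ^ 2 * (a.b₁ * magnetization η σ ^ P) +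
        √(1 - t) ^ 2 * (a.b₂ * magnetization η σ) + √(1 - t) * spinFld a σ p - a.b₃) *
      (f τ * Real.exp (∑ μ, fld a √t √(1 - t) σ p μ * τ μ +
        √(1 - t) ^ 2 * a.C / 2 * ∑ μ, τ μ ^ 2)) := fun τ => by ring
  simp only [e2]
  rw [integral_const_mul, integral_tilt _ _ hlt, ← mul_assoc, prod_tiltNorm _ hlt, ← Real.exp_add]
  congr 2
  rw [ham, den]
  ring

lemma Z₂_eq (ha : Small (netCouplings P β γ o N) P N) (ht0 : 0 ≤ t) (ht1 : t ≤ 1)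
    (η : Spins N) (ξ : Noise P N K) (J₁ J₂ : Aux N K) :
    Z₂ P β γ o t η ξ J₁ J₂ =
      zsum fun σ => ham (netCouplings P β γ o N) η √t √(1 - t) σ ((ξ, J₁), J₂) := by
  refine Finset.sum_congr rfl fun σ _ => ?_
  have := integral_mul_boltzmann ha ht0 ht1 η ξ J₁ J₂ σ fun _ => 1
  simpa using this

lemma weight_eq (ha : Small (netCouplings P β γ o N) P N) (ht0 : 0 ≤ t) (ht1 : t ≤ 1)
    (η : Spins N) (ξ : Noise P N K) (J₁ J₂ : Aux N K) :
    weight P β γ o t η ξ J₁ J₂ =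
      lvlW (lawAux N K) o.θ (ham (netCouplings P β γ o N) η √t √(1 - t)) ((ξ, J₁), J₂) := by
  simp only [weight, auxAvg, Z₂_eq ha ht0 ht1]
  rfl

lemma gibbs_eq (ha : Small (netCouplings P β γ o N) P N) (ht0 : 0 ≤ t) (ht1 : t ≤ 1)
    (η : Spins N) (ξ : Noise P N K) (J₁ J₂ : Aux N K) (f : Spins N → (Fin (K - 1) → ℝ) → ℝ) :
    gibbs P β γ o t η ξ J₁ J₂ f =
      ∑ σ, gw (fun σ => ham (netCouplings P β γ o N) η √t √(1 - t) σ ((ξ, J₁), J₂)) σ *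
        ∫ τ, f σ τ ∂(hidLaw (netCouplings P β γ o N) √t √(1 - t) σ ((ξ, J₁), J₂)) := by
  rw [gibbs, Z₂_eq ha ht0 ht1, Finset.sum_div]
  refine Finset.sum_congr rfl fun σ _ => ?_
  rw [integral_mul_boltzmann ha ht0 ht1, gw]
  ring

lemma gibbsPair_eq (ha : Small (netCouplings P β γ o N) P N) (ht0 : 0 ≤ t) (ht1 : t ≤ 1)
    (η : Spins N) (ξ : Noise P N K) (J₁ J₂ J₂' : Aux N K)
    {f : Spins N → (Fin (K - 1) → ℝ) → Spins N → (Fin (K - 1) → ℝ) → ℝ}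
    (hf : ∀ σ σ' (p p' : EnvPt P N K),
      Integrable (fun τ => ∫ τ', f σ τ σ' τ' ∂(hidLaw (netCouplings P β γ o N) √t √(1 - t) σ' p'))
        (hidLaw (netCouplings P β γ o N) √t √(1 - t) σ p)) :
    gibbsPair P β γ o t η ξ J₁ J₂ J₂' f =
      ∑ u : Spins N × Spins N,
        gw (fun σ => ham (netCouplings P β γ o N) η √t √(1 - t) σ ((ξ, J₁), J₂)) u.1 *
        gw (fun σ => ham (netCouplings P β γ o N) η √t √(1 - t) σ ((ξ, J₁), J₂')) u.2 *
        ∫ τ, ∫ τ', f u.1 τ u.2 τ'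
          ∂(hidLaw (netCouplings P β γ o N) √t √(1 - t) u.2 ((ξ, J₁), J₂'))
          ∂(hidLaw (netCouplings P β γ o N) √t √(1 - t) u.1 ((ξ, J₁), J₂)) := by
  rw [gibbsPair, gibbs_eq ha ht0 ht1, Fintype.sum_prod_type]
  refine Finset.sum_congr rfl fun σ _ => ?_
  simp only [gibbs_eq ha ht0 ht1]
  rw [integral_finsetSum _ fun σ' _ => (hf σ σ' _ _).const_mul _, Finset.mul_sum]
  refine Finset.sum_congr rfl fun σ' _ => ?_
  rw [integral_const_mul]
  ring

lemma abs_sqrt_le_one {x : ℝ} (hx : x ≤ 1) : |√x| ≤ 1 := by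
  rw [abs_of_nonneg (Real.sqrt_nonneg _)]
  exact Real.sqrt_le_one.2 hx

lemma avg_eq (ha : Small (netCouplings P β γ o N) P N) (ht0 : 0 ≤ t) (ht1 : t ≤ 1)
    (hθ0 : 0 < o.θ) (hθ1 : o.θ ≤ 1) (f : Spins N → Spins N → ℝ) :
    avg P β γ o t (K := K) f = 1 / 2 ^ N * ∑ η : Spins N,
      iAvg₀ (P := P) (K := K) (netCouplings P β γ o N) η
      √t √(1 - t) o.θ (fun σ _ => f η σ) := by
  rw [avg, patternAvg]
  congr 1
  refine Finset.sum_congr rfl fun η _ => ?_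
  have hE := ha.env (K := K) η (abs_sqrt_le_one ht1) (abs_sqrt_le_one (by linarith : 1 - t ≤ 1))
    hθ0 hθ1
  have hI := (hE.int₀ (δ := 0) (by norm_num) (f := fun σ _ => f η σ)
    fun σ => GBdd.const _).sum_integrable
  have hk := fun p => sum_ker₀_mul (γY := lawAux N K) (θ := o.θ)
    (H := ham (P := P) (netCouplings P β γ o N) η √t √(1 - t)) (fun σ _ => f η σ) p
  simp only [hk] at hI
  rw [iAvg₀, avg₀, kavg]
  simp only [hk]
  rw [integral_prod _ hI, integral_prod _ hI.integral_prod_left]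
  simp only [auxAvg, weight_eq ha ht0 ht1, gibbs_eq ha ht0 ht1, integral_const, probReal_univ,
    one_smul]
  rfl

/-- `⟨·⟩₂` after integration over the hidden variables. -/
lemma avgPair₂_eq (ha : Small (netCouplings P β γ o N) P N) (ht0 : 0 ≤ t) (ht1 : t ≤ 1)
    (hθ0 : 0 < o.θ) (hθ1 : o.θ ≤ 1)
    {f : Spins N → (Fin (K - 1) → ℝ) → Spins N → (Fin (K - 1) → ℝ) → ℝ}
    (hf : ∀ σ σ' (p p' : EnvPt P N K),
      Integrable (fun τ => ∫ τ', f σ τ σ' τ' ∂(hidLaw (netCouplings P β γ o N) √t √(1 - t) σ' p'))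
        (hidLaw (netCouplings P β γ o N) √t √(1 - t) σ p))
    {g : Spins N × Spins N → EnvPt P N K → EnvPt P N K → ℝ}
    (hg : ∀ u (p p' : EnvPt P N K), ∫ τ, ∫ τ', f u.1 τ u.2 τ'
          ∂(hidLaw (netCouplings P β γ o N) √t √(1 - t) u.2 p')
          ∂(hidLaw (netCouplings P β γ o N) √t √(1 - t) u.1 p) = g u p p') {δ : ℝ}
    (hδ : δ ≤ 7 * rate) (hgb : ∀ u, GBdd (envSize P N K) δ (fun p => g u p p)) :
    avgPair₂ P β γ o t (K := K) f = 1 / 2 ^ N * ∑ η : Spins N, iAvg₂ (P := P) (K := K)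
      (netCouplings P β γ o N) η √t √(1 - t) o.θ (fun u p => g u p p) := by
  rw [avgPair₂, patternAvg]
  congr 1
  refine Finset.sum_congr rfl fun η _ => ?_
  have hE := ha.env (K := K) η (abs_sqrt_le_one ht1) (abs_sqrt_le_one (by linarith : 1 - t ≤ 1))
    hθ0 hθ1
  have hI := (hE.int₂ hδ hgb).sum_integrable
  rw [iAvg₂, avg₂, kavg, integral_prod _ hI, integral_prod _ hI.integral_prod_left]
  simp only [auxAvg, weight_eq ha ht0 ht1, gibbsPair_eq ha ht0 ht1 _ _ _ _ _ hf, hg]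
  congr 1; ext ξ; congr 1; ext J₁; congr 1; ext J₂
  rw [Finset.mul_sum]
  refine Finset.sum_congr rfl fun u _ => ?_
  rw [ker₂]; ring

/-- `⟨·⟩₁` after integration over the hidden variables. -/
lemma avgPair₁_eq (ha : Small (netCouplings P β γ o N) P N) (ht0 : 0 ≤ t) (ht1 : t ≤ 1)
    (hθ0 : 0 < o.θ) (hθ1 : o.θ ≤ 1)
    {f : Spins N → (Fin (K - 1) → ℝ) → Spins N → (Fin (K - 1) → ℝ) → ℝ}
    (hf : ∀ σ σ' (p p' : EnvPt P N K),
      Integrable (fun τ => ∫ τ', f σ τ σ' τ' ∂(hidLaw (netCouplings P β γ o N) √t √(1 - t) σ' p'))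
        (hidLaw (netCouplings P β γ o N) √t √(1 - t) σ p))
    {g : Spins N × Spins N → EnvPt P N K → EnvPt P N K → ℝ}
    (hg : ∀ u (p p' : EnvPt P N K), ∫ τ, ∫ τ', f u.1 τ u.2 τ'
          ∂(hidLaw (netCouplings P β γ o N) √t √(1 - t) u.2 p')
          ∂(hidLaw (netCouplings P β γ o N) √t √(1 - t) u.1 p) = g u p p') {δ : ℝ}
    (hδ : δ ≤ 7 * rate)
    (hgb : ∀ u, GBdd (tripleSize (size₁ P N K) (sqSize (ι := Fin N ⊕ Fin (K - 1))))
      δ (fun q => g u (rep₁ q) (rep₂ q))) :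
    avgPair₁ P β γ o t (K := K) f = 1 / 2 ^ N * ∑ η : Spins N, iAvg₁ (P := P) (K := K)
      (netCouplings P β γ o N) η √t √(1 - t) o.θ (fun u q => g u (rep₁ q) (rep₂ q)) := by
  rw [avgPair₁, patternAvg]
  congr 1
  refine Finset.sum_congr rfl fun η _ => ?_
  have hE := ha.env (K := K) η (abs_sqrt_le_one ht1) (abs_sqrt_le_one (by linarith : 1 - t ≤ 1))
    hθ0 hθ1
  have hI := (hE.int₁ hδ hgb).sum_integrable
  rw [iAvg₁, hE.avg₁_eq hδ hgb]
  have hI2 := hI.integral_prod_left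
  have h4 : Integrable (fun x => ∫ y, ∫ y', ∑ u, ker₁ (lawAux N K) o.θ
      (ham (netCouplings P β γ o N) η √t √(1 - t)) u (x, y, y') *
        g u (rep₁ (x, y, y')) (rep₂ (x, y, y')) ∂(lawAux N K) ∂(lawAux N K)) (law₁ P N K) := by
    refine hI2.congr ?_
    filter_upwards [hI.prod_right_ae] with x hx
    exact integral_prod _ hx
  rw [integral_prod _ h4]
  simp only [auxAvg, weight_eq ha ht0 ht1, gibbsPair_eq ha ht0 ht1 _ _ _ _ _ hf, hg]
  congr 1; ext ξ; congr 1; ext J₁; congr 1; ext J₂; congr 1; ext J₂'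
  rw [Finset.mul_sum]
  refine Finset.sum_congr rfl fun u _ => ?_
  rw [ker₁, ker₀, ker₀]; ring

lemma integrable_tiltedLaw_sq {ι : Type} [Fintype ι] (h : ι → ℝ) (c : ℝ)
    (b : ι → ℝ) (p : ℝ) : Integrable (fun x => (∑ i, b i * x i - p) ^ 2) (tiltedLaw h c) := by
  have hL : ∀ i, MemLp (fun x : ι → ℝ => b i * x i) 2 (tiltedLaw h c) := fun i =>
    ((memLp_id_gaussianReal' 2 (by simp)).const_mul (b i)).comp_measurePreserving
      (measurePreserving_eval (fun i => gaussianReal (h i / (1 - c)) (Real.toNNReal (1 - c)⁻¹)) i)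
  exact ((memLp_finsetSum _ fun i _ => hL i).sub (memLp_const p)).integrable_sq

/-- The second moment of the deviation of the overlap of the hidden variables, given the spins and
the environment: the thermal fluctuations of the hidden variables add to the squared deviation of
the overlap of the conditional means. -/
lemma integral_overlapP_sq {h h' : Fin (K - 1) → ℝ} {c : ℝ} (hc : c < 1) (p : ℝ) :
    Integrable (fun τ => ∫ τ', (overlapP P N τ τ' - p) ^ 2 ∂(tiltedLaw h' c)) (tiltedLaw h c) ∧
    ∫ τ, ∫ τ', (overlapP P N τ τ' - p) ^ 2 ∂(tiltedLaw h' c) ∂(tiltedLaw h c) =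
      ((N : ℝ) ^ (P / 2 - 1) / K * ∑ μ, (h μ / (1 - c)) * (h' μ / (1 - c)) - p) ^ 2 +
      (1 - c)⁻¹ * ((N : ℝ) ^ (P / 2 - 1) / K) ^ 2 *
        (∑ μ, (h μ / (1 - c)) ^ 2 + ∑ μ, (h' μ / (1 - c)) ^ 2 + (K - 1 : ℕ) * (1 - c)⁻¹) := by
  set b : ℝ := (N : ℝ) ^ (P / 2 - 1) / K with hb
  have e1 : ∀ τ τ' : Fin (K - 1) → ℝ, (overlapP P N τ τ' - p) ^ 2 =
      (∑ μ, (b * τ μ) * τ' μ - p) ^ 2 := by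
    intro τ τ'
    rw [overlapP, hb, ← mul_assoc, Finset.mul_sum]
    congr 2
    exact Finset.sum_congr rfl fun μ _ => by ring
  -- For fixed `τ` the overlap is an affine function of the other replica. The sum of squares which
  -- remains is written as a sum of squares of linear functions, so that the same lemma applies
  -- again.
  have e2 : ∀ τ : Fin (K - 1) → ℝ, ∫ τ', (overlapP P N τ τ' - p) ^ 2 ∂(tiltedLaw h' c) =
      (∑ μ, (b * (h' μ / (1 - c))) * τ μ - p) ^ 2 +
        (1 - c)⁻¹ * b ^ 2 * ∑ μ, (∑ ν, (Pi.single μ 1 : Fin (K - 1) → ℝ) ν * τ ν - 0) ^ 2 := by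
    intro τ
    simp only [e1]
    rw [integral_tiltedLaw_linear_sq _ _ hc]
    congr 1
    · congr 2
      exact Finset.sum_congr rfl fun μ _ => by ring
    · rw [mul_assoc, Finset.mul_sum (a := b ^ 2)]
      congr 1
      refine Finset.sum_congr rfl fun μ _ => ?_
      simp [Pi.single_apply, mul_pow]
  have i1 := integrable_tiltedLaw_sq h c (fun μ => b * (h' μ / (1 - c))) p
  have i2 : Integrable (fun τ : Fin (K - 1) → ℝ => (1 - c)⁻¹ * b ^ 2 *
      ∑ μ, (∑ ν, (Pi.single μ 1 : Fin (K - 1) → ℝ) ν * τ ν - 0) ^ 2) (tiltedLaw h c) :=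
    (integrable_finsetSum _ fun μ _ => integrable_tiltedLaw_sq h c (Pi.single μ 1) 0).const_mul _
  simp only [e2]
  refine ⟨i1.add i2, ?_⟩
  rw [integral_add i1 i2, integral_const_mul,
    integral_finsetSum _ fun μ _ => integrable_tiltedLaw_sq h c (Pi.single μ 1) 0,
    integral_tiltedLaw_linear_sq _ _ hc]
  have e3 : ∀ μ : Fin (K - 1), ∫ τ, (∑ ν, (Pi.single μ 1 : Fin (K - 1) → ℝ) ν * τ ν - 0) ^ 2
      ∂(tiltedLaw h c) = (h μ / (1 - c)) ^ 2 + (1 - c)⁻¹ := by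
    intro μ
    rw [integral_tiltedLaw_linear_sq _ _ hc]
    simp [Pi.single_apply]
  simp only [e3]
  rw [Finset.sum_add_distrib, Finset.sum_const, Finset.card_univ, Fintype.card_fin, nsmul_eq_mul,
    Finset.mul_sum (a := b)]
  have e4 : ∑ μ, (b * (h' μ / (1 - c))) ^ 2 = b ^ 2 * ∑ μ, (h' μ / (1 - c)) ^ 2 := by
    rw [Finset.mul_sum]
    exact Finset.sum_congr rfl fun μ _ => by ring
  rw [e4]
  have e5 : ∑ μ, b * (h' μ / (1 - c)) * (h μ / (1 - c)) =
      ∑ μ, b * (h μ / (1 - c) * (h' μ / (1 - c))) :=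
    Finset.sum_congr rfl fun μ _ => by ring
  rw [e5]
  ring

variable (P N K) in
/-- The rescaling of the overlap of the hidden variables. -/
def ovScale : ℝ := (N : ℝ) ^ (P / 2 - 1) / K

/-- The part of the second moment of `p₁₂ - p̄` due to thermal fluctuations. -/
def thermal (a : Couplings) (s c : ℝ) (u : Spins N × Spins N) (p p' : EnvPt P N K) : ℝ :=
  (den a c)⁻¹ * ovScale P N K ^ 2 *
    (∑ μ, cmean a s c u.1 p μ ^ 2 + ∑ μ, cmean a s c u.2 p' μ ^ 2 + (K - 1 : ℕ) * (den a c)⁻¹)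

lemma thermal_nonneg {a : Couplings} {s c : ℝ} (hd : 0 < den a c) (u : Spins N × Spins N)
    (p p' : EnvPt P N K) : 0 ≤ thermal a s c u p p' := by
  unfold thermal
  positivity

/-- Under `⟨·⟩₂`, the overlap of the conditional means deviates less than the overlap of the
hidden variables. -/
lemma hid_dev₂_le (ha : Small (netCouplings P β γ o N) P N) (ht0 : 0 ≤ t) (ht1 : t ≤ 1)
    (hθ0 : 0 < o.θ) (hθ1 : o.θ ≤ 1) (p₀ : ℝ) :
    1 / 2 ^ N * ∑ η : Spins N, iAvg₂ (P := P) (K := K) (netCouplings P β γ o N) η √t √(1 - t) o.θ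
        (fun u p => (ovScale P N K *
          hidOv (netCouplings P β γ o N) √t √(1 - t) u.1 u.2 p p - p₀) ^ 2) ≤
      avgPair₂ P β γ o t (K := K) fun (_ : Spins N) τ _ τ' => (overlapP P N τ τ' - p₀) ^ 2 := by
  set a := netCouplings P β γ o N
  have hs := abs_sqrt_le_one ht1
  have hc := abs_sqrt_le_one (by linarith : 1 - t ≤ 1)
  have hd := ha.den_pos hc
  have hlt : √(1 - t) ^ 2 * a.C < 1 := by unfold den at hd; linarith
  have g1 : ∀ u : Spins N × Spins N, GBdd (envSize P N K) (rate + rate)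
      (fun p => ovScale P N K * hidOv a √t √(1 - t) u.1 u.2 p p - p₀) := fun u =>
    ((ha.gbdd_hidOv hs hc u).const_mul _).sub ((GBdd.const _).mono envSize_nonneg (by norm_num))
  have g2 : ∀ u : Spins N × Spins N, GBdd (envSize P N K) (4 * rate)
      (fun p => (ovScale P N K * hidOv a √t √(1 - t) u.1 u.2 p p - p₀) ^ 2) := fun u =>
    (((g1 u).mul (g1 u)).congr fun p => (sq _).symm).mono envSize_nonneg (by norm_num)
  have g3 : ∀ u : Spins N × Spins N, GBdd (envSize P N K) (4 * rate)
      (fun p => thermal a √t √(1 - t) u p p) := fun u =>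
    ((((ha.gbdd_sum_cmean_sq hs hc u.1).add (ha.gbdd_sum_cmean_sq hs hc u.2)).add
      ((GBdd.const _).mono envSize_nonneg (by norm_num))).const_mul _).mono envSize_nonneg
        (by norm_num)
  rw [avgPair₂_eq ha ht0 ht1 hθ0 hθ1 (f := fun _ τ _ τ' => (overlapP P N τ τ' - p₀) ^ 2)
    (fun σ σ' p p' => (integral_overlapP_sq hlt p₀).1)
    (g := fun u p p' => (ovScale P N K * hidOv a √t √(1 - t) u.1 u.2 p p' - p₀) ^ 2 +
      thermal a √t √(1 - t) u p p')
    (fun u p p' => (integral_overlapP_sq hlt p₀).2) (δ := 4 * rate) (by norm_num)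
    (fun u => (g2 u).add (g3 u))]
  refine mul_le_mul_of_nonneg_left (Finset.sum_le_sum fun η _ => ?_) (by positivity)
  have hE := ha.env (K := K) η hs hc hθ0 hθ1
  exact kavg_mono ker₂_nonneg (hE.int₂ (by norm_num) g2)
    (hE.int₂ (by norm_num) fun u => (g2 u).add (g3 u))
    fun u p => le_add_of_nonneg_right (thermal_nonneg hd u p p)

/-- Under `⟨·⟩₁`, the overlap of the conditional means deviates less than the overlap of the
hidden variables. -/
lemma hid_dev₁_le (ha : Small (netCouplings P β γ o N) P N) (ht0 : 0 ≤ t) (ht1 : t ≤ 1)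
    (hθ0 : 0 < o.θ) (hθ1 : o.θ ≤ 1) (p₀ : ℝ) :
    1 / 2 ^ N * ∑ η : Spins N, iAvg₁ (P := P) (K := K) (netCouplings P β γ o N) η √t √(1 - t) o.θ
        (fun u q => (ovScale P N K *
          hidOv (netCouplings P β γ o N) √t √(1 - t) u.1 u.2 (rep₁ q) (rep₂ q) - p₀) ^ 2) ≤
      avgPair₁ P β γ o t (K := K) fun (_ : Spins N) τ _ τ' => (overlapP P N τ τ' - p₀) ^ 2 := by
  set a := netCouplings P β γ o N
  have hs := abs_sqrt_le_one ht1
  have hc := abs_sqrt_le_one (by linarith : 1 - t ≤ 1)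
  have hd := ha.den_pos hc
  have hlt : √(1 - t) ^ 2 * a.C < 1 := by unfold den at hd; linarith
  have hr := (isSize_size₁ (P := P) (N := N) (K := K)).prod
    ((isSize_sqSize (N := N) (K := K)).prod (isSize_sqSize (N := N) (K := K))) |>.nonneg
  have g1 : ∀ u : Spins N × Spins N, GBdd (tripleSize (size₁ P N K) sqSize) (rate + rate)
      (fun q => ovScale P N K * hidOv a √t √(1 - t) u.1 u.2 (rep₁ q) (rep₂ q) - p₀) := fun u =>
    ((ha.gbdd_hidOv' hs hc u).const_mul _).sub ((GBdd.const _).mono hr (by norm_num))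
  have g2 : ∀ u : Spins N × Spins N, GBdd (tripleSize (size₁ P N K) sqSize) (4 * rate)
      (fun q => (ovScale P N K * hidOv a √t √(1 - t) u.1 u.2 (rep₁ q) (rep₂ q) - p₀) ^ 2) :=
    fun u => (((g1 u).mul (g1 u)).congr fun p => (sq _).symm).mono hr (by norm_num)
  have g3 : ∀ u : Spins N × Spins N, GBdd (tripleSize (size₁ P N K) sqSize) (4 * rate)
      (fun q => thermal a √t √(1 - t) u (rep₁ q) (rep₂ q)) := fun u =>
    (((((ha.gbdd_sum_cmean_sq hs hc u.1).rep₁ isSize_sqSize.nonneg (by norm_num)).add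
      ((ha.gbdd_sum_cmean_sq hs hc u.2).rep₂ isSize_sqSize.nonneg (by norm_num))).add
      ((GBdd.const _).mono hr (by norm_num))).const_mul _).mono hr (by norm_num)
  rw [avgPair₁_eq ha ht0 ht1 hθ0 hθ1 (f := fun _ τ _ τ' => (overlapP P N τ τ' - p₀) ^ 2)
    (fun σ σ' p p' => (integral_overlapP_sq hlt p₀).1)
    (g := fun u p p' => (ovScale P N K * hidOv a √t √(1 - t) u.1 u.2 p p' - p₀) ^ 2 +
      thermal a √t √(1 - t) u p p')
    (fun u p p' => (integral_overlapP_sq hlt p₀).2) (δ := 4 * rate) (by norm_num)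
    (fun u => (g2 u).add (g3 u))]
  refine mul_le_mul_of_nonneg_left (Finset.sum_le_sum fun η _ => ?_) (by positivity)
  have hE := ha.env (K := K) η hs hc hθ0 hθ1
  exact kavg_mono ker₁_nonneg (hE.int₁ (by norm_num) g2)
    (hE.int₁ (by norm_num) fun u => (g2 u).add (g3 u))
    fun u q => le_add_of_nonneg_right (thermal_nonneg hd u (rep₁ q) (rep₂ q))

lemma avgPair₂_spin (ha : Small (netCouplings P β γ o N) P N) (ht0 : 0 ≤ t) (ht1 : t ≤ 1)
    (hθ0 : 0 < o.θ) (hθ1 : o.θ ≤ 1) (f : Spins N → Spins N → ℝ) :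
    avgPair₂ P β γ o t (K := K) (fun σ _ σ' _ => f σ σ') =
      1 / 2 ^ N * ∑ η : Spins N, iAvg₂ (P := P) (K := K) (netCouplings P β γ o N) η √t √(1 - t) o.θ
        (fun u _ => f u.1 u.2) :=
  avgPair₂_eq ha ht0 ht1 hθ0 hθ1 (fun _ _ _ _ => integrable_const _)
    (g := fun u _ _ => f u.1 u.2) (fun u p p' => by simp) (δ := 0) (by norm_num)
    fun u => GBdd.const _

lemma avgPair₁_spin (ha : Small (netCouplings P β γ o N) P N) (ht0 : 0 ≤ t) (ht1 : t ≤ 1)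
    (hθ0 : 0 < o.θ) (hθ1 : o.θ ≤ 1) (f : Spins N → Spins N → ℝ) :
    avgPair₁ P β γ o t (K := K) (fun σ _ σ' _ => f σ σ') =
      1 / 2 ^ N * ∑ η : Spins N, iAvg₁ (P := P) (K := K) (netCouplings P β γ o N) η √t √(1 - t) o.θ
        (fun u _ => f u.1 u.2) :=
  avgPair₁_eq ha ht0 ht1 hθ0 hθ1 (fun _ _ _ _ => integrable_const _)
    (g := fun u _ _ => f u.1 u.2) (fun u p p' => by simp) (δ := 0) (by norm_num)
    fun u => GBdd.const _

end Link

/-! ### The one-body system at the beginning of the interpolation -/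

section OneBody

lemma sum_units (f : ℤˣ → ℝ) : ∑ u, f u = f 1 + f (-1) := by
  rw [show (Finset.univ : Finset ℤˣ) = {1, -1} from rfl, Finset.sum_pair (by decide)]

lemma sum_exp_field {N : ℕ} (x : Fin N → ℝ) :
    ∑ σ : Spins N, Real.exp (∑ i, x i * val (σ i)) = ∏ i, (2 * Real.cosh (x i)) := by
  have h : ∀ i, ∑ u : ℤˣ, Real.exp (x i * val u) = 2 * Real.cosh (x i) := by
    intro i
    rw [sum_units, Real.cosh_eq]
    simp [val]
    ring
  simp_rw [← h]
  rw [Finset.prod_univ_sum, Fintype.piFinset_univ]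
  exact Finset.sum_congr rfl fun σ _ => Real.exp_sum _ _

/-- The average of `cosh^θ` at a Gaussian field of strength `B` around `u`. -/
def coshAvg (θ B u : ℝ) : ℝ := ∫ y, Real.cosh (u + y * B) ^ θ ∂stdG

lemma integrable_cosh (B u : ℝ) : Integrable (fun y => Real.cosh (u + y * B)) stdG := by
  have h := fun b : ℝ => integrable_exp_quadratic b 0 (by norm_num)
  refine ((((h B).const_mul (Real.exp u)).add ((h (-B)).const_mul (Real.exp (-u)))).div_const
    2).congr (Eventually.of_forall fun y => ?_)
  simp only [Pi.add_apply, ← Real.exp_add, Real.cosh_eq]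
  congr 3 <;> ring_nf

lemma integral_cosh (B u : ℝ) :
    ∫ y, Real.cosh (u + y * B) ∂stdG = Real.cosh u * Real.exp (B ^ 2 / 2) := by
  have h := fun b : ℝ => integrable_exp_quadratic b 0 (by norm_num)
  have e : ∀ y : ℝ, Real.cosh (u + y * B) = Real.exp u / 2 * Real.exp (B * y + 0 / 2 * y ^ 2) +
      Real.exp (-u) / 2 * Real.exp (-B * y + 0 / 2 * y ^ 2) := by
    intro y
    have e1 : Real.exp u * Real.exp (B * y + 0 / 2 * y ^ 2) = Real.exp (u + y * B) := by
      rw [← Real.exp_add]; congr 1; ring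
    have e2 : Real.exp (-u) * Real.exp (-B * y + 0 / 2 * y ^ 2) = Real.exp (-(u + y * B)) := by
      rw [← Real.exp_add]; congr 1; ring
    rw [Real.cosh_eq]
    linear_combination -(1 / 2) * e1 - 1 / 2 * e2
  simp only [e]
  rw [integral_add ((h B).const_mul _) ((h (-B)).const_mul _), integral_const_mul,
    integral_const_mul, integral_exp_quadratic _ _ (by norm_num),
    integral_exp_quadratic _ _ (by norm_num), Real.cosh_eq]
  simp [tiltNorm]
  ring

lemma cosh_rpow_le {θ : ℝ} (hθ1 : θ ≤ 1) (x : ℝ) : Real.cosh x ^ θ ≤ Real.cosh x := by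
  simpa using Real.rpow_le_rpow_of_exponent_le (Real.one_le_cosh x) hθ1

lemma integrable_cosh_rpow {θ : ℝ} (hθ1 : θ ≤ 1) (B u : ℝ) :
    Integrable (fun y => Real.cosh (u + y * B) ^ θ) stdG := by
  refine (integrable_cosh B u).mono' ((by fun_prop : Measurable fun y : ℝ =>
    Real.cosh (u + y * B)).pow_const θ).aestronglyMeasurable (Eventually.of_forall fun y => ?_)
  rw [Real.norm_eq_abs, abs_of_nonneg (Real.rpow_nonneg (Real.cosh_pos _).le _)]
  exact cosh_rpow_le hθ1 _

lemma one_le_coshAvg {θ : ℝ} (hθ0 : 0 < θ) (hθ1 : θ ≤ 1) (B u : ℝ) : 1 ≤ coshAvg θ B u := by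
  have := integral_mono (integrable_const (1 : ℝ)) (integrable_cosh_rpow hθ1 B u) fun y =>
    Real.one_le_rpow (Real.one_le_cosh (u + y * B)) hθ0.le
  simpa [coshAvg] using this

lemma log_coshAvg_le {θ : ℝ} (hθ0 : 0 < θ) (hθ1 : θ ≤ 1) (B u : ℝ) :
    Real.log (coshAvg θ B u) ≤ |u| + B ^ 2 / 2 := by
  have h1 := integral_mono (integrable_cosh_rpow hθ1 B u) (integrable_cosh B u) fun y =>
    cosh_rpow_le hθ1 _
  rw [integral_cosh] at h1
  have h2 : Real.cosh u ≤ Real.exp |u| := by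
    rw [← Real.cosh_abs, Real.cosh_eq]
    have : Real.exp (-|u|) ≤ Real.exp |u| := Real.exp_le_exp.2 (by linarith [abs_nonneg u])
    linarith
  rw [Real.log_le_iff_le_exp (zero_lt_one.trans_le (one_le_coshAvg hθ0 hθ1 B u)), Real.exp_add]
  exact h1.trans (mul_le_mul_of_nonneg_right h2 (Real.exp_pos _).le)

lemma measurable_coshAvg (θ B : ℝ) : Measurable (coshAvg θ B) := by
  have : Measurable fun p : ℝ × ℝ => Real.cosh (p.1 + p.2 * B) ^ θ := by fun_prop
  exact this.stronglyMeasurable.integral_prod_right'.measurable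

lemma integral_stdG_neg (f : ℝ → ℝ) : ∫ x, f (-x) ∂stdG = ∫ x, f x ∂stdG := by
  have h : MeasurePreserving (fun x : ℝ => -x) stdG stdG :=
    ⟨measurable_neg, by simpa using gaussianReal_map_neg (μ := 0) (v := 1)⟩
  exact h.integral_comp (MeasurableEquiv.neg ℝ).measurableEmbedding f

lemma coshAvg_neg (θ B u : ℝ) : coshAvg θ B (-u) = coshAvg θ B u := by
  rw [coshAvg, coshAvg, ← integral_stdG_neg]
  congr 1; ext y
  rw [← Real.cosh_neg]
  congr 2; ring

lemma integrable_log_coshAvg {θ : ℝ} (hθ0 : 0 < θ) (hθ1 : θ ≤ 1) (B b u : ℝ) :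
    Integrable (fun x => Real.log (coshAvg θ B (u + b * x))) stdG := by
  have hid : Integrable (fun x : ℝ => x) stdG :=
    (memLp_id_gaussianReal' 1 (by simp)).integrable le_rfl
  have h2 : Integrable (fun x : ℝ => |u| + |b| * |x| + B ^ 2 / 2) stdG :=
    ((integrable_const _).add (hid.abs.const_mul _)).add (integrable_const _)
  refine h2.mono' ((measurable_coshAvg θ B).comp (by fun_prop : Measurable fun x : ℝ =>
    u + b * x)).log.aestronglyMeasurable (Eventually.of_forall fun x => ?_)
  rw [Real.norm_eq_abs, abs_of_nonneg (Real.log_nonneg (one_le_coshAvg hθ0 hθ1 _ _))]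
  refine (log_coshAvg_le hθ0 hθ1 _ _).trans ?_
  have := abs_add_le u (b * x)
  rw [abs_mul] at this
  linarith

/-- Gauge invariance: the sign of the external field is irrelevant. -/
lemma integral_log_coshAvg_val (θ B b ψ : ℝ) (u : ℤˣ) :
    ∫ x, Real.log (coshAvg θ B (ψ * val u + b * x)) ∂stdG =
      ∫ x, Real.log (coshAvg θ B (ψ + b * x)) ∂stdG := by
  rcases Int.units_eq_one_or u with rfl | rfl
  · simp [val]
  · rw [← integral_stdG_neg]
    congr 1; ext x
    rw [← coshAvg_neg]
    congr 2
    simp [val]; ring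

end OneBody

section Start

variable {P N K : ℕ} {a : Couplings} {θ : ℝ}

lemma ham_start (a : Couplings) (η σ : Spins N) (p : EnvPt P N K) :
    ham a η 0 1 σ p = (-a.b₃ - (K - 1 : ℕ) / 2 * Real.log (1 - a.C) +
        ∑ μ, (a.A₁ * p.1.2 (Sum.inr μ) + a.A₂ * p.2 (Sum.inr μ)) ^ 2 / (2 * (1 - a.C))) +
      ∑ i, (a.b₂ / N * val (η i) + a.B₁ * p.1.2 (Sum.inl i) + a.B₂ * p.2 (Sum.inl i)) *
        val (σ i) := by
  have h1 : ∑ i, (a.b₂ / N * val (η i) + a.B₁ * p.1.2 (Sum.inl i) + a.B₂ * p.2 (Sum.inl i)) *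
      val (σ i) = a.b₂ * magnetization η σ + spinFld a σ p := by
    rw [magnetization, spinFld]
    simp only [Finset.mul_sum, ← Finset.sum_add_distrib]
    exact Finset.sum_congr rfl fun i _ => by ring
  rw [h1, ham]
  simp only [fld, den, Finset.sum_div, zero_mul, one_mul, zero_add, one_pow, ne_eq,
    OfNat.ofNat_ne_zero, not_false_eq_true, zero_pow]
  ring

/-- The Gaussian integral over the second level of the contribution of one hidden variable. -/
lemma integral_hid (hd : 0 < 1 - a.C) (hD : 0 < 1 - a.C - θ * a.A₂ ^ 2) (x : ℝ) :
    ∫ y, Real.exp (θ * ((a.A₁ * x + a.A₂ * y) ^ 2 / (2 * (1 - a.C)))) ∂stdG =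
      Real.exp (θ * a.A₁ ^ 2 / (2 * (1 - a.C - θ * a.A₂ ^ 2)) * x ^ 2 -
        Real.log (1 - θ * a.A₂ ^ 2 / (1 - a.C)) / 2) := by
  have hlt : θ * a.A₂ ^ 2 / (1 - a.C) < 1 := by
    rw [div_lt_one hd]; linarith
  have e : ∀ y : ℝ, Real.exp (θ * ((a.A₁ * x + a.A₂ * y) ^ 2 / (2 * (1 - a.C)))) =
      Real.exp (θ * a.A₁ ^ 2 * x ^ 2 / (2 * (1 - a.C))) *
        Real.exp ((θ * a.A₁ * a.A₂ * x / (1 - a.C)) * y +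
          (θ * a.A₂ ^ 2 / (1 - a.C)) / 2 * y ^ 2) := by
    intro y
    rw [← Real.exp_add]
    congr 1
    field_simp
    ring
  simp only [e]
  rw [integral_const_mul, integral_exp_quadratic _ _ hlt, tiltNorm,
    inv_sqrt_eq_exp (by linarith), ← Real.exp_add, ← Real.exp_add]
  congr 1
  have h3 : 1 - θ * a.A₂ ^ 2 / (1 - a.C) = (1 - a.C - θ * a.A₂ ^ 2) / (1 - a.C) := by
    field_simp
  have : θ * a.A₁ ^ 2 * x ^ 2 / (2 * (1 - a.C)) +
      (θ * a.A₁ * a.A₂ * x / (1 - a.C)) ^ 2 / (2 * (1 - θ * a.A₂ ^ 2 / (1 - a.C))) =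
      θ * a.A₁ ^ 2 / (2 * (1 - a.C - θ * a.A₂ ^ 2)) * x ^ 2 := by
    rw [h3]
    have := hD.ne'
    have := hd.ne'
    field_simp
    ring
  linarith

/-- Without the noise patterns the spins and the hidden variables are independent of each other, so
the second-level average factorizes over the sites and the patterns. -/
lemma lvlU_start (hθ0 : 0 < θ) (hθ1 : θ ≤ 1) (hd : 0 < 1 - a.C)
    (hD : 0 < 1 - a.C - θ * a.A₂ ^ 2) (η : Spins N) (x : Lvl₁ P N K) :
    Real.log (lvlU (lawAux N K) θ (ham a η 0 1) x) =
      (θ * (-a.b₃ - (K - 1 : ℕ) / 2 * Real.log (1 - a.C)) + N * (θ * Real.log 2)) +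
      ∑ i, Real.log (coshAvg θ a.B₂ (a.b₂ / N * val (η i) + a.B₁ * x.2 (Sum.inl i))) +
      ∑ μ, (θ * a.A₁ ^ 2 / (2 * (1 - a.C - θ * a.A₂ ^ 2)) * x.2 (Sum.inr μ) ^ 2 -
        Real.log (1 - θ * a.A₂ ^ 2 / (1 - a.C)) / 2) := by
  set F : Fin N ⊕ Fin (K - 1) → ℝ → ℝ := Sum.elim
    (fun i y => Real.cosh ((a.b₂ / N * val (η i) + a.B₁ * x.2 (Sum.inl i)) + y * a.B₂) ^ θ)
    (fun μ y => Real.exp (θ * ((a.A₁ * x.2 (Sum.inr μ) + a.A₂ * y) ^ 2 / (2 * (1 - a.C))))) with hF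
  have hZ : ∀ y : Aux N K, zpow θ (ham a η 0 1) (x, y) =
      Real.exp (θ * (-a.b₃ - (K - 1 : ℕ) / 2 * Real.log (1 - a.C)) + N * (θ * Real.log 2)) *
        ∏ j, F j (y j) := by
    intro y
    simp only [zpow, zsum, ham_start, Real.exp_add, ← Finset.mul_sum]
    rw [← Real.exp_add, sum_exp_field, Real.mul_rpow (Real.exp_pos _).le
      (Finset.prod_nonneg fun i _ => by positivity), ← Real.exp_mul, Fintype.prod_sum_type]
    have e1 : (∏ i : Fin N, 2 * Real.cosh (a.b₂ / N * val (η i) + a.B₁ * x.2 (Sum.inl i) +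
        a.B₂ * y (Sum.inl i))) ^ θ = Real.exp (N * (θ * Real.log 2)) *
          ∏ i, F (Sum.inl i) (y (Sum.inl i)) := by
      rw [← Real.finsetProd_rpow _ _ fun i _ => by positivity]
      have : ∀ i : Fin N, (2 * Real.cosh (a.b₂ / N * val (η i) + a.B₁ * x.2 (Sum.inl i) +
          a.B₂ * y (Sum.inl i))) ^ θ =
            Real.exp (θ * Real.log 2) * F (Sum.inl i) (y (Sum.inl i)) := by
        intro i
        rw [Real.mul_rpow (by norm_num) (Real.cosh_pos _).le, Real.rpow_def_of_pos two_pos,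
          mul_comm (Real.log 2)]
        simp only [hF, Sum.elim_inl, mul_comm a.B₂]
      simp only [this, Finset.prod_mul_distrib, Finset.prod_const, Finset.card_univ,
        Fintype.card_fin, ← Real.exp_nat_mul]
    have e2 : ∏ μ, F (Sum.inr μ) (y (Sum.inr μ)) = Real.exp (θ *
        ∑ μ, (a.A₁ * x.2 (Sum.inr μ) + a.A₂ * y (Sum.inr μ)) ^ 2 / (2 * (1 - a.C))) := by
      simp only [hF, Sum.elim_inr]
      rw [← Real.exp_sum, Finset.mul_sum]
    have e3 : ∀ u v : ℝ, Real.exp ((u + v) * θ) = Real.exp (θ * u) * Real.exp (θ * v) :=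
      fun u v => by rw [← Real.exp_add]; congr 1; ring
    rw [e1, e2, e3]
    ring
  have hU : lvlU (lawAux N K) θ (ham a η 0 1) x =
      Real.exp (θ * (-a.b₃ - (K - 1 : ℕ) / 2 * Real.log (1 - a.C)) + N * (θ * Real.log 2)) *
        ((∏ i, coshAvg θ a.B₂ (a.b₂ / N * val (η i) + a.B₁ * x.2 (Sum.inl i))) *
        Real.exp (∑ μ, (θ * a.A₁ ^ 2 / (2 * (1 - a.C - θ * a.A₂ ^ 2)) * x.2 (Sum.inr μ) ^ 2 -
          Real.log (1 - θ * a.A₂ ^ 2 / (1 - a.C)) / 2))) := by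
    rw [lvlU]
    simp only [hZ]
    rw [integral_const_mul, lawAux, iidGaussian, integral_fintype_prod_eq_prod,
      Fintype.prod_sum_type, Real.exp_sum]
    simp only [hF, Sum.elim_inl, Sum.elim_inr, integral_hid hd hD]
    rfl
  have hG : ∀ i, 0 < coshAvg θ a.B₂ (a.b₂ / N * val (η i) + a.B₁ * x.2 (Sum.inl i)) := fun i =>
    zero_lt_one.trans_le (one_le_coshAvg hθ0 hθ1 _ _)
  rw [hU, Real.log_mul (Real.exp_pos _).ne'
    (mul_pos (Finset.prod_pos fun i _ => hG i) (Real.exp_pos _)).ne',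
    Real.log_mul (Finset.prod_pos fun i _ => hG i).ne' (Real.exp_pos _).ne', Real.log_exp,
    Real.log_exp, Real.log_prod fun i _ => (hG i).ne', ← add_assoc]

lemma integral_sq_stdG : ∫ x, x ^ 2 ∂stdG = 1 := by
  have hid : MemLp (fun x : ℝ => x) 2 stdG := memLp_id_gaussianReal' 2 (by simp)
  have h := gaussian_ibp (G := fun x => x) (G' := fun _ => 1) (fun s => hasDerivAt_id' s)
    (hid.integrable (by norm_num)) (by simpa [sq] using hid.integrable_sq) (integrable_const _)
  simpa [sq] using h

/-- The free energy of the one-body system. The first pattern disappears, because `cosh` is even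
and the Gaussian law symmetric. -/
lemma free_energy_start (hθ0 : 0 < θ) (hθ1 : θ ≤ 1) (hd : 0 < 1 - a.C)
    (hD : 0 < 1 - a.C - θ * a.A₂ ^ 2) (η : Spins N) :
    ∫ x, Real.log (lvlU (lawAux N K) θ (ham a η 0 1) x) ∂(law₁ P N K) =
      (θ * (-a.b₃ - (K - 1 : ℕ) / 2 * Real.log (1 - a.C)) + N * (θ * Real.log 2)) +
      N * ∫ x, Real.log (coshAvg θ a.B₂ (a.b₂ / N + a.B₁ * x)) ∂stdG +
      (K - 1 : ℕ) * (θ * a.A₁ ^ 2 / (2 * (1 - a.C - θ * a.A₂ ^ 2)) -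
        Real.log (1 - θ * a.A₂ ^ 2 / (1 - a.C)) / 2) := by
  simp only [lvlU_start hθ0 hθ1 hd hD]
  have hid : MemLp (fun x : ℝ => x) 2 stdG := memLp_id_gaussianReal' 2 (by simp)
  have hsq : Integrable (fun x : ℝ => θ * a.A₁ ^ 2 / (2 * (1 - a.C - θ * a.A₂ ^ 2)) * x ^ 2 -
        Real.log (1 - θ * a.A₂ ^ 2 / (1 - a.C)) / 2) stdG :=
    (hid.integrable_sq.const_mul _).sub (integrable_const _)
  have hmp : ∀ j : Fin N ⊕ Fin (K - 1), MeasurePreserving (fun x : Lvl₁ P N K => x.2 j)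
      (law₁ P N K) stdG := fun j =>
    (measurePreserving_eval (fun _ : Fin N ⊕ Fin (K - 1) => stdG) j).comp measurePreserving_snd
  have i1 : ∀ i : Fin N, Integrable (fun x : Lvl₁ P N K =>
      Real.log (coshAvg θ a.B₂ (a.b₂ / N * val (η i) + a.B₁ * x.2 (Sum.inl i)))) (law₁ P N K) :=
    fun i => (hmp (Sum.inl i)).integrable_comp_of_integrable
      (integrable_log_coshAvg hθ0 hθ1 _ _ _)
  have i2 : ∀ μ : Fin (K - 1), Integrable (fun x : Lvl₁ P N K =>
      θ * a.A₁ ^ 2 / (2 * (1 - a.C - θ * a.A₂ ^ 2)) * x.2 (Sum.inr μ) ^ 2 -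
        Real.log (1 - θ * a.A₂ ^ 2 / (1 - a.C)) / 2) (law₁ P N K) :=
    fun μ => (hmp (Sum.inr μ)).integrable_comp_of_integrable hsq
  have v1 : ∀ i : Fin N, ∫ x : Lvl₁ P N K,
      Real.log (coshAvg θ a.B₂ (a.b₂ / N * val (η i) + a.B₁ * x.2 (Sum.inl i))) ∂(law₁ P N K) =
        ∫ x, Real.log (coshAvg θ a.B₂ (a.b₂ / N + a.B₁ * x)) ∂stdG := by
    intro i
    rw [← integral_log_coshAvg_val θ a.B₂ a.B₁ (a.b₂ / N) (η i), ← (hmp (Sum.inl i)).map_eq,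
      integral_map (hmp _).measurable.aemeasurable]
    rw [(hmp _).map_eq]
    exact (integrable_log_coshAvg hθ0 hθ1 _ _ _).aestronglyMeasurable
  have v2 : ∀ μ : Fin (K - 1), ∫ x : Lvl₁ P N K,
      (θ * a.A₁ ^ 2 / (2 * (1 - a.C - θ * a.A₂ ^ 2)) * x.2 (Sum.inr μ) ^ 2 -
        Real.log (1 - θ * a.A₂ ^ 2 / (1 - a.C)) / 2) ∂(law₁ P N K) =
      θ * a.A₁ ^ 2 / (2 * (1 - a.C - θ * a.A₂ ^ 2)) -
        Real.log (1 - θ * a.A₂ ^ 2 / (1 - a.C)) / 2 := by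
    intro μ
    have e : ∫ x, (θ * a.A₁ ^ 2 / (2 * (1 - a.C - θ * a.A₂ ^ 2)) * x ^ 2 -
        Real.log (1 - θ * a.A₂ ^ 2 / (1 - a.C)) / 2) ∂stdG =
        θ * a.A₁ ^ 2 / (2 * (1 - a.C - θ * a.A₂ ^ 2)) -
        Real.log (1 - θ * a.A₂ ^ 2 / (1 - a.C)) / 2 := by
      rw [integral_sub (hid.integrable_sq.const_mul _) (integrable_const _), integral_const_mul,
        integral_sq_stdG]
      simp
    rw [← e, ← (hmp (Sum.inr μ)).map_eq, integral_map (hmp _).measurable.aemeasurable]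
    rw [(hmp _).map_eq]
    exact hsq.aestronglyMeasurable
  have s1 := integrable_finsetSum Finset.univ fun i _ => i1 i
  have s2 := integrable_finsetSum Finset.univ fun μ _ => i2 μ
  refine (integral_add ((integrable_const _).add s1) s2).trans ?_
  rw [integral_add' (integrable_const _) s1, integral_finsetSum _ fun i _ => i1 i,
    integral_finsetSum _ fun μ _ => i2 μ]
  simp only [v1, v2, integral_const, probReal_univ, one_smul, Finset.sum_const, Finset.card_univ,
    Fintype.card_fin, nsmul_eq_mul]

end Start

/-! ### Scaling of the couplings with the size -/

section Scaling

variable {P : ℕ} {β γ : ℝ} {o : OrderParameters}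

/-- The scale `N ^ (P/2 - 1)` of the overlap of the hidden variables. -/
def nn (P N : ℕ) : ℝ := (N : ℝ) ^ (P / 2 - 1)

/-- The variance `β' / N ^ (P/2 - 1)` of the field acting on a hidden variable. -/
def eps (P : ℕ) (β : ℝ) (N : ℕ) : ℝ := betaEff P β / nn P N

lemma betaEff_pos (hβ : 0 < β) : 0 < betaEff P β := by
  unfold betaEff
  have := Nat.factorial_pos P
  positivity

lemma nn_pos {N : ℕ} (hN : 0 < N) : 0 < nn P N := by
  unfold nn; positivity

lemma tendsto_nn (hP : 4 ≤ P) : Tendsto (nn P) atTop atTop := by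
  have h : P / 2 - 1 ≠ 0 := by omega
  exact (tendsto_pow_atTop h).comp tendsto_natCast_atTop_atTop

lemma tendsto_eps (hP : 4 ≤ P) : Tendsto (eps P β) atTop (𝓝 0) :=
  tendsto_const_nhds.div_atTop (tendsto_nn hP)

lemma pow_pred_eq (hPe : Even P) (hP : 4 ≤ P) (N : ℕ) : (N : ℝ) ^ (P - 1) = N * nn P N ^ 2 := by
  have h : P - 1 = 1 + (P / 2 - 1) * 2 := by
    obtain ⟨k, rfl⟩ := hPe; omega
  rw [nn, h, pow_add, pow_one, pow_mul]

lemma pow_div_pow_eq (hPe : Even P) (hP : 4 ≤ P) {N : ℕ} (hN : 0 < N) :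
    (N : ℝ) ^ P / (N : ℝ) ^ (P / 2) = N * nn P N := by
  have h : P = P / 2 + (1 + (P / 2 - 1)) := by
    obtain ⟨k, rfl⟩ := hPe; omega
  have h0 : (N : ℝ) ≠ 0 := by positivity
  rw [nn, div_eq_iff (by positivity)]
  nth_rewrite 1 [h]
  rw [pow_add, pow_add, pow_one]
  ring

lemma pow_half_eq (hP : 4 ≤ P) (N : ℕ) : (N : ℝ) ^ (P / 2) = N * nn P N := by
  have h : P / 2 = 1 + (P / 2 - 1) := by omega
  rw [nn]
  nth_rewrite 1 [h]
  rw [pow_add, pow_one]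

lemma abs_numPatterns_sub (hPe : Even P) (hP : 4 ≤ P) (hγ : 0 < γ) (N : ℕ) :
    |(numPatterns γ (P - 1) N : ℝ) - γ * (N * nn P N ^ 2)| ≤ 1 := by
  rw [← pow_pred_eq hPe hP]
  have h0 : 0 ≤ γ * (N : ℝ) ^ (P - 1) := by positivity
  have h1 := Nat.floor_le h0
  have h2 := Nat.lt_floor_add_one (γ * (N : ℝ) ^ (P - 1))
  rw [numPatterns, abs_le]
  constructor <;> linarith

lemma abs_numPatterns_pred_sub (hPe : Even P) (hP : 4 ≤ P) (hγ : 0 < γ) (N : ℕ) :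
    |((numPatterns γ (P - 1) N - 1 : ℕ) : ℝ) - γ * (N * nn P N ^ 2)| ≤ 2 := by
  have h1 := abs_le.1 (abs_numPatterns_sub hPe hP hγ N)
  rcases Nat.eq_zero_or_pos (numPatterns γ (P - 1) N) with h | h
  · rw [h] at h1 ⊢
    rw [abs_le]
    push_cast at h1 ⊢
    constructor <;> linarith
  · rw [Nat.cast_sub h, abs_le]
    push_cast
    constructor <;> linarith

lemma tendsto_size_mul_nn (hP : 4 ≤ P) : Tendsto (fun N : ℕ => N * nn P N ^ 2) atTop atTop := by
  have h1 : Tendsto (fun N : ℕ => (N : ℝ)) atTop atTop := tendsto_natCast_atTop_atTop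
  exact h1.atTop_mul_atTop₀ ((tendsto_pow_atTop two_ne_zero).comp (tendsto_nn hP))

lemma tendsto_ratio {x y : ℕ → ℝ} {c B : ℝ} (hy : Tendsto y atTop atTop)
    (h : ∀ N, |x N - c * y N| ≤ B) : Tendsto (fun N => x N / y N) atTop (𝓝 c) := by
  have h1 : Tendsto (fun N => (x N - c * y N) / y N) atTop (𝓝 0) := by
    refine squeeze_zero_norm' ?_ (tendsto_const_nhds (x := B).div_atTop hy)
    filter_upwards [hy.eventually_gt_atTop 0] with N hN
    rw [Real.norm_eq_abs, abs_div, abs_of_pos hN]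
    exact div_le_div_of_nonneg_right (h N) hN.le
  have h2 := h1.const_add c
  rw [add_zero] at h2
  refine h2.congr' ?_
  filter_upwards [hy.eventually_gt_atTop 0] with N hN
  field_simp
  ring

/-- The number of patterns per `N nn²`. -/
lemma tendsto_load (hPe : Even P) (hP : 4 ≤ P) (hγ : 0 < γ) :
    Tendsto (fun N : ℕ => (numPatterns γ (P - 1) N : ℝ) / (N * nn P N ^ 2)) atTop (𝓝 γ) :=
  tendsto_ratio (tendsto_size_mul_nn hP) (abs_numPatterns_sub hPe hP hγ)

lemma tendsto_load_pred (hPe : Even P) (hP : 4 ≤ P) (hγ : 0 < γ) :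
    Tendsto (fun N : ℕ => ((numPatterns γ (P - 1) N - 1 : ℕ) : ℝ) / (N * nn P N ^ 2)) atTop (𝓝 γ) :=
  tendsto_ratio (tendsto_size_mul_nn hP) (abs_numPatterns_pred_sub hPe hP hγ)

lemma tendsto_numPatterns (hPe : Even P) (hP : 4 ≤ P) (hγ : 0 < γ) :
    Tendsto (fun N : ℕ => (numPatterns γ (P - 1) N : ℝ)) atTop atTop := by
  have h := (tendsto_load hPe hP hγ).pos_mul_atTop hγ (tendsto_size_mul_nn hP)
  refine h.congr' ?_
  filter_upwards [(tendsto_size_mul_nn hP).eventually_gt_atTop 0] with N hN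
  exact div_mul_cancel₀ _ hN.ne'

lemma coefA₁_sq (hβ : 0 < β) (hQ : 0 ≤ o.q₁ ^ (P / 2)) (N : ℕ) :
    coefA₁ P β o N ^ 2 = eps P β N * o.q₁ ^ (P / 2) :=
  Real.sq_sqrt (mul_nonneg (div_nonneg (betaEff_pos hβ).le (by positivity)) hQ)

lemma coefA₂_sq (hβ : 0 < β) (hQ : 0 ≤ o.q₂ ^ (P / 2) - o.q₁ ^ (P / 2)) (N : ℕ) :
    coefA₂ P β o N ^ 2 = eps P β N * (o.q₂ ^ (P / 2) - o.q₁ ^ (P / 2)) :=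
  Real.sq_sqrt (mul_nonneg (div_nonneg (betaEff_pos hβ).le (by positivity)) hQ)

lemma sq_sqrt_le_abs (x : ℝ) : √x ^ 2 ≤ |x| := by
  rcases le_total 0 x with h | h
  · rw [Real.sq_sqrt h, abs_of_nonneg h]
  · rw [Real.sqrt_eq_zero_of_nonpos h]; simp

lemma kappa_sq (hPe : Even P) (hP : 4 ≤ P) (hβ : 0 < β) {N : ℕ} (hN : 0 < N) :
    (netCouplings P β γ o N).κ ^ 2 * (N : ℝ) ^ (P / 2) = eps P β N := by
  have h0 := betaEff_pos (P := P) hβ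
  have h1 := nn_pos (P := P) hN
  have h2 : (0 : ℝ) < N := by exact_mod_cast hN
  simp only [netCouplings]
  rw [Real.sq_sqrt (by positivity), pow_pred_eq hPe hP, pow_half_eq hP, eps]
  field_simp

/-- The couplings are small when the system is large. -/
lemma eventually_small (hPe : Even P) (hP : 4 ≤ P) (hβ : 0 < β) :
    ∀ᶠ N : ℕ in atTop, Small (netCouplings P β γ o N) P N := by
  have hb := betaEff_pos (P := P) hβ
  have h := tendsto_eps (P := P) (β := β) hP
  have hc : ∀ c : ℝ, ∀ δ > 0, ∀ᶠ N in atTop, |eps P β N * c| < δ := fun c δ hδ => by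
    have := (h.mul_const c).abs
    rw [zero_mul, abs_zero] at this
    exact this.eventually_lt_const hδ
  filter_upwards [hc (1 - o.q₂ ^ (P / 2)) (1 / 2) (by norm_num), hc 1 (1 / 200) (by norm_num),
    hc (o.q₁ ^ (P / 2)) (1 / 200) (by norm_num),
    hc (o.q₂ ^ (P / 2) - o.q₁ ^ (P / 2)) (1 / 200) (by norm_num), eventually_gt_atTop 0]
    with N h1 h2 h3 h4 hN
  refine ⟨h1.le, ?_, (sq_sqrt_le_abs _).trans h3.le, (sq_sqrt_le_abs _).trans h4.le, ?_, hPe⟩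
  · rw [kappa_sq hPe hP hβ hN]
    rw [mul_one] at h2
    exact (le_abs_self _).trans h2.le
  · change 0 ≤ betaEff P β * N / 2
    positivity

end Scaling

section StartLimit

variable {P : ℕ} {β γ : ℝ} {o : OrderParameters}

/-- Second-order expansion of the logarithm along a sequence. -/
lemma tendsto_sq_mul_log {x n : ℕ → ℝ} {y : ℝ} (hn : Tendsto n atTop atTop)
    (hx : Tendsto (fun N => n N * x N) atTop (𝓝 y)) :
    Tendsto (fun N => n N ^ 2 * (-Real.log (1 - x N) - x N)) atTop (𝓝 (y ^ 2 / 2)) := by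
  have hpos := hn.eventually_gt_atTop 0
  have hx0 : Tendsto x atTop (𝓝 0) := by
    refine (hx.div_atTop hn).congr' ?_
    filter_upwards [hpos] with N hN
    field_simp
  have h1 : Tendsto (fun N => n N ^ 2 * (-Real.log (1 - x N) - x N) - (n N * x N) ^ 2 / 2) atTop
      (𝓝 0) := by
    have h2 : Tendsto (fun N => 2 * |n N * x N| ^ 3 / n N) atTop (𝓝 0) :=
      ((hx.abs.pow 3).const_mul 2).div_atTop hn
    refine squeeze_zero_norm' ?_ h2
    filter_upwards [hpos, hx0.abs.eventually_le_const
      (by norm_num : |(0 : ℝ)| < 1 / 2)] with N hN hxN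
    have h3 := Real.abs_log_sub_add_sum_range_le (x := x N) (by linarith) 2
    simp only [Finset.sum_range_succ, Finset.sum_range_zero] at h3
    have h4 : |x N| ^ (2 + 1) / (1 - |x N|) ≤ 2 * |x N| ^ 3 := by
      rw [div_le_iff₀ (by linarith)]
      have := pow_nonneg (abs_nonneg (x N)) 3
      change |x N| ^ 3 ≤ _
      nlinarith [mul_nonneg this (by linarith : 0 ≤ 1 / 2 - |x N|)]
    rw [Real.norm_eq_abs]
    have e : n N ^ 2 * (-Real.log (1 - x N) - x N) - (n N * x N) ^ 2 / 2 =
        -(n N ^ 2 * (x N + x N ^ 2 / 2 + Real.log (1 - x N))) := by ring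
    rw [e, abs_neg, abs_mul, abs_of_nonneg (sq_nonneg _), abs_mul, abs_of_pos hN]
    have h5 : |x N + x N ^ 2 / 2 + Real.log (1 - x N)| ≤ 2 * |x N| ^ 3 := by
      refine le_trans (le_of_eq ?_) (h3.trans h4)
      norm_num
    calc n N ^ 2 * |x N + x N ^ 2 / 2 + Real.log (1 - x N)| ≤ n N ^ 2 * (2 * |x N| ^ 3) := by gcongr
      _ = _ := by field_simp
  have h2 := h1.add ((hx.pow 2).div_const 2)
  rw [zero_add] at h2
  exact h2.congr fun N => by ring

lemma start_identity {e u v Q θ : ℝ} (hd : 1 - e * u ≠ 0) (hD : 1 - e * u - θ * (e * v) ≠ 0)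
    (h : u + v + Q = 1) :
    e * Q / (2 * (1 - e * u - θ * (e * v))) + e * v / (1 - e * u) / 2 + e * u / 2 =
      e / 2 + e ^ 2 / 2 * (u * v / (1 - e * u) +
        Q * (u + θ * v) / (1 - e * u - θ * (e * v))) := by
  have h1 : e * v / (1 - e * u) = e * v + e ^ 2 * (u * v / (1 - e * u)) := by
    generalize hd' : 1 - e * u = d at *
    field_simp
    rw [← hd']; ring
  have h2 : e * Q / (2 * (1 - e * u - θ * (e * v))) = e * Q / 2 +
      e ^ 2 / 2 * (Q * (u + θ * v) / (1 - e * u - θ * (e * v))) := by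
    generalize hd' : 1 - e * u - θ * (e * v) = d at *
    field_simp
    rw [← hd']; ring
  rw [h1, h2]
  linear_combination e / 2 * h

lemma log_coshAvg_effField (x : ℝ) :
    coshAvg o.θ (coefB₂ P β γ o) (psi P β o + coefB₁ P β γ o * x) =
      ∫ y, Real.cosh (effField P β γ o x y) ^ o.θ ∂(gaussianReal 0 1) := by
  rw [coshAvg]
  congr 1; ext y
  congr 2
  rw [effField, psi, coefB₁, coefB₂]
  have e1 : betaEff P β / 2 * γ * P * (o.p₁ * o.q₁ ^ (P / 2 - 1)) =
      betaEff P β / 2 * γ * o.p₁ * P * o.q₁ ^ (P / 2 - 1) := by ring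
  have e2 : betaEff P β / 2 * γ * P * (o.p₂ * o.q₂ ^ (P / 2 - 1) - o.p₁ * o.q₁ ^ (P / 2 - 1)) =
      betaEff P β / 2 * P * γ * (o.p₂ * o.q₂ ^ (P / 2 - 1) - o.p₁ * o.q₁ ^ (P / 2 - 1)) := by ring
  rw [e1, e2]
  ring

/-- The free energy at the beginning of the interpolation. -/
def startLimit (P : ℕ) (β γ : ℝ) (o : OrderParameters) : ℝ :=
  Real.log 2
    + 1 / o.θ * ∫ x, Real.log (∫ y, Real.cosh (effField P β γ o x y) ^ o.θ ∂(gaussianReal 0 1))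
        ∂(gaussianReal 0 1)
    + γ * betaEff P β ^ 2 / 4 * ((1 - (o.q₂ ^ (P / 2)) ^ 2) +
        o.θ * ((o.q₂ ^ (P / 2)) ^ 2 - (o.q₁ ^ (P / 2)) ^ 2))

/-- The limit of the free energy of the one-body system. The terms of order `N ^ (P / 2 - 1)` from
the hidden variables cancel against the constant of the Hamiltonian; what is left is of second order
in `eps`, since the number of hidden variables per spin grows like `1 / eps ^ 2`. -/
lemma tendsto_start (hPe : Even P) (hP : 4 ≤ P) (hβ : 0 < β) (hγ : 0 < γ) (hθ0 : 0 < o.θ)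
    (hθ1 : o.θ ≤ 1) (hQ₁ : 0 ≤ o.q₁ ^ (P / 2)) (hQ₂ : 0 ≤ o.q₂ ^ (P / 2) - o.q₁ ^ (P / 2))
    {G : ℕ → ℝ} (hG : ∀ᶠ N : ℕ in atTop, ∃ η : Spins N,
      G N = 1 / (o.θ * N) * ∫ x, Real.log (lvlU (lawAux N (numPatterns γ (P - 1) N)) o.θ
        (ham (netCouplings P β γ o N) η 0 1) x) ∂(law₁ P N (numPatterns γ (P - 1) N))) :
    Tendsto G atTop (𝓝 (startLimit P β γ o)) := by
  have hb := betaEff_pos (P := P) hβ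
  set b := betaEff P β with hbdef
  set Q₁ := o.q₁ ^ (P / 2) with hQ1def
  set Q₂ := o.q₂ ^ (P / 2) with hQ2def
  set u := 1 - Q₂ with hu
  set v := Q₂ - Q₁ with hv
  set θ := o.θ with hθ
  set I := ∫ x, Real.log (∫ y, Real.cosh (effField P β γ o x y) ^ θ ∂(gaussianReal 0 1))
        ∂(gaussianReal 0 1) with hI
  set n := nn P with hn
  set e := eps P β with he
  set k : ℕ → ℝ := fun N => ((numPatterns γ (P - 1) N - 1 : ℕ) : ℝ) with hk
  have tn : Tendsto n atTop atTop := tendsto_nn hP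
  have te : Tendsto e atTop (𝓝 0) := tendsto_eps hP
  have tl : Tendsto (fun N : ℕ => k N / (N * n N ^ 2)) atTop (𝓝 γ) := tendsto_load_pred hPe hP hγ
  have hne : ∀ᶠ N in atTop, n N * e N = b := by
    filter_upwards [tn.eventually_gt_atTop 0] with N hN
    change n N * (b / n N) = b
    field_simp
  have tne : Tendsto (fun N => n N * e N) atTop (𝓝 b) :=
    tendsto_const_nhds.congr' (hne.mono fun N h => h.symm)
  have td : Tendsto (fun N => 1 - e N * u) atTop (𝓝 1) := by
    simpa using (te.mul_const u).const_sub 1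
  have tD : Tendsto (fun N => 1 - e N * u - θ * (e N * v)) atTop (𝓝 1) := by
    simpa using td.sub ((te.mul_const v).const_mul θ)
  -- The first-order terms of the logarithms are collected separately; here only the second order.
  have t1 : Tendsto (fun N => n N ^ 2 * (-Real.log (1 - e N * u) - e N * u)) atTop
      (𝓝 ((b * u) ^ 2 / 2)) := by
    refine tendsto_sq_mul_log tn ((tne.mul_const u).congr fun N => by ring)
  have t2 : Tendsto (fun N => n N ^ 2 * (-Real.log (1 - θ * (e N * v) / (1 - e N * u)) -
      θ * (e N * v) / (1 - e N * u))) atTop (𝓝 ((b * (θ * v)) ^ 2 / 2)) := by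
    refine tendsto_sq_mul_log tn ?_
    have := (tne.mul_const (θ * v)).div td one_ne_zero
    rw [div_one] at this
    exact this.congr fun N => by simp only [Pi.div_apply]; ring
  have t3 : Tendsto (fun N => (n N * e N) ^ 2 / 2 * (u * v / (1 - e N * u) +
      Q₁ * (u + θ * v) / (1 - e N * u - θ * (e N * v)))) atTop
      (𝓝 (b ^ 2 / 2 * (u * v / 1 + Q₁ * (u + θ * v) / 1))) :=
    ((tne.pow 2).div_const 2).mul ((tendsto_const_nhds.div td one_ne_zero).add
      (tendsto_const_nhds.div tD one_ne_zero))
  -- The integer part in the number of patterns changes the cancelling terms by `O(eps / N)`.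
  have t4 : Tendsto (fun N : ℕ => e N / 2 * ((k N - γ * (N * n N ^ 2)) / N)) atTop (𝓝 0) := by
    have h1 : Tendsto (fun N : ℕ => (k N - γ * (N * n N ^ 2)) / N) atTop (𝓝 0) := by
      refine squeeze_zero_norm' (a := fun N : ℕ => 2 / (N : ℝ)) ?_
        (tendsto_const_nhds.div_atTop tendsto_natCast_atTop_atTop)
      filter_upwards with N
      rw [Real.norm_eq_abs, abs_div, Nat.abs_cast]
      exact div_le_div_of_nonneg_right (abs_numPatterns_pred_sub hPe hP hγ N) (Nat.cast_nonneg _)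
    simpa using (te.div_const 2).mul h1
  have hlim := ((tendsto_const_nhds (x := Real.log 2 + 1 / θ * I)).add
    (tl.mul (((t1.div_const 2).add (t2.div_const (2 * θ))).add t3))).add t4
  have hval : Real.log 2 + 1 / θ * I + γ * ((b * u) ^ 2 / 2 / 2 + (b * (θ * v)) ^ 2 / 2 / (2 * θ) +
      b ^ 2 / 2 * (u * v / 1 + Q₁ * (u + θ * v) / 1)) + 0 = startLimit P β γ o := by
    rw [startLimit, ← hQ1def, ← hQ2def, ← hbdef, ← hθ, ← hI, hu, hv]
    field_simp
    ring
  rw [hval] at hlim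
  refine hlim.congr' ?_
  filter_upwards [hG, hne, td.eventually_const_lt one_pos, tD.eventually_const_lt one_pos,
    eventually_gt_atTop 0, tn.eventually_gt_atTop 0] with N hGN hneN hdN hDN hN hnN
  obtain ⟨η, hη⟩ := hGN
  have hN0 : (0 : ℝ) < N := by exact_mod_cast hN
  have eA₁ : (netCouplings P β γ o N).A₁ ^ 2 = e N * Q₁ := coefA₁_sq hβ hQ₁ N
  have eA₂ : (netCouplings P β γ o N).A₂ ^ 2 = e N * v := coefA₂_sq hβ hQ₂ N
  have eC : (netCouplings P β γ o N).C = e N * u := rfl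
  have eb₂ : (netCouplings P β γ o N).b₂ / N = psi P β o := by
    change N * psi P β o / N = _
    field_simp
  have eb₃ : (netCouplings P β γ o N).b₃ = b * γ / 2 * (N * n N) := by
    change b * γ / 2 * ((N : ℝ) ^ P / (N : ℝ) ^ (P / 2)) = _
    rw [pow_div_pow_eq hPe hP hN]
  rw [hη, free_energy_start hθ0 hθ1 (by rw [eC]; exact hdN) (by rw [eC, eA₂]; exact hDN), eA₁, eA₂,
    eC, eb₂, eb₃]
  have eI : ∫ x, Real.log (coshAvg o.θ (netCouplings P β γ o N).B₂
      (psi P β o + (netCouplings P β γ o N).B₁ * x)) ∂stdG = I := by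
    rw [hI]
    congr 1; ext x
    rw [← log_coshAvg_effField]
    rfl
  rw [eI]
  have hd0 := hdN.ne'
  have hD0 := hDN.ne'
  have hb' : b = n N * e N := hneN.symm
  have huv : u + v + Q₁ = 1 := by rw [hu, hv]; ring
  rw [hb']
  generalize Real.log (1 - e N * u) = l₁
  generalize Real.log (1 - θ * (e N * v) / (1 - e N * u)) = l₂
  have hkk : ((numPatterns γ (P - 1) N - 1 : ℕ) : ℝ) = k N := rfl
  rw [hkk]
  have hmain2 : e N * Q₁ / (2 * (1 - e N * u - θ * (e N * v))) =
      e N / 2 + e N ^ 2 / 2 * (u * v / (1 - e N * u) +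
        Q₁ * (u + θ * v) / (1 - e N * u - θ * (e N * v))) - e N * v / (1 - e N * u) / 2 -
        e N * u / 2 := by
    have := start_identity hd0 hD0 huv
    linarith
  have hmain3 : θ * (e N * Q₁) / (2 * (1 - e N * u - θ * (e N * v))) =
      θ * (e N * Q₁ / (2 * (1 - e N * u - θ * (e N * v)))) := by ring
  rw [hmain3, hmain2]
  generalize (u * v / (1 - e N * u) + Q₁ * (u + θ * v) / (1 - e N * u - θ * (e N * v))) = w
  field_simp
  ring

end StartLimit

/-! ### Concentration of observables under a mean -/

section Mean

variable {S T Ω : Type*} [Fintype S] [Fintype T] [MeasurableSpace Ω] {ν : Measure Ω}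
  {k f : T → Ω → ℝ}

/-- Nonnegative weights of total mass `1`. -/
structure MeanKer (ν : Measure Ω) (k : T → Ω → ℝ) : Prop where
  nonneg : ∀ t ω, 0 ≤ k t ω
  int : KInt ν k fun _ _ => 1
  one : kavg ν k (fun _ _ => 1) = 1

lemma KInt.fun_mul (hf : KInt ν k f) (w : T → ℝ) : KInt ν k fun t ω => w t * f t ω := fun t => by
  refine ((hf t).const_mul (w t)).congr (ae_of_all _ fun ω => ?_)
  simp only; ring

lemma MeanKer.int_fun (h : MeanKer ν k) (w : T → ℝ) : KInt ν k fun t _ => w t := fun t => by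
  refine ((h.int t).const_mul (w t)).congr (ae_of_all _ fun ω => ?_)
  simp only; ring

lemma MeanKer.sq_le (h : MeanKer ν k) (hf : KInt ν k f) (hf2 : KInt ν k fun t ω => f t ω ^ 2) :
    kavg ν k f ^ 2 ≤ kavg ν k fun t ω => f t ω ^ 2 := by
  set a := kavg ν k f
  have h0 := kavg_nonneg (ν := ν) h.nonneg (f := fun t ω => (f t ω - a) ^ 2)
    fun _ _ => sq_nonneg _
  have e : kavg ν k (fun t ω => (f t ω - a) ^ 2) = kavg ν k (fun t ω => f t ω ^ 2) - a ^ 2 := by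
    rw [kavg_congr (g := fun t ω => (f t ω ^ 2 - 2 * a * f t ω) + a ^ 2) fun t ω => by ring,
      kavg_add (hf2.sub (hf.const_mul _)) (h.int_fun _), kavg_sub hf2 (hf.const_mul _),
      kavg_const_mul (2 * a), kavg_const h.one]
    ring
  linarith

lemma MeanKer.le_sqrt (h : MeanKer ν k) (hf : KInt ν k f)
    (hf2 : KInt ν k fun t ω => f t ω ^ 2) : kavg ν k f ≤ √(kavg ν k fun t ω => f t ω ^ 2) :=
  (le_abs_self _).trans (Real.abs_le_sqrt (h.sq_le hf hf2))

lemma MeanKer.abs_le (h : MeanKer ν k) {w : T → ℝ} {B : ℝ} (hw : ∀ t, |w t| ≤ B) :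
    |kavg ν k fun t _ => w t| ≤ B := by
  have := abs_kavg_le h.nonneg (h.int_fun w) (h.int_fun fun _ => B) fun t _ => hw t
  rwa [kavg_const h.one] at this

/-- A Lipschitz constant of `x ↦ x ^ n` between `[-1, 1]` and `x₀`. -/
def powLip (n : ℕ) (x₀ : ℝ) : ℝ := n * max 1 |x₀| ^ (n - 1)

lemma powLip_nonneg (n : ℕ) (x₀ : ℝ) : 0 ≤ powLip n x₀ := by
  unfold powLip
  positivity

lemma abs_pow_sub_le_powLip {x x₀ : ℝ} (hx : |x| ≤ 1) (n : ℕ) :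
    |x ^ n - x₀ ^ n| ≤ powLip n x₀ * |x - x₀| := by
  refine (abs_pow_sub_pow_le x x₀ n).trans ?_
  rw [powLip, mul_comm _ |x - x₀|, mul_assoc]
  gcongr

lemma MeanKer.kavg_abs_pow_sub_le (h : MeanKer ν k) {w : T → ℝ} (hw : ∀ t, |w t| ≤ 1) (n : ℕ)
    (x₀ : ℝ) : kavg ν k (fun t _ => |w t ^ n - x₀ ^ n|) ≤
      powLip n x₀ * √(kavg ν k fun t _ => (w t - x₀) ^ 2) := by
  have h1 := kavg_mono h.nonneg (h.int_fun fun t => |w t ^ n - x₀ ^ n|)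
    (h.int_fun fun t => powLip n x₀ * |w t - x₀|) fun t _ => abs_pow_sub_le_powLip (hw t) n
  have h2 := h.le_sqrt (h.int_fun fun t => |w t - x₀|) (h.int_fun fun t => |w t - x₀| ^ 2)
  simp only [sq_abs] at h2
  rw [kavg_const_mul (powLip n x₀)] at h1
  exact h1.trans (mul_le_mul_of_nonneg_left h2 (powLip_nonneg _ _))

lemma MeanKer.abs_pow_sub_le (h : MeanKer ν k) {w : T → ℝ} (hw : ∀ t, |w t| ≤ 1) (n : ℕ)
    (x₀ : ℝ) : |kavg ν k (fun t _ => w t ^ n) - x₀ ^ n| ≤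
      powLip n x₀ * √(kavg ν k fun t _ => (w t - x₀) ^ 2) := by
  refine le_trans ?_ (h.kavg_abs_pow_sub_le hw n x₀)
  have e : kavg ν k (fun t _ => w t ^ n) - x₀ ^ n = kavg ν k (fun t _ => w t ^ n - x₀ ^ n) := by
    rw [kavg_sub (h.int_fun fun t => w t ^ n) (h.int_fun fun _ => x₀ ^ n), kavg_const h.one]
  rw [e]
  exact abs_kavg_le h.nonneg (h.int_fun fun t => w t ^ n - x₀ ^ n)
    (h.int_fun fun t => |w t ^ n - x₀ ^ n|) fun _ _ => le_rfl

/-- If both `w` and `f` concentrate, then the mean of `(w ^ n - x₀ ^ n) f` is small. -/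
lemma MeanKer.abs_pow_sub_mul_le (h : MeanKer ν k) {w : T → ℝ} (hw : ∀ t, |w t| ≤ 1) (n : ℕ)
    (x₀ y₀ : ℝ) (hf : KInt ν k f) (hf2 : KInt ν k fun t ω => (f t ω - y₀) ^ 2) :
    |kavg ν k (fun t ω => (w t ^ n - x₀ ^ n) * f t ω)| ≤
      powLip n x₀ ^ 2 / 2 * kavg ν k (fun t _ => (w t - x₀) ^ 2) +
      1 / 2 * kavg ν k (fun t ω => (f t ω - y₀) ^ 2) +
      |y₀| * (powLip n x₀ * √(kavg ν k fun t _ => (w t - x₀) ^ 2)) := by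
  set M := powLip n x₀
  have hM : 0 ≤ M := powLip_nonneg _ _
  have i1 := h.int_fun fun t => M ^ 2 / 2 * (w t - x₀) ^ 2
  have i2 : KInt ν k fun t ω => 1 / 2 * (f t ω - y₀) ^ 2 := hf2.const_mul _
  have i3 := h.int_fun fun t => |y₀| * |w t ^ n - x₀ ^ n|
  have key := abs_kavg_le h.nonneg (hf.fun_mul fun t => w t ^ n - x₀ ^ n) ((i1.add i2).add i3)
    fun t ω => by
      have h1 := abs_pow_sub_le_powLip (x₀ := x₀) (hw t) n
      have h2 : |w t ^ n - x₀ ^ n| ^ 2 ≤ M ^ 2 * (w t - x₀) ^ 2 := by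
        rw [← sq_abs (w t - x₀), ← mul_pow]
        exact pow_le_pow_left₀ (abs_nonneg _) h1 2
      have e : (w t ^ n - x₀ ^ n) * f t ω =
        (w t ^ n - x₀ ^ n) * (f t ω - y₀) + y₀ * (w t ^ n - x₀ ^ n) := by ring
      rw [e]
      refine (abs_add_le _ _).trans ?_
      rw [abs_mul, abs_mul]
      have h3 := sq_nonneg (|w t ^ n - x₀ ^ n| - |f t ω - y₀|)
      nlinarith [sq_abs (f t ω - y₀)]
  refine key.trans ?_
  rw [kavg_add (i1.add i2) i3, kavg_add i1 i2, kavg_const_mul (M ^ 2 / 2), kavg_const_mul (1 / 2),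
    kavg_const_mul |y₀|]
  gcongr
  exact h.kavg_abs_pow_sub_le hw n x₀

/-- The uniform mixture of a finite family of weights. -/
def mixKer (k : S → T → Ω → ℝ) (u : S × T) (ω : Ω) : ℝ := (Fintype.card S : ℝ)⁻¹ * k u.1 u.2 ω

lemma KInt.mix {k f : S → T → Ω → ℝ} (hf : ∀ s, KInt ν (k s) (f s)) :
    KInt ν (mixKer k) (fun u => f u.1 u.2) := fun u => by
  refine (((hf u.1) u.2).const_mul (Fintype.card S : ℝ)⁻¹).congr (ae_of_all _ fun ω => ?_)
  simp only [mixKer]; ring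

lemma kavg_mix {k f : S → T → Ω → ℝ} (hf : ∀ s, KInt ν (k s) (f s)) :
    kavg ν (mixKer k) (fun u => f u.1 u.2) =
      (Fintype.card S : ℝ)⁻¹ * ∑ s, kavg ν (k s) (f s) := by
  simp only [kavg, mixKer]
  rw [← integral_finsetSum _ fun s _ => (hf s).sum_integrable, ← integral_const_mul]
  refine integral_congr_ae (ae_of_all _ fun ω => ?_)
  simp only [Fintype.sum_prod_type, Finset.mul_sum, mul_assoc]

lemma MeanKer.mix [Nonempty S] {k : S → T → Ω → ℝ} (h : ∀ s, MeanKer ν (k s)) :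
    MeanKer ν (mixKer k) where
  nonneg u ω := mul_nonneg (by positivity) ((h u.1).nonneg u.2 ω)
  int := KInt.mix (f := fun _ _ _ => 1) fun s => (h s).int
  one := by
    have := kavg_mix (ν := ν) (k := k) (f := fun _ _ _ => 1) fun s => (h s).int
    rw [this]
    simp only [(h _).one, Finset.sum_const, Finset.card_univ, nsmul_eq_mul, mul_one]
    exact inv_mul_cancel₀ (by positivity)

end Mean

section EnvMean

variable {S X Y : Type*} [Fintype S] [Nonempty S] [MeasurableSpace X] [MeasurableSpace Y]
  {H : S → X × Y → ℝ} {θ : ℝ} {γX : Measure X} {γY : Measure Y} [IsProbabilityMeasure γX]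
  [IsProbabilityMeasure γY] {rX : X → ℝ} {rY : Y → ℝ}

lemma Env.mean₀ (hE : Env γX γY rX rY θ H) :
    MeanKer (γX.prod γY) (DenseHebbian.ker₀ γY θ H) :=
  ⟨ker₀_nonneg, hE.int₀ (δ := 0) (by norm_num) fun _ => GBdd.const 1, hE.avg₀_one⟩

lemma Env.mean₁ (hE : Env γX γY rX rY θ H) :
    MeanKer (γX.prod (γY.prod γY)) (DenseHebbian.ker₁ γY θ H) :=
  ⟨ker₁_nonneg, hE.int₁ (δ := 0) (by norm_num) fun _ => GBdd.const 1, hE.avg₁_one⟩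

lemma Env.mean₂ (hE : Env γX γY rX rY θ H) :
    MeanKer (γX.prod γY) (DenseHebbian.ker₂ γY θ H) :=
  ⟨ker₂_nonneg, hE.int₂ (δ := 0) (by norm_num) fun _ => GBdd.const 1, hE.avg₂_one⟩

end EnvMean

/-! ### Consequences of the concentration of the overlaps -/

section Conc

variable {P N K : ℕ} {β γ t : ℝ} {o : OrderParameters}

lemma powLip_one (x₀ : ℝ) : powLip 1 x₀ = 1 := by simp [powLip]

lemma card_spins_inv : (Fintype.card (Spins N) : ℝ)⁻¹ = 1 / 2 ^ N := by
  simp [Fintype.card_units_int]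

variable (P N K β γ t o) in
/-- The average `⟨(q₁₂ ^ (P/2) - q̄₂ ^ (P/2)) p₁₂⟩₂`, the hidden variables being replaced by their
conditional means. -/
def crossOv₂ : ℝ :=
  1 / 2 ^ N * ∑ η : Spins N, iAvg₂ (P := P) (K := K) (netCouplings P β γ o N) η √t √(1 - t) o.θ
    (fun u p => (overlapQ u.1 u.2 ^ (P / 2) - o.q₂ ^ (P / 2)) *
      (ovScale P N K * hidOv (netCouplings P β γ o N) √t √(1 - t) u.1 u.2 p p))

variable (P N K β γ t o) in
/-- The average `⟨(q₁₂ ^ (P/2) - q̄₁ ^ (P/2)) p₁₂⟩₁`, the hidden variables being replaced by their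
conditional means. -/
def crossOv₁ : ℝ :=
  1 / 2 ^ N * ∑ η : Spins N, iAvg₁ (P := P) (K := K) (netCouplings P β γ o N) η √t √(1 - t) o.θ
    (fun u q => (overlapQ u.1 u.2 ^ (P / 2) - o.q₁ ^ (P / 2)) *
      (ovScale P N K * hidOv (netCouplings P β γ o N) √t √(1 - t) u.1 u.2 (rep₁ q) (rep₂ q)))

/-- Concentration of both overlaps makes the cross term small. -/
lemma abs_crossOv₂_le (ha : Small (netCouplings P β γ o N) P N) (ht0 : 0 ≤ t) (ht1 : t ≤ 1)
    (hθ0 : 0 < o.θ) (hθ1 : o.θ ≤ 1) :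
    |crossOv₂ P N K β γ t o| ≤ powLip (P / 2) o.q₂ ^ 2 / 2 *
        avgPair₂ P β γ o t (K := K) (fun (σ : Spins N) _ σ' _ => (overlapQ σ σ' - o.q₂) ^ 2) +
      1 / 2 * avgPair₂ P β γ o t (K := K)
        (fun (_ : Spins N) τ _ τ' => (overlapP P N τ τ' - o.p₂) ^ 2) +
      |o.p₂| * (powLip (P / 2) o.q₂ * √(avgPair₂ P β γ o t (K := K)
        (fun (σ : Spins N) _ σ' _ => (overlapQ σ σ' - o.q₂) ^ 2))) := by
  rw [avgPair₂_spin ha ht0 ht1 hθ0 hθ1 fun σ σ' => (overlapQ σ σ' - o.q₂) ^ 2]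
  have hdev := hid_dev₂_le (K := K) ha ht0 ht1 hθ0 hθ1 o.p₂
  have hs := abs_sqrt_le_one ht1
  have hc := abs_sqrt_le_one (by linarith : 1 - t ≤ 1)
  have hE := fun η => ha.env (K := K) η hs hc hθ0 hθ1
  have hm := MeanKer.mix fun η => (hE η).mean₂
  have g1 : ∀ u : Spins N × Spins N, GBdd (envSize P N K) (rate + rate) fun p =>
      ovScale P N K * hidOv (netCouplings P β γ o N) √t √(1 - t) u.1 u.2 p p := fun u =>
    (ha.gbdd_hidOv hs hc u).const_mul _
  have g2 : ∀ u : Spins N × Spins N, GBdd (envSize P N K) (rate + rate + (rate + rate)) fun p =>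
      (ovScale P N K * hidOv (netCouplings P β γ o N) √t √(1 - t) u.1 u.2 p p - o.p₂) ^ 2 := by
    intro u
    have h := (g1 u).sub ((GBdd.const (r := envSize P N K) o.p₂).mono envSize_nonneg (by norm_num))
    exact (h.mul h).congr fun p => by ring
  have i1 := fun η => (hE η).int₂ (by norm_num) g1
  have i2 := fun η => (hE η).int₂ (by norm_num) g2
  have key := hm.abs_pow_sub_mul_le
    (w := fun v : Spins N × (Spins N × Spins N) => overlapQ v.2.1 v.2.2)
    (fun v => abs_overlapQ_le _ _) (P / 2) o.q₂ o.p₂ (KInt.mix i1) (KInt.mix i2)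
  have e0 := kavg_mix fun η => (i1 η).fun_mul
    fun u : Spins N × Spins N => overlapQ u.1 u.2 ^ (P / 2) - o.q₂ ^ (P / 2)
  have e1 := kavg_mix fun η => (hE η).mean₂.int_fun
    fun u : Spins N × Spins N => (overlapQ u.1 u.2 - o.q₂) ^ 2
  have e2 := kavg_mix i2
  rw [card_spins_inv] at e0 e1 e2
  rw [e0, e1, e2] at key
  exact key.trans
    (add_le_add (add_le_add le_rfl (mul_le_mul_of_nonneg_left hdev (by norm_num))) le_rfl)

/-- Concentration of both overlaps makes the cross term small. -/
lemma abs_crossOv₁_le (ha : Small (netCouplings P β γ o N) P N) (ht0 : 0 ≤ t) (ht1 : t ≤ 1)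
    (hθ0 : 0 < o.θ) (hθ1 : o.θ ≤ 1) :
    |crossOv₁ P N K β γ t o| ≤ powLip (P / 2) o.q₁ ^ 2 / 2 *
        avgPair₁ P β γ o t (K := K) (fun (σ : Spins N) _ σ' _ => (overlapQ σ σ' - o.q₁) ^ 2) +
      1 / 2 * avgPair₁ P β γ o t (K := K)
        (fun (_ : Spins N) τ _ τ' => (overlapP P N τ τ' - o.p₁) ^ 2) +
      |o.p₁| * (powLip (P / 2) o.q₁ * √(avgPair₁ P β γ o t (K := K)
        (fun (σ : Spins N) _ σ' _ => (overlapQ σ σ' - o.q₁) ^ 2))) := by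
  rw [avgPair₁_spin ha ht0 ht1 hθ0 hθ1 fun σ σ' => (overlapQ σ σ' - o.q₁) ^ 2]
  have hdev := hid_dev₁_le (K := K) ha ht0 ht1 hθ0 hθ1 o.p₁
  have hs := abs_sqrt_le_one ht1
  have hc := abs_sqrt_le_one (by linarith : 1 - t ≤ 1)
  have hE := fun η => ha.env (K := K) η hs hc hθ0 hθ1
  have hm := MeanKer.mix fun η => (hE η).mean₁
  have g1 : ∀ u : Spins N × Spins N, GBdd (tripleSize (size₁ P N K) sqSize) (rate + rate) fun q =>
      ovScale P N K * hidOv (netCouplings P β γ o N) √t √(1 - t) u.1 u.2 (rep₁ q) (rep₂ q) :=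
    fun u => (ha.gbdd_hidOv' hs hc u).const_mul _
  have g2 : ∀ u : Spins N × Spins N, GBdd (tripleSize (size₁ P N K) sqSize)
      (rate + rate + (rate + rate)) fun q => (ovScale P N K *
        hidOv (netCouplings P β γ o N) √t √(1 - t) u.1 u.2 (rep₁ q) (rep₂ q) - o.p₁) ^ 2 := by
    intro u
    have h := (g1 u).sub ((GBdd.const (r := tripleSize (size₁ P N K) sqSize) o.p₁).mono
      (hE 1).size_triple.nonneg (by norm_num))
    exact (h.mul h).congr fun p => by ring
  have i1 := fun η => (hE η).int₁ (by norm_num) g1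
  have i2 := fun η => (hE η).int₁ (by norm_num) g2
  have key := hm.abs_pow_sub_mul_le
    (w := fun v : Spins N × (Spins N × Spins N) => overlapQ v.2.1 v.2.2)
    (fun v => abs_overlapQ_le _ _) (P / 2) o.q₁ o.p₁ (KInt.mix i1) (KInt.mix i2)
  have e0 := kavg_mix fun η => (i1 η).fun_mul
    fun u : Spins N × Spins N => overlapQ u.1 u.2 ^ (P / 2) - o.q₁ ^ (P / 2)
  have e1 := kavg_mix fun η => (hE η).mean₁.int_fun
    fun u : Spins N × Spins N => (overlapQ u.1 u.2 - o.q₁) ^ 2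
  have e2 := kavg_mix i2
  rw [card_spins_inv] at e0 e1 e2
  rw [e0, e1, e2] at key
  exact key.trans
    (add_le_add (add_le_add le_rfl (mul_le_mul_of_nonneg_left hdev (by norm_num))) le_rfl)

lemma abs_avgPair₂_overlapQ_sub_le (ha : Small (netCouplings P β γ o N) P N) (ht0 : 0 ≤ t)
    (ht1 : t ≤ 1) (hθ0 : 0 < o.θ) (hθ1 : o.θ ≤ 1) :
    |avgPair₂ P β γ o t (K := K) (fun (σ : Spins N) _ σ' _ => overlapQ σ σ') - o.q₂| ≤
      √(avgPair₂ P β γ o t (K := K) (fun (σ : Spins N) _ σ' _ => (overlapQ σ σ' - o.q₂) ^ 2)) := by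
  rw [avgPair₂_spin ha ht0 ht1 hθ0 hθ1 fun σ σ' => (overlapQ σ σ' - o.q₂) ^ 2,
    avgPair₂_spin ha ht0 ht1 hθ0 hθ1 fun σ σ' => overlapQ σ σ']
  have hE := fun η => ha.env (K := K) η (abs_sqrt_le_one ht1)
    (abs_sqrt_le_one (by linarith : 1 - t ≤ 1)) hθ0 hθ1
  have key := (MeanKer.mix fun η => (hE η).mean₂).abs_pow_sub_le
    (w := fun v : Spins N × (Spins N × Spins N) => overlapQ v.2.1 v.2.2)
    (fun v => abs_overlapQ_le _ _) 1 o.q₂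
  have e0 := kavg_mix fun η => (hE η).mean₂.int_fun
    fun u : Spins N × Spins N => overlapQ u.1 u.2
  have e1 := kavg_mix fun η => (hE η).mean₂.int_fun
    fun u : Spins N × Spins N => (overlapQ u.1 u.2 - o.q₂) ^ 2
  rw [card_spins_inv] at e0 e1
  simp only [pow_one] at key
  rw [e0, e1] at key
  rwa [powLip_one, one_mul] at key

lemma abs_avgPair₁_overlapQ_sub_le (ha : Small (netCouplings P β γ o N) P N) (ht0 : 0 ≤ t)
    (ht1 : t ≤ 1) (hθ0 : 0 < o.θ) (hθ1 : o.θ ≤ 1) :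
    |avgPair₁ P β γ o t (K := K) (fun (σ : Spins N) _ σ' _ => overlapQ σ σ') - o.q₁| ≤
      √(avgPair₁ P β γ o t (K := K) (fun (σ : Spins N) _ σ' _ => (overlapQ σ σ' - o.q₁) ^ 2)) := by
  rw [avgPair₁_spin ha ht0 ht1 hθ0 hθ1 fun σ σ' => (overlapQ σ σ' - o.q₁) ^ 2,
    avgPair₁_spin ha ht0 ht1 hθ0 hθ1 fun σ σ' => overlapQ σ σ']
  have hE := fun η => ha.env (K := K) η (abs_sqrt_le_one ht1)
    (abs_sqrt_le_one (by linarith : 1 - t ≤ 1)) hθ0 hθ1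
  have key := (MeanKer.mix fun η => (hE η).mean₁).abs_pow_sub_le
    (w := fun v : Spins N × (Spins N × Spins N) => overlapQ v.2.1 v.2.2)
    (fun v => abs_overlapQ_le _ _) 1 o.q₁
  have e0 := kavg_mix fun η => (hE η).mean₁.int_fun
    fun u : Spins N × Spins N => overlapQ u.1 u.2
  have e1 := kavg_mix fun η => (hE η).mean₁.int_fun
    fun u : Spins N × Spins N => (overlapQ u.1 u.2 - o.q₁) ^ 2
  rw [card_spins_inv] at e0 e1
  simp only [pow_one] at key
  rw [e0, e1] at key
  rwa [powLip_one, one_mul] at key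

lemma abs_avg_magnetization_pow_sub_le (ha : Small (netCouplings P β γ o N) P N) (ht0 : 0 ≤ t)
    (ht1 : t ≤ 1) (hθ0 : 0 < o.θ) (hθ1 : o.θ ≤ 1) (n : ℕ) :
    |avg P β γ o t (K := K) (fun η σ : Spins N => magnetization η σ ^ n) - o.m ^ n| ≤
      powLip n o.m *
        √(avg P β γ o t (K := K) fun η σ : Spins N => (magnetization η σ - o.m) ^ 2) := by
  rw [avg_eq ha ht0 ht1 hθ0 hθ1 fun η σ => magnetization η σ ^ n,
    avg_eq ha ht0 ht1 hθ0 hθ1 fun η σ => (magnetization η σ - o.m) ^ 2]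
  have hE := fun η => ha.env (K := K) η (abs_sqrt_le_one ht1)
    (abs_sqrt_le_one (by linarith : 1 - t ≤ 1)) hθ0 hθ1
  have key := (MeanKer.mix fun η => (hE η).mean₀).abs_pow_sub_le
    (w := fun v : Spins N × Spins N => magnetization v.1 v.2)
    (fun v => abs_magnetization_le _ _) n o.m
  have e0 := kavg_mix fun η => (hE η).mean₀.int_fun fun σ : Spins N => magnetization η σ ^ n
  have e1 := kavg_mix fun η => (hE η).mean₀.int_fun
    fun σ : Spins N => (magnetization η σ - o.m) ^ 2
  rw [card_spins_inv] at e0 e1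
  rw [e0, e1] at key
  exact key

lemma abs_spinAvg_le {x : Spins N → ℝ} {B : ℝ} (hx : ∀ η, |x η| ≤ B) :
    |1 / 2 ^ N * ∑ η, x η| ≤ B := by
  rw [← card_spins_inv, abs_mul, abs_of_nonneg (by positivity), inv_mul_le_iff₀ (by positivity)]
  refine (Finset.abs_sum_le_sum_abs _ _).trans ((Finset.sum_le_sum fun η _ => hx η).trans ?_)
  simp

lemma abs_overlapQ_pow_sub_le (σ σ' : Spins N) (n : ℕ) (Q : ℝ) :
    |overlapQ σ σ' ^ n - Q| ≤ 1 + |Q| := by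
  refine (abs_sub _ _).trans (add_le_add_left ?_ _)
  rw [abs_pow]
  exact pow_le_one₀ (abs_nonneg _) (abs_overlapQ_le _ _)

lemma abs_crossOv₂_le_bound (ha : Small (netCouplings P β γ o N) P N) (ht0 : 0 ≤ t) (ht1 : t ≤ 1)
    (hθ0 : 0 < o.θ) (hθ1 : o.θ ≤ 1) {S : ℝ}
    (hS : ∀ η : Spins N, hidSq K P (netCouplings P β γ o N) η √t √(1 - t) o.θ ≤ S) :
    |crossOv₂ P N K β γ t o| ≤ (1 + |o.q₂ ^ (P / 2)|) * ovScale P N K * S := by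
  refine abs_spinAvg_le fun η => ?_
  have hsc : 0 ≤ ovScale P N K := by unfold ovScale; positivity
  have h := ha.abs_avg₂_hidOv_le (K := K) η (abs_sqrt_le_one ht1)
    (abs_sqrt_le_one (by linarith : 1 - t ≤ 1)) hθ0 hθ1
    (w := fun u => (overlapQ u.1 u.2 ^ (P / 2) - o.q₂ ^ (P / 2)) * ovScale P N K)
    (B := (1 + |o.q₂ ^ (P / 2)|) * ovScale P N K) fun u => by
      rw [abs_mul, abs_of_nonneg hsc]
      exact mul_le_mul_of_nonneg_right (abs_overlapQ_pow_sub_le _ _ _ _) hsc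
  simp only [mul_assoc] at h ⊢
  refine h.trans ?_
  have := hS η
  gcongr

lemma abs_crossOv₁_le_bound (ha : Small (netCouplings P β γ o N) P N) (ht0 : 0 ≤ t) (ht1 : t ≤ 1)
    (hθ0 : 0 < o.θ) (hθ1 : o.θ ≤ 1) {S : ℝ}
    (hS : ∀ η : Spins N, hidSq K P (netCouplings P β γ o N) η √t √(1 - t) o.θ ≤ S) :
    |crossOv₁ P N K β γ t o| ≤ (1 + |o.q₁ ^ (P / 2)|) * ovScale P N K * S := by
  refine abs_spinAvg_le fun η => ?_
  have hsc : 0 ≤ ovScale P N K := by unfold ovScale; positivity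
  have h := ha.abs_avg₁_hidOv_le (K := K) η (abs_sqrt_le_one ht1)
    (abs_sqrt_le_one (by linarith : 1 - t ≤ 1)) hθ0 hθ1
    (w := fun u => (overlapQ u.1 u.2 ^ (P / 2) - o.q₁ ^ (P / 2)) * ovScale P N K)
    (B := (1 + |o.q₁ ^ (P / 2)|) * ovScale P N K) fun u => by
      rw [abs_mul, abs_of_nonneg hsc]
      exact mul_le_mul_of_nonneg_right (abs_overlapQ_pow_sub_le _ _ _ _) hsc
  simp only [mul_assoc] at h ⊢
  refine h.trans ?_
  have := hS η
  gcongr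

lemma abs_avg_le (ha : Small (netCouplings P β γ o N) P N) (ht0 : 0 ≤ t) (ht1 : t ≤ 1)
    (hθ0 : 0 < o.θ) (hθ1 : o.θ ≤ 1) {f : Spins N → Spins N → ℝ} {B : ℝ}
    (hf : ∀ η σ, |f η σ| ≤ B) : |avg P β γ o t (K := K) f| ≤ B := by
  rw [avg_eq ha ht0 ht1 hθ0 hθ1 f]
  exact abs_spinAvg_le fun η => (ha.env (K := K) η (abs_sqrt_le_one ht1)
    (abs_sqrt_le_one (by linarith : 1 - t ≤ 1)) hθ0 hθ1).mean₀.abs_le (hf η)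

lemma abs_avgPair₂_le (ha : Small (netCouplings P β γ o N) P N) (ht0 : 0 ≤ t) (ht1 : t ≤ 1)
    (hθ0 : 0 < o.θ) (hθ1 : o.θ ≤ 1) {f : Spins N → Spins N → ℝ} {B : ℝ}
    (hf : ∀ σ σ', |f σ σ'| ≤ B) :
    |avgPair₂ P β γ o t (K := K) fun σ _ σ' _ => f σ σ'| ≤ B := by
  rw [avgPair₂_spin ha ht0 ht1 hθ0 hθ1 f]
  exact abs_spinAvg_le fun η => (ha.env (K := K) η (abs_sqrt_le_one ht1)
    (abs_sqrt_le_one (by linarith : 1 - t ≤ 1)) hθ0 hθ1).mean₂.abs_le fun u => hf u.1 u.2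

lemma abs_avgPair₁_le (ha : Small (netCouplings P β γ o N) P N) (ht0 : 0 ≤ t) (ht1 : t ≤ 1)
    (hθ0 : 0 < o.θ) (hθ1 : o.θ ≤ 1) {f : Spins N → Spins N → ℝ} {B : ℝ}
    (hf : ∀ σ σ', |f σ σ'| ≤ B) :
    |avgPair₁ P β γ o t (K := K) fun σ _ σ' _ => f σ σ'| ≤ B := by
  rw [avgPair₁_spin ha ht0 ht1 hθ0 hθ1 f]
  exact abs_spinAvg_le fun η => (ha.env (K := K) η (abs_sqrt_le_one ht1)
    (abs_sqrt_le_one (by linarith : 1 - t ≤ 1)) hθ0 hθ1).mean₁.abs_le fun u => hf u.1 u.2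

end Conc

section Bracket

variable {P N K : ℕ} {β γ t : ℝ} {o : OrderParameters}

variable (P N K β γ t o) in
/-- Twice the derivative of the free energy per spin with respect to `t`, by Gaussian integration
by parts. -/
def bracket : ℝ :=
  betaEff P β * avg P β γ o t (K := K) (fun η σ : Spins N => magnetization η σ ^ P)
    - 2 * psi P β o * avg P β γ o t (K := K) (fun η σ : Spins N => magnetization η σ)
    + betaEff P β * (K / (N * nn P N ^ 2)) *
      ((o.θ - 1) * crossOv₂ P N K β γ t o - o.θ * crossOv₁ P N K β γ t o)
    - coefB₁ P β γ o ^ 2 *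
      (1 + (o.θ - 1) * avgPair₂ P β γ o t (K := K) (fun (σ : Spins N) _ σ' _ => overlapQ σ σ')
        - o.θ * avgPair₁ P β γ o t (K := K) (fun (σ : Spins N) _ σ' _ => overlapQ σ σ'))
    - coefB₂ P β γ o ^ 2 *
      (1 + (o.θ - 1) * avgPair₂ P β γ o t (K := K) (fun (σ : Spins N) _ σ' _ => overlapQ σ σ'))

lemma spinOv_eq (hN : 0 < N) (σ σ' : Spins N) : spinOv σ σ' = N * overlapQ σ σ' := by
  have : (N : ℝ) ≠ 0 := by positivity
  rw [spinOv, overlapQ]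
  field_simp

/-- The difference of the contributions of the noise patterns and of the fields on the hidden
variables, in the normalization of the overlaps. -/
lemma eps_mul_cross₂ (hPe : Even P) (hP : 4 ≤ P) (hβ : 0 < β) (hN : 0 < N) (hK : 0 < K)
    (ha : Small (netCouplings P β γ o N) P N) (ht0 : 0 ≤ t) (ht1 : t ≤ 1)
    (hθ0 : 0 < o.θ) (hθ1 : o.θ ≤ 1) (η : Spins N) :
    (netCouplings P β γ o N).κ ^ 2 * ovR₂ K P (netCouplings P β γ o N) η √t √(1 - t) o.θ -
      eps P β N * o.q₂ ^ (P / 2) * ovY₂ K P (netCouplings P β γ o N) η √t √(1 - t) o.θ =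
    betaEff P β * (K / nn P N ^ 2) *
      iAvg₂ (P := P) (K := K) (netCouplings P β γ o N) η √t √(1 - t) o.θ
      (fun u p => (overlapQ u.1 u.2 ^ (P / 2) - o.q₂ ^ (P / 2)) *
        (ovScale P N K * hidOv (netCouplings P β γ o N) √t √(1 - t) u.1 u.2 p p)) := by
  have hk := kappa_sq (γ := γ) (o := o) hPe hP hβ hN
  set a := netCouplings P β γ o N
  have hs := abs_sqrt_le_one ht1
  have hc := abs_sqrt_le_one (by linarith : 1 - t ≤ 1)
  have hE := ha.env (K := K) η hs hc hθ0 hθ1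
  have i0 := hE.int₂ (by norm_num) (ha.gbdd_hidOv hs hc)
  have hnn := (nn_pos (P := P) hN).ne'
  have hK' : (K : ℝ) ≠ 0 := by positivity
  rw [ovR₂, ovY₂, iAvg₂, iAvg₂, iAvg₂, avg₂, avg₂, avg₂, ← kavg_const_mul (a.κ ^ 2),
    ← kavg_const_mul (eps P β N * o.q₂ ^ (P / 2)),
    ← kavg_const_mul (betaEff P β * (K / nn P N ^ 2)), ← kavg_sub
      ((i0.fun_mul fun u => spinOv u.1 u.2 ^ (P / 2)).const_mul _) (i0.const_mul _)]
  refine kavg_congr fun u p => ?_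
  rw [spinOv_eq hN, mul_pow, ovScale]
  change _ = betaEff P β * (K / nn P N ^ 2) * (_ * (nn P N / K * _))
  have e : betaEff P β * (K / nn P N ^ 2) * (nn P N / K) = eps P β N := by
    rw [eps]; field_simp
  linear_combination (overlapQ u.1 u.2 ^ (P / 2) * hidOv a √t √(1 - t) u.1 u.2 p p) * hk -
    (overlapQ u.1 u.2 ^ (P / 2) - o.q₂ ^ (P / 2)) * hidOv a √t √(1 - t) u.1 u.2 p p * e

lemma eps_mul_cross₁ (hPe : Even P) (hP : 4 ≤ P) (hβ : 0 < β) (hN : 0 < N) (hK : 0 < K)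
    (ha : Small (netCouplings P β γ o N) P N) (ht0 : 0 ≤ t) (ht1 : t ≤ 1)
    (hθ0 : 0 < o.θ) (hθ1 : o.θ ≤ 1) (η : Spins N) :
    (netCouplings P β γ o N).κ ^ 2 * ovR₁ K P (netCouplings P β γ o N) η √t √(1 - t) o.θ -
      eps P β N * o.q₁ ^ (P / 2) * ovY₁ K P (netCouplings P β γ o N) η √t √(1 - t) o.θ =
    betaEff P β * (K / nn P N ^ 2) *
      iAvg₁ (P := P) (K := K) (netCouplings P β γ o N) η √t √(1 - t) o.θ
      (fun u q => (overlapQ u.1 u.2 ^ (P / 2) - o.q₁ ^ (P / 2)) * (ovScale P N K *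
        hidOv (netCouplings P β γ o N) √t √(1 - t) u.1 u.2 (rep₁ q) (rep₂ q))) := by
  have hk := kappa_sq (γ := γ) (o := o) hPe hP hβ hN
  set a := netCouplings P β γ o N
  have hs := abs_sqrt_le_one ht1
  have hc := abs_sqrt_le_one (by linarith : 1 - t ≤ 1)
  have hE := ha.env (K := K) η hs hc hθ0 hθ1
  have i0 := hE.int₁ (by norm_num) (ha.gbdd_hidOv' hs hc)
  have hnn := (nn_pos (P := P) hN).ne'
  have hK' : (K : ℝ) ≠ 0 := by positivity
  rw [ovR₁, ovY₁, iAvg₁, iAvg₁, iAvg₁, avg₁, avg₁, avg₁, ← kavg_const_mul (a.κ ^ 2),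
    ← kavg_const_mul (eps P β N * o.q₁ ^ (P / 2)),
    ← kavg_const_mul (betaEff P β * (K / nn P N ^ 2)), ← kavg_sub
      ((i0.fun_mul fun u => spinOv u.1 u.2 ^ (P / 2)).const_mul _) (i0.const_mul _)]
  refine kavg_congr fun u q => ?_
  rw [spinOv_eq hN, mul_pow, ovScale]
  change _ = betaEff P β * (K / nn P N ^ 2) * (_ * (nn P N / K * _))
  have e : betaEff P β * (K / nn P N ^ 2) * (nn P N / K) = eps P β N := by
    rw [eps]; field_simp
  linear_combination
    (overlapQ u.1 u.2 ^ (P / 2) * hidOv a √t √(1 - t) u.1 u.2 (rep₁ q) (rep₂ q)) * hk -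
    (overlapQ u.1 u.2 ^ (P / 2) - o.q₁ ^ (P / 2)) *
      hidOv a √t √(1 - t) u.1 u.2 (rep₁ q) (rep₂ q) * e

/-- The average of the derivative of the Hamiltonian in the angle `α`, where `t = sin² α`. The
fields on the hidden variables and the quadratic term are tuned so that the one-replica contributions
`⟨∑ X_μ²⟩` cancel. -/
lemma avg_hamD_eq_bracket (hPe : Even P) (hP : 4 ≤ P) (hβ : 0 < β) (hN : 0 < N) (hK : 0 < K)
    (ha : Small (netCouplings P β γ o N) P N) (ht0 : 0 ≤ t) (ht1 : t ≤ 1)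
    (hθ0 : 0 < o.θ) (hθ1 : o.θ ≤ 1) (hQ₁ : 0 ≤ o.q₁ ^ (P / 2))
    (hQ₂ : 0 ≤ o.q₂ ^ (P / 2) - o.q₁ ^ (P / 2)) :
    1 / 2 ^ N * ∑ η : Spins N, iAvg₀ (P := P) (K := K) (netCouplings P β γ o N) η √t √(1 - t) o.θ
      (fun σ p => hamD (netCouplings P β γ o N) η √t √(1 - t) √(1 - t) (-√t) σ p 0) =
    √t * √(1 - t) * (N * bracket P N K β γ t o) := by
  have hs := abs_sqrt_le_one ht1
  have hc := abs_sqrt_le_one (by linarith : 1 - t ≤ 1)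
  have hk := kappa_sq (γ := γ) (o := o) hPe hP hβ hN
  have h1 : (netCouplings P β γ o N).A₁ ^ 2 = eps P β N * o.q₁ ^ (P / 2) := coefA₁_sq hβ hQ₁ N
  have h2 : (netCouplings P β γ o N).A₂ ^ 2 =
    eps P β N * (o.q₂ ^ (P / 2) - o.q₁ ^ (P / 2)) := coefA₂_sq hβ hQ₂ N
  have h3 : (netCouplings P β γ o N).C = eps P β N * (1 - o.q₂ ^ (P / 2)) := rfl
  have hN' : (N : ℝ) ≠ 0 := by positivity
  have hnn := (nn_pos (P := P) hN).ne'
  have e1 : ∀ η : Spins N, iAvg₀ (P := P) (K := K) (netCouplings P β γ o N) η √t √(1 - t) o.θ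
      (fun σ p => hamD (netCouplings P β γ o N) η √t √(1 - t) √(1 - t) (-√t) σ p 0) =
      √t * √(1 - t) * N * (betaEff P β *
          iAvg₀ (P := P) (K := K) (netCouplings P β γ o N) η √t √(1 - t) o.θ
          (fun σ _ => magnetization η σ ^ P)
        - 2 * psi P β o * iAvg₀ (P := P) (K := K) (netCouplings P β γ o N) η √t √(1 - t) o.θ
          (fun σ _ => magnetization η σ)
        + betaEff P β * (K / (N * nn P N ^ 2)) * ((o.θ - 1) *
            iAvg₂ (P := P) (K := K) (netCouplings P β γ o N) η √t √(1 - t) o.θ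
            (fun u p => (overlapQ u.1 u.2 ^ (P / 2) - o.q₂ ^ (P / 2)) *
              (ovScale P N K * hidOv (netCouplings P β γ o N) √t √(1 - t) u.1 u.2 p p)) -
          o.θ * iAvg₁ (P := P) (K := K) (netCouplings P β γ o N) η √t √(1 - t) o.θ
            (fun u q => (overlapQ u.1 u.2 ^ (P / 2) - o.q₁ ^ (P / 2)) * (ovScale P N K *
              hidOv (netCouplings P β γ o N) √t √(1 - t) u.1 u.2 (rep₁ q) (rep₂ q))))
        - coefB₁ P β γ o ^ 2 * (1 + (o.θ - 1) *
            iAvg₂ (P := P) (K := K) (netCouplings P β γ o N) η √t √(1 - t) o.θ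
              (fun u _ => overlapQ u.1 u.2)
          - o.θ * iAvg₁ (P := P) (K := K) (netCouplings P β γ o N) η √t √(1 - t) o.θ
              (fun u _ => overlapQ u.1 u.2))
        - coefB₂ P β γ o ^ 2 * (1 + (o.θ - 1) *
            iAvg₂ (P := P) (K := K) (netCouplings P β γ o N) η √t √(1 - t) o.θ
              (fun u _ => overlapQ u.1 u.2))) := by
    intro η
    have hx₂ := eps_mul_cross₂ hPe hP hβ hN hK ha ht0 ht1 hθ0 hθ1 η
    have hx₁ := eps_mul_cross₁ hPe hP hβ hN hK ha ht0 ht1 hθ0 hθ1 η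
    have hS₂ : ovS₂ K P (netCouplings P β γ o N) η √t √(1 - t) o.θ =
        N * iAvg₂ (P := P) (K := K) (netCouplings P β γ o N) η √t √(1 - t) o.θ
          (fun u _ => overlapQ u.1 u.2) := by
      rw [ovS₂, iAvg₂, iAvg₂, avg₂, avg₂, ← kavg_const_mul (N : ℝ)]
      exact kavg_congr fun u p => spinOv_eq hN _ _
    have hS₁ : ovS₁ K P (netCouplings P β γ o N) η √t √(1 - t) o.θ =
        N * iAvg₁ (P := P) (K := K) (netCouplings P β γ o N) η √t √(1 - t) o.θ
          (fun u _ => overlapQ u.1 u.2) := by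
      rw [ovS₁, iAvg₁, iAvg₁, avg₁, avg₁, ← kavg_const_mul (N : ℝ)]
      exact kavg_congr fun u p => spinOv_eq hN _ _
    have hb₁ : (netCouplings P β γ o N).b₁ = betaEff P β * N / 2 := rfl
    have hb₂ : (netCouplings P β γ o N).b₂ = N * psi P β o := rfl
    have hB₁ : (netCouplings P β γ o N).B₁ = coefB₁ P β γ o := rfl
    have hB₂ : (netCouplings P β γ o N).B₂ = coefB₂ P β γ o := rfl
    rw [ha.avg_hamD η hs hc hθ0 hθ1, hS₂, hS₁, hb₁, hb₂, hB₁, hB₂, hk, h1, h2, h3]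
    generalize iAvg₂ (P := P) (K := K) (netCouplings P β γ o N) η √t √(1 - t) o.θ
      (fun u p => (overlapQ u.1 u.2 ^ (P / 2) - o.q₂ ^ (P / 2)) *
        (ovScale P N K * hidOv (netCouplings P β γ o N) √t √(1 - t) u.1 u.2 p p)) = X₂ at *
    generalize iAvg₁ (P := P) (K := K) (netCouplings P β γ o N) η √t √(1 - t) o.θ
      (fun u q => (overlapQ u.1 u.2 ^ (P / 2) - o.q₁ ^ (P / 2)) * (ovScale P N K *
        hidOv (netCouplings P β γ o N) √t √(1 - t) u.1 u.2 (rep₁ q) (rep₂ q))) = X₁ at *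
    have e : (K : ℝ) / nn P N ^ 2 = N * (K / (N * nn P N ^ 2)) := by field_simp
    rw [e] at hx₁ hx₂
    linear_combination √t * √(1 - t) * ((o.θ - 1) * hx₂ - o.θ * hx₁)
  simp only [e1]
  rw [bracket, avg_eq ha ht0 ht1 hθ0 hθ1 fun η σ => magnetization η σ ^ P,
    avg_eq ha ht0 ht1 hθ0 hθ1 fun η σ => magnetization η σ,
    avgPair₂_spin ha ht0 ht1 hθ0 hθ1 fun σ σ' => overlapQ σ σ',
    avgPair₁_spin ha ht0 ht1 hθ0 hθ1 fun σ σ' => overlapQ σ σ', crossOv₁, crossOv₂]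
  have hcard : (1 : ℝ) / 2 ^ N * ∑ _η : Spins N, (1 : ℝ) = 1 := by
    rw [← card_spins_inv]
    simp
  simp only [← Finset.mul_sum, Finset.sum_add_distrib, Finset.sum_sub_distrib]
  linear_combination (-(√t * √(1 - t) * N * (coefB₁ P β γ o ^ 2 + coefB₂ P β γ o ^ 2))) * hcard

end Bracket

/-! ### Constraints on the order parameters -/

section Constraints

variable {P N K : ℕ} {β γ t : ℝ} {o : OrderParameters}

lemma overlapQ_eq_sum (σ σ' : Spins N) :
    overlapQ σ σ' = ∑ i, 1 / (N : ℝ) * (val (σ i) * val (σ' i)) := by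
  rw [overlapQ, Finset.mul_sum]

lemma spinAvg_nonneg {x : Spins N → ℝ} (hx : ∀ η, 0 ≤ x η) : 0 ≤ 1 / 2 ^ N * ∑ η, x η :=
  mul_nonneg (by positivity) (Finset.sum_nonneg fun η _ => hx η)

lemma avgPair₁_overlapQ_nonneg (ha : Small (netCouplings P β γ o N) P N) (ht0 : 0 ≤ t)
    (ht1 : t ≤ 1) (hθ0 : 0 < o.θ) (hθ1 : o.θ ≤ 1) :
    0 ≤ avgPair₁ P β γ o t (K := K) fun (σ : Spins N) _ σ' _ => overlapQ σ σ' := by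
  rw [avgPair₁_spin ha ht0 ht1 hθ0 hθ1 fun σ σ' => overlapQ σ σ']
  refine spinAvg_nonneg fun η => ?_
  have hE := ha.env (K := K) η (abs_sqrt_le_one ht1) (abs_sqrt_le_one (by linarith : 1 - t ≤ 1))
    hθ0 hθ1
  simp only [overlapQ_eq_sum]
  rw [iAvg₁, avg₁, kavg_sum _ fun i => hE.mean₁.int_fun
    fun u : Spins N × Spins N => 1 / (N : ℝ) * (val (u.1 i) * val (u.2 i))]
  refine Finset.sum_nonneg fun i _ => ?_
  rw [kavg_const_mul (1 / (N : ℝ))]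
  exact mul_nonneg (by positivity)
    (hE.avg₁_sq_nonneg (δ := 0) le_rfl (by norm_num) fun σ => GBdd.const (val (σ i)))

lemma avgPair₁_overlapQ_le (ha : Small (netCouplings P β γ o N) P N) (ht0 : 0 ≤ t)
    (ht1 : t ≤ 1) (hθ0 : 0 < o.θ) (hθ1 : o.θ ≤ 1) :
    avgPair₁ P β γ o t (K := K) (fun (σ : Spins N) _ σ' _ => overlapQ σ σ') ≤
      avgPair₂ P β γ o t (K := K) fun (σ : Spins N) _ σ' _ => overlapQ σ σ' := by
  rw [avgPair₁_spin ha ht0 ht1 hθ0 hθ1 fun σ σ' => overlapQ σ σ',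
    avgPair₂_spin ha ht0 ht1 hθ0 hθ1 fun σ σ' => overlapQ σ σ']
  refine mul_le_mul_of_nonneg_left (Finset.sum_le_sum fun η _ => ?_) (by positivity)
  have hE := ha.env (K := K) η (abs_sqrt_le_one ht1) (abs_sqrt_le_one (by linarith : 1 - t ≤ 1))
    hθ0 hθ1
  simp only [overlapQ_eq_sum]
  rw [iAvg₁, avg₁, kavg_sum _ fun i => hE.mean₁.int_fun
    fun u : Spins N × Spins N => 1 / (N : ℝ) * (val (u.1 i) * val (u.2 i)), iAvg₂, avg₂,
    kavg_sum _ fun i => hE.mean₂.int_fun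
    fun u : Spins N × Spins N => 1 / (N : ℝ) * (val (u.1 i) * val (u.2 i))]
  refine Finset.sum_le_sum fun i _ => ?_
  rw [kavg_const_mul (1 / (N : ℝ)), kavg_const_mul (1 / (N : ℝ))]
  exact mul_le_mul_of_nonneg_left
    (hE.avg₁_le_avg₂ (δ := 0) le_rfl (by norm_num) fun σ => GBdd.const (val (σ i)))
    (by positivity)

lemma tendsto_of_abs_sub_le_sqrt {x V : ℕ → ℝ} {y : ℝ} (hV : Tendsto V atTop (𝓝 0))
    (h : ∀ᶠ N in atTop, |x N - y| ≤ √(V N)) : Tendsto x atTop (𝓝 y) := by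
  have h1 : Tendsto (fun N => x N - y) atTop (𝓝 0) :=
    squeeze_zero_norm' h (by simpa using hV.sqrt)
  simpa using h1.add_const y

lemma tendsto_overlapQ₁ (hPe : Even P) (hP : 4 ≤ P) (hβ : 0 < β) (hθ0 : 0 < o.θ) (hθ1 : o.θ ≤ 1)
    (ho : OneRSBAnsatz P β γ o) (ht : t ∈ Set.Ico (0 : ℝ) 1) :
    Tendsto (fun N => avgPair₁ P β γ o t (K := numPatterns γ (P - 1) N)
      fun (σ : Spins N) _ σ' _ => overlapQ σ σ') atTop (𝓝 o.q₁) := by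
  refine tendsto_of_abs_sub_le_sqrt (ho.overlapQ_conc₁ t ht) ?_
  filter_upwards [eventually_small (γ := γ) (o := o) hPe hP hβ] with N ha
  exact abs_avgPair₁_overlapQ_sub_le ha ht.1 ht.2.le hθ0 hθ1

lemma tendsto_overlapQ₂ (hPe : Even P) (hP : 4 ≤ P) (hβ : 0 < β) (hθ0 : 0 < o.θ) (hθ1 : o.θ ≤ 1)
    (ho : OneRSBAnsatz P β γ o) (ht : t ∈ Set.Ico (0 : ℝ) 1) :
    Tendsto (fun N => avgPair₂ P β γ o t (K := numPatterns γ (P - 1) N)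
      fun (σ : Spins N) _ σ' _ => overlapQ σ σ') atTop (𝓝 o.q₂) := by
  refine tendsto_of_abs_sub_le_sqrt (ho.overlapQ_conc₂ t ht) ?_
  filter_upwards [eventually_small (γ := γ) (o := o) hPe hP hβ] with N ha
  exact abs_avgPair₂_overlapQ_sub_le ha ht.1 ht.2.le hθ0 hθ1

/-- A mean of squares is nonnegative. -/
lemma OneRSBAnsatz.q₁_nonneg (ho : OneRSBAnsatz P β γ o) (hPe : Even P) (hP : 4 ≤ P)
    (hβ : 0 < β) (hθ0 : 0 < o.θ) (hθ1 : o.θ ≤ 1) : 0 ≤ o.q₁ := by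
  refine ge_of_tendsto (tendsto_overlapQ₁ hPe hP hβ hθ0 hθ1 ho (t := 0) (by simp)) ?_
  filter_upwards [eventually_small (γ := γ) (o := o) hPe hP hβ] with N ha
  exact avgPair₁_overlapQ_nonneg ha le_rfl zero_le_one hθ0 hθ1

/-- Jensen's inequality for the average over the second level. -/
lemma OneRSBAnsatz.q₁_le_q₂ (ho : OneRSBAnsatz P β γ o) (hPe : Even P) (hP : 4 ≤ P)
    (hβ : 0 < β) (hθ0 : 0 < o.θ) (hθ1 : o.θ ≤ 1) : o.q₁ ≤ o.q₂ := by
  refine le_of_tendsto_of_tendsto (tendsto_overlapQ₁ hPe hP hβ hθ0 hθ1 ho (t := 0) (by simp))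
    (tendsto_overlapQ₂ hPe hP hβ hθ0 hθ1 ho (t := 0) (by simp)) ?_
  filter_upwards [eventually_small (γ := γ) (o := o) hPe hP hβ] with N ha
  exact avgPair₁_overlapQ_le ha le_rfl zero_le_one hθ0 hθ1

lemma abs_ovY₂_start_sub_le (ha : Small (netCouplings P β γ o N) P N)
    (hθ0 : 0 < o.θ) (hθ1 : o.θ ≤ 1) {Y : ℝ}
    (hY : ∀ η : Spins N, ovY₂ K P (netCouplings P β γ o N) η 0 1 o.θ = Y) :
    |ovScale P N K * Y - o.p₂| ≤ √(avgPair₂ P β γ o 0 (K := K)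
        (fun (_ : Spins N) τ _ τ' => (overlapP P N τ τ' - o.p₂) ^ 2)) := by
  have hdev := hid_dev₂_le (K := K) ha le_rfl zero_le_one hθ0 hθ1 o.p₂
  rw [Real.sqrt_zero, sub_zero, Real.sqrt_one] at hdev
  refine Real.abs_le_sqrt (le_trans ?_ hdev)
  have hs : |(0 : ℝ)| ≤ 1 := by norm_num
  have hc : |(1 : ℝ)| ≤ 1 := by norm_num
  have key : ∀ η : Spins N, (ovScale P N K * Y - o.p₂) ^ 2 ≤
      iAvg₂ (P := P) (K := K) (netCouplings P β γ o N) η 0 1 o.θ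
        (fun u p => (ovScale P N K *
          hidOv (netCouplings P β γ o N) 0 1 u.1 u.2 p p - o.p₂) ^ 2) := by
    intro η
    have hE := ha.env (K := K) η hs hc hθ0 hθ1
    have g0 : ∀ u : Spins N × Spins N, GBdd (envSize P N K) (rate + rate) fun p =>
        ovScale P N K * hidOv (netCouplings P β γ o N) 0 1 u.1 u.2 p p := fun u =>
      (ha.gbdd_hidOv hs hc u).const_mul _
    have g1 : ∀ u : Spins N × Spins N, GBdd (envSize P N K) (rate + rate) fun p =>
        ovScale P N K * hidOv (netCouplings P β γ o N) 0 1 u.1 u.2 p p - o.p₂ := fun u =>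
      (g0 u).sub ((GBdd.const (r := envSize P N K) o.p₂).mono envSize_nonneg (by norm_num))
    have h := hE.mean₂.sq_le (hE.int₂ (by norm_num) g1)
      (hE.int₂ (δ := rate + rate + (rate + rate)) (by norm_num) fun u =>
        ((g1 u).mul (g1 u)).congr fun p => by ring)
    rw [kavg_sub (hE.int₂ (by norm_num) g0) (hE.mean₂.int_fun fun _ => o.p₂),
      kavg_const hE.mean₂.one, kavg_const_mul (ovScale P N K)] at h
    rw [← hY η]
    exact h
  calc (ovScale P N K * Y - o.p₂) ^ 2 =
        1 / 2 ^ N * ∑ _η : Spins N, (ovScale P N K * Y - o.p₂) ^ 2 := by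
        rw [← card_spins_inv]
        simp
    _ ≤ _ := mul_le_mul_of_nonneg_left (Finset.sum_le_sum fun η _ => key η) (by positivity)

/-- At the beginning the overlap of the conditional means has an explicit mean `Y`, which by Jensen
is as close to `p̄₁` as the concentration of `p₁₂` allows. -/
lemma abs_ovY₁_start_sub_le (ha : Small (netCouplings P β γ o N) P N)
    (hθ0 : 0 < o.θ) (hθ1 : o.θ ≤ 1) {Y : ℝ}
    (hY : ∀ η : Spins N, ovY₁ K P (netCouplings P β γ o N) η 0 1 o.θ = Y) :
    |ovScale P N K * Y - o.p₁| ≤ √(avgPair₁ P β γ o 0 (K := K)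
        (fun (_ : Spins N) τ _ τ' => (overlapP P N τ τ' - o.p₁) ^ 2)) := by
  have hdev := hid_dev₁_le (K := K) ha le_rfl zero_le_one hθ0 hθ1 o.p₁
  rw [Real.sqrt_zero, sub_zero, Real.sqrt_one] at hdev
  refine Real.abs_le_sqrt (le_trans ?_ hdev)
  have hs : |(0 : ℝ)| ≤ 1 := by norm_num
  have hc : |(1 : ℝ)| ≤ 1 := by norm_num
  have key : ∀ η : Spins N, (ovScale P N K * Y - o.p₁) ^ 2 ≤
      iAvg₁ (P := P) (K := K) (netCouplings P β γ o N) η 0 1 o.θ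
        (fun u q => (ovScale P N K *
          hidOv (netCouplings P β γ o N) 0 1 u.1 u.2 (rep₁ q) (rep₂ q) - o.p₁) ^ 2) := by
    intro η
    have hE := ha.env (K := K) η hs hc hθ0 hθ1
    have g0 : ∀ u : Spins N × Spins N, GBdd (tripleSize (size₁ P N K) sqSize) (rate + rate)
        fun q => ovScale P N K *
          hidOv (netCouplings P β γ o N) 0 1 u.1 u.2 (rep₁ q) (rep₂ q) := fun u =>
      (ha.gbdd_hidOv' hs hc u).const_mul _
    have g1 : ∀ u : Spins N × Spins N, GBdd (tripleSize (size₁ P N K) sqSize) (rate + rate)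
        fun q => ovScale P N K *
          hidOv (netCouplings P β γ o N) 0 1 u.1 u.2 (rep₁ q) (rep₂ q) - o.p₁ := fun u =>
      (g0 u).sub ((GBdd.const (r := tripleSize (size₁ P N K) sqSize) o.p₁).mono
        hE.size_triple.nonneg (by norm_num))
    have h := hE.mean₁.sq_le (hE.int₁ (by norm_num) g1)
      (hE.int₁ (δ := rate + rate + (rate + rate)) (by norm_num) fun u =>
        ((g1 u).mul (g1 u)).congr fun p => by ring)
    rw [kavg_sub (hE.int₁ (by norm_num) g0) (hE.mean₁.int_fun fun _ => o.p₁),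
      kavg_const hE.mean₁.one, kavg_const_mul (ovScale P N K)] at h
    rw [← hY η]
    exact h
  calc (ovScale P N K * Y - o.p₁) ^ 2 =
        1 / 2 ^ N * ∑ _η : Spins N, (ovScale P N K * Y - o.p₁) ^ 2 := by
        rw [← card_spins_inv]
        simp
    _ ≤ _ := mul_le_mul_of_nonneg_left (Finset.sum_le_sum fun η _ => key η) (by positivity)

lemma tendsto_pred_div_numPatterns (hPe : Even P) (hP : 4 ≤ P) (hγ : 0 < γ) :
    Tendsto (fun N : ℕ => ((numPatterns γ (P - 1) N - 1 : ℕ) : ℝ) / numPatterns γ (P - 1) N) atTop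
      (𝓝 1) := by
  have h := tendsto_load_pred hPe hP hγ
  have h' := tendsto_load hPe hP hγ
  have h1 := h.div h' hγ.ne'
  rw [div_self hγ.ne'] at h1
  refine h1.congr' ?_
  filter_upwards [(tendsto_size_mul_nn hP).eventually_gt_atTop 0] with N hN
  rw [Pi.div_apply, div_div_div_cancel_right₀ hN.ne']

lemma tendsto_nn_mul_eps (hP : 4 ≤ P) (β : ℝ) :
    Tendsto (fun N : ℕ => nn P N * eps P β N) atTop (𝓝 (betaEff P β)) := by
  refine tendsto_const_nhds.congr' ?_
  filter_upwards [(tendsto_nn hP).eventually_gt_atTop 0] with N hN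
  rw [eps]
  field_simp

/-- At the beginning of the interpolation the hidden variables are independent of the spins, and
their overlaps are computed explicitly. -/
lemma OneRSBAnsatz.p_eq (ho : OneRSBAnsatz P β γ o) (hPe : Even P) (hP : 4 ≤ P)
    (hβ : 0 < β) (hγ : 0 < γ) (hθ0 : 0 < o.θ) (hθ1 : o.θ ≤ 1) (hQ₁ : 0 ≤ o.q₁ ^ (P / 2))
    (hQ₂ : 0 ≤ o.q₂ ^ (P / 2) - o.q₁ ^ (P / 2)) :
    o.p₁ = betaEff P β * o.q₁ ^ (P / 2) ∧ o.p₂ = betaEff P β * o.q₂ ^ (P / 2) := by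
  set Q₁ := o.q₁ ^ (P / 2)
  set Q₂ := o.q₂ ^ (P / 2)
  set θ := o.θ
  set n := nn P
  set e := eps P β
  set k : ℕ → ℝ := fun N =>
    ((numPatterns γ (P - 1) N - 1 : ℕ) : ℝ) / numPatterns γ (P - 1) N with hk
  have tk : Tendsto k atTop (𝓝 1) := tendsto_pred_div_numPatterns hPe hP hγ
  have te : Tendsto e atTop (𝓝 0) := tendsto_eps hP
  have tne : Tendsto (fun N => n N * e N) atTop (𝓝 (betaEff P β)) := tendsto_nn_mul_eps hP β
  have hA₁ : ∀ N, (netCouplings P β γ o N).A₁ ^ 2 = e N * Q₁ := fun N => coefA₁_sq hβ hQ₁ N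
  have hA₂ : ∀ N, (netCouplings P β γ o N).A₂ ^ 2 = e N * (Q₂ - Q₁) := fun N => coefA₂_sq hβ hQ₂ N
  have hC : ∀ N, (netCouplings P β γ o N).C = e N * (1 - Q₂) := fun N => rfl
  -- `y₁` and `y₂` are the exact means of the overlaps at `t = 0`.
  set y₁ : ℕ → ℝ := fun N => n N * e N * k N * Q₁ /
    (1 - e N * (1 - Q₂) - θ * (e N * (Q₂ - Q₁))) ^ 2 with hy₁
  have tD : Tendsto (fun N => 1 - e N * (1 - Q₂) - θ * (e N * (Q₂ - Q₁))) atTop (𝓝 1) := by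
    simpa using ((te.mul_const (1 - Q₂)).const_sub 1).sub ((te.mul_const (Q₂ - Q₁)).const_mul θ)
  have td : Tendsto (fun N => 1 - e N * (1 - Q₂)) atTop (𝓝 1) := by
    simpa using (te.mul_const (1 - Q₂)).const_sub 1
  have tE : Tendsto (fun N => 1 - e N * (1 - Q₂) - θ * (e N * Q₂)) atTop (𝓝 1) := by
    simpa using td.sub ((te.mul_const Q₂).const_mul θ)
  have ty₁ : Tendsto y₁ atTop (𝓝 (betaEff P β * Q₁)) := by
    have := (((tne.mul tk).mul_const Q₁).div (tD.pow 2) (by norm_num))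
    simp only [mul_one, one_pow, div_one] at this
    exact this
  set y₂ : ℕ → ℝ := fun N => (n N * e N * k N * Q₂ / (1 - e N * (1 - Q₂)) - θ * (e N * Q₁) * y₁ N) /
    (1 - e N * (1 - Q₂) - θ * (e N * Q₂)) with hy₂
  have ty₂ : Tendsto y₂ atTop (𝓝 (betaEff P β * Q₂)) := by
    have := ((((tne.mul tk).mul_const Q₂).div td (by norm_num)).sub
      (((te.mul_const Q₁).const_mul θ).mul ty₁)).div tE (by norm_num)
    simp only [mul_one, div_one, zero_mul, mul_zero, sub_zero] at this
    exact this
  have hev : ∀ᶠ N : ℕ in atTop, |y₁ N - o.p₁| ≤ √(avgPair₁ P β γ o 0 (K := numPatterns γ (P - 1) N)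
        (fun (_ : Spins N) τ _ τ' => (overlapP P N τ τ' - o.p₁) ^ 2)) ∧
      |y₂ N - o.p₂| ≤ √(avgPair₂ P β γ o 0 (K := numPatterns γ (P - 1) N)
        (fun (_ : Spins N) τ _ τ' => (overlapP P N τ τ' - o.p₂) ^ 2)) := by
    filter_upwards [eventually_small (γ := γ) (o := o) hPe hP hβ,
      (tendsto_numPatterns hPe hP hγ).eventually_gt_atTop 0, tE.eventually_const_lt one_pos,
      td.eventually_const_lt one_pos, eventually_gt_atTop 0] with N ha hK hEN hdN hN
    have hsc : ovScale P N (numPatterns γ (P - 1) N) ≠ 0 := (div_pos (nn_pos hN) hK).ne'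
    set K := numPatterns γ (P - 1) N with hKdef
    have hY₁ := fun η => ha.ovY₁_start (K := K) η hθ0 hθ1
    have s0 : |(0 : ℝ)| ≤ 1 := by norm_num
    have s1 : |(1 : ℝ)| ≤ 1 := by norm_num
    simp only [hA₁, hA₂, hC] at hY₁
    have e₁ : ovScale P N K * (((K - 1 : ℕ) : ℝ) * (e N * Q₁) /
        (1 - e N * (1 - Q₂) - θ * (e N * (Q₂ - Q₁))) ^ 2) = y₁ N := by
      rw [hy₁, ovScale]
      change n N / K * _ = n N * e N * (((K - 1 : ℕ) : ℝ) / K) * Q₁ / _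
      ring
    have hY₂ : ∀ η : Spins N,
        ovY₂ K P (netCouplings P β γ o N) η 0 1 o.θ = y₂ N / ovScale P N K := by
      intro η
      -- At `s = 0`, `c = 1` this is a linear equation for `ovY₂`, the other quantities being known.
      have h := ha.den_mul_hidSq (K := K) η s0 s1 hθ0 hθ1
      rw [hidSq_start ha η hθ0 hθ1, hY₁ η, hA₁, hA₂, den, hC] at h
      rw [eq_div_iff hsc, eq_div_iff hEN.ne', ← e₁]
      generalize ovY₂ K P (netCouplings P β γ o N) η 0 1 o.θ = Y at *
      have e₃ : n N * e N * k N * Q₂ / (1 - e N * (1 - Q₂)) =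
          ovScale P N K * (e N * Q₂ * (((K - 1 : ℕ) : ℝ) / (1 - e N * (1 - Q₂)))) := by
        rw [ovScale]
        change n N * e N * (((K - 1 : ℕ) : ℝ) / K) * Q₂ / _ = n N / K * _
        ring
      rw [e₃]
      simp only [one_pow, one_mul, ne_eq, OfNat.ofNat_ne_zero, not_false_eq_true, zero_pow,
        zero_mul, zero_add] at h
      linear_combination ovScale P N K * h
    have b₁ := abs_ovY₁_start_sub_le ha hθ0 hθ1 hY₁
    have b₂ := abs_ovY₂_start_sub_le ha hθ0 hθ1 hY₂
    rw [e₁] at b₁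
    rw [mul_div_cancel₀ _ hsc] at b₂
    exact ⟨b₁, b₂⟩
  constructor
  · exact tendsto_nhds_unique (tendsto_of_abs_sub_le_sqrt
      (ho.overlapP_conc₁ 0 (by simp)) (hev.mono fun N h => h.1)) ty₁
  · exact tendsto_nhds_unique (tendsto_of_abs_sub_le_sqrt
      (ho.overlapP_conc₂ 0 (by simp)) (hev.mono fun N h => h.2)) ty₂

end Constraints

/-! ### The derivative of the free energy along the interpolation -/

section BracketLimit

variable {P : ℕ} {β γ t : ℝ} {o : OrderParameters}

/-- The limit of `bracket` under the ansatz. -/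
def bracketLimit (P : ℕ) (β γ : ℝ) (o : OrderParameters) : ℝ :=
  betaEff P β * o.m ^ P - 2 * psi P β o * o.m
    - coefB₁ P β γ o ^ 2 * (1 + (o.θ - 1) * o.q₂ - o.θ * o.q₁)
    - coefB₂ P β γ o ^ 2 * (1 + (o.θ - 1) * o.q₂)

lemma tendsto_crossOv₂ (hPe : Even P) (hP : 4 ≤ P) (hβ : 0 < β) (hθ0 : 0 < o.θ) (hθ1 : o.θ ≤ 1)
    (ho : OneRSBAnsatz P β γ o) (ht : t ∈ Set.Ico (0 : ℝ) 1) :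
    Tendsto (fun N => crossOv₂ P N (numPatterns γ (P - 1) N) β γ t o) atTop (𝓝 0) := by
  have hq := ho.overlapQ_conc₂ t ht
  have hp := ho.overlapP_conc₂ t ht
  have h := ((hq.const_mul (powLip (P / 2) o.q₂ ^ 2 / 2)).add (hp.const_mul (1 / 2))).add
    ((hq.sqrt.const_mul (powLip (P / 2) o.q₂)).const_mul |o.p₂|)
  simp only [mul_zero, add_zero, Real.sqrt_zero] at h
  refine squeeze_zero_norm' ?_ h
  filter_upwards [eventually_small (γ := γ) (o := o) hPe hP hβ] with N ha
  exact abs_crossOv₂_le ha ht.1 ht.2.le hθ0 hθ1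

lemma tendsto_crossOv₁ (hPe : Even P) (hP : 4 ≤ P) (hβ : 0 < β) (hθ0 : 0 < o.θ) (hθ1 : o.θ ≤ 1)
    (ho : OneRSBAnsatz P β γ o) (ht : t ∈ Set.Ico (0 : ℝ) 1) :
    Tendsto (fun N => crossOv₁ P N (numPatterns γ (P - 1) N) β γ t o) atTop (𝓝 0) := by
  have hq := ho.overlapQ_conc₁ t ht
  have hp := ho.overlapP_conc₁ t ht
  have h := ((hq.const_mul (powLip (P / 2) o.q₁ ^ 2 / 2)).add (hp.const_mul (1 / 2))).add
    ((hq.sqrt.const_mul (powLip (P / 2) o.q₁)).const_mul |o.p₁|)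
  simp only [mul_zero, add_zero, Real.sqrt_zero] at h
  refine squeeze_zero_norm' ?_ h
  filter_upwards [eventually_small (γ := γ) (o := o) hPe hP hβ] with N ha
  exact abs_crossOv₁_le ha ht.1 ht.2.le hθ0 hθ1

lemma tendsto_magnetization_pow (hPe : Even P) (hP : 4 ≤ P) (hβ : 0 < β) (hθ0 : 0 < o.θ)
    (hθ1 : o.θ ≤ 1) (ho : OneRSBAnsatz P β γ o) (ht : t ∈ Set.Ico (0 : ℝ) 1) (n : ℕ) :
    Tendsto (fun N => avg P β γ o t (K := numPatterns γ (P - 1) N)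
      fun η σ : Spins N => magnetization η σ ^ n) atTop (𝓝 (o.m ^ n)) := by
  have h := (ho.magnetization_conc t ht).sqrt.const_mul (powLip n o.m)
  rw [Real.sqrt_zero, mul_zero] at h
  have h1 : Tendsto (fun N => avg P β γ o t (K := numPatterns γ (P - 1) N)
      (fun η σ : Spins N => magnetization η σ ^ n) - o.m ^ n) atTop (𝓝 0) := by
    refine squeeze_zero_norm' ?_ h
    filter_upwards [eventually_small (γ := γ) (o := o) hPe hP hβ] with N ha
    exact abs_avg_magnetization_pow_sub_le ha ht.1 ht.2.le hθ0 hθ1 n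
  simpa using h1.add_const (o.m ^ n)

/-- The overlaps self-average and the cross terms vanish. -/
lemma tendsto_bracket (hPe : Even P) (hP : 4 ≤ P) (hβ : 0 < β) (hγ : 0 < γ) (hθ0 : 0 < o.θ)
    (hθ1 : o.θ ≤ 1) (ho : OneRSBAnsatz P β γ o) (ht : t ∈ Set.Ico (0 : ℝ) 1) :
    Tendsto (fun N => bracket P N (numPatterns γ (P - 1) N) β γ t o) atTop
      (𝓝 (bracketLimit P β γ o)) := by
  have hm := tendsto_magnetization_pow hPe hP hβ hθ0 hθ1 ho ht
  have hq₂ := tendsto_overlapQ₂ hPe hP hβ hθ0 hθ1 ho ht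
  have hq₁ := tendsto_overlapQ₁ hPe hP hβ hθ0 hθ1 ho ht
  have hx₂ := tendsto_crossOv₂ hPe hP hβ hθ0 hθ1 ho ht
  have hx₁ := tendsto_crossOv₁ hPe hP hβ hθ0 hθ1 ho ht
  have hl := tendsto_load hPe hP hγ
  have h1 := hm 1
  simp only [pow_one] at h1
  have h := (((((hm P).const_mul (betaEff P β)).sub (h1.const_mul (2 * psi P β o))).add
    ((hl.const_mul (betaEff P β)).mul ((hx₂.const_mul (o.θ - 1)).sub (hx₁.const_mul o.θ)))).sub
    ((((hq₂.const_mul (o.θ - 1)).const_add 1).sub (hq₁.const_mul o.θ)).const_mul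
      (coefB₁ P β γ o ^ 2))).sub
    (((hq₂.const_mul (o.θ - 1)).const_add 1).const_mul (coefB₂ P β γ o ^ 2))
  have e : bracketLimit P β γ o = betaEff P β * o.m ^ P - 2 * psi P β o * o.m +
      betaEff P β * γ * ((o.θ - 1) * 0 - o.θ * 0) -
      coefB₁ P β γ o ^ 2 * (1 + (o.θ - 1) * o.q₂ - o.θ * o.q₁) -
      coefB₂ P β γ o ^ 2 * (1 + (o.θ - 1) * o.q₂) := by
    rw [bracketLimit]; ring
  rw [e]
  exact h

/-- The derivative is bounded uniformly in the size and in `t`. -/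
lemma eventually_abs_bracket_le (hPe : Even P) (hP : 4 ≤ P) (hβ : 0 < β) (hγ : 0 < γ)
    (hθ0 : 0 < o.θ) (hθ1 : o.θ ≤ 1) (hQ₁ : 0 ≤ o.q₁ ^ (P / 2))
    (hQ₂ : 0 ≤ o.q₂ ^ (P / 2) - o.q₁ ^ (P / 2)) :
    ∃ C, ∀ᶠ N in atTop, ∀ t ∈ Set.Icc (0 : ℝ) 1,
      |bracket P N (numPatterns γ (P - 1) N) β γ t o| ≤ C := by
  set b := betaEff P β with hb
  have hb0 : 0 < b := betaEff_pos hβ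
  set Q₁ := o.q₁ ^ (P / 2) with hQ₁def
  set Q₂ := o.q₂ ^ (P / 2) with hQ₂def
  set X := 5 * b * (1 + |Q₂|) with hX
  have hX0 : 0 ≤ X := by positivity
  refine ⟨b * 1 + 2 * |psi P β o| * 1 + b * (γ + 1) * ((1 + |Q₂|) * X + (1 + |Q₁|) * X)
    + coefB₁ P β γ o ^ 2 * 3 + coefB₂ P β γ o ^ 2 * 2, ?_⟩
  have te : Tendsto (fun N => eps P β N * (1 + |Q₂|)) atTop (𝓝 0) := by
    simpa using (tendsto_eps (β := β) hP).mul_const (1 + |Q₂|)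
  filter_upwards [eventually_small (γ := γ) (o := o) hPe hP hβ, eventually_gt_atTop 0,
    (tendsto_numPatterns hPe hP hγ).eventually_gt_atTop 0,
    (tendsto_load hPe hP hγ).eventually_le_const (lt_add_one γ),
    te.eventually_le_const (by norm_num : (0 : ℝ) < 1 / 50)] with N ha hN hK hl he t ht
  set K := numPatterns γ (P - 1) N
  have hs := abs_sqrt_le_one ht.2
  have hc := abs_sqrt_le_one (by linarith [ht.1] : 1 - t ≤ 1)
  have hn0 := nn_pos (P := P) hN
  have heps : 0 ≤ eps P β N := div_nonneg hb0.le hn0.le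
  -- The conditional means of the hidden variables satisfy `⟨∑ X_μ²⟩ = O(eps K)`, which bounds the
  -- rescaled overlap of the hidden variables.
  have hhid : ∀ η : Spins N, hidSq K P (netCouplings P β γ o N) η √t √(1 - t) o.θ ≤
      5 * (eps P β N * (1 + |Q₂|)) * K := by
    intro η
    refine (ha.hidSq_le (K := K) η hs hc hθ0 hθ1 (e := eps P β N * (1 + |Q₂|)) ?_ he).trans ?_
    · have h1 : (netCouplings P β γ o N).A₁ ^ 2 = eps P β N * Q₁ := coefA₁_sq hβ hQ₁ N
      have h2 : (netCouplings P β γ o N).A₂ ^ 2 = eps P β N * (Q₂ - Q₁) := coefA₂_sq hβ hQ₂ N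
      rw [kappa_sq hPe hP hβ hN, h1, h2, Real.sq_sqrt ht.1, Real.sq_sqrt (by linarith [ht.2])]
      have h3 : t * 1 ≤ 1 := by linarith [ht.2]
      have h4 : (1 - t) * Q₂ ≤ |Q₂| :=
        (le_abs_self _).trans (by
          rw [abs_mul, abs_of_nonneg (by linarith [ht.2] : 0 ≤ 1 - t)]
          exact mul_le_of_le_one_left (abs_nonneg _) (by linarith [ht.1]))
      calc t * eps P β N + (1 - t) * (eps P β N * Q₁ + eps P β N * (Q₂ - Q₁)) =
          eps P β N * (t * 1 + (1 - t) * Q₂) := by ring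
        _ ≤ _ := by gcongr
    · have hK1 : ((K - 1 : ℕ) : ℝ) ≤ K := by exact_mod_cast Nat.sub_le _ _
      gcongr
  have hsc : ovScale P N K * (5 * (eps P β N * (1 + |Q₂|)) * K) = X := by
    rw [ovScale, eps, hX]
    change nn P N / K * (5 * (b / nn P N * _) * _) = _
    field_simp
  have hx₂ := abs_crossOv₂_le_bound ha ht.1 ht.2 hθ0 hθ1 hhid
  have hx₁ := abs_crossOv₁_le_bound ha ht.1 ht.2 hθ0 hθ1 hhid
  rw [mul_assoc, hsc] at hx₂ hx₁
  have hmP := abs_avg_le (K := K) ha ht.1 ht.2 hθ0 hθ1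
    (f := fun η σ => magnetization η σ ^ P) fun η σ => abs_magnetization_pow_le η σ P
  have hm1 := abs_avg_le (K := K) ha ht.1 ht.2 hθ0 hθ1
    (f := fun η σ => magnetization η σ) fun η σ => abs_magnetization_le η σ
  have hq₂ := abs_avgPair₂_le (K := K) ha ht.1 ht.2 hθ0 hθ1
    (f := fun σ σ' => overlapQ σ σ') fun σ σ' => abs_overlapQ_le σ σ'
  have hq₁ := abs_avgPair₁_le (K := K) ha ht.1 ht.2 hθ0 hθ1
    (f := fun σ σ' => overlapQ σ σ') fun σ σ' => abs_overlapQ_le σ σ'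
  rw [bracket]
  have hl0 : 0 ≤ (K : ℝ) / (N * nn P N ^ 2) := by positivity
  generalize (K : ℝ) / (N * nn P N ^ 2) = l at *
  generalize crossOv₂ P N K β γ t o = x₂ at *
  generalize crossOv₁ P N K β γ t o = x₁ at *
  generalize avg P β γ o t (K := K) (fun η σ : Spins N => magnetization η σ ^ P) = mP at *
  generalize avg P β γ o t (K := K) (fun η σ : Spins N => magnetization η σ) = m1 at *
  generalize avgPair₂ P β γ o t (K := K) (fun (σ : Spins N) _ σ' _ => overlapQ σ σ') = q₂ at *
  generalize avgPair₁ P β γ o t (K := K) (fun (σ : Spins N) _ σ' _ => overlapQ σ σ') = q₁ at *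
  have hθa : |o.θ - 1| ≤ 1 := by rw [abs_le]; constructor <;> linarith
  have hθb : |o.θ| ≤ 1 := by rw [abs_of_pos hθ0]; exact hθ1
  have bq₂ : |(o.θ - 1) * q₂| ≤ 1 := by
    rw [abs_mul]; exact mul_le_one₀ hθa (abs_nonneg _) hq₂
  have bq₁ : |o.θ * q₁| ≤ 1 := by
    rw [abs_mul]; exact mul_le_one₀ hθb (abs_nonneg _) hq₁
  refine (abs_sub _ _).trans (add_le_add ((abs_sub _ _).trans (add_le_add
    ((abs_add_le _ _).trans (add_le_add ((abs_sub _ _).trans (add_le_add ?_ ?_)) ?_)) ?_)) ?_)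
  · rw [abs_mul, abs_of_pos hb0]
    gcongr
  · rw [abs_mul, abs_mul, abs_two]
    gcongr
  · rw [abs_mul, abs_mul, abs_of_pos hb0, abs_of_nonneg hl0]
    gcongr
    refine (abs_sub _ _).trans (add_le_add ?_ ?_)
    · rw [abs_mul]
      exact (mul_le_of_le_one_left (abs_nonneg _) hθa).trans hx₂
    · rw [abs_mul]
      exact (mul_le_of_le_one_left (abs_nonneg _) hθb).trans hx₁
  · rw [abs_mul, abs_of_nonneg (sq_nonneg _)]
    gcongr
    have h1 := abs_le.1 bq₂
    have h2 := abs_le.1 bq₁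
    rw [abs_le]
    constructor <;> linarith
  · rw [abs_mul, abs_of_nonneg (sq_nonneg _)]
    gcongr
    have h1 := abs_le.1 bq₂
    rw [abs_le]
    constructor <;> linarith

end BracketLimit

section FreeEnergy

variable {P N K : ℕ} {β γ θ : ℝ} {o : OrderParameters}

lemma measurable_hamD (a : Couplings) (η : Spins N) (s c s' c' : ℝ) (σ : Spins N) :
    Measurable fun p : EnvPt P N K => hamD a η s c s' c' σ p 0 := by
  have h1 := fun s c μ => measurable_fld (P := P) (K := K) a s c σ μ
  have h2 := measurable_spinFld (P := P) (K := K) a σ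
  unfold hamD fldD
  exact ((measurable_const.add ((h2.const_mul _).add measurable_const)).add
    ((Finset.measurable_sum _ fun μ _ => (h1 _ _ μ).mul
      ((h1 _ _ μ).add measurable_const)).div_const _)).add
    ((((Finset.measurable_sum _ fun μ _ => (h1 _ _ μ).pow_const 2).div_const _).add
      measurable_const).const_mul _)

/-- The interpolating free energy per spin at `t = sin² α`. -/
def freeEnergy (P N K : ℕ) (a : Couplings) (θ α : ℝ) : ℝ :=
  1 / 2 ^ N * ∑ η : Spins N, 1 / (θ * N) *
    ∫ x, Real.log (lvlU (lawAux N K) θ (ham a η (Real.sin α) (Real.cos α)) x) ∂(law₁ P N K)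

lemma Small.hasDerivAt_freeEnergy {a : Couplings} (ha : Small a P N) (hθ0 : 0 < θ) (hθ1 : θ ≤ 1)
    (α : ℝ) : HasDerivAt (freeEnergy P N K a θ)
      (1 / N * (1 / 2 ^ N * ∑ η : Spins N, iAvg₀ (P := P) (K := K) a η (Real.sin α) (Real.cos α) θ
        fun σ p => hamD a η (Real.sin α) (Real.cos α) (Real.cos α) (-Real.sin α) σ p 0)) α := by
  have key : ∀ η : Spins N, HasDerivAt (fun α => 1 / (θ * N) *
      ∫ x, Real.log (lvlU (lawAux N K) θ (ham a η (Real.sin α) (Real.cos α)) x) ∂(law₁ P N K))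
      (1 / N * iAvg₀ (P := P) (K := K) a η (Real.sin α) (Real.cos α) θ
        fun σ p => hamD a η (Real.sin α) (Real.cos α) (Real.cos α) (-Real.sin α) σ p 0) α := by
    intro η
    have bd : ∀ (s : ℝ) (σ : Spins N) (p : EnvPt P N K),
        |hamD a η (Real.sin s) (Real.cos s) (Real.cos s) (-Real.sin s) σ p 0| ≤
        (2 * |a.b₁| + 2 * |a.b₂| + spinConst a N + 2 * (K - 1 : ℕ)) + 1 * envSize P N K p :=
      fun s σ p => ha.abs_hamD_le η (Real.abs_sin_le_one s) (Real.abs_cos_le_one s)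
        (Real.abs_cos_le_one s) (by rw [abs_neg]; exact Real.abs_sin_le_one s) σ p
    have hC0 : 0 ≤ 2 * |a.b₁| + 2 * |a.b₂| + spinConst a N + 2 * ((K - 1 : ℕ) : ℝ) := by
      unfold spinConst
      positivity
    have hd := hasDerivAt_free_energy (isSize_size₁ (P := P) (N := N) (K := K)) isSize_sqSize
      hθ0 hθ1 (H := fun s => ham a η (Real.sin s) (Real.cos s))
      (H' := fun s σ p => hamD a η (Real.sin s) (Real.cos s) (Real.cos s) (-Real.sin s) σ p 0)
      (add_nonneg hC0 (by norm_num : (0 : ℝ) ≤ 20 * 1))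
      (fun s σ => measurable_ham a η _ _ σ) (fun s σ => measurable_hamD a η _ _ _ _ σ)
      (fun s σ p => hasDerivAt_ham a η σ (Real.hasDerivAt_sin s) (Real.hasDerivAt_cos s)
        (hasVel_const p s) (ha.den_pos (Real.abs_cos_le_one s)).ne')
      (fun s σ p => ha.ham_le η (Real.abs_sin_le_one s) (Real.abs_cos_le_one s) σ p)
      (fun s p => ha.exists_le_ham η (Real.abs_cos_le_one s) p)
      (fun s σ p => (bd s σ p).trans (affine_le_exp hC0 zero_le_one (envSize_nonneg p))) α
    refine (hd.const_mul (1 / (θ * N))).congr_deriv ?_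
    have hE := ha.env (K := K) η (Real.abs_sin_le_one α) (Real.abs_cos_le_one α) hθ0 hθ1
    rw [iAvg₀, hE.avg₀_eq (δ := rate) (by norm_num) fun σ =>
      GBdd.of_affine envSize_nonneg (measurable_hamD a η _ _ _ _ σ) hC0 zero_le_one (bd α σ)]
    rw [← mul_assoc]
    congr 1
    rw [one_div, mul_inv, one_div, mul_comm θ⁻¹, mul_assoc, inv_mul_cancel₀ hθ0.ne', mul_one]
  refine ((HasDerivAt.fun_sum fun η (_ : η ∈ Finset.univ) => key η).const_mul
    (1 / 2 ^ N : ℝ)).congr_deriv ?_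
  rw [← Finset.mul_sum]
  ring

lemma hasDerivAt_freeEnergy (hPe : Even P) (hP : 4 ≤ P) (hβ : 0 < β) (hN : 0 < N) (hK : 0 < K)
    (ha : Small (netCouplings P β γ o N) P N)
    (hθ0 : 0 < o.θ) (hθ1 : o.θ ≤ 1) (hQ₁ : 0 ≤ o.q₁ ^ (P / 2))
    (hQ₂ : 0 ≤ o.q₂ ^ (P / 2) - o.q₁ ^ (P / 2)) {α : ℝ} (h0 : 0 ≤ α) (h1 : α ≤ Real.pi / 2) :
    HasDerivAt (freeEnergy P N K (netCouplings P β γ o N) o.θ)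
      (Real.sin α * Real.cos α * bracket P N K β γ (Real.sin α ^ 2) o) α := by
  have hs : √(Real.sin α ^ 2) = Real.sin α :=
    Real.sqrt_sq (Real.sin_nonneg_of_nonneg_of_le_pi h0 (by linarith [Real.pi_pos]))
  have hc : √(1 - Real.sin α ^ 2) = Real.cos α := by
    rw [← Real.cos_sq', Real.sqrt_sq (Real.cos_nonneg_of_neg_pi_div_two_le_of_le
      (by linarith [Real.pi_pos]) h1)]
  have h := avg_hamD_eq_bracket hPe hP hβ hN hK ha (sq_nonneg (Real.sin α)) (Real.sin_sq_le_one α)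
    hθ0 hθ1 hQ₁ hQ₂
  rw [hs, hc] at h
  refine (ha.hasDerivAt_freeEnergy hθ0 hθ1 α).congr_deriv ?_
  have hN' : (N : ℝ) ≠ 0 := by positivity
  rw [h]
  field_simp

/-- At the end of the interpolation the system is the dense Hebbian network. -/
lemma ham_end (hPe : Even P) (hP : 4 ≤ P) (hβ : 0 < β) (hN : 0 < N) (η σ : Spins N)
    (p : EnvPt P N K) : ham (netCouplings P β γ o N) η 1 0 σ p =
      -β * hamiltonian P (P - 1) γ η p.1.1 σ := by
  have hsig : signalField P η σ ^ 2 = ((N : ℝ) * magnetization η σ) ^ P := by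
    have h1 : signalField P η σ = ∑ i : Fin (P / 2) → Fin N, mon η i * mon σ i := rfl
    rw [h1, sum_mon_mul_mon, ← pow_mul, Nat.div_mul_cancel hPe.two_dvd, magnetization]
    congr 1
    have : (N : ℝ) ≠ 0 := by positivity
    field_simp
  have hb := betaEff_pos (P := P) hβ
  have hκ : (netCouplings P β γ o N).κ ^ 2 = betaEff P β / (N : ℝ) ^ (P - 1) :=
    Real.sq_sqrt (by positivity)
  have hfac : (P ! : ℝ) ≠ 0 := by exact_mod_cast Nat.factorial_ne_zero P
  have hNp : (N : ℝ) ^ P = N ^ (P - 1) * N := by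
    rw [← pow_succ, Nat.sub_add_cancel (by omega)]
  have hN' : (N : ℝ) ^ (P - 1) ≠ 0 := by positivity
  have hfld : ∀ μ, fld (netCouplings P β γ o N) 1 0 σ p μ ^ 2 =
      betaEff P β / (N : ℝ) ^ (P - 1) * noiseField p.1.1 σ μ ^ 2 := by
    intro μ
    rw [← hκ, fld]
    ring
  rw [ham, den, hamiltonian, hsig, mul_pow, Nat.sub_add_cancel (by omega : 1 ≤ P)]
  simp only [hfld, ← Finset.mul_sum]
  have hb₁ : (netCouplings P β γ o N).b₁ = betaEff P β * N / 2 := rfl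
  have hb₃ : (netCouplings P β γ o N).b₃ =
    betaEff P β * γ / 2 * ((N : ℝ) ^ P / (N : ℝ) ^ (P / 2)) := rfl
  have hβe : betaEff P β = 2 * β / (P ! : ℝ) := rfl
  rw [hb₁, hb₃, hβe]
  norm_num
  rw [hNp]
  field_simp
  ring

/-- At the end of the interpolation the environment of the auxiliary fields is switched off, so the
two levels of averaging collapse and the free energy is the quenched pressure. -/
lemma freeEnergy_end (hPe : Even P) (hP : 4 ≤ P) (hβ : 0 < β) (hN : 0 < N) (hθ0 : 0 < o.θ) :
    freeEnergy P N (numPatterns γ (P - 1) N) (netCouplings P β γ o N) o.θ (Real.pi / 2) =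
      pressure P (P - 1) β γ N := by
  rw [freeEnergy, pressure, patternAvg, Real.sin_pi_div_two, Real.cos_pi_div_two, mul_left_comm]
  congr 1
  rw [Finset.mul_sum]
  refine Finset.sum_congr rfl fun η _ => ?_
  have e : ∀ x : Lvl₁ P N (numPatterns γ (P - 1) N),
      Real.log (lvlU (lawAux N (numPatterns γ (P - 1) N)) o.θ
        (ham (netCouplings P β γ o N) η 1 0) x) =
      o.θ * Real.log (partitionFunction P (P - 1) β γ η x.1) := by
    intro x
    have h1 : ∀ y, zpow o.θ (ham (netCouplings P β γ o N) η 1 0) (x, y) =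
        partitionFunction P (P - 1) β γ η x.1 ^ o.θ := by
      intro y
      simp only [zpow, zsum, ham_end hPe hP hβ hN]
      rfl
    have h2 : 0 < partitionFunction P (P - 1) β γ η x.1 :=
      Finset.sum_pos (fun _ _ => Real.exp_pos _) Finset.univ_nonempty
    rw [lvlU]
    simp only [h1, integral_const, probReal_univ, one_smul]
    exact Real.log_rpow h2 _
  simp only [e]
  rw [integral_const_mul, integral_fun_fst (μ := iidGaussian _) (ν := iidGaussian _)
    fun ξ => Real.log (partitionFunction P (P - 1) β γ η ξ)]
  rw [probReal_univ, one_smul]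
  have hN' : (N : ℝ) ≠ 0 := by positivity
  field_simp

end FreeEnergy

/-! ### The 1-RSB pressure -/

section RSB

variable {P : ℕ} {β γ : ℝ} {o : OrderParameters}

/-- Under the ansatz the strengths of the fields on the spins are genuine square roots. -/
lemma OneRSBAnsatz.coefB_sq (ho : OneRSBAnsatz P β γ o) (hPe : Even P) (hP : 4 ≤ P)
    (hβ : 0 < β) (hγ : 0 < γ) (hθ0 : 0 < o.θ) (hθ1 : o.θ ≤ 1) :
    coefB₁ P β γ o ^ 2 = betaEff P β / 2 * γ * P * (o.p₁ * o.q₁ ^ (P / 2 - 1)) ∧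
    coefB₂ P β γ o ^ 2 = betaEff P β / 2 * γ * P *
      (o.p₂ * o.q₂ ^ (P / 2 - 1) - o.p₁ * o.q₁ ^ (P / 2 - 1)) := by
  have hq₁ := ho.q₁_nonneg hPe hP hβ hθ0 hθ1
  have hq₂ := ho.q₁_le_q₂ hPe hP hβ hθ0 hθ1
  have hQ := pow_le_pow_left₀ hq₁ hq₂ (P / 2)
  obtain ⟨hp₁, hp₂⟩ := ho.p_eq hPe hP hβ hγ hθ0 hθ1 (by positivity) (by linarith)
  have hb := (betaEff_pos (P := P) hβ).le
  have h1 : 0 ≤ o.p₁ := by rw [hp₁]; positivity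
  have h2 : o.p₁ ≤ o.p₂ := by
    rw [hp₁, hp₂]
    exact mul_le_mul_of_nonneg_left hQ hb
  have h4 : 0 ≤ o.p₂ := h1.trans h2
  have h3 : o.p₁ * o.q₁ ^ (P / 2 - 1) ≤ o.p₂ * o.q₂ ^ (P / 2 - 1) := by gcongr
  exact ⟨Real.sq_sqrt (by positivity),
    Real.sq_sqrt (mul_nonneg (by positivity) (sub_nonneg.2 h3))⟩

lemma startLimit_add (hPe : Even P) (hP : 4 ≤ P)
    (hβ : 0 < β) (hγ : 0 < γ) (hθ0 : 0 < o.θ) (hθ1 : o.θ ≤ 1) (ho : OneRSBAnsatz P β γ o) :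
    startLimit P β γ o + bracketLimit P β γ o / 2 = oneRSBPressure P β γ o := by
  have hq₁ := ho.q₁_nonneg hPe hP hβ hθ0 hθ1
  have hQ := pow_le_pow_left₀ hq₁ (ho.q₁_le_q₂ hPe hP hβ hθ0 hθ1) (P / 2)
  obtain ⟨hp₁, hp₂⟩ := ho.p_eq hPe hP hβ hγ hθ0 hθ1 (by positivity) (by linarith)
  obtain ⟨hB₁, hB₂⟩ := ho.coefB_sq hPe hP hβ hγ hθ0 hθ1
  have e₁ : o.q₁ ^ (P / 2) = o.q₁ ^ (P / 2 - 1) * o.q₁ := by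
    rw [← pow_succ, Nat.sub_add_cancel (by omega)]
  have e₂ : o.q₂ ^ (P / 2) = o.q₂ ^ (P / 2 - 1) * o.q₂ := by
    rw [← pow_succ, Nat.sub_add_cancel (by omega)]
  have em : o.m ^ P = o.m ^ (P - 1) * o.m := by
    rw [← pow_succ, Nat.sub_add_cancel (by omega)]
  rw [startLimit, bracketLimit, oneRSBPressure, hB₁, hB₂, psi, em]
  rw [e₁] at hp₁ ⊢
  rw [e₂] at hp₂ ⊢
  rw [hp₁, hp₂]
  ring

/-- The fundamental theorem of calculus along a sequence of interpolations. -/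
lemma tendsto_of_interpolation {F D : ℕ → ℝ → ℝ} {x y L C : ℝ}
    (hD : ∀ᶠ N in atTop, ∀ α ∈ Set.Icc (0 : ℝ) (Real.pi / 2),
      HasDerivAt (F N) (Real.sin α * Real.cos α * D N (Real.sin α ^ 2)) α)
    (hC : ∀ᶠ N in atTop, ∀ t ∈ Set.Icc (0 : ℝ) 1, |D N t| ≤ C)
    (hL : ∀ t ∈ Set.Ico (0 : ℝ) 1, Tendsto (fun N => D N t) atTop (𝓝 L))
    (hx : Tendsto (fun N => F N 0) atTop (𝓝 x)) (hy : x + L / 2 = y) :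
    Tendsto (fun N => F N (Real.pi / 2)) atTop (𝓝 y) := by
  have hpi : (0 : ℝ) ≤ Real.pi / 2 := by positivity
  have hsub : Set.uIoc 0 (Real.pi / 2) ⊆ Set.Icc 0 (Real.pi / 2) := by
    rw [Set.uIoc_of_le hpi]
    exact Set.Ioc_subset_Icc_self
  have hbd : ∀ᶠ N in atTop, ∀ α ∈ Set.Icc (0 : ℝ) (Real.pi / 2), ‖deriv (F N) α‖ ≤ C := by
    filter_upwards [hD, hC] with N h1 h2 α hα
    have h3 := h2 (Real.sin α ^ 2) ⟨sq_nonneg _, Real.sin_sq_le_one α⟩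
    rw [(h1 α hα).deriv, Real.norm_eq_abs, abs_mul, abs_mul]
    calc |Real.sin α| * |Real.cos α| * |D N (Real.sin α ^ 2)| ≤ 1 * 1 * C := by
          gcongr
          · exact Real.abs_sin_le_one α
          · exact Real.abs_cos_le_one α
      _ = C := by ring
  have hint : ∀ᶠ N in atTop, ∫ α in (0 : ℝ)..(Real.pi / 2), deriv (F N) α =
      F N (Real.pi / 2) - F N 0 := by
    filter_upwards [hD, hbd] with N h1 h2
    refine intervalIntegral.integral_eq_sub_of_hasDerivAt
      (fun α hα => (h1 α (by rwa [Set.uIcc_of_le hpi] at hα)).differentiableAt.hasDerivAt) ?_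
    refine (intervalIntegrable_const (c := C)).mono_fun
      (measurable_deriv _).aestronglyMeasurable ?_
    refine (ae_restrict_mem measurableSet_uIoc).mono fun α hα => ?_
    exact (h2 α (hsub hα)).trans (le_abs_self C)
  have hlim : Tendsto (fun N => ∫ α in (0 : ℝ)..(Real.pi / 2), deriv (F N) α) atTop
      (𝓝 (∫ α in (0 : ℝ)..(Real.pi / 2), Real.sin α * Real.cos α * L)) := by
    refine intervalIntegral.tendsto_integral_filter_of_dominated_convergence (fun _ => C)
      (Eventually.of_forall fun N => (measurable_deriv _).aestronglyMeasurable) ?_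
      intervalIntegrable_const ?_
    · filter_upwards [hbd] with N h
      exact ae_of_all _ fun α hα => h α (hsub hα)
    · refine ae_of_all _ fun α hα => ?_
      have hα' := hsub hα
      have hder : (fun N => Real.sin α * Real.cos α * D N (Real.sin α ^ 2)) =ᶠ[atTop]
          fun N => deriv (F N) α := by
        filter_upwards [hD] with N h
        exact (h α hα').deriv.symm
      refine Tendsto.congr' hder ?_
      -- At the right endpoint, where the ansatz says nothing, the factor `cos α` vanishes.
      rcases eq_or_lt_of_le hα'.2 with h | h
      · simp [h]
      · refine (hL _ ⟨sq_nonneg _, ?_⟩).const_mul _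
        have hc : 0 < Real.cos α :=
          Real.cos_pos_of_mem_Ioo ⟨by linarith [hα'.1, Real.pi_pos], h⟩
        nlinarith [Real.sin_sq_add_cos_sq α]
  -- The integral of `sin α cos α` over the quarter period is `1 / 2`.
  have hval : ∫ α in (0 : ℝ)..(Real.pi / 2), Real.sin α * Real.cos α * L = L / 2 := by
    rw [intervalIntegral.integral_mul_const, integral_sin_mul_cos₁]
    simp
    ring
  rw [hval] at hlim
  have h := hx.add hlim
  rw [hy] at h
  refine h.congr' ?_
  filter_upwards [hint] with N h
  rw [h]
  ring

lemma tendsto_freeEnergy_start (hPe : Even P) (hP : 4 ≤ P) (hβ : 0 < β) (hγ : 0 < γ)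
    (hθ0 : 0 < o.θ) (hθ1 : o.θ ≤ 1) (hQ₁ : 0 ≤ o.q₁ ^ (P / 2))
    (hQ₂ : 0 ≤ o.q₂ ^ (P / 2) - o.q₁ ^ (P / 2)) :
    Tendsto (fun N => freeEnergy P N (numPatterns γ (P - 1) N) (netCouplings P β γ o N) o.θ 0)
      atTop (𝓝 (startLimit P β γ o)) := by
  refine tendsto_start hPe hP hβ hγ hθ0 hθ1 hQ₁ hQ₂ ?_
  have h1 : Tendsto (fun N => 1 - eps P β N * (1 - o.q₂ ^ (P / 2))) atTop (𝓝 1) := by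
    simpa using ((tendsto_eps (β := β) hP).mul_const (1 - o.q₂ ^ (P / 2))).const_sub 1
  have h2 : Tendsto (fun N => 1 - eps P β N * (1 - o.q₂ ^ (P / 2)) -
      o.θ * (eps P β N * (o.q₂ ^ (P / 2) - o.q₁ ^ (P / 2)))) atTop (𝓝 1) := by
    simpa using h1.sub (((tendsto_eps (β := β) hP).mul_const
      (o.q₂ ^ (P / 2) - o.q₁ ^ (P / 2))).const_mul o.θ)
  filter_upwards [h1.eventually_const_lt one_pos, h2.eventually_const_lt one_pos] with N hd hD
  refine ⟨1, ?_⟩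
  have hd' : 0 < 1 - (netCouplings P β γ o N).C := hd
  have hD' : 0 < 1 - (netCouplings P β γ o N).C - o.θ * (netCouplings P β γ o N).A₂ ^ 2 := by
    have h3 : (netCouplings P β γ o N).A₂ ^ 2 = _ := coefA₂_sq hβ hQ₂ N
    rw [h3]
    exact hD
  rw [freeEnergy, Real.sin_zero, Real.cos_zero]
  -- At the start the free energy does not depend on the first pattern.
  simp only [free_energy_start hθ0 hθ1 hd' hD']
  rw [← card_spins_inv, Finset.sum_const, nsmul_eq_mul, Finset.card_univ, ← mul_assoc,
    inv_mul_cancel₀ (by positivity), one_mul]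

theorem tendsto_pressure (hPe : Even P) (hP : 4 ≤ P) (hβ : 0 < β) (hγ : 0 < γ)
    (hθ0 : 0 < o.θ) (hθ1 : o.θ ≤ 1) (ho : OneRSBAnsatz P β γ o) :
    Tendsto (fun N : ℕ => pressure P (P - 1) β γ N) atTop (𝓝 (oneRSBPressure P β γ o)) := by
  have hq₁ := ho.q₁_nonneg hPe hP hβ hθ0 hθ1
  have hQ₁ : 0 ≤ o.q₁ ^ (P / 2) := by positivity
  have hQ₂ : 0 ≤ o.q₂ ^ (P / 2) - o.q₁ ^ (P / 2) :=
    sub_nonneg.2 (pow_le_pow_left₀ hq₁ (ho.q₁_le_q₂ hPe hP hβ hθ0 hθ1) (P / 2))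
  obtain ⟨C, hC⟩ := eventually_abs_bracket_le hPe hP hβ hγ hθ0 hθ1 hQ₁ hQ₂
  have h := tendsto_of_interpolation
    (F := fun N => freeEnergy P N (numPatterns γ (P - 1) N) (netCouplings P β γ o N) o.θ)
    (D := fun N t => bracket P N (numPatterns γ (P - 1) N) β γ t o) (by
      filter_upwards [eventually_small (γ := γ) (o := o) hPe hP hβ, eventually_gt_atTop 0,
        (tendsto_numPatterns hPe hP hγ).eventually_gt_atTop 0] with N ha hN hK α hα
      exact hasDerivAt_freeEnergy hPe hP hβ hN (by exact_mod_cast hK) ha hθ0 hθ1 hQ₁ hQ₂ hα.1 hα.2)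
    hC (fun t ht => tendsto_bracket hPe hP hβ hγ hθ0 hθ1 ho ht)
    (tendsto_freeEnergy_start hPe hP hβ hγ hθ0 hθ1 hQ₁ hQ₂)
    (startLimit_add hPe hP hβ hγ hθ0 hθ1 ho)
  refine h.congr' ?_
  filter_upwards [eventually_gt_atTop 0] with N hN
  exact freeEnergy_end hPe hP hβ hN hθ0

end RSB

/-! ### Sums of squares of Gaussian variables -/

section ChiSquare

variable {ι κ : Type} [Fintype ι] [Fintype κ]

/-- Orthonormal linear functionals of a standard Gaussian vector are independent and standard
Gaussian. -/
lemma map_iidGaussian [DecidableEq κ] (c : κ → ι → ℝ)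
    (hc : ∀ a b, ∑ i, c a i * c b i = if a = b then 1 else 0) :
    (iidGaussian ι).map (fun ξ a => ∑ i, c a i * ξ i) = iidGaussian κ := by
  refine (MeasurableEquiv.toLp 2 (κ → ℝ)).map_measurableEquiv_injective ?_
  change Measure.map (WithLp.toLp 2) _ = Measure.map (WithLp.toLp 2) _
  have hκ : Measure.map (WithLp.toLp 2) (iidGaussian κ) = stdGaussian (EuclideanSpace ℝ κ) :=
    map_pi_eq_stdGaussian
  have hι : Measure.map (WithLp.toLp 2) (iidGaussian ι) = stdGaussian (EuclideanSpace ℝ ι) :=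
    map_pi_eq_stdGaussian
  have hm : Measurable fun (ξ : ι → ℝ) (a : κ) => ∑ i, c a i * ξ i := by fun_prop
  rw [hκ, Measure.map_map (by fun_prop) hm]
  have : IsProbabilityMeasure (iidGaussian ι) := by unfold iidGaussian; infer_instance
  have hm' : Measurable (WithLp.toLp 2 ∘ fun (ξ : ι → ℝ) (a : κ) => ∑ i, c a i * ξ i) := by
    fun_prop
  have : IsProbabilityMeasure ((iidGaussian ι).map
      (WithLp.toLp 2 ∘ fun (ξ : ι → ℝ) (a : κ) => ∑ i, c a i * ξ i)) :=
    Measure.isProbabilityMeasure_map hm'.aemeasurable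
  refine Measure.ext_of_charFun (E := EuclideanSpace ℝ κ) ?_
  ext t
  set s : EuclideanSpace ℝ ι := WithLp.toLp 2 fun i => ∑ a, c a i * t a with hs
  have hst : ∀ ξ : ι → ℝ, inner ℝ (WithLp.toLp 2 fun a => ∑ i, c a i * ξ i) t =
      inner ℝ (WithLp.toLp 2 ξ) s := by
    intro ξ
    simp only [PiLp.inner_apply, hs, RCLike.inner_apply, conj_trivial]
    simp only [Finset.mul_sum, Finset.sum_mul]
    rw [Finset.sum_comm]
    exact Finset.sum_congr rfl fun i _ => Finset.sum_congr rfl fun a _ => by ring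
  have hn : ‖s‖ ^ 2 = ‖t‖ ^ 2 := by
    rw [EuclideanSpace.real_norm_sq_eq, EuclideanSpace.real_norm_sq_eq]
    have h1 : ∀ i, s i ^ 2 = ∑ a, ∑ b, t a * t b * (c a i * c b i) := by
      intro i
      rw [hs, sq]
      simp only
      rw [Finset.sum_mul_sum]
      exact Finset.sum_congr rfl fun a _ => Finset.sum_congr rfl fun b _ => by ring
    simp only [h1]
    rw [Finset.sum_comm]
    refine Finset.sum_congr rfl fun a _ => ?_
    rw [Finset.sum_comm]
    simp only [← Finset.mul_sum, hc]
    simp [sq]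
  have h2 := charFun_stdGaussian s
  rw [← hι, charFun_apply, integral_map (by fun_prop) (by fun_prop)] at h2
  rw [charFun_apply, integral_map hm'.aemeasurable (by fun_prop), charFun_stdGaussian,
    ← (sq_eq_sq₀ (norm_nonneg s) (norm_nonneg t)).1 hn, ← h2]
  simp only [Function.comp_apply, hst]

/-- The exponential moments of a centered squared standard Gaussian variable. -/
def chiMgf (v : ℝ) : ℝ := ∫ x, Real.exp (v * (x ^ 2 - 1)) ∂stdG

lemma chi_exp_eq (v x : ℝ) : Real.exp (v * (x ^ 2 - 1)) =
    Real.exp (-v) * Real.exp (0 * x + 2 * v / 2 * x ^ 2) := by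
  rw [← Real.exp_add]
  congr 1; ring

lemma integrable_chi {v : ℝ} (hv : 2 * v < 1) :
    Integrable (fun x => Real.exp (v * (x ^ 2 - 1))) stdG := by
  simp only [chi_exp_eq]
  exact (integrable_exp_quadratic 0 (2 * v) hv).const_mul _

lemma chiMgf_eq {v : ℝ} (hv : 2 * v < 1) :
    chiMgf v = Real.exp ((-Real.log (1 - 2 * v) - 2 * v) / 2) := by
  rw [chiMgf]
  simp only [chi_exp_eq]
  rw [integral_const_mul, integral_exp_quadratic 0 (2 * v) hv, tiltNorm,
    inv_sqrt_eq_exp (by linarith), ← Real.exp_add, ← Real.exp_add]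
  congr 1; ring

lemma chiMgf_zero : chiMgf 0 = 1 := by
  rw [chiMgf_eq (by norm_num)]
  simp

lemma integrable_exp_sum_chi {v : ι → ℝ} (hv : ∀ a, 2 * v a < 1) :
    Integrable (fun x : ι → ℝ => Real.exp (∑ a, v a * (x a ^ 2 - 1))) (iidGaussian ι) := by
  simp only [Real.exp_sum]
  exact Integrable.fintype_prod (f := fun a x => Real.exp (v a * (x ^ 2 - 1)))
    fun a => integrable_chi (hv a)

lemma integral_exp_sum_chi (v : ι → ℝ) :
    ∫ x : ι → ℝ, Real.exp (∑ a, v a * (x a ^ 2 - 1)) ∂(iidGaussian ι) = ∏ a, chiMgf (v a) := by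
  simp only [Real.exp_sum]
  exact integral_fintype_prod_eq_prod (f := fun a x => Real.exp (v a * (x ^ 2 - 1)))

/-- The exponential moments of a normalized centered chi-square variable with `n` degrees of
freedom. -/
def chiMoment (n : ℕ) (u : ℝ) : ℝ := chiMgf (u / √n) ^ n

/-- The central limit theorem for chi-square variables, at the level of exponential moments. -/
lemma tendsto_chiMoment (u : ℝ) :
    Tendsto (fun n => chiMoment n u) atTop (𝓝 (Real.exp (u ^ 2))) := by
  have hn : Tendsto (fun n : ℕ => √(n : ℝ)) atTop atTop :=
    Real.tendsto_sqrt_atTop.comp tendsto_natCast_atTop_atTop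
  have h1 := tendsto_sq_mul_log (x := fun n : ℕ => 2 * (u / √n)) (y := 2 * u) hn (by
    refine tendsto_const_nhds.congr' ?_
    filter_upwards [hn.eventually_gt_atTop 0] with n h
    field_simp)
  have h2 := Real.continuous_exp.continuousAt.tendsto.comp (h1.div_const 2)
  have e : (2 * u) ^ 2 / 2 / 2 = u ^ 2 := by ring
  rw [e] at h2
  refine h2.congr' ?_
  have h0 : Tendsto (fun n : ℕ => 2 * (u / √n)) atTop (𝓝 0) := by
    simpa using (tendsto_const_nhds (x := u).div_atTop hn).const_mul 2
  filter_upwards [h0.eventually_lt_const one_pos] with n hlt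
  rw [Function.comp_apply, chiMoment, chiMgf_eq hlt, ← Real.exp_nat_mul,
    Real.sq_sqrt (Nat.cast_nonneg n)]
  congr 1; ring

variable {n R : ℕ}

/-- The centered sums of squares of the columns of a matrix. -/
def chiSum (x : Fin n × Fin R → ℝ) (j : Fin R) : ℝ := ∑ μ, (x (μ, j) ^ 2 - 1)

lemma chiSum_comb (w : Fin R → ℝ) (x : Fin n × Fin R → ℝ) :
    ∑ j, w j * chiSum x j = ∑ a : Fin n × Fin R, w a.2 * (x a ^ 2 - 1) := by
  rw [Fintype.sum_prod_type_right]
  simp only [chiSum, Finset.mul_sum]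

lemma integral_exp_chiSum_comb (w : Fin R → ℝ) :
    ∫ x, Real.exp (∑ j, w j * chiSum x j) ∂(iidGaussian (Fin n × Fin R)) =
      ∏ j, chiMgf (w j) ^ n := by
  simp only [chiSum_comb]
  rw [integral_exp_sum_chi fun a : Fin n × Fin R => w a.2, Fintype.prod_prod_type_right]
  simp

lemma integrable_exp_chiSum_comb {w : Fin R → ℝ} (hw : ∀ j, 2 * w j < 1) :
    Integrable (fun x => Real.exp (∑ j, w j * chiSum x j)) (iidGaussian (Fin n × Fin R)) := by
  simp only [chiSum_comb]
  exact integrable_exp_sum_chi fun a => hw a.2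

lemma sum_single_mul (v : ℝ) (i : Fin R) (y : Fin R → ℝ) :
    ∑ j, (if j = i then v else 0) * y j = v * y i := by simp

lemma integral_exp_chiSum (v : ℝ) (i : Fin R) :
    ∫ x, Real.exp (v * chiSum x i) ∂(iidGaussian (Fin n × Fin R)) = chiMgf v ^ n := by
  have h := integral_exp_chiSum_comb (n := n) fun j => if j = i then v else 0
  simp only [sum_single_mul] at h
  rw [h, Finset.prod_eq_single i]
  · simp
  · intro j _ hj
    simp [hj, chiMgf_zero]
  · simp

lemma integrable_exp_chiSum {v : ℝ} (hv : 2 * v < 1) (i : Fin R) :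
    Integrable (fun x => Real.exp (v * chiSum x i)) (iidGaussian (Fin n × Fin R)) := by
  have h := integrable_exp_chiSum_comb (n := n) (w := fun j => if j = i then v else 0) fun j => by
    split_ifs <;> linarith
  simpa only [sum_single_mul] using h

lemma integral_exp_chiSum_add (v : ℝ) {i j : Fin R} (hij : i ≠ j) :
    ∫ x, Real.exp (v * (chiSum x i + chiSum x j)) ∂(iidGaussian (Fin n × Fin R)) =
      (chiMgf v ^ n) ^ 2 := by
  have h := integral_exp_chiSum_comb (n := n)
    fun l => (if l = i then v else 0) + if l = j then v else 0
  simp only [add_mul, Finset.sum_add_distrib, sum_single_mul] at h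
  simp only [mul_add]
  rw [h, ← Finset.mul_prod_erase _ _ (Finset.mem_univ i),
    ← Finset.mul_prod_erase _ _ (Finset.mem_erase.2 ⟨hij.symm, Finset.mem_univ j⟩),
    Finset.prod_eq_one]
  · simp [hij, hij.symm, sq]
  · intro l hl
    simp only [Finset.mem_erase, Finset.mem_univ, and_true] at hl
    simp [hl.1, hl.2, chiMgf_zero]

lemma integrable_exp_chiSum_add {v : ℝ} (hv : 4 * v < 1) (i j : Fin R) :
    Integrable (fun x => Real.exp (v * (chiSum x i + chiSum x j)))
      (iidGaussian (Fin n × Fin R)) := by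
  have h := integrable_exp_chiSum_comb (n := n)
    (w := fun l => (if l = i then v else 0) + if l = j then v else 0) fun l => by
    split_ifs <;> linarith
  simp only [add_mul, Finset.sum_add_distrib, sum_single_mul] at h
  simpa only [mul_add] using h

lemma integral_chiSum (j : Fin R) :
    Integrable (fun x : Fin n × Fin R → ℝ => chiSum x j) (iidGaussian (Fin n × Fin R)) ∧
      ∫ x : Fin n × Fin R → ℝ, chiSum x j ∂(iidGaussian (Fin n × Fin R)) = 0 := by
  have hi : Integrable (fun x : ℝ => x ^ 2 - 1) stdG :=
    ((memLp_id_gaussianReal 2).integrable_sq).sub (integrable_const _)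
  have h0 : ∫ x, (x ^ 2 - 1) ∂stdG = 0 := by
    have hi2 : Integrable (fun x : ℝ => x ^ 2) stdG := (memLp_id_gaussianReal 2).integrable_sq
    rw [integral_sub hi2 (integrable_const _), integral_sq_stdG]
    simp
  have hI : ∀ a : Fin n × Fin R, Integrable (fun x : Fin n × Fin R → ℝ => x a ^ 2 - 1)
      (iidGaussian (Fin n × Fin R)) := fun a =>
    integrable_comp_eval (μ := fun _ : Fin n × Fin R => stdG) (i := a) hi
  refine ⟨integrable_finsetSum _ fun μ _ => hI (μ, j), ?_⟩
  simp only [chiSum]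
  rw [integral_finsetSum _ fun μ _ => hI (μ, j)]
  refine Finset.sum_eq_zero fun μ _ => ?_
  rw [← h0]
  exact integral_comp_eval (μ := fun _ : Fin n × Fin R => stdG) (i := (μ, j))
    (f := fun x => x ^ 2 - 1) hi.aestronglyMeasurable

lemma integral_sum_exp_chiSum {v : ℝ} (hv : 4 * v < 1) :
    Integrable (fun x : Fin n × Fin R → ℝ => ∑ j, Real.exp (v * chiSum x j))
        (iidGaussian (Fin n × Fin R)) ∧
      ∫ x : Fin n × Fin R → ℝ, ∑ j, Real.exp (v * chiSum x j) ∂(iidGaussian (Fin n × Fin R)) =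
        R * chiMgf v ^ n := by
  have hI : ∀ j, Integrable (fun x : Fin n × Fin R → ℝ => Real.exp (v * chiSum x j))
      (iidGaussian (Fin n × Fin R)) := fun j => integrable_exp_chiSum (by linarith) j
  refine ⟨integrable_finsetSum _ fun j _ => hI j, ?_⟩
  rw [integral_finsetSum _ fun j _ => hI j]
  simp [integral_exp_chiSum]

/-- The off-diagonal pairs factorize by independence. -/
lemma integral_sum_exp_chiSum_sq {v : ℝ} (hv : 4 * v < 1) :
    Integrable (fun x : Fin n × Fin R → ℝ => (∑ j, Real.exp (v * chiSum x j)) ^ 2)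
        (iidGaussian (Fin n × Fin R)) ∧
      ∫ x : Fin n × Fin R → ℝ, (∑ j, Real.exp (v * chiSum x j)) ^ 2
          ∂(iidGaussian (Fin n × Fin R)) ≤
        R * chiMgf (2 * v) ^ n + (R * chiMgf v ^ n) ^ 2 := by
  have e : ∀ x : Fin n × Fin R → ℝ, (∑ j, Real.exp (v * chiSum x j)) ^ 2 =
      ∑ i, ∑ j, Real.exp (v * (chiSum x i + chiSum x j)) := by
    intro x
    rw [sq, Finset.sum_mul_sum]
    exact Finset.sum_congr rfl fun i _ => Finset.sum_congr rfl fun j _ => by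
      rw [mul_add, Real.exp_add]
  have hI : ∀ i j, Integrable (fun x : Fin n × Fin R → ℝ =>
      Real.exp (v * (chiSum x i + chiSum x j))) (iidGaussian (Fin n × Fin R)) := fun i j =>
    integrable_exp_chiSum_add hv i j
  simp only [e]
  refine ⟨integrable_finsetSum _ fun i _ => integrable_finsetSum _ fun j _ => hI i j, ?_⟩
  rw [integral_finsetSum _ fun i _ => integrable_finsetSum _ fun j _ => hI i j]
  have hb : ∀ i j : Fin R, ∫ x : Fin n × Fin R → ℝ, Real.exp (v * (chiSum x i + chiSum x j))
      ∂(iidGaussian (Fin n × Fin R)) ≤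
        (if i = j then chiMgf (2 * v) ^ n else 0) + (chiMgf v ^ n) ^ 2 := by
    intro i j
    split_ifs with h
    · subst h
      refine le_trans (le_of_eq ?_) (le_add_of_nonneg_right (sq_nonneg _))
      rw [← integral_exp_chiSum (2 * v) i]
      refine integral_congr_ae (ae_of_all _ fun x => ?_)
      simp only
      congr 1; ring
    · rw [zero_add, integral_exp_chiSum_add v h]
  calc _ ≤ ∑ i : Fin R, ∑ j : Fin R,
        ((if i = j then chiMgf (2 * v) ^ n else 0) + (chiMgf v ^ n) ^ 2) :=
        Finset.sum_le_sum fun i _ => by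
          rw [integral_finsetSum _ fun j _ => hI i j]
          exact Finset.sum_le_sum fun j _ => hb i j
    _ = _ := by
        simp [Finset.sum_add_distrib]
        ring

/-- A lower bound for the maximum of the chi-square sums, by the second moment method: either the
sum of the exponentials is at least half of its mean `R w`, or its normalized deviation from the
mean is at least `1 / 2`. -/
def maxBound (j₀ : Fin R) (v w : ℝ) (x : Fin n × Fin R → ℝ) : ℝ :=
  Real.log (w / 2) / v * (1 - 4 * ((∑ j, Real.exp (v * chiSum x j)) / (R * w) - 1) ^ 2) +
    (chiSum x j₀ - √n * Real.exp ((√n)⁻¹ * chiSum x j₀))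

/-- In the first case of the second moment method some summand is at least `w / 2`; in the second
the leading term of `maxBound` is nonpositive and the remaining one is at most `chiSum x j₀`. -/
lemma exists_maxBound_le (hn : 0 < n) (j₀ : Fin R) {v w : ℝ} (hv : 0 < v) (hw : 2 ≤ w)
    (x : Fin n × Fin R → ℝ) : ∃ j, maxBound j₀ v w x ≤ chiSum x j := by
  have hR : 0 < R := Fin.pos j₀
  have hR' : (0 : ℝ) < R := by exact_mod_cast hR
  have hs : (0 : ℝ) < √n := Real.sqrt_pos.2 (by exact_mod_cast hn)
  have hb : 0 ≤ Real.log (w / 2) / v :=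
    div_nonneg (Real.log_nonneg (by linarith)) hv.le
  have hexp : chiSum x j₀ ≤ √n * Real.exp ((√n)⁻¹ * chiSum x j₀) := by
    have h1 := Real.add_one_le_exp ((√n)⁻¹ * chiSum x j₀)
    calc chiSum x j₀ = √n * ((√n)⁻¹ * chiSum x j₀) := by field_simp
      _ ≤ _ := mul_le_mul_of_nonneg_left (by linarith) hs.le
  rw [maxBound]
  set y := (∑ j, Real.exp (v * chiSum x j)) / (R * w) with hy
  rcases le_or_gt (1 / 2) y with h | h
  · obtain ⟨j, -, hj⟩ := Finset.exists_le_of_sum_le (s := (Finset.univ : Finset (Fin R)))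
      (f := fun _ => w / 2) (g := fun j => Real.exp (v * chiSum x j)) ⟨j₀, Finset.mem_univ _⟩ (by
        rw [hy, le_div_iff₀ (by positivity)] at h
        simp only [Finset.sum_const, Finset.card_univ, Fintype.card_fin, nsmul_eq_mul]
        linarith)
    refine ⟨j, ?_⟩
    have h1 : Real.log (w / 2) / v ≤ chiSum x j := by
      rw [div_le_iff₀ hv, Real.log_le_iff_le_exp (by linarith), mul_comm]
      exact hj
    nlinarith [mul_nonneg hb (sq_nonneg (y - 1))]
  · refine ⟨j₀, ?_⟩
    have h1 : 1 - 4 * (y - 1) ^ 2 ≤ 0 := by nlinarith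
    have h2 := mul_nonneg_of_nonpos_of_nonpos h1 (neg_nonpos.2 hb)
    have h3 : 0 ≤ √n * Real.exp ((√n)⁻¹ * chiSum x j₀) := by positivity
    nlinarith

lemma integral_maxBound (hn : 36 < n) (j₀ : Fin R) {u : ℝ} (hu : 0 < u)
    (hun : 4 * (u / √n) < 1) (hw : 2 ≤ chiMoment n u) :
    Integrable (maxBound j₀ (u / √n) (chiMoment n u)) (iidGaussian (Fin n × Fin R)) ∧
      √n * (Real.log (chiMoment n u / 2) / u *
          (1 - 4 * (chiMoment n (2 * u) / (R * chiMoment n u ^ 2))) - chiMoment n 1) ≤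
        ∫ x, maxBound j₀ (u / √n) (chiMoment n u) x ∂(iidGaussian (Fin n × Fin R)) := by
  have hR : (0 : ℝ) < R := by exact_mod_cast Fin.pos j₀
  have hs6 : 6 < √(n : ℝ) := by
    rw [Real.lt_sqrt (by norm_num)]
    norm_num
    exact_mod_cast hn
  have hs : 0 < √(n : ℝ) := by linarith
  set w := chiMoment n u with hwdef
  set v := u / √n with hvdef
  have hwv : chiMgf v ^ n = w := rfl
  have hw2 : chiMgf (2 * v) ^ n = chiMoment n (2 * u) := by
    rw [chiMoment, hvdef, mul_div_assoc]
  have hv1 : 2 * (√(n : ℝ))⁻¹ < 1 := by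
    rw [← div_eq_mul_inv, div_lt_one hs]
    linarith
  obtain ⟨i1, e1⟩ := integral_sum_exp_chiSum (n := n) (R := R) hun
  obtain ⟨i2, e2⟩ := integral_sum_exp_chiSum_sq (n := n) (R := R) hun
  obtain ⟨i3, e3⟩ := integral_chiSum (n := n) j₀
  have i4 := integrable_exp_chiSum (n := n) hv1 j₀
  have e4 : ∫ x, Real.exp ((√n)⁻¹ * chiSum x j₀) ∂(iidGaussian (Fin n × Fin R)) =
      chiMoment n 1 := by
    rw [integral_exp_chiSum, chiMoment, one_div]
  rw [hwv] at e1
  rw [hwv, hw2] at e2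
  have hexp : ∀ x : Fin n × Fin R → ℝ, maxBound j₀ v w x =
      Real.log (w / 2) / v * (-3 - 4 / (R * w) ^ 2 * (∑ j, Real.exp (v * chiSum x j)) ^ 2 +
        8 / (R * w) * ∑ j, Real.exp (v * chiSum x j)) +
      (chiSum x j₀ - √n * Real.exp ((√n)⁻¹ * chiSum x j₀)) := by
    intro x
    rw [maxBound]
    field_simp
    ring
  have hprob : IsProbabilityMeasure (iidGaussian (Fin n × Fin R)) := by
    unfold iidGaussian; infer_instance
  have j0 : Integrable (fun x : Fin n × Fin R → ℝ =>
      -3 - 4 / (R * w) ^ 2 * (∑ j, Real.exp (v * chiSum x j)) ^ 2)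
      (iidGaussian (Fin n × Fin R)) := (integrable_const (-3 : ℝ)).sub (i2.const_mul _)
  have j1 : Integrable (fun x : Fin n × Fin R → ℝ =>
      -3 - 4 / (R * w) ^ 2 * (∑ j, Real.exp (v * chiSum x j)) ^ 2 +
        8 / (R * w) * ∑ j, Real.exp (v * chiSum x j))
      (iidGaussian (Fin n × Fin R)) := j0.add (i1.const_mul _)
  have j2 : Integrable (fun x : Fin n × Fin R → ℝ =>
      chiSum x j₀ - √n * Real.exp ((√n)⁻¹ * chiSum x j₀))
      (iidGaussian (Fin n × Fin R)) := i3.sub (i4.const_mul _)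
  have hfun : maxBound j₀ v w = fun x : Fin n × Fin R → ℝ =>
      Real.log (w / 2) / v * (-3 - 4 / (R * w) ^ 2 * (∑ j, Real.exp (v * chiSum x j)) ^ 2 +
        8 / (R * w) * ∑ j, Real.exp (v * chiSum x j)) +
      (chiSum x j₀ - √n * Real.exp ((√n)⁻¹ * chiSum x j₀)) := funext hexp
  rw [hfun]
  refine ⟨(j1.const_mul _).add j2, ?_⟩
  have hb : 0 ≤ Real.log (w / 2) / v :=
    div_nonneg (Real.log_nonneg (by linarith)) (by positivity)
  rw [integral_add (j1.const_mul _) j2, integral_const_mul, integral_sub i3 (i4.const_mul _),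
    integral_const_mul, e3, e4,
    integral_add j0 (i1.const_mul _), integral_sub (integrable_const _) (i2.const_mul _),
    integral_const_mul, integral_const_mul, e1, integral_const, probReal_univ, one_smul]
  set S := ∫ x : Fin n × Fin R → ℝ, (∑ j, Real.exp (v * chiSum x j)) ^ 2
          ∂(iidGaussian (Fin n × Fin R))
  have hw0 : 0 < w := by linarith
  have key : 1 - 4 * (chiMoment n (2 * u) / (R * w ^ 2)) ≤
      -3 - 4 / (R * w) ^ 2 * S + 8 / (R * w) * (R * w) := by
    have h1 : 4 / (R * w) ^ 2 * S ≤
        4 / (R * w) ^ 2 * (R * chiMoment n (2 * u) + (R * w) ^ 2) := by gcongr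
    have h2 : 4 / (R * w) ^ 2 * (R * chiMoment n (2 * u) + (R * w) ^ 2) =
        4 * (chiMoment n (2 * u) / (R * w ^ 2)) + 4 := by field_simp
    have h3 : 8 / (R * w) * (R * w) = 8 := by field_simp
    linarith
  have h4 := mul_le_mul_of_nonneg_left key hb
  have h5 : √n * (Real.log (w / 2) / u * (1 - 4 * (chiMoment n (2 * u) / (R * w ^ 2))) -
      chiMoment n 1) = Real.log (w / 2) / v * (1 - 4 * (chiMoment n (2 * u) / (R * w ^ 2))) -
      √n * chiMoment n 1 := by
    rw [hvdef]
    field_simp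
  rw [h5]
  linarith

/-- The expected maximum of `R` independent normalized chi-square variables is unbounded as `R`
and the number `n` of degrees of freedom grow. -/
lemma exists_expected_max (A : ℝ) : ∃ n₀ R₀ : ℕ, ∀ n R : ℕ, n₀ ≤ n → R₀ ≤ R →
    ∃ G : (Fin n × Fin R → ℝ) → ℝ, Integrable G (iidGaussian (Fin n × Fin R)) ∧
      (∀ x, ∃ j, G x ≤ chiSum x j) ∧ A * √n ≤ ∫ x, G x ∂(iidGaussian (Fin n × Fin R)) := by
  -- For large `R` the sum of the exponentials concentrates around its mean `R w`, so that the
  -- maximum is at least about `√n log w / u`, which is close to `√n u`.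
  set u : ℝ := max 2 (4 * (A + 3)) with hu
  have hu2 : 2 ≤ u := le_max_left _ _
  have huA : 4 * (A + 3) ≤ u := le_max_right _ _
  have hu0 : 0 < u := by linarith
  have hsqrt : Tendsto (fun n : ℕ => √(n : ℝ)) atTop atTop :=
    Real.tendsto_sqrt_atTop.comp tendsto_natCast_atTop_atTop
  have hlog2 : Real.log 2 < 1 := by
    have := Real.log_two_lt_d9
    linarith
  have h1 : ∀ᶠ n in atTop, 2 * Real.exp (u ^ 2 / 2) ≤ chiMoment n u := by
    refine (tendsto_chiMoment u).eventually_const_le ?_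
    calc 2 * Real.exp (u ^ 2 / 2) = Real.exp (Real.log 2 + u ^ 2 / 2) := by
          rw [Real.exp_add, Real.exp_log two_pos]
      _ < Real.exp (u ^ 2) := Real.exp_lt_exp.2 (by nlinarith)
  have h2 := (tendsto_chiMoment (2 * u)).eventually_le_const (lt_add_one _)
  have h3 : ∀ᶠ n in atTop, chiMoment n 1 ≤ 3 := by
    refine (tendsto_chiMoment 1).eventually_le_const ?_
    have := Real.exp_one_lt_d9
    norm_num
    linarith
  obtain ⟨n₀, hn₀⟩ := eventually_atTop.1 (h1.and (h2.and (h3.and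
    ((hsqrt.eventually_gt_atTop (4 * u)).and (eventually_gt_atTop 36)))))
  obtain ⟨R₀, hR₀⟩ := exists_nat_gt (8 * (Real.exp ((2 * u) ^ 2) + 1))
  refine ⟨n₀, R₀, fun n R hn hR => ?_⟩
  obtain ⟨a1, a2, a3, a4, a5⟩ := hn₀ n hn
  have hRR : 8 * (Real.exp ((2 * u) ^ 2) + 1) < (R : ℝ) :=
    hR₀.trans_le (by exact_mod_cast hR)
  have hexp0 := Real.exp_pos ((2 * u) ^ 2)
  have hR0 : (0 : ℝ) < R := by linarith
  have hR1 : 0 < R := by exact_mod_cast hR0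
  have hs : 0 < √(n : ℝ) := by linarith
  have hw2 : 2 ≤ chiMoment n u := by
    have := Real.one_le_exp (by positivity : 0 ≤ u ^ 2 / 2)
    linarith
  have hun : 4 * (u / √n) < 1 := by
    rw [← mul_div_assoc, div_lt_one hs]
    exact a4
  obtain ⟨b1, b2⟩ := integral_maxBound a5 (⟨0, hR1⟩ : Fin R) hu0 hun hw2
  refine ⟨_, b1, exists_maxBound_le (by omega) _ (by positivity) hw2, le_trans ?_ b2⟩
  rw [mul_comm]
  refine mul_le_mul_of_nonneg_left ?_ hs.le
  have c1 : u ^ 2 / 2 ≤ Real.log (chiMoment n u / 2) := by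
    rw [Real.le_log_iff_exp_le (by linarith)]
    linarith
  have c2 : u / 2 ≤ Real.log (chiMoment n u / 2) / u := by
    rw [le_div_iff₀ hu0]
    nlinarith
  have c3 : 1 / 2 ≤ 1 - 4 * (chiMoment n (2 * u) / (R * chiMoment n u ^ 2)) := by
    have : chiMoment n (2 * u) / (R * chiMoment n u ^ 2) ≤ 1 / 8 := by
      rw [div_le_iff₀ (by positivity)]
      nlinarith [mul_le_mul hw2 hw2 (by norm_num) (by linarith)]
    linarith
  have c4 : u / 2 * (1 / 2) ≤ Real.log (chiMoment n u / 2) / u *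
      (1 - 4 * (chiMoment n (2 * u) / (R * chiMoment n u ^ 2))) :=
    mul_le_mul c2 c3 (by norm_num) (le_trans (by positivity) c2)
  linarith

end ChiSquare

/-! ### Boundedness of the pressure at the maximal storage -/

section Bounded

variable {P : ℕ} {β γ : ℝ}

/-- The pressure is compared with the one-body system without any order, whose free energy
converges; the derivative of the interpolation is bounded. -/
lemma isIntensive_pred (hPe : Even P) (hP : 4 ≤ P) (hβ : 0 < β) (hγ : 0 < γ) :
    IsIntensive P β γ (P - 1) := by
  set o : OrderParameters := ⟨0, 0, 0, 0, 0, 1⟩ with ho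
  have hk : P / 2 ≠ 0 := by omega
  have hθ0 : 0 < o.θ := one_pos
  have hθ1 : o.θ ≤ 1 := le_rfl
  have hQ₁ : 0 ≤ o.q₁ ^ (P / 2) := by simp [ho, hk]
  have hQ₂ : 0 ≤ o.q₂ ^ (P / 2) - o.q₁ ^ (P / 2) := by simp [ho]
  obtain ⟨C, hC⟩ := eventually_abs_bracket_le hPe hP hβ hγ hθ0 hθ1 hQ₁ hQ₂
  have h0 := (tendsto_freeEnergy_start hPe hP hβ hγ hθ0 hθ1 hQ₁ hQ₂).abs.eventually_le_const
    (lt_add_one _)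
  have hev : ∀ᶠ N in atTop, |pressure P (P - 1) β γ N| ≤
      |startLimit P β γ o| + 1 + C * (Real.pi / 2 - 0) := by
    filter_upwards [hC, h0, eventually_small (γ := γ) (o := o) hPe hP hβ, eventually_gt_atTop 0,
      (tendsto_numPatterns hPe hP hγ).eventually_gt_atTop 0] with N hCN h0N ha hN hK
    have h1 := norm_image_sub_le_of_norm_deriv_le_segment' (a := 0) (b := Real.pi / 2) (C := C)
      (fun α hα => (hasDerivAt_freeEnergy hPe hP hβ hN (by exact_mod_cast hK) ha hθ0 hθ1 hQ₁ hQ₂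
        hα.1 hα.2).hasDerivWithinAt) (fun α _ => by
        have h3 := hCN (Real.sin α ^ 2) ⟨sq_nonneg _, Real.sin_sq_le_one α⟩
        rw [Real.norm_eq_abs, abs_mul, abs_mul]
        calc |Real.sin α| * |Real.cos α| * |bracket P N _ β γ (Real.sin α ^ 2) o| ≤ 1 * 1 * C := by
              gcongr
              · exact Real.abs_sin_le_one α
              · exact Real.abs_cos_le_one α
          _ = C := by ring) (Real.pi / 2) ⟨by positivity, le_rfl⟩
    rw [freeEnergy_end hPe hP hβ hN hθ0, Real.norm_eq_abs] at h1
    have h2 := abs_sub_abs_le_abs_sub (pressure P (P - 1) β γ N)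
      (freeEnergy P N (numPatterns γ (P - 1) N) (netCouplings P β γ o N) o.θ 0)
    linarith
  -- The finitely many remaining sizes are added to the bound.
  obtain ⟨N₀, hN₀⟩ := eventually_atTop.1 hev
  set B := |startLimit P β γ o| + 1 + C * (Real.pi / 2 - 0)
  refine ⟨|B| + ∑ N ∈ Finset.range N₀, |pressure P (P - 1) β γ N|, fun N => ?_⟩
  have hs : 0 ≤ ∑ N ∈ Finset.range N₀, |pressure P (P - 1) β γ N| :=
    Finset.sum_nonneg fun _ _ => abs_nonneg _
  rcases le_or_gt N₀ N with h | h
  · linarith [hN₀ N h, le_abs_self B]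
  · have := Finset.single_le_sum (f := fun N => |pressure P (P - 1) β γ N|)
      (fun _ _ => abs_nonneg _) (Finset.mem_range.2 h)
    linarith [abs_nonneg B]

end Bounded

/-! ### Divergence of the pressure above the maximal storage -/

section Unbounded

variable {P N K a : ℕ} {β γ : ℝ}

/-- `R` pairwise orthogonal configurations of `2 ^ R` spins: the coordinate functions on the cube
`{±1} ^ R`. -/
lemma exists_orthogonal_spins (R : ℕ) : ∃ σ : Fin R → Spins (2 ^ R), ∀ i j,
    ∑ s, val (σ i s) * val (σ j s) = if i = j then ((2 ^ R : ℕ) : ℝ) else 0 := by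
  have hcard : Fintype.card (Fin (2 ^ R)) = Fintype.card (Fin R → ℤˣ) := by
    simp [Fintype.card_units_int]
  set e := Fintype.equivOfCardEq hcard
  refine ⟨fun j s => e s j, fun i j => ?_⟩
  rw [e.sum_comp fun x : Fin R → ℤˣ => val (x i) * val (x j)]
  split_ifs with h
  · subst h
    simp only [← sq, val_sq]
    simp [Fintype.card_units_int]
  · -- flipping the coordinate `i` changes the sign of the sum
    have h1 := Equiv.sum_comp (Equiv.mulLeft (Pi.mulSingle i (-1) : Fin R → ℤˣ))
      fun x : Fin R → ℤˣ => val (x i) * val (x j)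
    have h2 : ∀ x : Fin R → ℤˣ, val ((Equiv.mulLeft (Pi.mulSingle i (-1) : Fin R → ℤˣ)) x i) *
        val ((Equiv.mulLeft (Pi.mulSingle i (-1) : Fin R → ℤˣ)) x j) =
        -(val (x i) * val (x j)) := by
      intro x
      simp [Pi.mulSingle_eq_of_ne (Ne.symm h), val_neg]
    simp only [h2, Finset.sum_neg_distrib] at h1
    linarith

/-- The coefficients of the normalized noise fields of a family of configurations. -/
def fieldCoef {R : ℕ} (P N K : ℕ) (σ : Fin R → Spins N) (b : Fin (K - 1) × Fin R)
    (p : Fin (K - 1) × (Fin (P / 2) → Fin N)) : ℝ :=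
  if p.1 = b.1 then mon (σ b.2) p.2 / √((N : ℝ) ^ (P / 2)) else 0

lemma sum_fieldCoef_mul {R : ℕ} (σ : Fin R → Spins N) (ξ : Noise P N K)
    (b : Fin (K - 1) × Fin R) : ∑ p, fieldCoef P N K σ b p * ξ p =
      noiseField ξ (σ b.2) b.1 / √((N : ℝ) ^ (P / 2)) := by
  rw [Fintype.sum_prod_type, Finset.sum_eq_single b.1]
  · rw [noiseField, Finset.sum_div]
    refine Finset.sum_congr rfl fun i _ => ?_
    simp only [fieldCoef, if_true, mon]
    ring
  · intro μ _ hμ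
    simp [fieldCoef, hμ]
  · simp

lemma sum_fieldCoef_mul_fieldCoef {R : ℕ} (hN : 0 < N) (hk : P / 2 ≠ 0) {σ : Fin R → Spins N}
    (hσ : ∀ i j, ∑ s, val (σ i s) * val (σ j s) = if i = j then (N : ℝ) else 0)
    (b b' : Fin (K - 1) × Fin R) :
    ∑ p, fieldCoef P N K σ b p * fieldCoef P N K σ b' p = if b = b' then 1 else 0 := by
  have h := sum_fieldCoef_mul (P := P) (K := K) σ (fieldCoef P N K σ b') b
  rw [h, noiseField]
  have hN' : (0 : ℝ) < (N : ℝ) ^ (P / 2) := by positivity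
  rcases eq_or_ne b.1 b'.1 with h1 | h1
  · have h2 : ∑ i : Fin (P / 2) → Fin N, fieldCoef P N K σ b' (b.1, i) * ∏ k, val (σ b.2 (i k)) =
        (∑ i : Fin (P / 2) → Fin N, mon (σ b.2) i * mon (σ b'.2) i) / √((N : ℝ) ^ (P / 2)) := by
      rw [Finset.sum_div]
      refine Finset.sum_congr rfl fun i _ => ?_
      simp only [fieldCoef, h1, if_true, mon]
      ring
    rw [h2, sum_mon_mul_mon, hσ, div_div, Real.mul_self_sqrt hN'.le]
    by_cases h3 : b.2 = b'.2
    · rw [if_pos h3, if_pos (Prod.ext h1 h3), div_self hN'.ne']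
    · rw [if_neg h3, if_neg fun h => h3 (congrArg Prod.snd h), zero_pow hk, zero_div]
  · have h2 : ∀ i, fieldCoef P N K σ b' (b.1, i) = 0 := fun i => by simp [fieldCoef, h1]
    simp only [h2, zero_mul, Finset.sum_const_zero, zero_div]
    rw [if_neg fun h => h1 (congrArg Prod.fst h)]

lemma neg_mul_hamiltonian (η : Spins N) (ξ : Noise P N K) (σ : Spins N) :
    -β * hamiltonian P a γ η ξ σ =
      β / ((P ! : ℝ) * (N : ℝ) ^ (P - 1)) * (signalField P η σ ^ 2 + ∑ μ, noiseField ξ σ μ ^ 2) -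
        β * (γ / (P ! : ℝ) * ((N : ℝ) ^ (a + 1) / (N : ℝ) ^ (P / 2))) := by
  rw [hamiltonian]
  ring

lemma exp_le_partitionFunction (η : Spins N) (ξ : Noise P N K) (σ : Spins N) :
    Real.exp (-β * hamiltonian P a γ η ξ σ) ≤ partitionFunction P a β γ η ξ :=
  Finset.single_le_sum (f := fun σ => Real.exp (-β * hamiltonian P a γ η ξ σ))
    (fun _ _ => (Real.exp_pos _).le) (Finset.mem_univ σ)

lemma le_log_partitionFunction (η : Spins N) (ξ : Noise P N K) (σ : Spins N) :
    -β * hamiltonian P a γ η ξ σ ≤ Real.log (partitionFunction P a β γ η ξ) := by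
  rw [Real.le_log_iff_exp_le ((Real.exp_pos _).trans_le (exp_le_partitionFunction η ξ σ))]
  exact exp_le_partitionFunction η ξ σ

lemma integrable_noiseField_sq (σ : Spins N) (μ : Fin (K - 1)) :
    Integrable (fun ξ : Noise P N K => noiseField ξ σ μ ^ 2) (iidGaussian _) := by
  have h : Integrable (fun ξ : Noise P N K => (N : ℝ) ^ (P / 2) * ∑ i, ξ (μ, i) ^ 2)
      (iidGaussian _) := (integrable_finsetSum _ fun i _ =>
    integrable_comp_eval (μ := fun _ : Fin (K - 1) × (Fin (P / 2) → Fin N) => stdG) (i := (μ, i))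
      (memLp_id_gaussianReal 2).integrable_sq).const_mul _
  refine h.mono' ((measurable_noiseField σ μ).pow_const 2).aestronglyMeasurable
    (ae_of_all _ fun ξ => ?_)
  rw [Real.norm_eq_abs, abs_of_nonneg (sq_nonneg _)]
  exact noiseField_sq_le ξ σ μ

lemma integrable_log_partitionFunction (η : Spins N) :
    Integrable (fun ξ : Noise P N K => Real.log (partitionFunction P a β γ η ξ))
      (iidGaussian _) := by
  have hprob : IsProbabilityMeasure (iidGaussian (Fin (K - 1) × (Fin (P / 2) → Fin N))) := by
    unfold iidGaussian; infer_instance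
  have hH : ∀ σ, Integrable (fun ξ : Noise P N K => -β * hamiltonian P a γ η ξ σ)
      (iidGaussian _) := by
    intro σ
    simp only [neg_mul_hamiltonian]
    exact (((integrable_const _).add (integrable_finsetSum _ fun μ _ =>
      integrable_noiseField_sq σ μ)).const_mul _).sub (integrable_const _)
  have hm : Measurable fun ξ : Noise P N K => Real.log (partitionFunction P a β γ η ξ) := by
    refine Real.measurable_log.comp (Finset.measurable_sum _ fun σ _ => Real.measurable_exp.comp ?_)
    simp only [neg_mul_hamiltonian]
    exact ((measurable_const.add (Finset.measurable_sum _ fun μ _ =>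
      (measurable_noiseField σ μ).pow_const 2)).const_mul _).sub measurable_const
  have hb : Integrable (fun ξ : Noise P N K => ∑ σ, |-β * hamiltonian P a γ η ξ σ| +
      Real.log (Fintype.card (Spins N))) (iidGaussian _) :=
    (integrable_finsetSum _ fun σ _ => (hH σ).abs).add (integrable_const _)
  refine hb.mono' hm.aestronglyMeasurable (ae_of_all _ fun ξ => ?_)
  have hle : ∀ σ, |-β * hamiltonian P a γ η ξ σ| ≤ ∑ σ, |-β * hamiltonian P a γ η ξ σ| := fun σ =>
    Finset.single_le_sum (f := fun σ => |-β * hamiltonian P a γ η ξ σ|)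
      (fun _ _ => abs_nonneg _) (Finset.mem_univ σ)
  have hc : (0 : ℝ) < Fintype.card (Spins N) := by exact_mod_cast Fintype.card_pos
  have hc1 : 0 ≤ Real.log (Fintype.card (Spins N)) :=
    Real.log_nonneg (by exact_mod_cast Fintype.card_pos)
  rw [Real.norm_eq_abs, abs_le]
  constructor
  · have h1 := le_log_partitionFunction (a := a) (β := β) (γ := γ) η ξ (1 : Spins N)
    linarith [neg_abs_le (-β * hamiltonian P a γ η ξ (1 : Spins N)), hle 1]
  · have hpos := (Real.exp_pos _).trans_le
      (exp_le_partitionFunction (a := a) (β := β) (γ := γ) η ξ (1 : Spins N))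
    rw [Real.log_le_iff_le_exp hpos, Real.exp_add, Real.exp_log hc, partitionFunction]
    refine (Finset.sum_le_sum fun σ _ =>
      Real.exp_le_exp.2 ((le_abs_self _).trans (hle σ))).trans (le_of_eq ?_)
    rw [Finset.sum_const, Finset.card_univ, nsmul_eq_mul, mul_comm]

/-- The maximum of the energy over orthogonal configurations bounds the quenched free energy from
below. -/
lemma le_integral_log_partitionFunction {R : ℕ} (hPe : Even P) (hP : 4 ≤ P) (hβ : 0 < β)
    (hN : 0 < N) {σ : Fin R → Spins N}
    (hσ : ∀ i j, ∑ s, val (σ i s) * val (σ j s) = if i = j then (N : ℝ) else 0)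
    (hK : γ * (N : ℝ) ^ a - 2 ≤ (K - 1 : ℕ)) {G : (Fin (K - 1) × Fin R → ℝ) → ℝ}
    (hG : Integrable G (iidGaussian (Fin (K - 1) × Fin R)))
    (hle : ∀ x, ∃ j, G x ≤ chiSum x j) (η : Spins N) :
    β / (P ! : ℝ) * ((N : ℝ) ^ (P / 2) / (N : ℝ) ^ (P - 1)) *
        (∫ x, G x ∂(iidGaussian (Fin (K - 1) × Fin R)) - 2) ≤
      ∫ ξ : Noise P N K, Real.log (partitionFunction P a β γ η ξ) ∂(iidGaussian _) := by
  have hprob : IsProbabilityMeasure (iidGaussian (Fin (K - 1) × (Fin (P / 2) → Fin N))) := by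
    unfold iidGaussian; infer_instance
  set ψ : Noise P N K → Fin (K - 1) × Fin R → ℝ := fun ξ b => ∑ p, fieldCoef P N K σ b p * ξ p
    with hψ
  have hψm : Measurable ψ := by fun_prop
  have hmap : (iidGaussian _).map ψ = iidGaussian (Fin (K - 1) × Fin R) :=
    map_iidGaussian (fieldCoef P N K σ)
      (sum_fieldCoef_mul_fieldCoef hN (by omega) hσ)
  rw [← hmap] at hG ⊢
  rw [integral_map hψm.aemeasurable hG.aestronglyMeasurable]
  have hG' : Integrable (fun ξ => G (ψ ξ)) (iidGaussian _) := hG.comp_measurable hψm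
  have hc : (∫ ξ, G (ψ ξ) ∂(iidGaussian (Fin (K - 1) × (Fin (P / 2) → Fin N))) - 2) =
      ∫ ξ, (G (ψ ξ) - 2) ∂(iidGaussian (Fin (K - 1) × (Fin (P / 2) → Fin N))) := by
    rw [integral_sub hG' (integrable_const _)]
    simp
  rw [hc, ← integral_const_mul]
  refine integral_mono ((hG'.sub (integrable_const _)).const_mul _)
    (integrable_log_partitionFunction η) fun ξ => ?_
  obtain ⟨j, hj⟩ := hle (ψ ξ)
  refine le_trans ?_ (le_log_partitionFunction η ξ (σ j))
  have hNp : (0 : ℝ) < N := by exact_mod_cast hN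
  have hfac : (0 : ℝ) < (P ! : ℝ) := by exact_mod_cast Nat.factorial_pos P
  have hsum : ∑ μ, noiseField ξ (σ j) μ ^ 2 =
      (N : ℝ) ^ (P / 2) * (chiSum (ψ ξ) j + (K - 1 : ℕ)) := by
    have h1 : ∀ μ, ψ ξ (μ, j) ^ 2 = noiseField ξ (σ j) μ ^ 2 / (N : ℝ) ^ (P / 2) := by
      intro μ
      simp only [hψ, sum_fieldCoef_mul]
      rw [div_pow, Real.sq_sqrt (by positivity)]
    simp only [chiSum, h1, Finset.sum_sub_distrib, ← Finset.sum_div]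
    simp
    field_simp
  have hpow : (N : ℝ) ^ (a + 1) / (N : ℝ) ^ (P / 2) =
      (N : ℝ) ^ (P / 2) / (N : ℝ) ^ (P - 1) * (N : ℝ) ^ a := by
    have h2 : P - 1 + 1 = P / 2 + P / 2 := by obtain ⟨k, rfl⟩ := hPe; omega
    rw [div_mul_eq_mul_div, div_eq_div_iff (by positivity) (by positivity), ← pow_add, ← pow_add,
      ← pow_add]
    congr 1
    omega
  rw [neg_mul_hamiltonian, hsum, hpow]
  -- The signal term is nonnegative and is dropped.
  have hsig := sq_nonneg (signalField P η (σ j))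
  set l := β / (P ! : ℝ) * ((N : ℝ) ^ (P / 2) / (N : ℝ) ^ (P - 1)) with hl
  have hl0 : 0 ≤ l := by positivity
  have e : β / ((P ! : ℝ) * (N : ℝ) ^ (P - 1)) * (signalField P η (σ j) ^ 2 +
      (N : ℝ) ^ (P / 2) * (chiSum (ψ ξ) j + (K - 1 : ℕ))) -
      β * (γ / (P ! : ℝ) * ((N : ℝ) ^ (P / 2) / (N : ℝ) ^ (P - 1) * (N : ℝ) ^ a)) =
      β / ((P ! : ℝ) * (N : ℝ) ^ (P - 1)) * signalField P η (σ j) ^ 2 +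
      l * (chiSum (ψ ξ) j + ((K - 1 : ℕ) - γ * (N : ℝ) ^ a)) := by
    rw [hl]
    field_simp
    ring
  rw [e]
  refine le_trans ?_ (le_add_of_nonneg_left (by positivity))
  exact mul_le_mul_of_nonneg_left (by linarith) hl0

/-- For `a ≥ P` the fluctuation `√K` of the sum of the squared normalized fields of a single
configuration is of the order of `N ^ (P / 2)` at least, which already gives an extensive
contribution to the energy. The maximum over orthogonal configurations multiplies it by an
arbitrarily large constant. -/
lemma not_isIntensive (hPe : Even P) (hP : 4 ≤ P) (hβ : 0 < β) (hγ : 0 < γ) (ha : P ≤ a) :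
    ¬ IsIntensive P β γ a := by
  rintro ⟨C, hC⟩
  set c := β / (P ! : ℝ) with hc
  have hc0 : 0 < c := by
    have := Nat.factorial_pos P
    positivity
  set A := (|C| + 2 * c + 1) / (c * √(γ / 2)) with hA
  have hg : 0 < √(γ / 2) := Real.sqrt_pos.2 (by positivity)
  have hA0 : 0 < A := by positivity
  obtain ⟨n₀, R₀, hmax⟩ := exists_expected_max A
  -- the size of the system is `2 ^ R`
  have hpow : Tendsto (fun R : ℕ => γ / 2 * (((2 ^ R : ℕ) : ℝ) ^ P)) atTop atTop := by
    refine Tendsto.const_mul_atTop (by positivity) ?_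
    exact ((tendsto_pow_atTop (by omega)).comp tendsto_natCast_atTop_atTop).comp
      (tendsto_pow_atTop_atTop_of_one_lt one_lt_two)
  obtain ⟨R, hRR, hR2, hRn⟩ := ((eventually_ge_atTop R₀).and
    ((hpow.eventually_ge_atTop 2).and (hpow.eventually_ge_atTop n₀))).exists
  set N := 2 ^ R with hN
  have hN0 : 0 < N := by positivity
  have hN1 : (1 : ℝ) ≤ N := by exact_mod_cast hN0
  obtain ⟨σ, hσ⟩ := exists_orthogonal_spins R
  set K := numPatterns γ a N with hKdef
  have hK : γ * (N : ℝ) ^ a - 2 ≤ (K - 1 : ℕ) := by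
    have h1 := Nat.lt_floor_add_one (γ * (N : ℝ) ^ a)
    have h2 : (K : ℝ) ≤ (K - 1 : ℕ) + 1 := by
      have h3 : K ≤ K - 1 + 1 := by omega
      exact_mod_cast h3
    rw [hKdef, numPatterns] at h2 ⊢
    linarith
  have hn : γ / 2 * (N : ℝ) ^ P ≤ (K - 1 : ℕ) := by
    have h1 : (N : ℝ) ^ P ≤ (N : ℝ) ^ a := pow_le_pow_right₀ hN1 ha
    nlinarith
  obtain ⟨G, hG, hle, hint⟩ := hmax (K - 1) R (by exact_mod_cast hRn.trans hn) hRR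
  have hlow := le_integral_log_partitionFunction (K := K) hPe hP hβ hN0 hσ hK hG hle
  set I := ∫ x, G x ∂(iidGaussian (Fin (K - 1) × Fin R))
  have hp : 1 / (N : ℝ) * (c * ((N : ℝ) ^ (P / 2) / (N : ℝ) ^ (P - 1)) * (I - 2)) ≤
      pressure P a β γ N := by
    rw [pressure, patternAvg]
    refine mul_le_mul_of_nonneg_left ?_ (by positivity)
    calc c * ((N : ℝ) ^ (P / 2) / (N : ℝ) ^ (P - 1)) * (I - 2) = 1 / 2 ^ N *
          ∑ _η : Spins N, c * ((N : ℝ) ^ (P / 2) / (N : ℝ) ^ (P - 1)) * (I - 2) := by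
          rw [← card_spins_inv, Finset.sum_const, Finset.card_univ, nsmul_eq_mul, ← mul_assoc,
            inv_mul_cancel₀ (by positivity), one_mul]
      _ ≤ _ := mul_le_mul_of_nonneg_left (Finset.sum_le_sum fun η _ => hlow η) (by positivity)
  have hPP : (N : ℝ) ^ P = N ^ (P / 2) * N ^ (P / 2) := by
    rw [← pow_add]
    congr 1
    obtain ⟨k, rfl⟩ := hPe
    omega
  have hP1 : (N : ℝ) * (N : ℝ) ^ (P - 1) = N ^ (P / 2) * N ^ (P / 2) := by
    rw [← hPP, ← pow_succ', Nat.sub_add_cancel (by omega)]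
  set M := (N : ℝ) ^ (P / 2) with hM
  have hM1 : 1 ≤ M := one_le_pow₀ hN1
  have hM0 : 0 < M := by linarith
  have e : 1 / (N : ℝ) * (c * (M / (N : ℝ) ^ (P - 1)) * (I - 2)) = c / M * (I - 2) := by
    have : (N : ℝ) ^ (P - 1) = M * M / N := by
      rw [← hP1]
      field_simp
    rw [this]
    field_simp
  have hsq : √(γ / 2) * M ≤ √((K - 1 : ℕ) : ℝ) := by
    refine Real.le_sqrt_of_sq_le (le_trans (le_of_eq ?_) hn)
    rw [mul_pow, Real.sq_sqrt (by positivity), hPP]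
    ring
  have h1 : A * (√(γ / 2) * M) ≤ I := (mul_le_mul_of_nonneg_left hsq hA0.le).trans hint
  have h2 : c / M * (A * (√(γ / 2) * M) - 2) ≤ pressure P a β γ N := by
    refine le_trans (mul_le_mul_of_nonneg_left (by linarith) (by positivity)) (e ▸ hp)
  have h3 : c / M * (A * (√(γ / 2) * M) - 2) = |C| + 2 * c + 1 - 2 * (c / M) := by
    rw [hA]
    field_simp
  have h4 : c / M ≤ c := div_le_self hc0.le hM1
  have h5 := (abs_le.1 (hC N)).2
  linarith [le_abs_self C]

end Unbounded

end DenseHebbian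

end

theorem mainTheorem2 (P : ℕ) (hPeven : Even P) (hP : 4 ≤ P) (β γ : ℝ) (hβ : 0 < β) (hγ : 0 < γ) :
    IsGreatest {a : ℕ | DenseHebbian.IsIntensive P β γ a} (P - 1) ∧
      ∀ o : DenseHebbian.OrderParameters, 0 < o.θ → o.θ ≤ 1 →
        DenseHebbian.OneRSBAnsatz P β γ o →
          Tendsto (fun N : ℕ => DenseHebbian.pressure P (P - 1) β γ N) atTop
            (𝓝 (DenseHebbian.oneRSBPressure P β γ o)) := by
  refine ⟨⟨DenseHebbian.isIntensive_pred hPeven hP hβ hγ, fun a ha => ?_⟩,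
    fun o hθ0 hθ1 ho => DenseHebbian.tendsto_pressure hPeven hP hβ hγ hθ0 hθ1 ho⟩
  by_contra h
  exact DenseHebbian.not_isIntensive hPeven hP hβ hγ (by omega) ha
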